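/- Let $a<b$, $\Omega=(a,b)$, $T>0$, $V:\Omega\to\mathbb R$ and $f:[0,\infty)\to\mathbb R$, and write $G(z)=f(|z|^2)z$ for $z\in\mathbb C$. For $m\ge1$ let $H^m_{\rm per}(\Omega)=\{\phi\in H^m(\Omega):\phi^{(k)}(a)=\phi^{(k)}(b),\ 0\le k\le m-1\}$. Consider the nonlinear Schrödinger equation with periodic boundary conditions $$i\partial_t\psi=-\partial_{xx}\psi+V\psi+f(|\psi|^2)\psi\quad\text{on }\Omega\times(0,T],\qquad \psi(\cdot,0)=\psi_0 .$$ *Scheme.* Let $\tau>0$, let $N$ be a positive even integer, $h=(b-a)/N$, $x_j=a+jh$ $(0\le j\le N)$, $\mu_l=2\pi l/(b-a)$, $\mathcal T_N=\{-N/2,\dots,N/2-1\}$, $X_N=\operatorname{span}\{e^{i\mu_l(x-a)}:l\in\mathcal T_N\}$, $\varphi_1(z)=(e^z-1)/z$ with $\varphi_1(0)=1$. For a function $u$ put $\widehat u_l=\frac1{b-a}\int_a^b u(x)e^{-i\mu_l(x-a)}\,dx$, and for a grid function $v=(v_0,\dots,v_N)$ put $\widetilde v_l=\frac1N\sum_{j=0}^{N-1}v_je^{-i\mu_l(x_j-a)}$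 and $I_Nv=\sum_{l\in\mathcal T_N}\widetilde v_l\,e^{i\mu_l(x-a)}$; for a continuous function $\phi$ on $[a,b]$, $I_N\phi$ is $I_N$ applied to $(\phi(x_j))_j$. The EWI extended Fourier pseudospectral scheme is $\psi^0_j=\psi_0(x_j)$ and $$\psi^{n+1}_j=\sum_{l\in\mathcal T_N}e^{-i\tau\mu_l^2}\,\widetilde{(\psi^n)}_l\,e^{i\mu_l(x_j-a)}-i\tau\sum_{l\in\mathcal T_N}\varphi_1(-i\tau\mu_l^2)\Big(\widehat{(V I_N\psi^n)}_l+\widetilde{G(\psi^n)}_l\Big)e^{i\mu_l(x_j-a)},\quad 0\le j\le N,\ n\ge0 .$$ *Assumptions on $f$.* (A) There is a function $C_{\rm Lip}$ such that $|G(z_1)-G(z_2)|\le C_{\rm Lip}(M_0)|z_1-z_2|$ whenever $M_0>0$ and $|z_1|,|z_2|\le M_0$. (B) $\|G(v)-G(w)\|_{H^1}\le C(\|v\|_{H^3},\|w\|_{H^2})\|v-w\|_{H^1}$ for all $v\in H^3(\Omega)$, $w\in H^2(\Omega)$. (B') $\|I_N(G(v)-G(w))\|_{H^1}\le C(\|v\|_{H^3},\|w\|_{H^2})\|v-w\|_{H^1}$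 for all positive even $N$ and all $v,w\in X_N$. (C) with exponent $\alpha$: $G(v)\in H^\alpha_{\rm per}(\Omega)$ for all $v\in H^\alpha_{\rm per}(\Omega)$. In (B) and (B') the constant $C(\cdot,\cdot)$ is bounded on bounded sets, and in (B') it is independent of $N$. *Claim.* Suppose that $f$ satisfies (A) and (C) with $\alpha=2$, and let $M$ be a real number. Then there are $\tau_0>0$, $h_0>0$ and a constant $C$, depending only on $M$, $T$, $\Omega$ and $f$, such that the following holds for every $V\in L^\infty(\Omega)$ and every solution $\psi\in C([0,T];H^2_{\rm per}(\Omega))\cap C^1([0,T];L^2(\Omega))$ of the equation with $$\max\{\|\psi\|_{L^\infty([0,T];H^2)},\|\psi\|_{L^\infty([0,T];L^\infty)},\|\partial_t\psi\|_{L^\infty([0,T];L^2)},\|V\|_{L^\infty}\}\le M .$$ (i) For all $0<\tau<\tau_0$, all $0<h<h_0$ and all integers $0\le n\le T/\tau$, with $t_n=n\tau$, $$\|\psi(\cdot,t_n)-I_N\psi^n\|_{L^2}\le C(\tau+h^2),\qquad \|I_N\psi^n\|_{H^2}\le C,\qquad \|\psi(\cdot,t_n)-I_N\psi^n\|_{H^1}\le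 C(\sqrt\tau+h).$$ (ii) If moreover $V\in W^{1,4}(\Omega)\cap H^1_{\rm per}(\Omega)$, $f$ satisfies (B), (B') and (C) with $\alpha=3$, and $\psi\in C([0,T];H^3_{\rm per}(\Omega))\cap C^1([0,T];H^1(\Omega))$, then there is a constant $C'$, independent of $\tau$, $h$ and $n$, such that for all $0<\tau<\tau_0$, $0<h<h_0$ and $0\le n\le T/\tau$, $$\|\psi(\cdot,t_n)-I_N\psi^n\|_{L^2}\le C'(\tau+h^3),\qquad \|\psi(\cdot,t_n)-I_N\psi^n\|_{H^1}\le C'(\tau+h^2).$$ -/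

import Mathlib

open MeasureTheory Set Filter Topology
open scoped ENNReal NNReal ContDiff

noncomputable section

namespace EWI

/-! ### Sobolev spaces on the interval (a, b), through weak derivatives -/

/-- Lebesgue measure on `Ω = (a, b)`. -/
def vol (a b : ℝ) : Measure ℝ := volume.restrict (Ioo a b)

/-- `g` is the weak derivative of `u` on `(a, b)`. -/
def IsWeakDeriv (a b : ℝ) (u g : ℝ → ℂ) : Prop :=
  LocallyIntegrableOn u (Ioo a b) ∧ LocallyIntegrableOn g (Ioo a b) ∧
    ∀ φ : ℝ → ℝ, ContDiff ℝ ∞ φ → HasCompactSupport φ → tsupport φ ⊆ Ioo a b →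
      ∫ x in Ioo a b, deriv φ x • u x = -∫ x in Ioo a b, φ x • g x

/-- `w 0, …, w m` are the weak derivatives of `u` of orders `0, …, m` on `(a, b)`. -/
def IsWeakDerivs (a b : ℝ) (m : ℕ) (u : ℝ → ℂ) (w : ℕ → ℝ → ℂ) : Prop :=
  w 0 =ᵐ[vol a b] u ∧ ∀ k < m, IsWeakDeriv a b (w k) (w (k + 1))

/-- `u ∈ W^{m,p}(a, b)`. -/
def MemW (a b : ℝ) (m : ℕ) (p : ℝ≥0∞) (u : ℝ → ℂ) : Prop :=
  ∃ w : ℕ → ℝ → ℂ, IsWeakDerivs a b m u w ∧ ∀ k ≤ m, MemLp (w k) p (vol a b)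

/-- The `H^m(a, b)` norm `(∑_{k ≤ m} ‖u^{(k)}‖²_{L²})^{1/2}`. The weak derivatives are unique almost
everywhere, so the infimum is over a single value; it is `∞` if there are no weak derivatives. -/
def hNorm (a b : ℝ) (m : ℕ) (u : ℝ → ℂ) : ℝ≥0∞ :=
  ⨅ (w : ℕ → ℝ → ℂ) (_ : IsWeakDerivs a b m u w),
    (∑ k ∈ Finset.range (m + 1), eLpNorm (w k) 2 (vol a b) ^ 2) ^ (1 / 2 : ℝ)

/-- `u ∈ H^m_per(a, b)`: `u ∈ H^m(a, b)` and the continuous representatives of `u^{(k)}` on `[a, b]`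
satisfy `u^{(k)}(a) = u^{(k)}(b)` for `0 ≤ k ≤ m - 1`. -/
def MemHper (a b : ℝ) (m : ℕ) (u : ℝ → ℂ) : Prop :=
  ∃ w : ℕ → ℝ → ℂ, IsWeakDerivs a b m u w ∧ (∀ k ≤ m, MemLp (w k) 2 (vol a b)) ∧
    ∀ k < m, ContinuousOn (w k) (Icc a b) ∧ w k a = w k b

/-! ### Functions of time with values in Sobolev spaces -/

/-- `ψ ∈ C([0, T]; H^m_per(a, b))`. -/
def ContHper (a b T : ℝ) (m : ℕ) (ψ : ℝ → ℝ → ℂ) : Prop :=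
  ∀ t ∈ Icc 0 T, MemHper a b m (ψ t) ∧
    Tendsto (fun s => hNorm a b m (ψ s - ψ t)) (𝓝[Icc 0 T] t) (𝓝 0)

/-- `ψ ∈ C¹([0, T]; H^m(a, b))` with time derivative `ψt` (for `m = 0` the space is `L²(a, b)`). -/
def ContDiffH (a b T : ℝ) (m : ℕ) (ψ ψt : ℝ → ℝ → ℂ) : Prop :=
  ∀ t ∈ Icc 0 T, MemW a b m 2 (ψ t) ∧ MemW a b m 2 (ψt t) ∧
    Tendsto (fun s => hNorm a b m (ψt s - ψt t)) (𝓝[Icc 0 T] t) (𝓝 0) ∧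
    Tendsto (fun s => hNorm a b m ((s - t)⁻¹ • (ψ s - ψ t) - ψt t)) (𝓝[Icc 0 T \ {t}] t) (𝓝 0)

/-! ### The nonlinear Schrödinger equation -/

/-- The nonlinearity `G(z) = f(|z|²) z`. -/
def G (f : ℝ → ℝ) (z : ℂ) : ℂ := (f (‖z‖ ^ 2) : ℂ) * z

/-- `ψ`, with time derivative `ψt`, satisfies `i ∂ₜψ = -∂ₓₓψ + V ψ + f(|ψ|²) ψ` on `(a, b) × (0, T]`
and `ψ(·, 0) = ψ₀`. Each `ψ t` is the continuous representative on `[a, b]`, so that point values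
make sense. -/
structure IsNLSESolution (a b T : ℝ) (V f : ℝ → ℝ) (ψ₀ : ℝ → ℂ) (ψ ψt : ℝ → ℝ → ℂ) : Prop where
  continuousOn : ∀ t ∈ Icc 0 T, ContinuousOn (ψ t) (Icc a b)
  initial : ∀ x ∈ Icc a b, ψ 0 x = ψ₀ x
  equation : ∀ t ∈ Ioc 0 T, ∃ w : ℕ → ℝ → ℂ, IsWeakDerivs a b 2 (ψ t) w ∧
    ∀ᵐ x ∂vol a b, Complex.I * ψt t x = -w 2 x + (V x : ℂ) * ψ t x + G f (ψ t x)

/-- `max {‖ψ‖_{L^∞([0,T];H²)}, ‖ψ‖_{L^∞([0,T];L^∞)}, ‖∂ₜψ‖_{L^∞([0,T];L²)}, ‖V‖_{L^∞}}`. -/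
def sizeM (a b T : ℝ) (V : ℝ → ℝ) (ψ ψt : ℝ → ℝ → ℂ) : ℝ≥0∞ :=
  max (max (⨆ t ∈ Icc 0 T, hNorm a b 2 (ψ t)) (⨆ t ∈ Icc 0 T, eLpNorm (ψ t) ∞ (vol a b)))
    (max (⨆ t ∈ Icc 0 T, eLpNorm (ψt t) 2 (vol a b)) (eLpNorm V ∞ (vol a b)))

/-! ### The extended Fourier pseudospectral discretization -/

/-- `μ_l = 2πl / (b - a)`. -/
def freq (a b : ℝ) (l : ℤ) : ℝ := 2 * Real.pi * l / (b - a)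

/-- `x ↦ e^{i μ_l (x - a)}`. -/
def mode (a b : ℝ) (l : ℤ) (x : ℝ) : ℂ := Complex.exp (Complex.I * (freq a b l * (x - a) : ℝ))

/-- The index set `{-N/2, …, N/2 - 1}`, for even `N`. -/
def idx (N : ℕ) : Finset ℤ := Finset.Ico (-((N : ℤ) / 2)) ((N : ℤ) / 2)

/-- The mesh size `h = (b - a) / N`. -/
def mesh (a b : ℝ) (N : ℕ) : ℝ := (b - a) / N

/-- The grid point `x_j = a + j h`. -/
def node (a b : ℝ) (N j : ℕ) : ℝ := a + j * mesh a b N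

/-- The trigonometric space `X_N`. -/
def XN (a b : ℝ) (N : ℕ) : Submodule ℂ (ℝ → ℂ) :=
  Submodule.span ℂ (mode a b '' (idx N : Set ℤ))

/-- The Fourier coefficient of `u` of index `l`. -/
def fourierCoef (a b : ℝ) (u : ℝ → ℂ) (l : ℤ) : ℂ :=
  1 / ((b - a : ℝ) : ℂ) * ∫ x in a..b, u x * mode a b (-l) x

/-- The discrete Fourier coefficient of the grid function `v = (v_0, …, v_N)` of index `l`. -/
def discreteCoef (a b : ℝ) (N : ℕ) (v : Fin (N + 1) → ℂ) (l : ℤ) : ℂ :=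
  1 / (N : ℂ) * ∑ j : Fin N, v j.castSucc * mode a b (-l) (node a b N j)

/-- The trigonometric interpolation operator `I_N` on grid functions. -/
def interp (a b : ℝ) (N : ℕ) (v : Fin (N + 1) → ℂ) (x : ℝ) : ℂ :=
  ∑ l ∈ idx N, discreteCoef a b N v l * mode a b l x

/-- The grid function of point values of `u`. -/
def gridValues (a b : ℝ) (N : ℕ) (u : ℝ → ℂ) : Fin (N + 1) → ℂ := fun j => u (node a b N j)

/-- The entire function `φ₁(z) = (e^z - 1) / z`. -/
def phi1 (z : ℂ) : ℂ := if z = 0 then 1 else (Complex.exp z - 1) / z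

/-- One step of the EWI-EFP scheme with time step `τ`. -/
def efpStep (a b : ℝ) (V f : ℝ → ℝ) (τ : ℝ) (N : ℕ) (v : Fin (N + 1) → ℂ) : Fin (N + 1) → ℂ :=
  fun j =>
    (∑ l ∈ idx N, Complex.exp (-Complex.I * (τ * freq a b l ^ 2 : ℝ)) * discreteCoef a b N v l *
        mode a b l (node a b N j)) -
      Complex.I * τ * ∑ l ∈ idx N, phi1 (-Complex.I * (τ * freq a b l ^ 2 : ℝ)) *
        (fourierCoef a b (fun x => (V x : ℂ) * interp a b N v x) l +
          discreteCoef a b N (fun k => G f (v k)) l) * mode a b l (node a b N j)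

/-- The EWI-EFP grid solution at step `n`, started from the point values of `ψ₀`. -/
def efp (a b : ℝ) (V f : ℝ → ℝ) (ψ₀ : ℝ → ℂ) (τ : ℝ) (N : ℕ) : ℕ → Fin (N + 1) → ℂ
  | 0 => gridValues a b N ψ₀
  | n + 1 => efpStep a b V f τ N (efp a b V f ψ₀ τ N n)

/-! ### Assumptions on the nonlinearity -/

/-- `z ↦ f(|z|²) z` is locally Lipschitz continuous. -/
def AssumptionA (f : ℝ → ℝ) : Prop :=
  ∃ CLip : ℝ → ℝ, ∀ M₀ > 0, ∀ z₁ z₂ : ℂ, ‖z₁‖ ≤ M₀ → ‖z₂‖ ≤ M₀ →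
    ‖G f z₁ - G f z₂‖ ≤ CLip M₀ * ‖z₁ - z₂‖

/-- `‖G(v) - G(w)‖_{H¹} ≤ C(‖v‖_{H³}, ‖w‖_{H²}) ‖v - w‖_{H¹}` for `v ∈ H³`, `w ∈ H²`; the constant
`C(·, ·)` is bounded on bounded sets. -/
def AssumptionB (a b : ℝ) (f : ℝ → ℝ) : Prop :=
  ∀ R : ℝ≥0, ∃ C : ℝ≥0, ∀ v w : ℝ → ℂ, MemW a b 3 2 v → MemW a b 2 2 w →
    hNorm a b 3 v ≤ R → hNorm a b 2 w ≤ R →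
      hNorm a b 1 (fun x => G f (v x) - G f (w x)) ≤ C * hNorm a b 1 (v - w)

/-- `‖I_N (G(v) - G(w))‖_{H¹} ≤ C(‖v‖_{H³}, ‖w‖_{H²}) ‖v - w‖_{H¹}` for `v, w ∈ X_N`, where `C(·, ·)`
is independent of `N` and bounded on bounded sets. -/
def AssumptionB' (a b : ℝ) (f : ℝ → ℝ) : Prop :=
  ∀ R : ℝ≥0, ∃ C : ℝ≥0, ∀ N : ℕ, 0 < N → Even N → ∀ v ∈ XN a b N, ∀ w ∈ XN a b N,
    hNorm a b 3 v ≤ R → hNorm a b 2 w ≤ R →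
      hNorm a b 1 (interp a b N (gridValues a b N (fun x => G f (v x) - G f (w x)))) ≤
        C * hNorm a b 1 (v - w)

/-- `f(|v|²) v ∈ H^α_per` for all `v ∈ H^α_per`. -/
def AssumptionC (a b : ℝ) (α : ℕ) (f : ℝ → ℝ) : Prop :=
  ∀ v : ℝ → ℂ, MemHper a b α v → MemHper a b α (fun x => G f (v x))

end EWI

end

/-! Everything is done on Fourier coefficients. There the exact solution satisfies i c_l' = μ_l² c_l
+ g_l, where g(t) collects the coefficients of Vψ + G(ψ) (`CoefEvol`). The scheme is the exact flow
with g frozen at the left end of the step (`ewiStep`) and then replaced by its discretization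
(`discForce`, `discreteCoef_efp_succ`). The multipliers e^{-iτμ²} and φ₁(-iτμ²) have modulus at most
1, so a step is stable in every Fourier-weighted norm. The local error is O(τ²) as soon as g is
Lipschitz in time (`CoefEvol.local_error`), which follows from (A) and the bound on ∂ₜψ. Projection
and aliasing errors are O(h^m), and a discrete Gronwall inequality gives the L² rate, provided the
numerical solution stays in a fixed ball where G is Lipschitz.

That ball is secured by H² stability, with no relation imposed between τ and h. Let x^n be the
numerical coefficients, F the discretized force, and Y^n = μ² x^n + F(x^n). Since zφ₁(z) = e^z - 1,
one has the exact identities μ² x^{n+1} = e^{-iτμ²} Y^n - F(x^n) and x^{n+1} - x^n = -iτφ₁ Y^n.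
Hence Y^{n+1} = e^{-iτμ²} Y^n + F(x^{n+1}) - F(x^n), and ‖Y^n‖ grows by a factor of at most 1 +
(M+K)τ per step (`IsDiscSol.nrm_residual_le`). Interpolating between a small L² error and a bounded
H² norm controls the sup norm at the next step, which closes the induction (`SolData.stability`),
and also yields the H¹ rate √τ + h.

The delicate point is uniformity of the constants: they may depend on the solution only through M,
whereas (C) merely says that G maps H^α_per into itself. Testing (C) on a function that is linear on
the middle of Ω shows that g(r) = f(r²)r has an α-th derivative γ in L² near every bounded range
(`AssumptionC.exists_chain`). Conversely, such a g acts boundedly. The critical terms in the α-th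
derivative of G(v) are γ(|v|)(|v|')^α and averages of γ times |v'|^α; the averages appear because v
is complex and its phase varies too. Neither is bounded pointwise. With φ = γ², one integrates over
a period the derivative of |v'|^{2j} P(|v|) Re(v̄v') for a suitable profile P (`prof`); this
exchanges φ(|v|)(|v|')² for ‖φ‖_{L¹}|v''| (`integral_energy_le`). A Hardy-type inequality
(`avg_sq_le`) puts the averages under the same energy. The estimate is proved for continuous γ
vanishing near 0 and for trigonometric polynomials v, and passes to the limit on finitely many
coefficients at a time (`SmoothApprox.exists_bound`).

For (ii) the L² argument is repeated with three derivatives, and Gronwall is run once more with the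
weight μ. Assumption (B) makes the force Lipschitz in time in H¹. Assumption (B') compares the
interpolated nonlinearity at the projected solution, bounded in H³, with that at the numerical
solution, bounded in H² by (i). The inverse inequality turns the remaining O(h³) terms into O(h²) in
H¹. -/

noncomputable section

namespace EWI

/-! ### Primitives of integrable functions -/

/-- `u` is absolutely continuous on `[a, b]` with derivative `g`. -/
structure IsPrim (a b : ℝ) (u g : ℝ → ℂ) : Prop where
  intble : IntervalIntegrable g volume a b
  eq : ∀ x ∈ Icc a b, u x = u a + ∫ t in a..x, g t

/-- Fubini on the triangle s ≤ x. It replaces integration by parts when the densities are only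
integrable, and gives both the product rule for absolutely continuous functions and the Taylor
remainder formula. -/
theorem intervalIntegral_swap {a b : ℝ} (hab : a ≤ b) {p q : ℝ → ℂ}
    (hp : IntervalIntegrable p volume a b) (hq : IntervalIntegrable q volume a b) :
    ∫ x in a..b, p x * ∫ s in a..x, q s = ∫ s in a..b, (∫ x in s..b, p x) * q s := by
  rw [intervalIntegrable_iff_integrableOn_Ioc_of_le hab] at hp hq
  rw [intervalIntegral.integral_of_le hab, intervalIntegral.integral_of_le hab]
  have hint : Integrable (Function.uncurry fun x s : ℝ => if s ≤ x then p x * q s else 0)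
      ((volume.restrict (Ioc a b)).prod (volume.restrict (Ioc a b))) := by
    have h := (Integrable.mul_prod hp hq).indicator
      (s := {z : ℝ × ℝ | z.2 ≤ z.1}) (measurableSet_le measurable_snd measurable_fst)
    refine h.congr (Eventually.of_forall fun z => ?_)
    simp [Function.uncurry, indicator]
  have h := integral_integral_swap hint
  have h1 : ∀ x ∈ Ioc a b, (∫ s in Ioc a b, if s ≤ x then p x * q s else 0) =
      p x * ∫ s in a..x, q s := by
    intro x hx
    rw [intervalIntegral.integral_of_le hx.1.le, ← integral_const_mul,
      ← integral_indicator measurableSet_Ioc, ← integral_indicator measurableSet_Ioc]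
    congr 1; ext s
    simp only [indicator, mem_Ioc]
    have := hx.2
    by_cases h1 : a < s <;> by_cases h2 : s ≤ x <;> simp [h1, h2] 
    intro h; exact absurd (h2.trans this) (not_le.mpr h)
  have h2 : ∀ s ∈ Ioc a b, (∫ x in Ioc a b, if s ≤ x then p x * q s else 0) =
      (∫ x in s..b, p x) * q s := by
    intro s hs
    have e : ∫ x in s..b, p x = ∫ x in Icc s b, p x := by
      rw [intervalIntegral.integral_of_le hs.2, integral_Icc_eq_integral_Ioc]
    rw [e, ← integral_mul_const, ← integral_indicator measurableSet_Ioc,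
      ← integral_indicator measurableSet_Icc]
    congr 1; ext x
    simp only [indicator, mem_Ioc, mem_Icc]
    have := hs.1
    by_cases h1 : s ≤ x <;> by_cases h2 : x ≤ b <;> simp [h1, h2]
    intro h; exact absurd (this.trans_le h1) (not_lt.mpr h)
  rw [setIntegral_congr_fun measurableSet_Ioc h1, setIntegral_congr_fun measurableSet_Ioc h2] at h
  exact h

namespace IsPrim

variable {a b : ℝ} {u v g k : ℝ → ℂ}

theorem continuousOn (hab : a ≤ b) (h : IsPrim a b u g) : ContinuousOn u (Icc a b) := by
  have := intervalIntegral.continuousOn_primitive_interval' h.intble left_mem_uIcc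
  rw [uIcc_of_le hab] at this
  exact (continuousOn_const.add this).congr h.eq

theorem intble_mono (h : IsPrim a b u g) {c d : ℝ} (hac : a ≤ c) (hcd : c ≤ d) (hdb : d ≤ b) :
    IntervalIntegrable g volume c d :=
  h.intble.mono_set (by rw [uIcc_of_le hcd, uIcc_of_le (hac.trans (hcd.trans hdb))]
                        exact Icc_subset_Icc hac hdb)

theorem sub_eq (h : IsPrim a b u g) {c d : ℝ} (hac : a ≤ c) (hcd : c ≤ d) (hdb : d ≤ b) :
    u d = u c + ∫ t in c..d, g t := by
  rw [h.eq d ⟨hac.trans hcd, hdb⟩, h.eq c ⟨hac, hcd.trans hdb⟩, add_assoc,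
    intervalIntegral.integral_add_adjacent_intervals (h.intble_mono le_rfl hac (hcd.trans hdb))
      (h.intble_mono hac hcd hdb)]

theorem mono (h : IsPrim a b u g) {c d : ℝ} (hac : a ≤ c) (hcd : c ≤ d) (hdb : d ≤ b) :
    IsPrim c d u g :=
  ⟨h.intble_mono hac hcd hdb, fun _ hx => h.sub_eq hac hx.1 (hx.2.trans hdb)⟩

theorem add (h : IsPrim a b u g) (h' : IsPrim a b v k) :
    IsPrim a b (fun x => u x + v x) (fun x => g x + k x) := by
  refine ⟨h.intble.add h'.intble, fun x hx => ?_⟩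
  rw [intervalIntegral.integral_add (h.intble_mono le_rfl hx.1 hx.2)
    (h'.intble_mono le_rfl hx.1 hx.2), h.eq x hx, h'.eq x hx]
  ring

theorem const_mul (h : IsPrim a b u g) (c : ℂ) :
    IsPrim a b (fun x => c * u x) (fun x => c * g x) := by
  refine ⟨h.intble.const_mul c, fun x hx => ?_⟩
  rw [intervalIntegral.integral_const_mul, h.eq x hx]
  ring

theorem sub (h : IsPrim a b u g) (h' : IsPrim a b v k) :
    IsPrim a b (fun x => u x - v x) (fun x => g x - k x) := by
  simpa [sub_eq_add_neg] using h.add (h'.const_mul (-1))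

theorem congr_left (h : IsPrim a b u g) (huv : EqOn u v (Icc a b)) (hab : a ≤ b) :
    IsPrim a b v g :=
  ⟨h.intble, fun x hx => by rw [← huv hx, ← huv (left_mem_Icc.2 hab)]; exact h.eq x hx⟩

/-- Each factor is expanded as its value at a plus a primitive. What remains are double integrals
over two complementary triangles, so pointwise differentiability is never invoked. -/
theorem mul (hab : a ≤ b) (h : IsPrim a b u g) (h' : IsPrim a b v k) :
    IsPrim a b (fun x => u x * v x) (fun x => g x * v x + u x * k x) := by
  have key : ∀ {a b : ℝ} {u v g k : ℝ → ℂ}, a ≤ b → IsPrim a b u g → IsPrim a b v k →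
      IntervalIntegrable (fun x => g x * v x) volume a b := by
    intro a b u v g k hab h h'
    exact h.intble.mul_continuousOn (by rw [uIcc_of_le hab]; exact h'.continuousOn hab)
  have i1 := key hab h h'
  have i2 : IntervalIntegrable (fun x => u x * k x) volume a b := by
    simpa [mul_comm] using key hab h' h
  refine ⟨i1.add i2, fun y hy => ?_⟩
  have hay := hy.1
  replace h := h.mono le_rfl hay hy.2
  replace h' := h'.mono le_rfl hay hy.2
  have j1 := key hay h h'
  have j2 : IntervalIntegrable (fun x => u x * k x) volume a y := by
    simpa [mul_comm] using key hay h' h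
  have pu : ContinuousOn (fun x => ∫ t in a..x, g t) (uIcc a y) :=
    intervalIntegral.continuousOn_primitive_interval' h.intble left_mem_uIcc
  have pv : ContinuousOn (fun x => ∫ t in a..x, k t) (uIcc a y) :=
    intervalIntegral.continuousOn_primitive_interval' h'.intble left_mem_uIcc
  rw [intervalIntegral.integral_add j1 j2]
  have e1 : ∫ x in a..y, g x * v x = (∫ x in a..y, g x) * v a +
      ∫ s in a..y, (∫ x in s..y, g x) * k s := by
    rw [← intervalIntegral_swap hay h.intble h'.intble, ← intervalIntegral.integral_mul_const,
      ← intervalIntegral.integral_add (h.intble.mul_const _) (h.intble.mul_continuousOn pv)]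
    refine intervalIntegral.integral_congr fun x hx => ?_
    rw [uIcc_of_le hay] at hx
    rw [h'.eq x hx]; ring
  have e2 : ∫ x in a..y, u x * k x = u a * (∫ x in a..y, k x) +
      ∫ s in a..y, (∫ x in a..s, g x) * k s := by
    rw [← intervalIntegral.integral_const_mul,
      ← intervalIntegral.integral_add (h'.intble.const_mul _) (h'.intble.continuousOn_mul pu)]
    refine intervalIntegral.integral_congr fun x hx => ?_
    rw [uIcc_of_le hay] at hx
    rw [h.eq x hx]; ring
  -- The triangles x ≥ s and x ≤ s fill the square, whose integral is the product of the two
  -- increments.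
  have e3 : (∫ s in a..y, (∫ x in s..y, g x) * k s) + ∫ s in a..y, (∫ x in a..s, g x) * k s =
      (∫ x in a..y, g x) * ∫ x in a..y, k x := by
    have pg : ContinuousOn (fun s => ∫ x in s..y, g x) (uIcc a y) := by
      refine intervalIntegral.continuousOn_primitive_interval_left ?_
      rw [uIcc_of_le hay]
      exact (intervalIntegrable_iff_integrableOn_Icc_of_le hay).1 h.intble
    rw [← intervalIntegral.integral_const_mul,
      ← intervalIntegral.integral_add (h'.intble.continuousOn_mul pg)
        (h'.intble.continuousOn_mul pu)]
    refine intervalIntegral.integral_congr fun x hx => ?_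
    rw [uIcc_of_le hay] at hx
    rw [← intervalIntegral.integral_add_adjacent_intervals (h.intble_mono le_rfl hx.1 hx.2)
      (h.intble_mono hx.1 hx.2 le_rfl)]
    ring
  have hy' : y ∈ Icc a y := right_mem_Icc.2 hay
  rw [e1, e2, h.eq y hy', h'.eq y hy']
  linear_combination -e3

theorem of_hasDerivAt (hu : ∀ x, HasDerivAt u (g x) x) (hg : Continuous g) :
    IsPrim a b u g := by
  refine ⟨hg.intervalIntegrable _ _, fun x _ => ?_⟩
  rw [intervalIntegral.integral_eq_sub_of_hasDerivAt (fun y _ => hu y) (hg.intervalIntegrable _ _)]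
  ring

end IsPrim

/-! ### Weak derivatives -/

theorem integrableOn_vol_iff {a b : ℝ} (hab : a ≤ b) {g : ℝ → ℂ} :
    Integrable g (vol a b) ↔ IntervalIntegrable g volume a b := by
  rw [intervalIntegrable_iff_integrableOn_Ioo_of_le hab]; rfl

theorem integral_vol {a b : ℝ} (hab : a ≤ b) {E : Type*} [NormedAddCommGroup E] [NormedSpace ℝ E]
    (g : ℝ → E) : ∫ x, g x ∂vol a b = ∫ x in a..b, g x := by
  rw [intervalIntegral.integral_of_le hab, vol, integral_Ioc_eq_integral_Ioo]

instance (a b : ℝ) : IsFiniteMeasure (vol a b) :=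
  ⟨by simp [vol]⟩

theorem IsPrim.isWeakDeriv {a b : ℝ} (hab : a ≤ b) {u g : ℝ → ℂ} (h : IsPrim a b u g) :
    IsWeakDeriv a b u g := by
  refine ⟨((h.continuousOn hab).mono Ioo_subset_Icc_self).locallyIntegrableOn measurableSet_Ioo,
    IntegrableOn.locallyIntegrableOn ((integrableOn_vol_iff hab).2 h.intble), ?_⟩
  intro φ hφ hc hs
  have h1 : IsPrim a b (fun x => (φ x : ℂ)) (fun x => ((deriv φ x : ℝ) : ℂ)) := by
    refine IsPrim.of_hasDerivAt (fun x => ?_) ?_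
    · exact ((hφ.differentiable (by simp)).differentiableAt.hasDerivAt).ofReal_comp
    · exact Complex.continuous_ofReal.comp (hφ.continuous_deriv (by simp))
  have h0 : ∀ x, x ∉ Ioo a b → φ x = 0 := fun x hx => image_eq_zero_of_notMem_tsupport
    (fun hx' => hx (hs hx'))
  have h2 := (h1.mul hab h).eq b (right_mem_Icc.2 hab)
  simp only [h0 a (by simp), h0 b (by simp)] at h2
  rw [intervalIntegral.integral_add] at h2
  · rw [← integral_Ioc_eq_integral_Ioo, ← integral_Ioc_eq_integral_Ioo,
      ← intervalIntegral.integral_of_le hab, ← intervalIntegral.integral_of_le hab]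
    simp only [Complex.real_smul]
    simp only [Complex.ofReal_zero, zero_mul, zero_add] at h2
    exact eq_neg_of_add_eq_zero_left h2.symm
  · exact h1.intble.mul_continuousOn (by rw [uIcc_of_le hab]; exact h.continuousOn hab)
  · exact h.intble.continuousOn_mul (by rw [uIcc_of_le hab]; exact h1.continuousOn hab)

namespace IsWeakDeriv

variable {a b : ℝ} {u v g k : ℝ → ℂ}

theorem congr_ae (h : IsWeakDeriv a b u g) (huv : u =ᵐ[vol a b] v) (hgk : g =ᵐ[vol a b] k) :
    IsWeakDeriv a b v k := by
  refine ⟨h.1.congr huv, h.2.1.congr hgk, fun φ hφ hc hs => ?_⟩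
  have e1 : ∫ x in Ioo a b, deriv φ x • v x = ∫ x in Ioo a b, deriv φ x • u x :=
    integral_congr_ae (huv.mono fun x hx => by simp [hx])
  have e2 : ∫ x in Ioo a b, φ x • k x = ∫ x in Ioo a b, φ x • g x :=
    integral_congr_ae (hgk.mono fun x hx => by simp [hx])
  rw [e1, e2]; exact h.2.2 φ hφ hc hs

theorem integrable_smul (hu : LocallyIntegrableOn u (Ioo a b)) {φ : ℝ → ℝ} (hφ : Continuous φ)
    (hc : HasCompactSupport φ) (hs : tsupport φ ⊆ Ioo a b) :
    IntegrableOn (fun x => φ x • u x) (Ioo a b) := by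
  have h1 : IntegrableOn u (tsupport φ) := hu.integrableOn_compact_subset hs hc
  have h2 : IntegrableOn (fun x => φ x • u x) (tsupport φ) :=
    IntegrableOn.continuousOn_smul h1 hφ.continuousOn hc
  have h3 : Integrable (fun x => φ x • u x) := by
    rw [integrableOn_iff_integrable_of_support_subset] at h2
    · exact h2
    · intro x hx
      by_contra h
      exact hx (by simp [image_eq_zero_of_notMem_tsupport h])
  exact h3.integrableOn

theorem sub (h : IsWeakDeriv a b u g) (h' : IsWeakDeriv a b v k) :
    IsWeakDeriv a b (u - v) (g - k) := by
  refine ⟨h.1.sub h'.1, h.2.1.sub h'.2.1, fun φ hφ hc hs => ?_⟩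
  have hs' : tsupport (deriv φ) ⊆ Ioo a b := (tsupport_deriv_subset).trans hs
  simp only [Pi.sub_apply, smul_sub]
  rw [integral_sub (integrable_smul h.1 (hφ.continuous_deriv (by simp)) hc.deriv hs')
      (integrable_smul h'.1 (hφ.continuous_deriv (by simp)) hc.deriv hs'),
    integral_sub (integrable_smul h.2.1 hφ.continuous hc hs)
      (integrable_smul h'.2.1 hφ.continuous hc hs), h.2.2 φ hφ hc hs, h'.2.2 φ hφ hc hs]
  ring

theorem ae_unique (h : IsWeakDeriv a b u g) (h' : IsWeakDeriv a b u k) : g =ᵐ[vol a b] k := by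
  have h0 := h.sub h'
  have := isOpen_Ioo.ae_eq_zero_of_integral_contDiff_smul_eq_zero (μ := volume) h0.2.1
    (fun φ hφ hc hs => by
      have e := h0.2.2 φ hφ hc hs
      simp only [sub_self, Pi.zero_apply, smul_zero, integral_zero] at e
      rw [← setIntegral_eq_integral_of_forall_compl_eq_zero (s := Ioo a b)]
      · exact neg_eq_zero.1 e.symm
      · intro x hx
        rw [image_eq_zero_of_notMem_tsupport fun hx' => hx (hs hx'), zero_smul])
  filter_upwards [(ae_restrict_iff' measurableSet_Ioo).2 this] with x hx
  exact sub_eq_zero.1 hx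

/-- A test function of mean zero is the derivative of a test function: its primitive from a vanishes
left of the support by construction, and right of it because the mean is zero. -/
theorem integral_smul_eq_zero (hab : a < b) (h : IsWeakDeriv a b u 0) {η : ℝ → ℝ}
    (hη : ContDiff ℝ ∞ η) (hc : HasCompactSupport η) (hs : tsupport η ⊆ Ioo a b)
    (h0 : ∫ x, η x = 0) : ∫ x in Ioo a b, η x • u x = 0 := by
  -- The primitive will be supported in [c, d], which must stay strictly inside (a, b). An empty
  -- support has no extreme points, so the midpoint serves there.
  obtain ⟨c, d, hac, hcd, hdb, hsub⟩ : ∃ c d, a < c ∧ c ≤ d ∧ d < b ∧ tsupport η ⊆ Icc c d := by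
    rcases (tsupport η).eq_empty_or_nonempty with he | hne
    · exact ⟨(a + b) / 2, (a + b) / 2, by linarith, le_rfl, by linarith, by simp [he]⟩
    · obtain ⟨p, hp, hp'⟩ := hc.exists_isLeast hne
      obtain ⟨q, hq, hq'⟩ := hc.exists_isGreatest hne
      exact ⟨p, q, (hs hp).1, hp' hq, (hs hq).2, fun x hx => ⟨hp' hx, hq' hx⟩⟩
  set φ : ℝ → ℝ := fun x => ∫ t in a..x, η t
  have hd : ∀ x, HasDerivAt φ (η x) x := fun x =>
    (hη.continuous.integral_hasStrictDerivAt a x).hasDerivAt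
  have hφ : ContDiff ℝ ∞ φ := by
    rw [contDiff_infty_iff_deriv]
    refine ⟨fun x => (hd x).differentiableAt, ?_⟩
    rwa [show deriv φ = η from funext fun x => (hd x).deriv]
  have hz : ∀ x ∉ Icc c d, η x = 0 := fun x hx =>
    image_eq_zero_of_notMem_tsupport fun h => hx (hsub h)
  have hφ0 : ∀ x ∉ Icc c d, φ x = 0 := by
    intro x hx
    rcases lt_or_ge x c with hxc | hxc
    · refine intervalIntegral.integral_zero_ae (Eventually.of_forall fun t ht => hz t fun h => ?_)
      rw [uIoc, mem_Ioc] at ht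
      exact absurd (h.1.trans ht.2) (not_le.2 (max_lt hac hxc))
    · have hxd : d < x := lt_of_not_ge fun h => hx ⟨hxc, h⟩
      rw [← h0]
      refine intervalIntegral.integral_eq_integral_of_support_subset fun t ht => ?_
      have ht' : t ∈ Icc c d := by_contra fun h => ht (hz t h)
      exact ⟨hac.trans_le ht'.1, ht'.2.trans hxd.le⟩
  have hts : tsupport φ ⊆ Icc c d :=
    closure_minimal (fun x hx => by_contra fun h => hx (hφ0 x h)) isClosed_Icc
  have := h.2.2 φ hφ (isCompact_Icc.of_isClosed_subset (isClosed_tsupport _) hts)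
    (hts.trans fun x hx => ⟨hac.trans_le hx.1, hx.2.trans_lt hdb⟩)
  rw [show deriv φ = η from funext fun x => (hd x).deriv] at this
  simpa using this

theorem _root_.EWI.exists_bump {a b : ℝ} (hab : a < b) : ∃ η : ℝ → ℝ, ContDiff ℝ ∞ η ∧
    HasCompactSupport η ∧ tsupport η ⊆ Ioo a b ∧ ∫ x, η x = 1 := by
  have hr : 0 < (b - a) / 8 := by linarith
  obtain ⟨B, hB⟩ : ∃ B : ContDiffBump ((a + b) / 2), B.rOut = (b - a) / 4 :=
    ⟨⟨(b - a) / 8, (b - a) / 4, hr, by linarith⟩, rfl⟩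
  refine ⟨B.normed volume, B.contDiff_normed, B.hasCompactSupport_normed, ?_, B.integral_normed⟩
  rw [B.tsupport_normed_eq, hB]
  intro x hx
  rw [Metric.mem_closedBall, Real.dist_eq, abs_le] at hx
  constructor <;> linarith [hx.1, hx.2]

/-- Subtracting (∫ η) η₀ from η leaves mean zero, so the previous lemma applies to the difference.
-/
theorem integral_smul_eq_of_bump (hab : a < b) (h : IsWeakDeriv a b u 0) {η η₀ : ℝ → ℝ}
    (hη : ContDiff ℝ ∞ η) (hc : HasCompactSupport η) (hs : tsupport η ⊆ Ioo a b)
    (hη₀ : ContDiff ℝ ∞ η₀) (hη₀c : HasCompactSupport η₀) (hη₀s : tsupport η₀ ⊆ Ioo a b)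
    (hη₀i : ∫ x, η₀ x = 1) :
    ∫ x in Ioo a b, η x • u x = (∫ x, η x) • ∫ x in Ioo a b, η₀ x • u x := by
  have hηi : Integrable η := hη.continuous.integrable_of_hasCompactSupport hc
  have hη₀i' : Integrable η₀ := hη₀.continuous.integrable_of_hasCompactSupport hη₀c
  generalize hI : ∫ x, η x = I
  have hθ := h.integral_smul_eq_zero hab (η := fun x => η x - I * η₀ x)
    (hη.sub (contDiff_const.mul hη₀)) (hc.sub hη₀c.mul_left)
    ((tsupport_sub _ _).trans (union_subset hs (tsupport_mul_subset_right.trans hη₀s)))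
    (by rw [integral_sub hηi (hη₀i'.const_mul I), integral_const_mul, hη₀i, mul_one, hI, sub_self])
  simp only [sub_smul, mul_smul] at hθ
  have i2 : IntegrableOn (fun x => I • η₀ x • u x) (Ioo a b) :=
    (integrable_smul h.1 hη₀.continuous hη₀c hη₀s).smul I
  rw [integral_sub (integrable_smul h.1 hη.continuous hc hs) i2, integral_smul] at hθ
  exact sub_eq_zero.1 hθ

/-- The du Bois-Reymond lemma: u and the constant ∫ η₀ u have the same pairing with every test
function. -/
theorem exists_ae_eq_const (hab : a < b) (h : IsWeakDeriv a b u 0) :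
    ∃ c : ℂ, u =ᵐ[vol a b] fun _ => c := by
  obtain ⟨η₀, hη₀, hη₀c, hη₀s, hη₀i⟩ := exists_bump hab
  refine ⟨∫ x in Ioo a b, η₀ x • u x, ?_⟩
  have key : ∀ η : ℝ → ℝ, ContDiff ℝ ∞ η → HasCompactSupport η → tsupport η ⊆ Ioo a b →
      ∫ x in Ioo a b, η x • u x = (∫ x, η x) • ∫ x in Ioo a b, η₀ x • u x := fun η hη hc hs =>
    h.integral_smul_eq_of_bump hab hη hc hs hη₀ hη₀c hη₀s hη₀i
  generalize (∫ x in Ioo a b, η₀ x • u x) = c at key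
  have hcl : LocallyIntegrableOn (fun _ : ℝ => c) (Ioo a b) :=
    continuousOn_const.locallyIntegrableOn measurableSet_Ioo
  have hall : ∀ η : ℝ → ℝ, tsupport η ⊆ Ioo a b → ∀ v : ℝ → ℂ,
      ∫ x in Ioo a b, η x • v x = ∫ x, η x • v x := fun η hs v =>
    setIntegral_eq_integral_of_forall_compl_eq_zero fun x hx => by
      rw [image_eq_zero_of_notMem_tsupport fun hx' => hx (hs hx'), zero_smul]
  have := isOpen_Ioo.ae_eq_zero_of_integral_contDiff_smul_eq_zero (μ := volume) (h.1.sub hcl)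
    (fun η hη hc hs => by
      rw [← hall η hs]
      simp only [Pi.sub_apply, smul_sub]
      rw [integral_sub (integrable_smul h.1 hη.continuous hc hs)
        (integrable_smul hcl hη.continuous hc hs), hall η hs fun _ => c, integral_smul_const,
        key η hη hc hs, sub_self])
  filter_upwards [(ae_restrict_iff' measurableSet_Ioo).2 this] with x hx
  exact sub_eq_zero.1 hx

/-- The difference of u and the primitive of g has weak derivative 0, hence is a.e. constant;
continuity up to the endpoints upgrades this to every point of [a, b]. From here on weak derivatives
are handled as genuine primitives. -/
theorem isPrim (hab : a < b) (h : IsWeakDeriv a b u g) (hu : ContinuousOn u (Icc a b))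
    (hg : IntervalIntegrable g volume a b) : IsPrim a b u g := by
  have hP : IsPrim a b (fun x => ∫ t in a..x, g t) g := ⟨hg, fun x _ => by simp⟩
  have h0 := h.sub (hP.isWeakDeriv hab.le)
  rw [sub_self] at h0
  obtain ⟨c, hc⟩ := h0.exists_ae_eq_const hab
  have hc' : EqOn (u - fun x => ∫ t in a..x, g t) (fun _ => c) (Icc a b) := by
    refine Measure.eqOn_Icc_of_ae_eq volume hab.ne ?_
      (hu.sub (hP.continuousOn hab.le)) continuousOn_const
    rwa [Measure.restrict_congr_set Ioo_ae_eq_Icc.symm]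
  refine ⟨hg, fun x hx => ?_⟩
  have h1 := hc' hx
  have h2 := hc' (left_mem_Icc.2 hab.le)
  simp only [Pi.sub_apply, intervalIntegral.integral_same, sub_zero] at h1 h2
  rw [h2, ← h1]; ring

end IsWeakDeriv

/-! ### The Sobolev norm through a family of weak derivatives -/

namespace IsWeakDerivs

variable {a b : ℝ} {m : ℕ} {u v : ℝ → ℂ} {w w' : ℕ → ℝ → ℂ}

theorem ae_unique (h : IsWeakDerivs a b m u w) (h' : IsWeakDerivs a b m u w') :
    ∀ k ≤ m, w k =ᵐ[vol a b] w' k := by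
  intro k
  induction k with
  | zero => exact fun _ => h.1.trans h'.1.symm
  | succ k ih =>
    intro hk
    exact (h.2 k hk).ae_unique ((h'.2 k hk).congr_ae (ih (by omega)).symm EventuallyEq.rfl)

theorem congr_ae (h : IsWeakDerivs a b m u w) (huv : u =ᵐ[vol a b] v) :
    IsWeakDerivs a b m v w := ⟨h.1.trans huv, h.2⟩

theorem sub (h : IsWeakDerivs a b m u w) (h' : IsWeakDerivs a b m v w') :
    IsWeakDerivs a b m (u - v) (w - w') :=
  ⟨h.1.sub h'.1, fun k hk => (h.2 k hk).sub (h'.2 k hk)⟩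

theorem hNorm_eq (h : IsWeakDerivs a b m u w) : hNorm a b m u =
    (∑ k ∈ Finset.range (m + 1), eLpNorm (w k) 2 (vol a b) ^ 2) ^ (1 / 2 : ℝ) := by
  refine le_antisymm (iInf₂_le w h) (le_iInf₂ fun w' h' => ?_)
  refine le_of_eq (congrArg (· ^ (1 / 2 : ℝ)) (Finset.sum_congr rfl fun k hk => ?_))
  rw [eLpNorm_congr_ae (h.ae_unique h' k (by simpa [Nat.lt_succ_iff] using hk))]

theorem eLpNorm_le_hNorm (h : IsWeakDerivs a b m u w) {k : ℕ} (hk : k ≤ m) :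
    eLpNorm (w k) 2 (vol a b) ≤ hNorm a b m u := by
  rw [h.hNorm_eq]
  calc eLpNorm (w k) 2 (vol a b) = (eLpNorm (w k) 2 (vol a b) ^ 2) ^ (1 / 2 : ℝ) := by
        rw [← ENNReal.rpow_natCast, ← ENNReal.rpow_mul]; norm_num
    _ ≤ _ := ENNReal.rpow_le_rpow (Finset.single_le_sum
        (f := fun k => eLpNorm (w k) 2 (vol a b) ^ 2) (fun _ _ => zero_le)
        (Finset.mem_range.2 (by omega))) (by norm_num)

theorem hNorm_le (h : IsWeakDerivs a b m u w) :
    hNorm a b m u ≤ ∑ k ∈ Finset.range (m + 1), eLpNorm (w k) 2 (vol a b) := by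
  rw [h.hNorm_eq]
  calc _ ≤ ((∑ k ∈ Finset.range (m + 1), eLpNorm (w k) 2 (vol a b)) ^ 2) ^ (1 / 2 : ℝ) := by
        refine ENNReal.rpow_le_rpow ?_ (by norm_num)
        rw [sq, Finset.sum_mul]
        refine Finset.sum_le_sum fun k hk => ?_
        rw [sq]
        gcongr
        exact Finset.single_le_sum (f := fun k => eLpNorm (w k) 2 (vol a b))
          (fun _ _ => zero_le) hk
    _ = _ := by rw [← ENNReal.rpow_natCast, ← ENNReal.rpow_mul]; norm_num

end IsWeakDerivs

/-- `w 0, …, w m` are successive derivatives on `[a, b]` of a periodic function in `H^m`. -/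
structure HPer (a b : ℝ) (m : ℕ) (w : ℕ → ℝ → ℂ) : Prop where
  prim : ∀ k < m, IsPrim a b (w k) (w (k + 1))
  per : ∀ k < m, w k a = w k b
  memLp : ∀ k ≤ m, MemLp (w k) 2 (vol a b)

theorem _root_.MeasureTheory.MemLp.intervalIntegrable_of_vol {a b : ℝ} (hab : a ≤ b) {u : ℝ → ℂ}
    {p : ℝ≥0∞} (hp : 1 ≤ p) (h : MemLp u p (vol a b)) : IntervalIntegrable u volume a b :=
  (integrableOn_vol_iff hab).1 (h.integrable hp)

namespace HPer

variable {a b : ℝ} {m : ℕ} {w w' : ℕ → ℝ → ℂ}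

theorem mono (h : HPer a b m w) {j : ℕ} (hj : j ≤ m) : HPer a b j w :=
  ⟨fun k hk => h.prim k (hk.trans_le hj), fun k hk => h.per k (hk.trans_le hj),
    fun k hk => h.memLp k (hk.trans hj)⟩

theorem isWeakDerivs (hab : a ≤ b) (h : HPer a b m w) : IsWeakDerivs a b m (w 0) w :=
  ⟨EventuallyEq.rfl, fun k hk => (h.prim k hk).isWeakDeriv hab⟩

theorem continuousOn (hab : a ≤ b) (h : HPer a b m w) {k : ℕ} (hk : k < m) :
    ContinuousOn (w k) (Icc a b) := (h.prim k hk).continuousOn hab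

theorem memHper (hab : a ≤ b) (h : HPer a b m w) : MemHper a b m (w 0) :=
  ⟨w, h.isWeakDerivs hab, h.memLp, fun k hk => ⟨h.continuousOn hab hk, h.per k hk⟩⟩

theorem sub (h : HPer a b m w) (h' : HPer a b m w') : HPer a b m (w - w') :=
  ⟨fun k hk => (h.prim k hk).sub (h'.prim k hk),
    fun k hk => by simp [h.per k hk, h'.per k hk], fun k hk => (h.memLp k hk).sub (h'.memLp k hk)⟩

theorem const_mul (h : HPer a b m w) (c : ℂ) : HPer a b m (fun k x => c * w k x) :=
  ⟨fun k hk => (h.prim k hk).const_mul c,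
    fun k hk => by simp [h.per k hk], fun k hk => (h.memLp k hk).const_mul c⟩

end HPer

theorem MemHper.exists_hPer {a b : ℝ} (hab : a < b) {m : ℕ} {u : ℝ → ℂ} (h : MemHper a b m u) :
    ∃ w, HPer a b m w ∧ w 0 =ᵐ[vol a b] u := by
  obtain ⟨w, hw, hL, hc⟩ := h
  exact ⟨w, ⟨fun k hk => (hw.2 k hk).isPrim hab (hc k hk).1
    ((hL (k + 1) hk).intervalIntegrable_of_vol hab.le one_le_two), fun k hk => (hc k hk).2, hL⟩, hw.1⟩

theorem eqOn_of_ae_eq_vol {a b : ℝ} (hab : a < b) {u v : ℝ → ℂ} (h : u =ᵐ[vol a b] v)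
    (hu : ContinuousOn u (Icc a b)) (hv : ContinuousOn v (Icc a b)) : EqOn u v (Icc a b) := by
  refine Measure.eqOn_Icc_of_ae_eq volume hab.ne ?_ hu hv
  rwa [Measure.restrict_congr_set Ioo_ae_eq_Icc.symm]

/-- The scheme samples point values, so the chain of derivatives must start with u itself and not
with an a.e. equal function. Two continuous representatives agree on the closed interval, so entry 0
can be replaced by u. -/
theorem MemHper.exists_hPer_eq {a b : ℝ} (hab : a < b) {m : ℕ} (hm : 0 < m) {u : ℝ → ℂ}
    (h : MemHper a b m u) (hu : ContinuousOn u (Icc a b)) :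
    ∃ w, HPer a b m w ∧ w 0 = u := by
  obtain ⟨w, hw, hwu⟩ := h.exists_hPer hab
  have he : EqOn (w 0) u (Icc a b) :=
    eqOn_of_ae_eq_vol hab hwu (hw.continuousOn hab.le hm) hu
  refine ⟨Function.update w 0 u, ⟨fun k hk => ?_, fun k hk => ?_, fun k hk => ?_⟩, by simp⟩
  · rcases k with _ | k
    · simpa using (hw.prim 0 hk).congr_left he hab.le
    · simpa using hw.prim (k + 1) hk
  · rcases k with _ | k
    · simpa using (he (left_mem_Icc.2 hab.le)) ▸ (he (right_mem_Icc.2 hab.le)) ▸ hw.per 0 hk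
    · simpa using hw.per (k + 1) hk
  · rcases k with _ | k
    · simpa using (hw.memLp 0 hk).ae_eq hwu
    · simpa using hw.memLp (k + 1) hk

/-! ### Euclidean norms of finitely many coefficients -/

/-- The `ℓ²` norm of the restriction of `c` to `F`. -/
def nrm (F : Finset ℤ) (c : ℤ → ℂ) : ℝ := √(∑ l ∈ F, ‖c l‖ ^ 2)

section nrm

variable {F : Finset ℤ} {c d : ℤ → ℂ}

theorem nrm_nonneg (F : Finset ℤ) (c : ℤ → ℂ) : 0 ≤ nrm F c := Real.sqrt_nonneg _

theorem nrm_sq (F : Finset ℤ) (c : ℤ → ℂ) : nrm F c ^ 2 = ∑ l ∈ F, ‖c l‖ ^ 2 :=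
  Real.sq_sqrt (Finset.sum_nonneg fun _ _ => by positivity)

theorem nrm_eq_norm (F : Finset ℤ) (c : ℤ → ℂ) :
    nrm F c = ‖(WithLp.toLp 2 fun l : F => c l : EuclideanSpace ℂ F)‖ := by
  rw [EuclideanSpace.norm_eq, nrm]
  congr 1
  exact (Finset.sum_coe_sort F fun l => ‖c l‖ ^ 2).symm

theorem nrm_add_le (F : Finset ℤ) (c d : ℤ → ℂ) :
    nrm F (fun l => c l + d l) ≤ nrm F c + nrm F d := by
  simp only [nrm_eq_norm]
  exact norm_add_le (WithLp.toLp 2 fun l : F => c l : EuclideanSpace ℂ F)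
    (WithLp.toLp 2 fun l : F => d l)

theorem nrm_le_nrm_mul {K : ℝ} (hK : 0 ≤ K) (h : ∀ l ∈ F, ‖c l‖ ≤ K * ‖d l‖) :
    nrm F c ≤ K * nrm F d := by
  refine Real.sqrt_le_iff.2 ⟨mul_nonneg hK (nrm_nonneg _ _), ?_⟩
  rw [mul_pow, nrm_sq, Finset.mul_sum]
  refine Finset.sum_le_sum fun l hl => ?_
  rw [← mul_pow]
  exact pow_le_pow_left₀ (norm_nonneg _) (h l hl) 2

theorem nrm_mono (h : ∀ l ∈ F, ‖c l‖ ≤ ‖d l‖) : nrm F c ≤ nrm F d := by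
  simpa using nrm_le_nrm_mul zero_le_one (by simpa using h)

theorem nrm_congr (h : ∀ l ∈ F, ‖c l‖ = ‖d l‖) : nrm F c = nrm F d :=
  le_antisymm (nrm_mono fun l hl => (h l hl).le) (nrm_mono fun l hl => (h l hl).ge)

theorem nrm_sub_le (F : Finset ℤ) (c d : ℤ → ℂ) :
    nrm F (fun l => c l - d l) ≤ nrm F c + nrm F d := by
  simpa [sub_eq_add_neg, nrm_congr (c := fun l => -d l) (d := d) (F := F) (by simp)]
    using nrm_add_le F c fun l => -d l

theorem nrm_le_sub_add (F : Finset ℤ) (c d : ℤ → ℂ) :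
    nrm F c ≤ nrm F (fun l => c l - d l) + nrm F d := by
  simpa using nrm_add_le F (fun l => c l - d l) d

theorem norm_le_nrm {l : ℤ} (hl : l ∈ F) : ‖c l‖ ≤ nrm F c :=
  Real.le_sqrt_of_sq_le (Finset.single_le_sum (f := fun l => ‖c l‖ ^ 2)
    (fun _ _ => by positivity) hl)

/-- Cauchy–Schwarz applied to |c_l| and m_l²|c_l|. With m the frequencies this is ‖u'‖² ≤ ‖u‖ ‖u''‖,
the interpolation that produces the rate √τ + h in H¹ and the sup bound in the stability induction.
-/
theorem nrm_sq_le_mul (m : ℤ → ℝ) : nrm F (fun l => m l * c l) ^ 2 ≤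
    nrm F c * nrm F (fun l => ((m l ^ 2 : ℝ) : ℂ) * c l) := by
  rw [nrm_sq]
  calc ∑ l ∈ F, ‖(m l : ℂ) * c l‖ ^ 2 = ∑ l ∈ F, ‖c l‖ * ‖((m l ^ 2 : ℝ) : ℂ) * c l‖ := by
        refine Finset.sum_congr rfl fun l _ => ?_
        simp [mul_pow]
        ring
    _ ≤ _ := Real.sum_mul_le_sqrt_mul_sqrt _ _ _

end nrm

/-! ### The `L²` norm as a real number -/

/-- The `L²(a, b)` norm as a real number. -/
def l2 (a b : ℝ) (u : ℝ → ℂ) : ℝ := (eLpNorm u 2 (vol a b)).toReal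

section l2

variable {a b : ℝ} {u v : ℝ → ℂ}

theorem l2_nonneg (a b : ℝ) (u : ℝ → ℂ) : 0 ≤ l2 a b u := ENNReal.toReal_nonneg

theorem ofReal_l2 (hu : MemLp u 2 (vol a b)) : ENNReal.ofReal (l2 a b u) = eLpNorm u 2 (vol a b) :=
  ENNReal.ofReal_toReal hu.eLpNorm_ne_top

theorem l2_le_of_eLpNorm_le {K : ℝ} (hK : 0 ≤ K) (h : eLpNorm u 2 (vol a b) ≤ ENNReal.ofReal K) :
    l2 a b u ≤ K := ENNReal.toReal_le_of_le_ofReal hK h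

theorem l2_add_le (hu : MemLp u 2 (vol a b)) (hv : MemLp v 2 (vol a b)) :
    l2 a b (fun x => u x + v x) ≤ l2 a b u + l2 a b v := by
  rw [l2, l2, l2, ← ENNReal.toReal_add hu.eLpNorm_ne_top hv.eLpNorm_ne_top]
  exact ENNReal.toReal_mono (ENNReal.add_ne_top.2 ⟨hu.eLpNorm_ne_top, hv.eLpNorm_ne_top⟩)
    (eLpNorm_add_le hu.1 hv.1 one_le_two)

theorem l2_sub_le (hu : MemLp u 2 (vol a b)) (hv : MemLp v 2 (vol a b)) :
    l2 a b (fun x => u x - v x) ≤ l2 a b u + l2 a b v := by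
  rw [l2, l2, l2, ← ENNReal.toReal_add hu.eLpNorm_ne_top hv.eLpNorm_ne_top]
  exact ENNReal.toReal_mono (ENNReal.add_ne_top.2 ⟨hu.eLpNorm_ne_top, hv.eLpNorm_ne_top⟩)
    (eLpNorm_sub_le hu.1 hv.1 one_le_two)

theorem l2_le_mul {K : ℝ} (hK : 0 ≤ K) (hv : MemLp v 2 (vol a b))
    (h : ∀ᵐ x ∂vol a b, ‖u x‖ ≤ K * ‖v x‖) : l2 a b u ≤ K * l2 a b v := by
  refine l2_le_of_eLpNorm_le (mul_nonneg hK (l2_nonneg _ _ _)) ?_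
  rw [ENNReal.ofReal_mul hK, ofReal_l2 hv]
  exact eLpNorm_le_mul_eLpNorm_of_ae_le_mul h 2

theorem memLp_of_continuousOn (hu : ContinuousOn u (Icc a b)) (p : ℝ≥0∞) :
    MemLp u p (vol a b) := by
  obtain ⟨K, hK⟩ := isCompact_Icc.exists_bound_of_continuousOn hu
  refine MemLp.of_bound ((hu.mono Ioo_subset_Icc_self).aestronglyMeasurable measurableSet_Ioo) K ?_
  exact (ae_restrict_iff' measurableSet_Ioo).2
    (Eventually.of_forall fun x hx => hK x (Ioo_subset_Icc_self hx))

theorem ae_vol_of_forall_Icc {p : ℝ → Prop} (h : ∀ x ∈ Icc a b, p x) : ∀ᵐ x ∂vol a b, p x :=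
  (ae_restrict_iff' measurableSet_Ioo).2
    (Eventually.of_forall fun x hx => h x (Ioo_subset_Icc_self hx))

theorem integrable_norm_sq (hab : a ≤ b) (hu : MemLp u 2 (vol a b)) :
    IntervalIntegrable (fun x => ‖u x‖ ^ 2) volume a b := by
  rw [intervalIntegrable_iff_integrableOn_Ioo_of_le hab]
  exact hu.integrable_norm_pow two_ne_zero

theorem l2_sq (hab : a ≤ b) (hu : MemLp u 2 (vol a b)) :
    l2 a b u ^ 2 = ∫ x in a..b, ‖u x‖ ^ 2 := by
  rw [← integral_vol hab, l2, hu.eLpNorm_eq_integral_rpow_norm two_ne_zero ENNReal.ofNat_ne_top,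
    ENNReal.toReal_ofReal (by positivity)]
  simp only [ENNReal.toReal_ofNat, Real.rpow_ofNat]
  rw [← Real.rpow_natCast, ← Real.rpow_mul (integral_nonneg fun _ => by positivity)]
  norm_num

end l2

/-! ### Fourier coefficients -/

section coef

variable {a b : ℝ} {u v g : ℝ → ℂ}

theorem norm_mode (a b : ℝ) (l : ℤ) (x : ℝ) : ‖mode a b l x‖ = 1 := by
  rw [mode, mul_comm, Complex.norm_exp_ofReal_mul_I]

theorem freq_neg (a b : ℝ) (l : ℤ) : freq a b (-l) = -freq a b l := by
  simp [freq]; ring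

theorem freq_add (a b : ℝ) (k l : ℤ) : freq a b (k + l) = freq a b k + freq a b l := by
  simp [freq]; ring

theorem mode_add (a b : ℝ) (k l : ℤ) (x : ℝ) :
    mode a b (k + l) x = mode a b k x * mode a b l x := by
  simp only [mode]
  rw [← Complex.exp_add, freq_add]
  congr 1; push_cast; ring

theorem mode_left (a b : ℝ) (l : ℤ) : mode a b l a = 1 := by simp [mode]

theorem mode_right (hab : a < b) (l : ℤ) : mode a b l b = 1 := by
  rw [mode, Complex.exp_eq_one_iff]
  refine ⟨l, ?_⟩
  have : ((b - a : ℝ) : ℂ) ≠ 0 := by exact_mod_cast (sub_pos.2 hab).ne'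
  simp only [freq]
  push_cast at this ⊢
  field_simp

theorem mode_conj (a b : ℝ) (l : ℤ) (x : ℝ) :
    (starRingEnd ℂ) (mode a b l x) = mode a b (-l) x := by
  simp only [mode]
  rw [← Complex.exp_conj, freq_neg]
  congr 1
  simp only [map_mul, Complex.conj_I, Complex.conj_ofReal]
  push_cast; ring

theorem hasDerivAt_mode (a b : ℝ) (l : ℤ) (x : ℝ) :
    HasDerivAt (mode a b l) (Complex.I * freq a b l * mode a b l x) x := by
  have h1 : HasDerivAt (fun x : ℝ => Complex.I * ((freq a b l * (x - a) : ℝ) : ℂ))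
      (Complex.I * freq a b l) x := by
    have := (((hasDerivAt_id x).sub_const a).const_mul (freq a b l)).ofReal_comp
    simpa using this.const_mul Complex.I
  exact h1.cexp.congr_deriv (mul_comm _ _)

theorem continuous_mode (a b : ℝ) (l : ℤ) : Continuous (mode a b l) :=
  continuous_iff_continuousAt.2 fun x => (hasDerivAt_mode a b l x).continuousAt

/-- The exponentials here are based at a, those of `fourierCoeffOn` at 0. The coefficients therefore
differ by a unimodular factor, which is harmless for Parseval. -/
theorem norm_fourierCoef (hab : a < b) (u : ℝ → ℂ) (l : ℤ) :
    ‖fourierCoef a b u l‖ = ‖fourierCoeffOn hab u l‖ := by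
  rw [fourierCoeffOn_eq_integral, fourierCoef]
  have e : ∀ x : ℝ, u x * mode a b (-l) x = mode a b l a *
      Complex.exp (Complex.I * (freq a b l * a : ℝ)) *
        ((fourier (-l) (x : AddCircle (b - a)) : ℂ) • u x) := by
    intro x
    rw [fourier_coe_apply, mode_left, one_mul, mode, smul_eq_mul, ← mul_assoc, ← Complex.exp_add,
      mul_comm (u x)]
    congr 2
    rw [freq_neg]
    simp only [freq]
    push_cast
    ring
  simp only [e]
  rw [intervalIntegral.integral_const_mul, norm_mul, norm_mul, norm_mul, norm_mode,
    mul_comm Complex.I, Complex.norm_exp_ofReal_mul_I, norm_smul, norm_div, Complex.norm_real]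
  simp

theorem hasSum_norm_sq_fourierCoef (hab : a < b) (hu : MemLp u 2 (vol a b)) :
    HasSum (fun l => ‖fourierCoef a b u l‖ ^ 2) ((b - a)⁻¹ * l2 a b u ^ 2) := by
  simp only [norm_fourierCoef hab, l2_sq hab.le hu]
  refine hasSum_sq_fourierCoeffOn hab ?_
  rwa [← Measure.restrict_congr_set Ioo_ae_eq_Ioc]

theorem nrm_fourierCoef_le (hab : a < b) (hu : MemLp u 2 (vol a b)) (F : Finset ℤ) :
    nrm F (fourierCoef a b u) ≤ l2 a b u / √(b - a) := by
  have h0 : 0 < b - a := sub_pos.2 hab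
  refine Real.sqrt_le_iff.2 ⟨div_nonneg (l2_nonneg _ _ _) (Real.sqrt_nonneg _), ?_⟩
  rw [div_pow, Real.sq_sqrt h0.le, div_eq_inv_mul]
  exact sum_le_hasSum F (fun _ _ => by positivity) (hasSum_norm_sq_fourierCoef hab hu)

/-- The converse direction of Parseval: a bound on all finite sets of coefficients, uniform in the
set, bounds the function. This is why the later estimates are stated for an arbitrary `F`. -/
theorem l2_le_of_nrm_le (hab : a < b) (hu : MemLp u 2 (vol a b)) {B : ℝ}
    (h : ∀ F, nrm F (fourierCoef a b u) ≤ B) : l2 a b u ≤ √(b - a) * B := by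
  have h0 : 0 < b - a := sub_pos.2 hab
  have hB : 0 ≤ B := (nrm_nonneg ∅ _).trans (h ∅)
  refine abs_le_of_sq_le_sq' ?_ (by positivity) |>.2
  rw [mul_pow, Real.sq_sqrt h0.le, ← inv_mul_le_iff₀ h0]
  refine hasSum_le_of_sum_le (hasSum_norm_sq_fourierCoef hab hu) fun F => ?_
  rw [← nrm_sq]
  exact pow_le_pow_left₀ (nrm_nonneg _ _) (h F) 2

theorem intervalIntegrable_mul_mode (hab : a ≤ b) (hu : MemLp u 2 (vol a b)) (l : ℤ) :
    IntervalIntegrable (fun x => u x * mode a b l x) volume a b :=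
  (hu.intervalIntegrable_of_vol hab one_le_two).mul_continuousOn (continuous_mode a b l).continuousOn

theorem fourierCoef_add (hab : a ≤ b) (hu : MemLp u 2 (vol a b)) (hv : MemLp v 2 (vol a b))
    (l : ℤ) : fourierCoef a b (fun x => u x + v x) l = fourierCoef a b u l + fourierCoef a b v l := by
  simp only [fourierCoef, add_mul]
  rw [intervalIntegral.integral_add (intervalIntegrable_mul_mode hab hu _)
    (intervalIntegrable_mul_mode hab hv _), mul_add]

theorem fourierCoef_const_mul (c : ℂ) (u : ℝ → ℂ) (l : ℤ) :
    fourierCoef a b (fun x => c * u x) l = c * fourierCoef a b u l := by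
  simp only [fourierCoef, mul_assoc]
  rw [intervalIntegral.integral_const_mul]; ring

theorem fourierCoef_sub (hab : a ≤ b) (hu : MemLp u 2 (vol a b)) (hv : MemLp v 2 (vol a b))
    (l : ℤ) : fourierCoef a b (fun x => u x - v x) l = fourierCoef a b u l - fourierCoef a b v l := by
  simp only [fourierCoef, sub_mul]
  rw [intervalIntegral.integral_sub (intervalIntegrable_mul_mode hab hu _)
    (intervalIntegrable_mul_mode hab hv _), mul_sub]

theorem fourierCoef_congr_ae (hab : a ≤ b) (h : u =ᵐ[vol a b] v) (l : ℤ) :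
    fourierCoef a b u l = fourierCoef a b v l := by
  simp only [fourierCoef]
  rw [← integral_vol hab, ← integral_vol hab]
  congr 1
  exact integral_congr_ae (h.mono fun x hx => by simp [hx])

theorem norm_fourierCoef_le (hab : a < b) (hu : MemLp u 2 (vol a b)) (l : ℤ) :
    ‖fourierCoef a b u l‖ ≤ l2 a b u / √(b - a) :=
  (norm_le_nrm (Finset.mem_singleton_self l)).trans (nrm_fourierCoef_le hab hu {l})

/-- Integration by parts against a mode; periodicity cancels the boundary term, since the modes
equal 1 at both ends. -/
theorem IsPrim.fourierCoef_eq (hab : a < b) (h : IsPrim a b u g) (hper : u a = u b) (l : ℤ) :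
    fourierCoef a b g l = Complex.I * freq a b l * fourierCoef a b u l := by
  have he : IsPrim a b (mode a b (-l)) fun x => Complex.I * freq a b (-l) * mode a b (-l) x :=
    IsPrim.of_hasDerivAt (hasDerivAt_mode a b (-l)) (continuous_const.mul (continuous_mode a b _))
  have h1 := (h.mul hab.le he).eq b (right_mem_Icc.2 hab.le)
  have i1 : IntervalIntegrable (fun x => u x * mode a b (-l) x) volume a b :=
    ((h.continuousOn hab.le).mul (continuous_mode a b _).continuousOn).intervalIntegrable_of_Icc
      hab.le
  have e : ∀ x, u x * (Complex.I * freq a b (-l) * mode a b (-l) x) =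
      -(Complex.I * freq a b l) * (u x * mode a b (-l) x) := by
    intro x; rw [freq_neg]; push_cast; ring
  simp only [e] at h1
  rw [intervalIntegral.integral_add (h.intble.mul_continuousOn (continuous_mode a b _).continuousOn)
    (i1.const_mul _), intervalIntegral.integral_const_mul, mode_left, mode_right hab, hper] at h1
  simp only [fourierCoef]
  linear_combination (-1 / ((b - a : ℝ) : ℂ)) * h1

theorem HPer.fourierCoef_eq (hab : a < b) {m : ℕ} {w : ℕ → ℝ → ℂ} (h : HPer a b m w) {k : ℕ}
    (hk : k ≤ m) (l : ℤ) :
    fourierCoef a b (w k) l = (Complex.I * freq a b l) ^ k * fourierCoef a b (w 0) l := by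
  induction k with
  | zero => simp
  | succ k ih =>
    rw [(h.prim k hk).fourierCoef_eq hab (h.per k hk), ih (by omega), pow_succ]; ring

theorem HPer.nrm_le (hab : a < b) {m : ℕ} {w : ℕ → ℝ → ℂ} (h : HPer a b m w) {k : ℕ}
    (hk : k ≤ m) (F : Finset ℤ) :
    nrm F (fun l => (freq a b l : ℂ) ^ k * fourierCoef a b (w 0) l) ≤
      l2 a b (w k) / √(b - a) := by
  refine le_trans (le_of_eq (nrm_congr fun l _ => ?_)) (nrm_fourierCoef_le hab (h.memLp k hk) F)
  rw [h.fourierCoef_eq hab hk]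
  simp [mul_pow]

end coef

/-! ### Trigonometric polynomials -/

/-- The trigonometric polynomial with coefficients `c` on `F`. -/
def tp (a b : ℝ) (F : Finset ℤ) (c : ℤ → ℂ) (x : ℝ) : ℂ := ∑ l ∈ F, c l * mode a b l x

/-- The derivatives of a trigonometric polynomial. -/
def tpd (a b : ℝ) (F : Finset ℤ) (c : ℤ → ℂ) (k : ℕ) : ℝ → ℂ :=
  tp a b F fun l => (Complex.I * freq a b l) ^ k * c l

section tp

variable {a b : ℝ} {F : Finset ℤ} {c d : ℤ → ℂ}

theorem tpd_zero (a b : ℝ) (F : Finset ℤ) (c : ℤ → ℂ) : tpd a b F c 0 = tp a b F c := by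
  simp [tpd]

theorem hasDerivAt_tpd (a b : ℝ) (F : Finset ℤ) (c : ℤ → ℂ) (k : ℕ) (x : ℝ) :
    HasDerivAt (tpd a b F c k) (tpd a b F c (k + 1) x) x := by
  have := HasDerivAt.fun_sum (u := F) fun l _ =>
    (hasDerivAt_mode a b l x).const_mul ((Complex.I * freq a b l) ^ k * c l)
  refine this.congr_deriv (Finset.sum_congr rfl fun l _ => ?_)
  beta_reduce; ring

theorem continuous_tpd (a b : ℝ) (F : Finset ℤ) (c : ℤ → ℂ) (k : ℕ) : Continuous (tpd a b F c k) :=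
  continuous_iff_continuousAt.2 fun x => (hasDerivAt_tpd a b F c k x).continuousAt

theorem continuous_tp (a b : ℝ) (F : Finset ℤ) (c : ℤ → ℂ) : Continuous (tp a b F c) := by
  rw [← tpd_zero]; exact continuous_tpd a b F c 0

theorem tp_periodic (hab : a < b) (F : Finset ℤ) (c : ℤ → ℂ) : tp a b F c a = tp a b F c b := by
  simp [tp, mode_left, mode_right hab]

theorem hPer_tpd (hab : a < b) (F : Finset ℤ) (c : ℤ → ℂ) (m : ℕ) : HPer a b m (tpd a b F c) :=
  ⟨fun k _ => IsPrim.of_hasDerivAt (hasDerivAt_tpd a b F c k) (continuous_tpd a b F c (k + 1)),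
    fun _ _ => tp_periodic hab F _,
    fun k _ => memLp_of_continuousOn (continuous_tpd a b F c k).continuousOn 2⟩

theorem memLp_tp (a b : ℝ) (F : Finset ℤ) (c : ℤ → ℂ) : MemLp (tp a b F c) 2 (vol a b) :=
  memLp_of_continuousOn (continuous_tp a b F c).continuousOn 2

theorem fourierCoef_mode (hab : a < b) (k l : ℤ) :
    fourierCoef a b (mode a b k) l = if l = k then 1 else 0 := by
  have h0 : ((b - a : ℝ) : ℂ) ≠ 0 := by exact_mod_cast (sub_pos.2 hab).ne'
  split_ifs with h
  · subst h
    simp only [fourierCoef, ← mode_add, add_neg_cancel]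
    simp only [mode, freq]
    simp
    push_cast at h0
    field_simp
  · have he : IsPrim a b (mode a b (k - l)) fun x => Complex.I * freq a b (k - l) * mode a b (k - l) x :=
      IsPrim.of_hasDerivAt (hasDerivAt_mode a b _) (continuous_const.mul (continuous_mode a b _))
    have h1 := he.eq b (right_mem_Icc.2 hab.le)
    rw [mode_left, mode_right hab, intervalIntegral.integral_const_mul] at h1
    have h2 : (freq a b (k - l) : ℂ) ≠ 0 := by
      have : ((k - l : ℤ) : ℝ) ≠ 0 := by exact_mod_cast sub_ne_zero.2 (Ne.symm h)
      have h3 : (b - a) ≠ 0 := (sub_pos.2 hab).ne'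
      exact_mod_cast div_ne_zero (mul_ne_zero (by positivity) this) h3
    have h4 : ∫ x in a..b, mode a b (k - l) x = 0 := by
      simpa [h2] using h1
    simp only [fourierCoef, ← mode_add, ← sub_eq_add_neg, h4, mul_zero]

theorem fourierCoef_tp (hab : a < b) (F : Finset ℤ) (c : ℤ → ℂ) (l : ℤ) :
    fourierCoef a b (tp a b F c) l = if l ∈ F then c l else 0 := by
  have : fourierCoef a b (tp a b F c) l = ∑ k ∈ F, c k * fourierCoef a b (mode a b k) l := by
    simp only [fourierCoef, tp, Finset.sum_mul]
    rw [intervalIntegral.integral_finsetSum, Finset.mul_sum]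
    · refine Finset.sum_congr rfl fun k _ => ?_
      simp only [mul_assoc]
      rw [intervalIntegral.integral_const_mul]; ring
    · intro k _
      exact ((continuous_const.mul (continuous_mode a b k)).mul
        (continuous_mode a b _)).intervalIntegrable _ _
  rw [this]
  simp [fourierCoef_mode hab]

theorem l2_tp (hab : a < b) (F : Finset ℤ) (c : ℤ → ℂ) :
    l2 a b (tp a b F c) = √(b - a) * nrm F c := by
  have h0 : 0 < b - a := sub_pos.2 hab
  have h1 := hasSum_norm_sq_fourierCoef hab (memLp_tp a b F c)
  have h2 : HasSum (fun l => ‖fourierCoef a b (tp a b F c) l‖ ^ 2) (nrm F c ^ 2) := by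
    rw [nrm_sq]
    have h3 : ∑ l ∈ F, ‖c l‖ ^ 2 = ∑ l ∈ F, ‖fourierCoef a b (tp a b F c) l‖ ^ 2 :=
      Finset.sum_congr rfl fun l hl => by rw [fourierCoef_tp hab, if_pos hl]
    rw [h3]
    exact hasSum_sum_of_ne_finset_zero fun l hl => by simp [fourierCoef_tp hab, hl]
  have h4 := h1.unique h2
  rw [inv_mul_eq_iff_eq_mul₀ h0.ne'] at h4
  rw [← Real.sqrt_sq (l2_nonneg a b _), h4, Real.sqrt_mul h0.le, Real.sqrt_sq (nrm_nonneg _ _)]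

theorem l2_tpd (hab : a < b) (F : Finset ℤ) (c : ℤ → ℂ) (k : ℕ) :
    l2 a b (tpd a b F c k) = √(b - a) * nrm F fun l => (freq a b l : ℂ) ^ k * c l := by
  rw [tpd, l2_tp hab]
  congr 1
  exact nrm_congr fun l _ => by simp [mul_pow]

end tp

/-! ### The grid -/

section grid

variable {a b : ℝ} {N : ℕ}

theorem mesh_pos (hab : a < b) (hN : 0 < N) : 0 < mesh a b N :=
  div_pos (sub_pos.2 hab) (Nat.cast_pos.2 hN)

theorem mul_mesh (hN : 0 < N) : N * mesh a b N = b - a :=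
  mul_div_cancel₀ _ (Nat.cast_pos.2 hN).ne'

theorem node_mem_Icc (hab : a < b) (hN : 0 < N) {j : ℕ} (hj : j ≤ N) : node a b N j ∈ Icc a b := by
  have h := mesh_pos hab hN
  have h1 : (j : ℝ) * mesh a b N ≤ N * mesh a b N := by gcongr
  rw [mul_mesh hN] at h1
  exact ⟨le_add_of_nonneg_right (by positivity), by rw [node]; linarith⟩

theorem node_succ (a b : ℝ) (N j : ℕ) : node a b N (j + 1) = node a b N j + mesh a b N := by
  simp [node]; ring

theorem sum_exp_eq_zero (hN : 0 < N) {d : ℤ} (hd : ¬ (N : ℤ) ∣ d) :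
    ∑ j ∈ Finset.range N, Complex.exp (2 * Real.pi * Complex.I * (d * j / N)) = 0 := by
  set z := Complex.exp (2 * Real.pi * Complex.I * (d / N)) with hz
  have hN' : (N : ℂ) ≠ 0 := by exact_mod_cast hN.ne'
  have e : ∀ j : ℕ, Complex.exp (2 * Real.pi * Complex.I * (d * j / N)) = z ^ j := by
    intro j
    rw [hz, ← Complex.exp_nat_mul]
    congr 1; ring
  have hz1 : z ≠ 1 := by
    rw [hz, Ne, Complex.exp_eq_one_iff]
    rintro ⟨n, hn⟩
    have h2 : (2 * Real.pi * Complex.I : ℂ) ≠ 0 := Complex.two_pi_I_ne_zero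
    have h3 : (d / N : ℂ) = n := by
      have : (2 * Real.pi * Complex.I : ℂ) * (d / N - n) = 0 := by linear_combination hn
      rcases mul_eq_zero.1 this with h | h
      · exact absurd h h2
      · exact sub_eq_zero.1 h
    rw [div_eq_iff hN'] at h3
    exact hd ⟨n, by rw [mul_comm]; exact_mod_cast h3⟩
  have hzN : z ^ N = 1 := by
    rw [← e N, Complex.exp_eq_one_iff]
    exact ⟨d, by field_simp⟩
  simp only [e]
  rw [geom_sum_eq hz1, hzN, sub_self, zero_div]

theorem mode_node (hab : a < b) (N : ℕ) (l : ℤ) (j : ℕ) :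
    mode a b l (node a b N j) = Complex.exp (2 * Real.pi * Complex.I * (l * j / N)) := by
  have h0 : ((b - a : ℝ) : ℂ) ≠ 0 := by exact_mod_cast (sub_pos.2 hab).ne'
  simp only [mode, freq, node, mesh]
  congr 1
  push_cast at h0 ⊢
  field_simp
  ring

theorem card_idx (hev : Even N) : (idx N).card = N := by
  obtain ⟨m, rfl⟩ := hev
  simp [idx]; omega

/-- Evenness makes `idx N` a block of N consecutive frequencies. Shifting it to start at 0 pulls out
a factor independent of the summation index and leaves a full geometric sum over N-th roots of
unity. -/
theorem sum_mode_idx (hab : a < b) (hN : 0 < N) (hev : Even N) {j k : ℕ} (hj : j < N) (hk : k < N) :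
    ∑ l ∈ idx N, mode a b l (node a b N j) * mode a b (-l) (node a b N k) =
      if j = k then (N : ℂ) else 0 := by
  split_ifs with h
  · subst h
    simp [← mode_conj, Complex.mul_conj, Complex.normSq_eq_norm_sq, norm_mode, card_idx hev]
  · have hd : ¬ (N : ℤ) ∣ ((j : ℤ) - k) := by
      intro hd
      have := Int.eq_zero_of_abs_lt_dvd hd (by rw [abs_lt]; omega)
      omega
    obtain ⟨m, rfl⟩ := hev
    have e : idx (m + m) = (Finset.range (m + m)).map
        ⟨fun i : ℕ => (i : ℤ) - m, fun x y h => by simpa using h⟩ := by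
      ext l
      simp only [idx, Finset.mem_Ico, Finset.mem_map, Finset.mem_range]
      constructor
      · intro h
        exact ⟨(l + m).toNat, by omega, by change (((l + m).toNat : ℕ) : ℤ) - m = l; omega⟩
      · rintro ⟨i, hi, rfl⟩
        change _ ≤ (i : ℤ) - m ∧ (i : ℤ) - m < _
        push_cast
        omega
    rw [e, Finset.sum_map]
    have := sum_exp_eq_zero hN hd
    calc _ = ∑ i ∈ Finset.range (m + m),
          Complex.exp (2 * Real.pi * Complex.I * (-m * (j - k) / (m + m : ℕ))) *
            Complex.exp (2 * Real.pi * Complex.I * (((j - k : ℤ) : ℂ) * i / (m + m : ℕ))) := by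
          refine Finset.sum_congr rfl fun i _ => ?_
          change mode a b ((i : ℤ) - m) _ * mode a b (-((i : ℤ) - m)) _ = _
          rw [mode_node hab, mode_node hab, ← Complex.exp_add, ← Complex.exp_add]
          congr 1; push_cast; ring
      _ = 0 := by rw [← Finset.mul_sum, this, mul_zero]

theorem sum_mode_node (hab : a < b) (hN : 0 < N) {k l : ℤ} (hk : k ∈ idx N) (hl : l ∈ idx N) :
    ∑ j : Fin N, mode a b k (node a b N j) * mode a b (-l) (node a b N j) =
      if k = l then (N : ℂ) else 0 := by
  rw [Fin.sum_univ_eq_sum_range fun j => mode a b k (node a b N j) * mode a b (-l) (node a b N j)]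
  simp only [← mode_add]
  split_ifs with h
  · subst h
    simp [mode_node hab]
  · have hd : ¬ (N : ℤ) ∣ (k + -l) := by
      intro hd
      simp only [idx, Finset.mem_Ico] at hk hl
      have := Int.eq_zero_of_abs_lt_dvd hd (by rw [abs_lt]; omega)
      omega
    simp only [mode_node hab]
    exact sum_exp_eq_zero hN hd

theorem interp_eq_tp (a b : ℝ) (N : ℕ) (v : Fin (N + 1) → ℂ) :
    interp a b N v = tp a b (idx N) (discreteCoef a b N v) := rfl

theorem discreteCoef_eq_of_eq_tp (hab : a < b) (hN : 0 < N) {v : Fin (N + 1) → ℂ} {c : ℤ → ℂ}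
    (h : ∀ j : Fin N, v j.castSucc = tp a b (idx N) c (node a b N j)) {l : ℤ} (hl : l ∈ idx N) :
    discreteCoef a b N v l = c l := by
  have hN' : (N : ℂ) ≠ 0 := by exact_mod_cast hN.ne'
  simp only [discreteCoef, h, tp, Finset.sum_mul]
  rw [Finset.sum_comm]
  have : ∀ k ∈ idx N, ∑ j : Fin N, c k * mode a b k (node a b N j) * mode a b (-l) (node a b N j) =
      c k * if k = l then (N : ℂ) else 0 := by
    intro k hk
    rw [← sum_mode_node hab hN hk hl, Finset.mul_sum]
    simp only [mul_assoc]
  rw [Finset.sum_congr rfl this]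
  simp [hl]
  field_simp

theorem interp_node (hab : a < b) (hN : 0 < N) (hev : Even N) (v : Fin (N + 1) → ℂ) (j : Fin N) :
    interp a b N v (node a b N j) = v j.castSucc := by
  have hN' : (N : ℂ) ≠ 0 := by exact_mod_cast hN.ne'
  have : ∀ l ∈ idx N, discreteCoef a b N v l * mode a b l (node a b N j) =
      ∑ k : Fin N, 1 / (N : ℂ) * (v k.castSucc *
        (mode a b l (node a b N j) * mode a b (-l) (node a b N k))) := by
    intro l _
    rw [discreteCoef, Finset.mul_sum, Finset.sum_mul]
    exact Finset.sum_congr rfl fun k _ => by ring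
  rw [interp, Finset.sum_congr rfl this, Finset.sum_comm]
  simp only [← Finset.mul_sum]
  simp only [sum_mode_idx hab hN hev j.isLt (Fin.isLt _)]
  simp [Fin.val_inj]
  field_simp

/-- Discrete Parseval: one factor is unfolded into its grid sum, the sums are exchanged, and the
other factor reassembles into the interpolant, which returns the grid values. Pointwise Lipschitz
bounds on the grid thereby become ℓ² bounds on coefficients. -/
theorem nrm_discreteCoef_sq (hab : a < b) (hN : 0 < N) (hev : Even N) (v : Fin (N + 1) → ℂ) :
    nrm (idx N) (discreteCoef a b N v) ^ 2 = 1 / N * ∑ j : Fin N, ‖v j.castSucc‖ ^ 2 := by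
  have h : ((∑ l ∈ idx N, ‖discreteCoef a b N v l‖ ^ 2 : ℝ) : ℂ) =
      ((1 / N * ∑ j : Fin N, ‖v j.castSucc‖ ^ 2 : ℝ) : ℂ) := by
    have e : ∀ z : ℂ, ((‖z‖ ^ 2 : ℝ) : ℂ) = z * (starRingEnd ℂ) z := fun z => by
      rw [Complex.mul_conj, Complex.normSq_eq_norm_sq]
    push_cast
    simp only [← Complex.ofReal_pow, e]
    have e2 : ∀ l, discreteCoef a b N v l * (starRingEnd ℂ) (discreteCoef a b N v l) =
        ∑ j : Fin N, 1 / (N : ℂ) * (v j.castSucc *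
          (starRingEnd ℂ) (discreteCoef a b N v l * mode a b l (node a b N j))) := by
      intro l
      nth_rewrite 1 [discreteCoef]
      rw [Finset.mul_sum, Finset.sum_mul]
      refine Finset.sum_congr rfl fun j _ => ?_
      rw [map_mul, mode_conj]; ring
    simp only [e2]
    rw [Finset.sum_comm]
    simp only [← Finset.mul_sum, ← map_sum]
    congr 2
    ext j
    rw [← interp_node hab hN hev v j]
    rfl
  rw [nrm_sq]
  exact_mod_cast h

theorem nrm_discreteCoef_le_mul (hab : a < b) (hN : 0 < N) (hev : Even N) {v w : Fin (N + 1) → ℂ}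
    {K : ℝ} (hK : 0 ≤ K) (h : ∀ j : Fin N, ‖v j.castSucc‖ ≤ K * ‖w j.castSucc‖) :
    nrm (idx N) (discreteCoef a b N v) ≤ K * nrm (idx N) (discreteCoef a b N w) := by
  refine abs_le_of_sq_le_sq' ?_ (mul_nonneg hK (nrm_nonneg _ _)) |>.2
  rw [mul_pow, nrm_discreteCoef_sq hab hN hev, nrm_discreteCoef_sq hab hN hev, mul_left_comm]
  gcongr
  rw [Finset.mul_sum]
  refine Finset.sum_le_sum fun j _ => ?_
  rw [← mul_pow]
  exact pow_le_pow_left₀ (norm_nonneg _) (h j) 2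

theorem discreteCoef_sub (a b : ℝ) (N : ℕ) (v w : Fin (N + 1) → ℂ) (l : ℤ) :
    discreteCoef a b N (fun j => v j - w j) l = discreteCoef a b N v l - discreteCoef a b N w l := by
  simp only [discreteCoef, sub_mul, Finset.sum_sub_distrib, mul_sub]

theorem abs_freq_eq (hab : a < b) (hN : 0 < N) (l : ℤ) :
    |freq a b l| = Real.pi / mesh a b N * (2 * |(l : ℝ)| / N) := by
  have h0 : 0 < b - a := sub_pos.2 hab
  have hN' : (0 : ℝ) < N := Nat.cast_pos.2 hN
  rw [freq, abs_div, abs_mul, abs_mul, abs_of_pos h0, abs_of_pos Real.pi_pos, mesh]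
  simp
  field_simp

theorem abs_freq_le (hab : a < b) (hN : 0 < N) {l : ℤ} (hl : l ∈ idx N) :
    |freq a b l| ≤ Real.pi / mesh a b N := by
  have hm := mesh_pos hab hN
  have hN' : (0 : ℝ) < N := Nat.cast_pos.2 hN
  rw [abs_freq_eq hab hN]
  refine mul_le_of_le_one_right (by positivity) ?_
  rw [div_le_one hN']
  simp only [idx, Finset.mem_Ico] at hl
  have : 2 * |l| ≤ N := by
    rcases abs_cases l with h | h <;> omega
  exact_mod_cast this

/-- Outside the index set 2|l| ≥ N, with equality at l = N/2. The same threshold π/h bounds the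
retained frequencies from above, where it is attained at l = -N/2. -/
theorem le_abs_freq (hab : a < b) (hN : 0 < N) (hev : Even N) {l : ℤ} (hl : l ∉ idx N) :
    Real.pi / mesh a b N ≤ |freq a b l| := by
  have hm := mesh_pos hab hN
  have hN' : (0 : ℝ) < N := Nat.cast_pos.2 hN
  rw [abs_freq_eq hab hN]
  refine le_mul_of_one_le_right (by positivity) ?_
  rw [one_le_div hN']
  obtain ⟨m, rfl⟩ := hev
  simp only [idx, Finset.mem_Ico, not_and, not_lt] at hl
  have : ((m + m : ℕ) : ℤ) ≤ 2 * |l| := by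
    rcases abs_cases l with h | h <;> omega
  exact_mod_cast this

/-- The inverse inequality on trigonometric polynomials. -/
theorem nrm_freq_pow_mul_le (hab : a < b) (hN : 0 < N) (k : ℕ) (c : ℤ → ℂ) :
    nrm (idx N) (fun l => (freq a b l : ℂ) ^ k * c l) ≤
      (Real.pi / mesh a b N) ^ k * nrm (idx N) c := by
  have hm := mesh_pos hab hN
  refine nrm_le_nrm_mul (by positivity) fun l hl => ?_
  rw [norm_mul, norm_pow, Complex.norm_real, Real.norm_eq_abs]
  gcongr
  exact abs_freq_le hab hN hl

end grid

/-! ### Pointwise values of absolutely continuous functions -/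

section sup

variable {a b : ℝ} {u g : ℝ → ℂ}

/-- Cauchy–Schwarz, read off from the nonnegativity of the variance of ‖g‖. -/
theorem sq_integral_norm_le (hab : a < b) (hg : IntervalIntegrable g volume a b)
    (hg2 : IntervalIntegrable (fun x => ‖g x‖ ^ 2) volume a b) :
    (∫ x in a..b, ‖g x‖) ^ 2 ≤ (b - a) * ∫ x in a..b, ‖g x‖ ^ 2 := by
  have h0 : 0 < b - a := sub_pos.2 hab
  set J := ∫ x in a..b, ‖g x‖ with hJ
  have h1 : 0 ≤ ∫ x in a..b, (‖g x‖ - J / (b - a)) ^ 2 :=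
    intervalIntegral.integral_nonneg hab.le fun _ _ => by positivity
  have e : ∀ x, (‖g x‖ - J / (b - a)) ^ 2 =
      ‖g x‖ ^ 2 - 2 * (J / (b - a)) * ‖g x‖ + (J / (b - a)) ^ 2 := fun x => by ring
  simp only [e] at h1
  rw [intervalIntegral.integral_add (hg2.sub (hg.norm.const_mul _)) intervalIntegrable_const,
    intervalIntegral.integral_sub hg2 (hg.norm.const_mul _),
    intervalIntegral.integral_const_mul, intervalIntegral.integral_const, ← hJ, smul_eq_mul] at h1
  have h2 : 2 * (J / (b - a)) * J - (b - a) * (J / (b - a)) ^ 2 = J ^ 2 / (b - a) := by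
    field_simp; ring
  rw [← div_le_iff₀' h0]
  linarith

/-- From |u(y)| ≤ |u(x)| + ∫|g|, squared and averaged over x. The explicit dependence on the length
matters, because the inequality is applied both to Ω and to single mesh cells. -/
theorem IsPrim.mul_norm_sq_le (hab : a < b) (h : IsPrim a b u g)
    (hg2 : IntervalIntegrable (fun x => ‖g x‖ ^ 2) volume a b) {y : ℝ} (hy : y ∈ Icc a b) :
    (b - a) * ‖u y‖ ^ 2 ≤
      2 * (∫ x in a..b, ‖u x‖ ^ 2) + 2 * (b - a) ^ 2 * ∫ x in a..b, ‖g x‖ ^ 2 := by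
  have h0 : 0 < b - a := sub_pos.2 hab
  have hcu := h.continuousOn hab.le
  have h1 : ∀ x ∈ Icc a b, ‖u y‖ ^ 2 ≤ 2 * ‖u x‖ ^ 2 + 2 * ((b - a) * ∫ x in a..b, ‖g x‖ ^ 2) := by
    intro x hx
    have h2 : ‖u y‖ ≤ ‖u x‖ + ∫ x in a..b, ‖g x‖ := by
      have h3 : u y - u x = ∫ t in x..y, g t := by
        rw [← intervalIntegral.integral_interval_sub_left
          (h.intble_mono le_rfl hy.1 hy.2) (h.intble_mono le_rfl hx.1 hx.2), h.eq y hy, h.eq x hx]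
        ring
      have h4 : ‖∫ t in x..y, g t‖ ≤ ∫ t in a..b, ‖g t‖ := by
        refine intervalIntegral.norm_integral_le_integral_norm_uIoc.trans ?_
        rw [intervalIntegral.integral_of_le hab.le]
        refine setIntegral_mono_set ?_ (Eventually.of_forall fun _ => norm_nonneg _) ?_
        · exact (intervalIntegrable_iff_integrableOn_Ioc_of_le hab.le).1 h.intble.norm
        · exact (Ioc_subset_Ioc (le_min hx.1 hy.1) (max_le hx.2 hy.2)).eventuallyLE
      have : u y = u x + ∫ t in x..y, g t := by rw [← h3]; ring
      rw [this]
      exact (norm_add_le _ _).trans (by gcongr)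
    have h5 := sq_integral_norm_le hab h.intble hg2
    have h6 : 0 ≤ ∫ x in a..b, ‖g x‖ :=
      intervalIntegral.integral_nonneg hab.le fun _ _ => norm_nonneg _
    nlinarith [sq_nonneg (‖u x‖ - ∫ x in a..b, ‖g x‖), norm_nonneg (u y), norm_nonneg (u x)]
  have i1 : IntervalIntegrable (fun x => ‖u x‖ ^ 2) volume a b :=
    (hcu.norm.pow 2).intervalIntegrable_of_Icc hab.le
  have h2 := intervalIntegral.integral_mono_on hab.le intervalIntegrable_const
    ((i1.const_mul 2).add intervalIntegrable_const) h1
  rw [intervalIntegral.integral_add (i1.const_mul 2) intervalIntegrable_const,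
    intervalIntegral.integral_const, intervalIntegral.integral_const,
    intervalIntegral.integral_const_mul, smul_eq_mul, smul_eq_mul] at h2
  linarith

theorem IsPrim.norm_sq_le (hab : a < b) (h : IsPrim a b u g) (hg : MemLp g 2 (vol a b)) {y : ℝ}
    (hy : y ∈ Icc a b) :
    ‖u y‖ ^ 2 ≤ 2 / (b - a) * l2 a b u ^ 2 + 2 * (b - a) * l2 a b g ^ 2 := by
  have h0 : 0 < b - a := sub_pos.2 hab
  have h1 := h.mul_norm_sq_le hab (integrable_norm_sq hab.le hg) hy
  rw [← l2_sq hab.le hg,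
    ← l2_sq hab.le (memLp_of_continuousOn (h.continuousOn hab.le) 2)] at h1
  have : ‖u y‖ ^ 2 ≤ (2 * l2 a b u ^ 2 + 2 * (b - a) ^ 2 * l2 a b g ^ 2) / (b - a) := by
    rw [le_div_iff₀ h0]; linarith
  refine this.trans (le_of_eq ?_)
  field_simp

theorem norm_tp_sq_le (hab : a < b) (F : Finset ℤ) (c : ℤ → ℂ) {y : ℝ} (hy : y ∈ Icc a b) :
    ‖tp a b F c y‖ ^ 2 ≤
      2 * nrm F c ^ 2 + 2 * (b - a) ^ 2 * nrm F (fun l => freq a b l * c l) ^ 2 := by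
  have h0 : 0 < b - a := sub_pos.2 hab
  have hP := hPer_tpd hab F c 1
  have h1 := (hP.prim 0 one_pos).norm_sq_le hab (hP.memLp 1 le_rfl) hy
  rw [zero_add, l2_tpd hab, l2_tpd hab, tpd_zero] at h1
  simp only [pow_zero, one_mul, pow_one, mul_pow, Real.sq_sqrt h0.le] at h1
  refine h1.trans (le_of_eq ?_)
  field_simp

/-- The preceding inequality on each cell, evaluated at its left node, and summed. The cell length h
supplies the factor h² in front of the derivative. -/
theorem HPer.sum_norm_sq_node_le {N : ℕ} (hab : a < b) (hN : 0 < N) {w : ℕ → ℝ → ℂ}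
    (h : HPer a b 1 w) : mesh a b N * ∑ j : Fin N, ‖w 0 (node a b N j)‖ ^ 2 ≤
      2 * l2 a b (w 0) ^ 2 + 2 * mesh a b N ^ 2 * l2 a b (w 1) ^ 2 := by
  have hm := mesh_pos hab hN
  have hn0 : node a b N 0 = a := by simp [node]
  have hnN : node a b N N = b := by rw [node, mul_mesh hN]; ring
  have hsum : ∀ v : ℝ → ℂ, MemLp v 2 (vol a b) →
      ∑ j ∈ Finset.range N, ∫ x in node a b N j..node a b N (j + 1), ‖v x‖ ^ 2 = l2 a b v ^ 2 := by
    intro v hv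
    rw [intervalIntegral.sum_integral_adjacent_intervals, hn0, hnN, l2_sq hab.le hv]
    intro k hk
    refine (integrable_norm_sq hab.le hv).mono_set ?_
    rw [uIcc_of_le hab.le]
    exact uIcc_subset_Icc (node_mem_Icc hab hN hk.le) (node_mem_Icc hab hN hk)
  rw [Fin.sum_univ_eq_sum_range fun j => ‖w 0 (node a b N j)‖ ^ 2, ← hsum _ (h.memLp 0 zero_le_one),
    ← hsum _ (h.memLp 1 le_rfl), Finset.mul_sum, Finset.mul_sum, Finset.mul_sum,
    ← Finset.sum_add_distrib]
  refine Finset.sum_le_sum fun j hj => ?_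
  have hj' := Finset.mem_range.1 hj
  have hlt : node a b N j < node a b N (j + 1) := by rw [node_succ]; linarith
  have h1 := (h.prim 0 one_pos).mono (node_mem_Icc hab hN hj'.le).1 hlt.le (node_mem_Icc hab hN hj').2
  have i1 : IntervalIntegrable (fun x => ‖w 1 x‖ ^ 2) volume (node a b N j) (node a b N (j + 1)) := by
    refine (integrable_norm_sq hab.le (h.memLp 1 le_rfl)).mono_set ?_
    rw [uIcc_of_le hab.le]
    exact uIcc_subset_Icc (node_mem_Icc hab hN hj'.le) (node_mem_Icc hab hN hj')
  have h2 := h1.mul_norm_sq_le hlt i1 (left_mem_Icc.2 hlt.le)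
  have e : node a b N (j + 1) - node a b N j = mesh a b N := by rw [node_succ]; ring
  rw [e] at h2
  exact h2

end sup

/-! ### Projection and interpolation errors -/

section proj

variable {a b : ℝ} {N m : ℕ} {w : ℕ → ℝ → ℂ}

/-- Only frequencies outside the index set survive, and there 1 ≤ h|μ|/π; each unused derivative is
exchanged for one power of h/π. -/
theorem l2_sub_tpd_le (hab : a < b) (hN : 0 < N) (hev : Even N) (h : HPer a b m w) {B : ℝ}
    (hB : ∀ F, nrm F (fun l => (freq a b l : ℂ) ^ m * fourierCoef a b (w 0) l) ≤ B) {k : ℕ}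
    (hk : k ≤ m) :
    l2 a b (w k - tpd a b (idx N) (fourierCoef a b (w 0)) k) ≤
      √(b - a) * ((mesh a b N / Real.pi) ^ (m - k) * B) := by
  have hm := mesh_pos hab hN
  have hP := hPer_tpd hab (idx N) (fourierCoef a b (w 0)) m
  refine l2_le_of_nrm_le hab ((h.memLp k hk).sub (hP.memLp k hk)) fun F => ?_
  refine (nrm_le_nrm_mul (by positivity) fun l _ => ?_).trans
    (mul_le_mul_of_nonneg_left (hB F) (by positivity))
  have e : fourierCoef a b (w k - tpd a b (idx N) (fourierCoef a b (w 0)) k) l =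
      fourierCoef a b (w k) l - fourierCoef a b (tpd a b (idx N) (fourierCoef a b (w 0)) k) l :=
    fourierCoef_sub hab.le (h.memLp k hk) (hP.memLp k hk) l
  rw [e, h.fourierCoef_eq hab hk, tpd, fourierCoef_tp hab]
  split_ifs with hl
  · rw [sub_self, norm_zero]; positivity
  · have hf := le_abs_freq hab hN hev hl
    simp only [sub_zero, norm_mul, norm_pow, Complex.norm_I, one_mul, Complex.norm_real,
      Real.norm_eq_abs]
    rw [← mul_assoc]
    gcongr
    calc |freq a b l| ^ k = 1 ^ (m - k) * |freq a b l| ^ k := by simp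
      _ ≤ (mesh a b N / Real.pi * |freq a b l|) ^ (m - k) * |freq a b l| ^ k := by
          gcongr
          calc (1 : ℝ) = mesh a b N / Real.pi * (Real.pi / mesh a b N) := by
                field_simp
            _ ≤ _ := by gcongr
      _ = (mesh a b N / Real.pi) ^ (m - k) * |freq a b l| ^ m := by
          rw [mul_pow, mul_assoc, ← pow_add, Nat.sub_add_cancel hk]

/-- Interpolation reproduces the projected part exactly, so the aliasing error consists of the
discrete coefficients of the projection remainder. Discrete Parseval and the sampling inequality
bound it by the remainder and h times its derivative, both O(h^m). -/
theorem nrm_discreteCoef_sub_fourierCoef_le (hab : a < b) (hN : 0 < N) (hev : Even N) (hm1 : 1 ≤ m)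
    (h : HPer a b m w) {B : ℝ}
    (hB : ∀ F, nrm F (fun l => (freq a b l : ℂ) ^ m * fourierCoef a b (w 0) l) ≤ B) :
    nrm (idx N) (fun l => discreteCoef a b N (gridValues a b N (w 0)) l -
      fourierCoef a b (w 0) l) ≤ 2 * mesh a b N ^ m * B := by
  have hm := mesh_pos hab hN
  have h0 : 0 < b - a := sub_pos.2 hab
  have hB0 : 0 ≤ B := (nrm_nonneg ∅ _).trans (hB ∅)
  set c := fourierCoef a b (w 0)
  set r := w - tpd a b (idx N) c with hr
  have hrP : HPer a b 1 r := (h.mono hm1).sub (hPer_tpd hab (idx N) c 1)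
  have e1 : nrm (idx N) (fun l => discreteCoef a b N (gridValues a b N (w 0)) l - c l) =
      nrm (idx N) (discreteCoef a b N (gridValues a b N (r 0))) := by
    refine nrm_congr fun l hl => ?_
    have : discreteCoef a b N (gridValues a b N (tp a b (idx N) c)) l = c l :=
      discreteCoef_eq_of_eq_tp hab hN (fun _ => rfl) hl
    rw [← this, ← discreteCoef_sub, ← tpd_zero]
    rfl
  rw [e1]
  refine abs_le_of_sq_le_sq' ?_ (by positivity) |>.2
  rw [nrm_discreteCoef_sq hab hN hev]
  have h1 := hrP.sum_norm_sq_node_le hab hN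
  have h2 : l2 a b (r 0) ≤ √(b - a) * ((mesh a b N / Real.pi) ^ (m - 0) * B) :=
    l2_sub_tpd_le hab hN hev h hB (Nat.zero_le m)
  have h3 : l2 a b (r 1) ≤ √(b - a) * ((mesh a b N / Real.pi) ^ (m - 1) * B) :=
    l2_sub_tpd_le hab hN hev h hB hm1
  have h2' := pow_le_pow_left₀ (l2_nonneg _ _ _) h2 2
  have h3' := pow_le_pow_left₀ (l2_nonneg _ _ _) h3 2
  obtain ⟨n, rfl⟩ : ∃ n, m = n + 1 := ⟨m - 1, by omega⟩
  simp only [mul_pow, Real.sq_sqrt h0.le, Nat.sub_zero, Nat.add_sub_cancel] at h2' h3'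
  have hN' : (0 : ℝ) < N := Nat.cast_pos.2 hN
  have hNm := mul_mesh (a := a) (b := b) hN
  have h4 : (b - a) * (1 / N * ∑ j : Fin N, ‖r 0 (node a b N j)‖ ^ 2) ≤
      (b - a) * (2 * mesh a b N ^ (n + 1) * B) ^ 2 := by
    have e2 : (b - a) * (1 / N * ∑ j : Fin N, ‖r 0 (node a b N j)‖ ^ 2) =
        mesh a b N * ∑ j : Fin N, ‖r 0 (node a b N j)‖ ^ 2 := by
      rw [← hNm]; field_simp
    rw [e2]
    have hp : 0 < (mesh a b N / Real.pi) ^ n := by positivity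
    have hle : (mesh a b N / Real.pi) ^ n ≤ mesh a b N ^ n := by
      refine pow_le_pow_left₀ (by positivity) (div_le_self hm.le ?_) n
      linarith [Real.pi_gt_three]
    have hpi : 1 / Real.pi ≤ 1 := by
      rw [div_le_one Real.pi_pos]; linarith [Real.pi_gt_three]
    have hpi0 : 0 < 1 / Real.pi := by positivity
    calc _ ≤ 2 * ((b - a) * (((mesh a b N / Real.pi) ^ (n + 1)) ^ 2 * B ^ 2)) +
          2 * mesh a b N ^ 2 * ((b - a) * (((mesh a b N / Real.pi) ^ n) ^ 2 * B ^ 2)) := by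
          refine h1.trans ?_
          gcongr
      _ = (b - a) * B ^ 2 * mesh a b N ^ 2 * ((mesh a b N / Real.pi) ^ n) ^ 2 *
          (2 * (1 / Real.pi) ^ 2 + 2) := by
          rw [pow_succ (mesh a b N / Real.pi) n]; ring
      -- Here 2/π² + 2 ≤ 4, and the square root of 4 is the constant 2 of the statement.
      _ ≤ (b - a) * B ^ 2 * mesh a b N ^ 2 * (mesh a b N ^ n) ^ 2 * 4 := by
          gcongr
          nlinarith
      _ = _ := by ring
  exact le_of_mul_le_mul_left h4 h0

end proj

/-! ### Radial functions along a curve -/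

section radial

variable {v v₁ v₂ : ℝ → ℂ} {δ : ℝ} {x : ℝ}

/-- The norm is not differentiable at 0, but k is constant near 0. Where v vanishes the derivative
is therefore 0, which agrees with the formula because division by zero gives 0. -/
theorem hasDerivAt_radial {k k' : ℝ → ℝ} {c : ℝ} (hδ : 0 < δ) (hk : ∀ s < δ, k s = c)
    (hd : ∀ s > 0, HasDerivAt k (k' s) s) {v' : ℂ}
    (hv : HasDerivAt v v' x) :
    HasDerivAt (fun x => k ‖v x‖) (k' ‖v x‖ / ‖v x‖ * inner ℝ (v x) v') x := by
  by_cases h0 : v x = 0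
  · have h1 : ∀ᶠ y in 𝓝 x, k ‖v y‖ = c := by
      have : ∀ᶠ y in 𝓝 x, ‖v y‖ < δ :=
        hv.continuousAt.norm.eventually_lt continuousAt_const (by simpa [h0] using hδ)
      exact this.mono fun y hy => hk _ hy
    simpa [h0] using (hasDerivAt_const x c).congr_of_eventuallyEq h1
  · have hpos : 0 < ‖v x‖ := norm_pos_iff.2 h0
    have h1 : HasDerivAt (fun y => ‖v y‖) (inner ℝ (v x) v' / ‖v x‖) x := by
      have h2 := hv.norm_sq.sqrt (by positivity)
      simp only [Real.sqrt_sq (norm_nonneg _)] at h2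
      refine h2.congr_deriv ?_
      field_simp
    refine ((hd _ hpos).comp x h1).congr_deriv ?_
    ring

theorem continuous_radial {k : ℝ → ℝ} {c : ℝ} (hδ : 0 < δ) (hk : ∀ s < δ, k s = c)
    (hc : ∀ s > 0, ContinuousAt k s) (hv : Continuous v) : Continuous fun x => k ‖v x‖ := by
  have : Continuous fun s : ℝ => k s := by
    refine continuous_iff_continuousAt.2 fun s => ?_
    rcases lt_or_ge s δ with h | h
    · exact (continuousAt_const (y := c)).congr
        ((eventually_lt_nhds h).mono fun y hy => (hk y hy).symm)
    · exact hc s (hδ.trans_le h)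
  exact this.comp hv.norm

theorem abs_inner_div_le (z w : ℂ) : |inner ℝ z w / ‖z‖| ≤ ‖w‖ := by
  rw [abs_div, abs_norm]
  rcases (norm_nonneg z).eq_or_lt with h | h
  · rw [← h]; simp
  · rw [div_le_iff₀ h, mul_comm]; exact abs_real_inner_le_norm z w

end radial

/-! ### Moments -/

/-- `∫₀^ρ sⁱ γ(s) ds`. -/
def mom (γ : ℝ → ℝ) (i : ℕ) (ρ : ℝ) : ℝ := ∫ s in (0 : ℝ)..ρ, s ^ i * γ s

section mom

variable {γ φ : ℝ → ℝ} {δ ρ : ℝ}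

theorem hasDerivAt_mom (hγ : Continuous γ) (i : ℕ) (ρ : ℝ) :
    HasDerivAt (mom γ i) (ρ ^ i * γ ρ) ρ :=
  (((continuous_pow i).mul hγ).integral_hasStrictDerivAt 0 ρ).hasDerivAt

theorem integral_eq_zero_of_lt (hδ : 0 < δ) {ξ : ℝ → ℝ} (h : ∀ s ≤ δ, ξ s = 0) {ρ : ℝ}
    (hρ : ρ < δ) : ∫ s in (0 : ℝ)..ρ, ξ s = 0 := by
  refine intervalIntegral.integral_zero_ae (Eventually.of_forall fun t ht => h t ?_)
  rw [uIoc, mem_Ioc] at ht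
  exact ht.2.trans (max_le hδ.le hρ.le)

theorem mom_eq_zero (hδ : 0 < δ) (h : ∀ s ≤ δ, γ s = 0) (i : ℕ) (hρ : ρ < δ) : mom γ i ρ = 0 :=
  integral_eq_zero_of_lt hδ (fun s hs => by rw [h s hs, mul_zero]) hρ

theorem abs_mom_le (hγ : Continuous γ) (i : ℕ) (hρ : 0 ≤ ρ) :
    |mom γ i ρ| ≤ ρ ^ i * mom (fun s => |γ s|) 0 ρ := by
  rw [mom, mom, ← intervalIntegral.integral_const_mul]
  refine (intervalIntegral.abs_integral_le_integral_abs hρ).trans ?_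
  refine intervalIntegral.integral_mono_on hρ
    (((continuous_pow i).mul hγ).abs.intervalIntegrable _ _)
    ((continuous_const.mul ((continuous_pow 0).mul hγ.abs)).intervalIntegrable _ _) fun s hs => ?_
  rw [abs_mul, abs_pow, abs_of_nonneg hs.1, pow_zero, one_mul]
  exact mul_le_mul_of_nonneg_right (pow_le_pow_left₀ hs.1 hs.2 i) (abs_nonneg _)

theorem mom_mono (hγ : Continuous γ) (h0 : ∀ s, 0 ≤ γ s) {ρ R : ℝ} (hρ : 0 ≤ ρ) (hR : ρ ≤ R) :
    mom γ 0 ρ ≤ mom γ 0 R := by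
  simp only [mom, pow_zero, one_mul]
  refine intervalIntegral.integral_mono_interval le_rfl hρ hR
    (Eventually.of_forall h0) (hγ.intervalIntegrable _ _)

theorem mom_nonneg (h0 : ∀ s, 0 ≤ γ s) (hρ : 0 ≤ ρ) : 0 ≤ mom γ 0 ρ := by
  simp only [mom, pow_zero, one_mul]
  exact intervalIntegral.integral_nonneg hρ fun s _ => h0 s

/-- `∫₀^ρ s^{1/2} φ(s) ds`. -/
def halfMom (φ : ℝ → ℝ) (ρ : ℝ) : ℝ := ∫ s in (0 : ℝ)..ρ, √s * φ s

theorem hasDerivAt_halfMom (hφ : Continuous φ) (ρ : ℝ) : HasDerivAt (halfMom φ) (√ρ * φ ρ) ρ :=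
  ((Real.continuous_sqrt.mul hφ).integral_hasStrictDerivAt 0 ρ).hasDerivAt

theorem halfMom_nonneg (h0 : ∀ s, 0 ≤ φ s) (hρ : 0 ≤ ρ) : 0 ≤ halfMom φ ρ :=
  intervalIntegral.integral_nonneg hρ fun s _ => mul_nonneg (Real.sqrt_nonneg _) (h0 s)

theorem halfMom_le (hφ : Continuous φ) (h0 : ∀ s, 0 ≤ φ s) (hρ : 0 ≤ ρ) :
    halfMom φ ρ ≤ √ρ * mom φ 0 ρ := by
  rw [halfMom, mom, ← intervalIntegral.integral_const_mul]
  refine intervalIntegral.integral_mono_on hρ ((Real.continuous_sqrt.mul hφ).intervalIntegrable _ _)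
    ((continuous_const.mul ((continuous_pow 0).mul hφ)).intervalIntegrable _ _) fun s hs => ?_
  rw [pow_zero, one_mul]
  exact mul_le_mul_of_nonneg_right (Real.sqrt_le_sqrt hs.2) (h0 s)

/-- A weighted Cauchy–Schwarz inequality. -/
theorem sq_mom_abs_le (hγ : Continuous γ) (hρ : 0 < ρ) :
    mom (fun s => |γ s|) 0 ρ ^ 2 ≤ 2 * √ρ * halfMom (fun s => γ s ^ 2) ρ := by
  set A := mom (fun s => |γ s|) 0 ρ with hA
  have hA0 : 0 ≤ A := mom_nonneg (fun s => abs_nonneg _) hρ.le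
  have hB0 : 0 ≤ halfMom (fun s => γ s ^ 2) ρ := halfMom_nonneg (fun s => sq_nonneg _) hρ.le
  have hs : 0 < √ρ := Real.sqrt_pos.2 hρ
  rcases hA0.eq_or_lt with h | hpos
  · rw [← h, zero_pow two_ne_zero]; positivity
  -- Young's inequality 2|γ| ≤ t s^{-1/2} + t⁻¹ s^{1/2} γ² with t chosen so that the first term
  -- integrates to exactly A, half of the left side. This needs A > 0.
  set t := A / (2 * √ρ) with ht
  have htp : 0 < t := by positivity
  have h1 : ∫ s in (0 : ℝ)..ρ, 2 * (s ^ 0 * |γ s|) ≤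
      ∫ s in (0 : ℝ)..ρ, (t * s ^ (-(1 / 2) : ℝ) + t⁻¹ * (√s * γ s ^ 2)) := by
    refine intervalIntegral.integral_mono_on_of_le_Ioo hρ.le
      ((continuous_const.mul ((continuous_pow 0).mul hγ.abs)).intervalIntegrable _ _)
      (((intervalIntegral.intervalIntegrable_rpow' (by norm_num)).const_mul t).add
        ((continuous_const.mul (Real.continuous_sqrt.mul (hγ.pow 2))).intervalIntegrable _ _))
      fun s hs => ?_
    have hs0 : 0 < s := hs.1
    have hq : 0 < √s := Real.sqrt_pos.2 hs0
    rw [Real.rpow_neg hs0.le, ← Real.sqrt_eq_rpow, pow_zero, one_mul]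
    have e : t * (√s)⁻¹ + t⁻¹ * (√s * γ s ^ 2) - 2 * |γ s| =
        (t * √s)⁻¹ * (t - √s * |γ s|) ^ 2 := by
      rw [← sq_abs (γ s)]
      field_simp
      ring
    have : 0 ≤ (t * √s)⁻¹ * (t - √s * |γ s|) ^ 2 := by positivity
    linarith
  have i2 : IntervalIntegrable (fun s => t⁻¹ * (√s * γ s ^ 2)) volume 0 ρ :=
    (continuous_const.mul (Real.continuous_sqrt.mul (hγ.pow 2))).intervalIntegrable _ _
  rw [intervalIntegral.integral_const_mul, intervalIntegral.integral_add
    ((intervalIntegral.intervalIntegrable_rpow' (by norm_num)).const_mul t) i2,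
    intervalIntegral.integral_const_mul, intervalIntegral.integral_const_mul,
    integral_rpow (Or.inl (by norm_num))] at h1
  have e1 : (-(1 / 2) + 1 : ℝ) = 1 / 2 := by norm_num
  rw [e1, ← Real.sqrt_eq_rpow, Real.zero_rpow (by norm_num)] at h1
  change 2 * A ≤ t * ((√ρ - 0) / (1 / 2)) + t⁻¹ * halfMom (fun s => γ s ^ 2) ρ at h1
  have e2 : t * ((√ρ - 0) / (1 / 2)) = A := by rw [ht]; field_simp; ring
  have e3 : t⁻¹ = 2 * √ρ / A := by rw [ht, inv_div]
  rw [e2, e3] at h1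
  have h2 : A ≤ 2 * √ρ / A * halfMom (fun s => γ s ^ 2) ρ := by linarith
  rw [div_mul_eq_mul_div, le_div_iff₀ hpos] at h2
  rw [sq]; exact h2

end mom

/-! ### The radial energy estimate -/

section energy

variable {v v₁ v₂ : ℝ → ℂ} {φ : ℝ → ℝ} {δ a b R : ℝ}

/-- The energy density controlled by `integral_energy_le`. -/
def energy (φ : ℝ → ℝ) (z w : ℂ) : ℝ :=
  φ ‖z‖ * (inner ℝ z w / ‖z‖) ^ 2 + halfMom φ ‖z‖ / (‖z‖ * √‖z‖) * ‖w‖ ^ 2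

/-- The radial profile `3 ρ⁻¹ ∫₀^ρ φ - 2 ρ^{-3/2} ∫₀^ρ s^{1/2} φ` and its derivative. -/
def prof (φ : ℝ → ℝ) (ρ : ℝ) : ℝ := (3 * mom φ 0 ρ - 2 * (halfMom φ ρ / √ρ)) / ρ

/-- The derivative of `prof`. -/
def prof' (φ : ℝ → ℝ) (ρ : ℝ) : ℝ :=
  (φ ρ + halfMom φ ρ / (ρ * √ρ)) / ρ - (3 * mom φ 0 ρ - 2 * (halfMom φ ρ / √ρ)) / ρ ^ 2

theorem hasDerivAt_prof (hφ : Continuous φ) {ρ : ℝ} (hρ : 0 < ρ) :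
    HasDerivAt (prof φ) (prof' φ ρ) ρ := by
  have hs : 0 < √ρ := Real.sqrt_pos.2 hρ
  have h1 := ((hasDerivAt_mom hφ 0 ρ).const_mul 3).sub
    (((hasDerivAt_halfMom hφ ρ).div (Real.hasDerivAt_sqrt hρ.ne') hs.ne').const_mul 2)
  refine (h1.div (hasDerivAt_id ρ) hρ.ne').congr_deriv ?_
  have e : ρ = √ρ ^ 2 := (Real.sq_sqrt hρ.le).symm
  simp only [prof', Pi.sub_apply, Pi.div_apply, id, pow_zero, one_mul, mul_one]
  generalize √ρ = r at *
  subst e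
  field_simp
  ring

theorem halfMom_eq_zero (hδ : 0 < δ) (hz : ∀ s ≤ δ, φ s = 0) {ρ : ℝ} (hρ : ρ < δ) :
    halfMom φ ρ = 0 :=
  integral_eq_zero_of_lt hδ (fun s hs => by rw [hz s hs, mul_zero]) hρ

theorem prof_eq_zero (hδ : 0 < δ) (hz : ∀ s ≤ δ, φ s = 0) {ρ : ℝ} (hρ : ρ < δ) :
    prof φ ρ = 0 := by
  simp [prof, halfMom_eq_zero hδ hz hρ, mom_eq_zero hδ hz 0 hρ]

theorem abs_prof_mul_le (hφ : Continuous φ) (h0 : ∀ s, 0 ≤ φ s) {ρ : ℝ} (hρ : 0 ≤ ρ)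
    (hR : ρ ≤ R) : |prof φ ρ| * ρ ≤ 3 * mom φ 0 R := by
  have hm := mom_mono hφ h0 hρ hR
  have hm0 := mom_nonneg h0 hρ
  rcases hρ.eq_or_lt with rfl | hpos
  · rw [mul_zero]; linarith
  have hs : 0 < √ρ := Real.sqrt_pos.2 hpos
  have h1 : halfMom φ ρ / √ρ ≤ mom φ 0 ρ := by
    rw [div_le_iff₀' hs]; exact halfMom_le hφ h0 hρ
  have h2 : 0 ≤ halfMom φ ρ / √ρ := div_nonneg (halfMom_nonneg h0 hρ) hs.le
  rw [prof, abs_div, abs_of_pos hpos, div_mul_cancel₀ _ hpos.ne', abs_of_nonneg (by linarith)]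
  linarith

/-- Write P for the profile, n = ρ^{-3/2}∫ s^{1/2}φ, and u for the radial component of w. Since
(ρP)' = φ + n, the right side equals (φ + n)u² + P(|w|² - u²). The claim is then P ≥ n, which holds
because ∫ s^{1/2}φ ≤ √ρ ∫ φ. Thus the radial direction produces φ and the transversal direction does
not destroy n. -/
theorem energy_le_prof (hφ : Continuous φ) (h0 : ∀ s, 0 ≤ φ s) (z w : ℂ) :
    energy φ z w ≤ prof' φ ‖z‖ / ‖z‖ * inner ℝ z w * inner ℝ z w + prof φ ‖z‖ * ‖w‖ ^ 2 := by
  rcases (norm_nonneg z).eq_or_lt with h | hρ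
  · simp [energy, ← h, prof]
  have hs : 0 < √‖z‖ := Real.sqrt_pos.2 hρ
  have hu := abs_inner_div_le z w
  have hB := halfMom_le hφ h0 hρ.le
  have hB0 := halfMom_nonneg h0 hρ.le
  simp only [energy, prof', prof]
  generalize inner ℝ z w = s at *
  generalize ‖z‖ = ρ at *
  set n := halfMom φ ρ / (ρ * √ρ) with hn
  set Y := (3 * mom φ 0 ρ - 2 * (halfMom φ ρ / √ρ)) with hY
  have h1 : n ≤ Y / ρ := by
    have : halfMom φ ρ / √ρ ≤ mom φ 0 ρ := by rw [div_le_iff₀' hs]; exact hB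
    have e : n = halfMom φ ρ / √ρ / ρ := by rw [hn, div_div, mul_comm]
    rw [e]
    gcongr
    linarith
  have h2 : (s / ρ) ^ 2 ≤ ‖w‖ ^ 2 := by
    rw [← sq_abs]; exact pow_le_pow_left₀ (abs_nonneg _) hu 2
  have e : ((φ ρ + n) / ρ - Y / ρ ^ 2) / ρ * s * s + Y / ρ * ‖w‖ ^ 2 =
      φ ρ * (s / ρ) ^ 2 + n * ‖w‖ ^ 2 + (Y / ρ - n) * (‖w‖ ^ 2 - (s / ρ) ^ 2) := by
    field_simp
    ring
  rw [e]
  have := mul_nonneg (sub_nonneg.2 h1) (sub_nonneg.2 h2)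
  linarith

theorem continuous_energy (hφ : Continuous φ) (hδ : 0 < δ) (hz : ∀ s ≤ δ, φ s = 0)
    (hv : Continuous v) (hv₁ : Continuous v₁) : Continuous fun x => energy φ (v x) (v₁ x) := by
  have h1 : Continuous fun x => φ ‖v x‖ / ‖v x‖ ^ 2 :=
    continuous_radial (k := fun s => φ s / s ^ 2) (c := 0) hδ
      (fun s hs => by rw [hz s hs.le, zero_div])
      (fun s hs => hφ.continuousAt.div (continuousAt_id.pow 2) (by positivity)) hv
  have h2 : Continuous fun x => halfMom φ ‖v x‖ / (‖v x‖ * √‖v x‖) :=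
    continuous_radial (k := fun s => halfMom φ s / (s * √s)) (c := 0) hδ
      (fun s hs => by rw [halfMom_eq_zero hδ hz hs, zero_div])
      (fun s hs => (hasDerivAt_halfMom hφ s).continuousAt.div
        (continuousAt_id.mul Real.continuous_sqrt.continuousAt)
        (mul_pos hs (Real.sqrt_pos.2 hs)).ne') hv
  have e : (fun x => energy φ (v x) (v₁ x)) = fun x => φ ‖v x‖ / ‖v x‖ ^ 2 *
      inner ℝ (v x) (v₁ x) ^ 2 + halfMom φ ‖v x‖ / (‖v x‖ * √‖v x‖) * ‖v₁ x‖ ^ 2 := by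
    ext x; rw [energy, div_pow]; ring
  rw [e]
  exact (h1.mul ((hv.inner hv₁).pow 2)).add (h2.mul (hv₁.norm.pow 2))

/-- A vector-valued form of (Φ(u)u')' = Φ'(u)u'² + Φ(u)u''. Over a period the exact derivative
integrates to 0, so the energy is paid for by second derivatives times P(|v|)|v|, bounded by 3∫φ.
Only the L¹ norm of φ enters, which is what makes the bound usable for φ = γ² with γ merely in L².
-/
theorem integral_energy_le (hφ : Continuous φ) (h0 : ∀ s, 0 ≤ φ s) (hδ : 0 < δ)
    (hz : ∀ s ≤ δ, φ s = 0) (hab : a ≤ b) (hv : ∀ x, HasDerivAt v (v₁ x) x)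
    (hv₁ : ∀ x, HasDerivAt v₁ (v₂ x) x) (hv₂ : Continuous v₂) (hper : v a = v b)
    (hper₁ : v₁ a = v₁ b) (hR : ∀ x ∈ Icc a b, ‖v x‖ ≤ R) (j : ℕ) :
    ∫ x in a..b, (‖v₁ x‖ ^ 2) ^ j * energy φ (v x) (v₁ x) ≤
      3 * mom φ 0 R * (2 * j + 1) * ∫ x in a..b, (‖v₁ x‖ ^ 2) ^ j * ‖v₂ x‖ := by
  have cv : Continuous v := continuous_iff_continuousAt.2 fun x => (hv x).continuousAt
  have cv₁ : Continuous v₁ := continuous_iff_continuousAt.2 fun x => (hv₁ x).continuousAt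
  have cp : Continuous fun x => prof φ ‖v x‖ :=
    continuous_radial hδ (fun s hs => prof_eq_zero hδ hz hs)
      (fun s hs => (hasDerivAt_prof hφ hs).continuousAt) cv
  have cp' : Continuous fun x => prof' φ ‖v x‖ / ‖v x‖ :=
    continuous_radial (k := fun s => prof' φ s / s) (c := 0) hδ
      (fun s hs => by
        rw [prof', hz s hs.le, halfMom_eq_zero hδ hz hs, mom_eq_zero hδ hz 0 hs]; simp)
      (fun s hs => by
        have hs' := Real.sqrt_pos.2 hs
        have c1 : ContinuousAt (fun s : ℝ => √s) s := Real.continuous_sqrt.continuousAt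
        have c2 := (hasDerivAt_halfMom hφ s).continuousAt
        have c3 := (hasDerivAt_mom hφ 0 s).continuousAt
        have c4 : ContinuousAt (fun s : ℝ => s) s := continuousAt_id
        exact ((((hφ.continuousAt.add (c2.div (c4.mul c1) (mul_pos hs hs').ne')).div c4 hs.ne').sub
          (((c3.const_mul 3).sub ((c2.div c1 hs'.ne').const_mul 2)).div (c4.pow 2)
            (pow_pos hs 2).ne'))).div c4 hs.ne') cv
  have ce := continuous_energy (v₁ := v₁) hφ hδ hz cv cv₁
  -- The quantity whose increment over the period vanishes; its derivative contains the energy plus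
  -- terms linear in v₂.
  set H : ℝ → ℝ := fun x => (‖v₁ x‖ ^ 2) ^ j * (prof φ ‖v x‖ * inner ℝ (v₁ x) (v x)) with hH
  set H' : ℝ → ℝ := fun x => (j * (‖v₁ x‖ ^ 2) ^ (j - 1) * (2 * inner ℝ (v₁ x) (v₂ x))) *
      (prof φ ‖v x‖ * inner ℝ (v₁ x) (v x)) + (‖v₁ x‖ ^ 2) ^ j *
      (prof' φ ‖v x‖ / ‖v x‖ * inner ℝ (v x) (v₁ x) * inner ℝ (v₁ x) (v x) +
        prof φ ‖v x‖ * (inner ℝ (v₁ x) (v₁ x) + inner ℝ (v₂ x) (v x))) with hH'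
  have hd : ∀ x, HasDerivAt H (H' x) x := fun x =>
    ((hv₁ x).norm_sq.pow j).mul ((hasDerivAt_radial hδ (fun s hs => prof_eq_zero hδ hz hs)
      (fun s hs => hasDerivAt_prof hφ hs) (hv x)).mul ((hv₁ x).inner ℝ (hv x)))
  have cH' : Continuous H' := by
    have i1 := cv₁.inner (𝕜 := ℝ) hv₂
    have i2 := cv₁.inner (𝕜 := ℝ) cv
    have i3 := cv.inner (𝕜 := ℝ) cv₁
    have i4 := cv₁.inner (𝕜 := ℝ) cv₁
    have i5 := hv₂.inner (𝕜 := ℝ) cv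
    have n1 := cv₁.norm.pow 2
    exact ((((continuous_const.mul (n1.pow _)).mul (continuous_const.mul i1)).mul (cp.mul i2)).add
      ((n1.pow j).mul (((cp'.mul i3).mul i2).add (cp.mul (i4.add i5)))))
  have hint : ∫ x in a..b, H' x = 0 := by
    rw [intervalIntegral.integral_eq_sub_of_hasDerivAt (fun x _ => hd x)
      (cH'.intervalIntegrable _ _), hH]
    simp only [hper, hper₁, sub_self]
  have c1 : Continuous fun x => (‖v₁ x‖ ^ 2) ^ j * energy φ (v x) (v₁ x) :=
    ((cv₁.norm.pow 2).pow j).mul ce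
  have c2 : Continuous fun x => (‖v₁ x‖ ^ 2) ^ j * ‖v₂ x‖ :=
    ((cv₁.norm.pow 2).pow j).mul hv₂.norm
  have hpt : ∀ x ∈ Icc a b, (‖v₁ x‖ ^ 2) ^ j * energy φ (v x) (v₁ x) ≤
      H' x + 3 * mom φ 0 R * (2 * j + 1) * ((‖v₁ x‖ ^ 2) ^ j * ‖v₂ x‖) := by
    intro x hx
    have e1 := energy_le_prof hφ h0 (v x) (v₁ x)
    have e2 := abs_prof_mul_le hφ h0 (norm_nonneg (v x)) (hR x hx)
    have k1 := abs_real_inner_le_norm (v₁ x) (v₂ x)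
    have k2 := abs_real_inner_le_norm (v₁ x) (v x)
    have k3 := abs_real_inner_le_norm (v₂ x) (v x)
    have hsymm : inner ℝ (v₁ x) (v x) = inner ℝ (v x) (v₁ x) := real_inner_comm _ _
    have hself : inner ℝ (v₁ x) (v₁ x) = ‖v₁ x‖ ^ 2 := real_inner_self_eq_norm_sq _
    set E := 3 * mom φ 0 R
    set P := ‖v₁ x‖ ^ 2 with hP
    have hP0 : 0 ≤ P := by positivity
    have hPj : 0 ≤ P ^ j := by positivity
    have t1 : |j * P ^ (j - 1) * (2 * inner ℝ (v₁ x) (v₂ x)) *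
        (prof φ ‖v x‖ * inner ℝ (v₁ x) (v x))| ≤ 2 * j * (P ^ j * ‖v₂ x‖) * E := by
      -- Differentiating the weight gives the exponent j - 1, truncated at j = 0, where the term
      -- vanishes anyway. For j > 0 it costs 2j, which together with the 1 from the last term gives
      -- 2j + 1.
      rcases Nat.eq_zero_or_pos j with rfl | hj
      · simp
      have ej : P ^ j = P ^ (j - 1) * ‖v₁ x‖ * ‖v₁ x‖ := by
        obtain ⟨i, rfl⟩ : ∃ i, j = i + 1 := ⟨j - 1, by omega⟩
        rw [pow_succ, Nat.add_sub_cancel, hP]; ring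
      have hPj' : 0 ≤ P ^ (j - 1) := by positivity
      rw [abs_mul, abs_mul, abs_mul, abs_mul, abs_mul, abs_of_nonneg hPj', Nat.abs_cast, abs_two]
      calc _ ≤ j * P ^ (j - 1) * (2 * (‖v₁ x‖ * ‖v₂ x‖)) *
            (|prof φ ‖v x‖| * (‖v₁ x‖ * ‖v x‖)) := by gcongr
        _ = 2 * j * (P ^ (j - 1) * ‖v₁ x‖ * ‖v₁ x‖ * ‖v₂ x‖) * (|prof φ ‖v x‖| * ‖v x‖) := by ring
        _ ≤ _ := by rw [ej]; gcongr
    have t3 : |prof φ ‖v x‖ * inner ℝ (v₂ x) (v x)| ≤ ‖v₂ x‖ * E := by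
      rw [abs_mul]
      calc _ ≤ |prof φ ‖v x‖| * (‖v₂ x‖ * ‖v x‖) := by gcongr
        _ = ‖v₂ x‖ * (|prof φ ‖v x‖| * ‖v x‖) := by ring
        _ ≤ _ := by gcongr
    have t2 := mul_le_mul_of_nonneg_left e1 hPj
    have t3' := mul_le_mul_of_nonneg_left (neg_le_of_abs_le t3) hPj
    have t1' := neg_le_of_abs_le t1
    simp only [hH', hself, hsymm] at t1' ⊢
    linarith
  have := intervalIntegral.integral_mono_on hab (c1.intervalIntegrable _ _)
    ((cH'.intervalIntegrable (μ := volume) _ _).add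
      ((c2.intervalIntegrable (μ := volume) _ _).const_mul _)) hpt
  rwa [intervalIntegral.integral_add (cH'.intervalIntegrable _ _)
    ((c2.intervalIntegrable _ _).const_mul _), hint, zero_add,
    intervalIntegral.integral_const_mul] at this

end energy

/-! ### Derivatives of radial multiples of a curve -/

section comp

variable {v v₁ v₂ v₃ : ℝ → ℂ} {k p r t : ℝ → ℝ} {δ c : ℝ} {x : ℝ}

/-- Writing k' as p(s)s cancels the norm in the denominator. Iterating ρ⁻¹ d/dρ keeps every
derivative of k(|v|)v polynomial in inner products of v and its derivatives, with radial
coefficients. -/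
theorem hasDerivAt_radial_mul (hδ : 0 < δ) (hk : ∀ s < δ, k s = c) (hp : ∀ s < δ, p s = 0)
    (hd : ∀ s > 0, HasDerivAt k (p s * s) s) {v' : ℂ} (hv : HasDerivAt v v' x) :
    HasDerivAt (fun x => k ‖v x‖) (p ‖v x‖ * inner ℝ (v x) v') x := by
  refine (hasDerivAt_radial hδ hk hd hv).congr_deriv ?_
  rcases (norm_nonneg (v x)).eq_or_lt with h | h
  · simp [← h, hp 0 hδ]
  · rw [mul_div_cancel_right₀ _ h.ne']

/-- The first derivative of `k(|v|) v`. -/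
def comp₁ (k p : ℝ → ℝ) (v v₁ : ℝ → ℂ) (x : ℝ) : ℂ :=
  ((p ‖v x‖ * inner ℝ (v x) (v₁ x) : ℝ) : ℂ) * v x + (k ‖v x‖ : ℂ) * v₁ x

/-- The second derivative of `k(|v|) v`. -/
def comp₂ (k p r : ℝ → ℝ) (v v₁ v₂ : ℝ → ℂ) (x : ℝ) : ℂ :=
  ((r ‖v x‖ * inner ℝ (v x) (v₁ x) ^ 2 +
    p ‖v x‖ * (‖v₁ x‖ ^ 2 + inner ℝ (v x) (v₂ x)) : ℝ) : ℂ) * v x +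
  ((2 * (p ‖v x‖ * inner ℝ (v x) (v₁ x)) : ℝ) : ℂ) * v₁ x + (k ‖v x‖ : ℂ) * v₂ x

/-- The third derivative of `k(|v|) v`. -/
def comp₃ (k p r t : ℝ → ℝ) (v v₁ v₂ v₃ : ℝ → ℂ) (x : ℝ) : ℂ :=
  ((t ‖v x‖ * inner ℝ (v x) (v₁ x) ^ 3 +
    3 * (r ‖v x‖ * inner ℝ (v x) (v₁ x) * (‖v₁ x‖ ^ 2 + inner ℝ (v x) (v₂ x))) +
    p ‖v x‖ * (3 * inner ℝ (v₁ x) (v₂ x) + inner ℝ (v x) (v₃ x)) : ℝ) : ℂ) * v x +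
  ((3 * (r ‖v x‖ * inner ℝ (v x) (v₁ x) ^ 2) +
    3 * (p ‖v x‖ * (‖v₁ x‖ ^ 2 + inner ℝ (v x) (v₂ x))) : ℝ) : ℂ) * v₁ x +
  ((3 * (p ‖v x‖ * inner ℝ (v x) (v₁ x)) : ℝ) : ℂ) * v₂ x + (k ‖v x‖ : ℂ) * v₃ x

theorem hasDerivAt_inner₁ (hv : HasDerivAt v (v₁ x) x) (hv₁ : HasDerivAt v₁ (v₂ x) x) :
    HasDerivAt (fun x => inner ℝ (v x) (v₁ x)) (‖v₁ x‖ ^ 2 + inner ℝ (v x) (v₂ x)) x := by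
  refine (hv.inner ℝ hv₁).congr_deriv ?_
  rw [real_inner_self_eq_norm_sq, add_comm]

theorem hasDerivAt_inner₂ (hv : HasDerivAt v (v₁ x) x) (hv₁ : HasDerivAt v₁ (v₂ x) x)
    (hv₂ : HasDerivAt v₂ (v₃ x) x) :
    HasDerivAt (fun x => ‖v₁ x‖ ^ 2 + inner ℝ (v x) (v₂ x))
      (3 * inner ℝ (v₁ x) (v₂ x) + inner ℝ (v x) (v₃ x)) x := by
  refine (hv₁.norm_sq.add (hv.inner ℝ hv₂)).congr_deriv ?_
  ring

theorem hasDerivAt_comp₀ (hδ : 0 < δ) (hk : ∀ s < δ, k s = c) (hp : ∀ s < δ, p s = 0)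
    (hdk : ∀ s > 0, HasDerivAt k (p s * s) s) (hv : HasDerivAt v (v₁ x) x) :
    HasDerivAt (fun x => (k ‖v x‖ : ℂ) * v x) (comp₁ k p v v₁ x) x :=
  (hasDerivAt_radial_mul hδ hk hp hdk hv).ofReal_comp.mul hv

theorem hasDerivAt_comp₁ (hδ : 0 < δ) (hk : ∀ s < δ, k s = c) (hp : ∀ s < δ, p s = 0)
    (hr : ∀ s < δ, r s = 0) (hdk : ∀ s > 0, HasDerivAt k (p s * s) s)
    (hdp : ∀ s > 0, HasDerivAt p (r s * s) s) (hv : HasDerivAt v (v₁ x) x)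
    (hv₁ : HasDerivAt v₁ (v₂ x) x) :
    HasDerivAt (comp₁ k p v v₁) (comp₂ k p r v v₁ v₂ x) x := by
  have dk := (hasDerivAt_radial_mul hδ hk hp hdk hv).ofReal_comp
  have dp := hasDerivAt_radial_mul hδ hp hr hdp hv
  have ds := hasDerivAt_inner₁ hv hv₁
  refine (((dp.mul ds).ofReal_comp.mul hv).add (dk.mul hv₁)).congr_deriv ?_
  simp only [comp₂, Pi.mul_apply]
  push_cast
  ring

theorem hasDerivAt_comp₂ (hδ : 0 < δ) (hk : ∀ s < δ, k s = c) (hp : ∀ s < δ, p s = 0)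
    (hr : ∀ s < δ, r s = 0) (ht : ∀ s < δ, t s = 0) (hdk : ∀ s > 0, HasDerivAt k (p s * s) s)
    (hdp : ∀ s > 0, HasDerivAt p (r s * s) s) (hdr : ∀ s > 0, HasDerivAt r (t s * s) s)
    (hv : HasDerivAt v (v₁ x) x) (hv₁ : HasDerivAt v₁ (v₂ x) x) (hv₂ : HasDerivAt v₂ (v₃ x) x) :
    HasDerivAt (comp₂ k p r v v₁ v₂) (comp₃ k p r t v v₁ v₂ v₃ x) x := by
  have dk := (hasDerivAt_radial_mul hδ hk hp hdk hv).ofReal_comp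
  have dp := hasDerivAt_radial_mul hδ hp hr hdp hv
  have dr := hasDerivAt_radial_mul hδ hr ht hdr hv
  have ds := hasDerivAt_inner₁ hv hv₁
  have ds' := hasDerivAt_inner₂ hv hv₁ hv₂
  refine (((((dr.mul (ds.pow 2)).add (dp.mul ds')).ofReal_comp.mul hv).add
    (((dp.mul ds).const_mul 2).ofReal_comp.mul hv₁)).add (dk.mul hv₂)).congr_deriv ?_
  simp only [comp₃, Pi.mul_apply, Pi.pow_apply, Pi.add_apply]
  push_cast
  ring

theorem continuous_comp₂ (hδ : 0 < δ) (hk : ∀ s < δ, k s = c) (hp : ∀ s < δ, p s = 0)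
    (hr : ∀ s < δ, r s = 0) (ck : ∀ s > 0, ContinuousAt k s) (cp : ∀ s > 0, ContinuousAt p s)
    (cr : ∀ s > 0, ContinuousAt r s) (hv : Continuous v) (hv₁ : Continuous v₁)
    (hv₂ : Continuous v₂) : Continuous (comp₂ k p r v v₁ v₂) := by
  have k1 := continuous_radial hδ hk ck hv
  have p1 := continuous_radial hδ hp cp hv
  have r1 := continuous_radial hδ hr cr hv
  have s1 := hv.inner (𝕜 := ℝ) hv₁
  have s2 := hv.inner (𝕜 := ℝ) hv₂
  have q := (hv₁.norm.pow 2).add s2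
  exact ((((Complex.continuous_ofReal.comp ((r1.mul (s1.pow 2)).add (p1.mul q))).mul hv)).add
    ((Complex.continuous_ofReal.comp (continuous_const.mul (p1.mul s1))).mul hv₁)).add
    ((Complex.continuous_ofReal.comp k1).mul hv₂)

theorem continuous_comp₃ (hδ : 0 < δ) (hk : ∀ s < δ, k s = c) (hp : ∀ s < δ, p s = 0)
    (hr : ∀ s < δ, r s = 0) (ht : ∀ s < δ, t s = 0) (ck : ∀ s > 0, ContinuousAt k s)
    (cp : ∀ s > 0, ContinuousAt p s) (cr : ∀ s > 0, ContinuousAt r s)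
    (ct : ∀ s > 0, ContinuousAt t s) (hv : Continuous v) (hv₁ : Continuous v₁)
    (hv₂ : Continuous v₂) (hv₃ : Continuous v₃) : Continuous (comp₃ k p r t v v₁ v₂ v₃) := by
  have k1 := continuous_radial hδ hk ck hv
  have p1 := continuous_radial hδ hp cp hv
  have r1 := continuous_radial hδ hr cr hv
  have t1 := continuous_radial hδ ht ct hv
  have s1 := hv.inner (𝕜 := ℝ) hv₁
  have s2 := hv.inner (𝕜 := ℝ) hv₂
  have s3 := hv.inner (𝕜 := ℝ) hv₃
  have s4 := hv₁.inner (𝕜 := ℝ) hv₂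
  have q := (hv₁.norm.pow 2).add s2
  exact ((((Complex.continuous_ofReal.comp (((t1.mul (s1.pow 3)).add
    (continuous_const.mul ((r1.mul s1).mul q))).add (p1.mul ((continuous_const.mul s4).add s3)))).mul
    hv).add ((Complex.continuous_ofReal.comp ((continuous_const.mul (r1.mul (s1.pow 2))).add
    (continuous_const.mul (p1.mul q)))).mul hv₁)).add
    ((Complex.continuous_ofReal.comp (continuous_const.mul (p1.mul s1))).mul hv₂)).add
    ((Complex.continuous_ofReal.comp k1).mul hv₃)

theorem inner_eq_div_mul (z w : ℂ) : inner ℝ z w = inner ℝ z w / ‖z‖ * ‖z‖ := by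
  rcases eq_or_ne z 0 with rfl | h
  · simp
  · rw [div_mul_cancel₀ _ (norm_ne_zero_iff.2 h)]

/-- The powers of ‖z‖ in the hypotheses compensate the singularities of the radial coefficients at
0. Here g stands for γ(|z|), A for the average of |γ| on [0, |z|] and Γ for a bound on its integral.
Neither g nor A will be bounded uniformly, so the terms carrying them are kept for the energy
estimate. -/
theorem norm_comp₂_le {z z₁ z₂ : ℂ} {κ π ϱ g A c Γ : ℝ} (hA : 0 ≤ A) (hΓ : ‖z‖ * A ≤ Γ)
    (hκ : |κ| ≤ c) (hπ : |π| * ‖z‖ ≤ A) (hϱ : |ϱ| * ‖z‖ ^ 3 ≤ |g| + 3 * A) :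
    ‖((ϱ * inner ℝ z z₁ ^ 2 + π * (‖z₁‖ ^ 2 + inner ℝ z z₂) : ℝ) : ℂ) * z +
      ((2 * (π * inner ℝ z z₁) : ℝ) : ℂ) * z₁ + (κ : ℂ) * z₂‖ ≤
    |g| * (inner ℝ z z₁ / ‖z‖) ^ 2 + 6 * A * ‖z₁‖ ^ 2 + (c + Γ) * ‖z₂‖ := by
  have hu := abs_inner_div_le z z₁
  have hs := inner_eq_div_mul z z₁
  have h2 := abs_real_inner_le_norm z z₂
  generalize inner ℝ z z₁ / ‖z‖ = u at *
  generalize inner ℝ z z₂ = s₂ at *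
  rw [hs]
  have hρ := norm_nonneg z
  have hW := norm_nonneg z₁
  have hZ := norm_nonneg z₂
  have hc : 0 ≤ c := (abs_nonneg _).trans hκ
  have hu2 : u ^ 2 ≤ ‖z₁‖ ^ 2 := by
    rw [← sq_abs]; exact pow_le_pow_left₀ (abs_nonneg _) hu 2
  have hq : |‖z₁‖ ^ 2 + s₂| ≤ ‖z₁‖ ^ 2 + ‖z‖ * ‖z₂‖ :=
    (abs_add_le _ _).trans (by rw [abs_of_nonneg (by positivity)]; gcongr)
  have e1 : ‖((ϱ * (u * ‖z‖) ^ 2 + π * (‖z₁‖ ^ 2 + s₂) : ℝ) : ℂ) * z‖ ≤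
      (|ϱ| * ‖z‖ ^ 3) * u ^ 2 + (|π| * ‖z‖) * (‖z₁‖ ^ 2 + ‖z‖ * ‖z₂‖) := by
    rw [norm_mul, Complex.norm_real, Real.norm_eq_abs]
    calc _ ≤ (|ϱ| * (u * ‖z‖) ^ 2 + |π| * (‖z₁‖ ^ 2 + ‖z‖ * ‖z₂‖)) * ‖z‖ := by
          gcongr
          refine (abs_add_le _ _).trans ?_
          rw [abs_mul, abs_mul, abs_of_nonneg (sq_nonneg (u * ‖z‖))]
          gcongr
      _ = _ := by ring
  have e2 : ‖((2 * (π * (u * ‖z‖)) : ℝ) : ℂ) * z₁‖ ≤ 2 * (|π| * ‖z‖) * ‖z₁‖ ^ 2 := by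
    rw [norm_mul, Complex.norm_real, Real.norm_eq_abs, abs_mul, abs_mul, abs_mul, abs_norm, abs_two]
    calc _ ≤ 2 * (|π| * (‖z₁‖ * ‖z‖)) * ‖z₁‖ := by gcongr
      _ = _ := by ring
  have e3 : ‖(κ : ℂ) * z₂‖ ≤ c * ‖z₂‖ := by
    rw [norm_mul, Complex.norm_real, Real.norm_eq_abs]; gcongr
  have e4 : (|ϱ| * ‖z‖ ^ 3) * u ^ 2 ≤ |g| * u ^ 2 + 3 * A * ‖z₁‖ ^ 2 := by
    calc _ ≤ (|g| + 3 * A) * u ^ 2 := by gcongr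
      _ ≤ _ := by rw [add_mul]; gcongr
  have e5 : (|π| * ‖z‖) * (‖z₁‖ ^ 2 + ‖z‖ * ‖z₂‖) ≤ A * ‖z₁‖ ^ 2 + Γ * ‖z₂‖ := by
    calc _ ≤ A * (‖z₁‖ ^ 2 + ‖z‖ * ‖z₂‖) := by gcongr
      _ = A * ‖z₁‖ ^ 2 + (‖z‖ * A) * ‖z₂‖ := by ring
      _ ≤ _ := by gcongr
  have e6 : 2 * (|π| * ‖z‖) * ‖z₁‖ ^ 2 ≤ 2 * A * ‖z₁‖ ^ 2 := by gcongr
  refine (norm_add_le _ _).trans ((add_le_add ((norm_add_le _ _).trans (add_le_add e1 e2)) e3).trans ?_)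
  linarith

theorem norm_comp₃_le {z z₁ z₂ z₃ : ℂ} {κ π ϱ θ g A c Γ R : ℝ} (hA : 0 ≤ A) (hΓ : ‖z‖ * A ≤ Γ)
    (hR : ‖z‖ ≤ R) (hκ : |κ| ≤ c) (hπ : |π| ≤ A) (hϱ : |ϱ| * ‖z‖ ^ 2 ≤ 2 * A)
    (hθ : |θ| * ‖z‖ ^ 4 ≤ |g| + 9 * A) :
    ‖((θ * inner ℝ z z₁ ^ 3 + 3 * (ϱ * inner ℝ z z₁ * (‖z₁‖ ^ 2 + inner ℝ z z₂)) +
        π * (3 * inner ℝ z₁ z₂ + inner ℝ z z₃) : ℝ) : ℂ) * z +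
      ((3 * (ϱ * inner ℝ z z₁ ^ 2) + 3 * (π * (‖z₁‖ ^ 2 + inner ℝ z z₂)) : ℝ) : ℂ) * z₁ +
      ((3 * (π * inner ℝ z z₁) : ℝ) : ℂ) * z₂ + (κ : ℂ) * z₃‖ ≤
    |g| * |inner ℝ z z₁ / ‖z‖| ^ 3 + 24 * A * ‖z₁‖ ^ 3 + 15 * Γ * (‖z₁‖ * ‖z₂‖) +
      (c + R * Γ) * ‖z₃‖ := by
  have hu := abs_inner_div_le z z₁
  have hs := inner_eq_div_mul z z₁
  have h2 := abs_real_inner_le_norm z z₂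
  have h3 := abs_real_inner_le_norm z z₃
  have h12 := abs_real_inner_le_norm z₁ z₂
  generalize inner ℝ z z₁ / ‖z‖ = u at *
  generalize inner ℝ z z₂ = s₂ at *
  generalize inner ℝ z z₃ = s₃ at *
  generalize inner ℝ z₁ z₂ = s₁₂ at *
  rw [hs]
  have hρ := norm_nonneg z
  have hW := norm_nonneg z₁
  have hZ := norm_nonneg z₂
  have hZ3 := norm_nonneg z₃
  have hc : 0 ≤ c := (abs_nonneg _).trans hκ
  have hu0 := abs_nonneg u
  have hu2 : |u| ^ 2 ≤ ‖z₁‖ ^ 2 := pow_le_pow_left₀ (abs_nonneg _) hu 2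
  have hu3 : |u| ^ 3 ≤ ‖z₁‖ ^ 3 := pow_le_pow_left₀ (abs_nonneg _) hu 3
  have hΓ0 : 0 ≤ Γ := (mul_nonneg hρ hA).trans hΓ
  have hq : |‖z₁‖ ^ 2 + s₂| ≤ ‖z₁‖ ^ 2 + ‖z‖ * ‖z₂‖ :=
    (abs_add_le _ _).trans (by rw [abs_of_nonneg (by positivity)]; gcongr)
  set q := ‖z₁‖ ^ 2 + s₂
  have e1 : ‖((θ * (u * ‖z‖) ^ 3 + 3 * (ϱ * (u * ‖z‖) * q) + π * (3 * s₁₂ + s₃) : ℝ) : ℂ) * z‖ ≤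
      (|g| + 9 * A) * |u| ^ 3 + 3 * (2 * A) * (‖z₁‖ * (‖z₁‖ ^ 2 + ‖z‖ * ‖z₂‖)) +
        A * (3 * (‖z₁‖ * ‖z₂‖) + ‖z‖ * ‖z₃‖) * ‖z‖ := by
    rw [norm_mul, Complex.norm_real, Real.norm_eq_abs]
    calc _ ≤ (|θ| * (|u| * ‖z‖) ^ 3 + 3 * (|ϱ| * (|u| * ‖z‖) * |q|) +
          |π| * (3 * |s₁₂| + |s₃|)) * ‖z‖ := by
          gcongr
          refine (abs_add_le _ _).trans (add_le_add ((abs_add_le _ _).trans (add_le_add ?_ ?_)) ?_)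
          · simp [abs_mul, abs_pow]
          · simp [abs_mul]
          · rw [abs_mul]
            gcongr
            refine (abs_add_le _ _).trans (le_of_eq ?_)
            simp [abs_mul]
      _ = (|θ| * ‖z‖ ^ 4) * |u| ^ 3 + 3 * (|ϱ| * ‖z‖ ^ 2) * (|u| * |q|) +
          |π| * (3 * |s₁₂| + |s₃|) * ‖z‖ := by ring
      _ ≤ _ := by gcongr
  have e2 : ‖((3 * (ϱ * (u * ‖z‖) ^ 2) + 3 * (π * q) : ℝ) : ℂ) * z₁‖ ≤
      (3 * (2 * A) * ‖z₁‖ ^ 2 + 3 * (A * (‖z₁‖ ^ 2 + ‖z‖ * ‖z₂‖))) * ‖z₁‖ := by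
    rw [norm_mul, Complex.norm_real, Real.norm_eq_abs]
    gcongr
    calc _ ≤ 3 * (|ϱ| * ‖z‖ ^ 2) * |u| ^ 2 + 3 * (|π| * |q|) := by
          refine (abs_add_le _ _).trans (le_of_eq ?_)
          simp [abs_mul, abs_pow, mul_pow]
          ring
      _ ≤ _ := by gcongr
  have e3 : ‖((3 * (π * (u * ‖z‖)) : ℝ) : ℂ) * z₂‖ ≤ 3 * (A * (‖z₁‖ * ‖z‖)) * ‖z₂‖ := by
    rw [norm_mul, Complex.norm_real, Real.norm_eq_abs, abs_mul, abs_mul, abs_mul, abs_norm,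
      abs_of_pos (by norm_num : (0 : ℝ) < 3)]
    gcongr
  have e4 : ‖(κ : ℂ) * z₃‖ ≤ c * ‖z₃‖ := by
    rw [norm_mul, Complex.norm_real, Real.norm_eq_abs]; gcongr
  have f1 : ‖z‖ * A * (‖z₁‖ * ‖z₂‖) ≤ Γ * (‖z₁‖ * ‖z₂‖) := by gcongr
  have f2 : ‖z‖ * (‖z‖ * A) * ‖z₃‖ ≤ R * Γ * ‖z₃‖ := by gcongr; exact hρ.trans hR
  have f3 : A * |u| ^ 3 ≤ A * ‖z₁‖ ^ 3 := by gcongr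
  refine (norm_add_le _ _).trans ((add_le_add ((norm_add_le _ _).trans
    (add_le_add ((norm_add_le _ _).trans (add_le_add e1 e2)) e3)) e4).trans ?_)
  linarith

end comp

/-! ### Radial profiles with prescribed second or third derivative -/

section profiles

variable {γ : ℝ → ℝ} {δ c ρ : ℝ}

/-- `g(ρ) / ρ` for `g(ρ) = c ρ + ∫₀^ρ (ρ - s) γ(s) ds`. -/
def kTwo (c : ℝ) (γ : ℝ → ℝ) (ρ : ℝ) : ℝ := c + mom γ 0 ρ - mom γ 1 ρ / ρ

/-- `ρ⁻¹` times the derivative of `kTwo`. -/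
def pTwo (γ : ℝ → ℝ) (ρ : ℝ) : ℝ := mom γ 1 ρ / ρ ^ 3

/-- `ρ⁻¹` times the derivative of `pTwo`. -/
def rTwo (γ : ℝ → ℝ) (ρ : ℝ) : ℝ := γ ρ / ρ ^ 3 - 3 * mom γ 1 ρ / ρ ^ 5

/-- `g(ρ) / ρ` for `g(ρ) = c ρ + ∫₀^ρ (ρ - s)² / 2 γ(s) ds`. -/
def kThree (c : ℝ) (γ : ℝ → ℝ) (ρ : ℝ) : ℝ :=
  c + (ρ * mom γ 0 ρ - 2 * mom γ 1 ρ + mom γ 2 ρ / ρ) / 2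

/-- `ρ⁻¹` times the derivative of `kThree`. -/
def pThree (γ : ℝ → ℝ) (ρ : ℝ) : ℝ := (mom γ 0 ρ / ρ - mom γ 2 ρ / ρ ^ 3) / 2

/-- `ρ⁻¹` times the derivative of `pThree`. -/
def rThree (γ : ℝ → ℝ) (ρ : ℝ) : ℝ := (3 * mom γ 2 ρ / ρ ^ 5 - mom γ 0 ρ / ρ ^ 3) / 2

/-- `ρ⁻¹` times the derivative of `rThree`. -/
def tThree (γ : ℝ → ℝ) (ρ : ℝ) : ℝ :=
  (2 * γ ρ / ρ ^ 4 + 3 * mom γ 0 ρ / ρ ^ 5 - 15 * mom γ 2 ρ / ρ ^ 7) / 2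

theorem hasDerivAt_kTwo (hγ : Continuous γ) (c : ℝ) (hρ : 0 < ρ) :
    HasDerivAt (kTwo c γ) (pTwo γ ρ * ρ) ρ := by
  refine (((hasDerivAt_mom hγ 0 ρ).const_add c).sub
    ((hasDerivAt_mom hγ 1 ρ).div (hasDerivAt_id ρ) hρ.ne')).congr_deriv ?_
  simp only [pTwo, id]
  field_simp
  ring

theorem hasDerivAt_pTwo (hγ : Continuous γ) (hρ : 0 < ρ) :
    HasDerivAt (pTwo γ) (rTwo γ ρ * ρ) ρ := by
  refine ((hasDerivAt_mom hγ 1 ρ).div (hasDerivAt_pow 3 ρ) (by positivity)).congr_deriv ?_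
  simp only [rTwo]
  field_simp
  norm_num
  ring

theorem hasDerivAt_kThree (hγ : Continuous γ) (c : ℝ) (hρ : 0 < ρ) :
    HasDerivAt (kThree c γ) (pThree γ ρ * ρ) ρ := by
  refine ((((((hasDerivAt_id ρ).mul (hasDerivAt_mom hγ 0 ρ)).sub
    ((hasDerivAt_mom hγ 1 ρ).const_mul 2)).add ((hasDerivAt_mom hγ 2 ρ).div (hasDerivAt_id ρ)
    hρ.ne')).div_const 2).const_add c).congr_deriv ?_
  simp only [pThree, id]
  field_simp
  ring

theorem hasDerivAt_pThree (hγ : Continuous γ) (hρ : 0 < ρ) :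
    HasDerivAt (pThree γ) (rThree γ ρ * ρ) ρ := by
  refine ((((hasDerivAt_mom hγ 0 ρ).div (hasDerivAt_id ρ) hρ.ne').sub
    ((hasDerivAt_mom hγ 2 ρ).div (hasDerivAt_pow 3 ρ) (by positivity))).div_const 2).congr_deriv ?_
  simp only [rThree, id]
  field_simp
  norm_num
  ring

theorem hasDerivAt_rThree (hγ : Continuous γ) (hρ : 0 < ρ) :
    HasDerivAt (rThree γ) (tThree γ ρ * ρ) ρ := by
  refine (((((hasDerivAt_mom hγ 2 ρ).const_mul 3).div (hasDerivAt_pow 5 ρ) (by positivity)).sub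
    ((hasDerivAt_mom hγ 0 ρ).div (hasDerivAt_pow 3 ρ) (by positivity))).div_const 2).congr_deriv ?_
  simp only [tThree]
  field_simp
  norm_num
  ring

/-- The average `ρ⁻¹ ∫₀^ρ |γ|`. -/
def avg (γ : ℝ → ℝ) (ρ : ℝ) : ℝ := mom (fun s => |γ s|) 0 ρ / ρ

theorem avg_nonneg (γ : ℝ → ℝ) (hρ : 0 ≤ ρ) : 0 ≤ avg γ ρ :=
  div_nonneg (mom_nonneg (fun _ => abs_nonneg _) hρ) hρ

/-- A Hardy-type inequality from the weighted Cauchy–Schwarz bound: the square of the average of |γ|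
is at most twice the second coefficient of the energy for φ = γ². -/
theorem avg_sq_le (hγ : Continuous γ) (hρ : 0 ≤ ρ) :
    avg γ ρ ^ 2 ≤ 2 * (halfMom (fun s => γ s ^ 2) ρ / (ρ * √ρ)) := by
  rcases hρ.eq_or_lt with rfl | hρ
  · simp [avg]
  have hs : 0 < √ρ := Real.sqrt_pos.2 hρ
  have h := sq_mom_abs_le hγ hρ
  have e : 2 * (halfMom (fun s => γ s ^ 2) ρ / (ρ * √ρ)) =
      2 * √ρ * halfMom (fun s => γ s ^ 2) ρ / ρ ^ 2 := by
    have e1 : ρ = √ρ ^ 2 := (Real.sq_sqrt hρ.le).symm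
    generalize √ρ = x at *
    generalize halfMom (fun s => γ s ^ 2) ρ = y at *
    subst e1
    field_simp
  rw [avg, div_pow, e]
  gcongr

/-- On [0, ρ] the weight s^i is at most ρ^i, so every normalized moment reduces to the single
quantity `avg`. All singular coefficients of the profiles are combinations of such moments and γ. -/
theorem abs_mom_div_le (hγ : Continuous γ) (i : ℕ) (hρ : 0 < ρ) :
    |mom γ i ρ| / ρ ^ (i + 1) ≤ avg γ ρ := by
  rw [avg, div_le_div_iff₀ (by positivity) hρ, pow_succ]
  calc |mom γ i ρ| * ρ ≤ ρ ^ i * mom (fun s => |γ s|) 0 ρ * ρ := by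
        gcongr; exact abs_mom_le hγ i hρ.le
    _ = _ := by ring

theorem mul_avg_le (hγ : Continuous γ) {R : ℝ} (hρ : 0 ≤ ρ) (hR : ρ ≤ R) :
    ρ * avg γ ρ ≤ mom (fun s => |γ s|) 0 R := by
  rcases hρ.eq_or_lt with rfl | h
  · rw [zero_mul]; exact mom_nonneg (fun _ => abs_nonneg _) hR
  · rw [avg, mul_div_cancel₀ _ h.ne']
    exact mom_mono hγ.abs (fun _ => abs_nonneg _) hρ hR

theorem abs_pTwo_le (hγ : Continuous γ) (hρ : 0 ≤ ρ) : |pTwo γ ρ| * ρ ≤ avg γ ρ := by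
  rcases hρ.eq_or_lt with rfl | h
  · simp [avg]
  have h1 := abs_mom_div_le hγ 1 h
  refine le_trans (le_of_eq ?_) h1
  rw [pTwo, abs_div, abs_of_pos (pow_pos h 3)]
  field_simp

theorem abs_rTwo_le (hγ : Continuous γ) (hρ : 0 ≤ ρ) :
    |rTwo γ ρ| * ρ ^ 3 ≤ |γ ρ| + 3 * avg γ ρ := by
  rcases hρ.eq_or_lt with rfl | h
  · simp [avg]
  have h1 := abs_mom_div_le hγ 1 h
  have e : |rTwo γ ρ| * ρ ^ 3 = |γ ρ - 3 * (mom γ 1 ρ / ρ ^ (1 + 1))| := by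
    have : γ ρ - 3 * (mom γ 1 ρ / ρ ^ (1 + 1)) = rTwo γ ρ * ρ ^ 3 := by
      rw [rTwo]; field_simp; ring
    rw [this, abs_mul, abs_of_pos (pow_pos h 3)]
  rw [e]
  refine (abs_sub _ _).trans ?_
  rw [abs_mul, abs_div, abs_of_pos (pow_pos h (1 + 1)), abs_of_pos (by norm_num : (0 : ℝ) < 3)]
  gcongr

theorem abs_kTwo_le (hγ : Continuous γ) (c : ℝ) {R : ℝ} (hρ : 0 ≤ ρ) (hR : ρ ≤ R) :
    |kTwo c γ ρ| ≤ |c| + 2 * mom (fun s => |γ s|) 0 R := by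
  have hm := mom_mono hγ.abs (fun _ => abs_nonneg _) hρ hR
  have h0 := (abs_mom_le hγ 0 hρ).trans_eq (by rw [pow_zero, one_mul])
  have h1 : |mom γ 1 ρ / ρ| ≤ mom (fun s => |γ s|) 0 ρ := by
    rcases hρ.eq_or_lt with rfl | h
    · simp [mom]
    rw [abs_div, abs_of_pos h, div_le_iff₀' h]
    simpa using abs_mom_le hγ 1 hρ
  rw [kTwo]
  refine (abs_sub _ _).trans ?_
  linarith [abs_add_le c (mom γ 0 ρ)]

theorem abs_kThree_le (hγ : Continuous γ) (c : ℝ) {R : ℝ} (hρ : 0 ≤ ρ) (hR : ρ ≤ R) :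
    |kThree c γ ρ| ≤ |c| + 2 * (R * mom (fun s => |γ s|) 0 R) := by
  have hm := mom_mono hγ.abs (fun _ => abs_nonneg _) hρ hR
  have hm0 := mom_nonneg (fun s => abs_nonneg (γ s)) hρ
  have hmR : ρ * mom (fun s => |γ s|) 0 ρ ≤ R * mom (fun s => |γ s|) 0 R :=
    mul_le_mul hR hm hm0 (hρ.trans hR)
  have h0 : |ρ * mom γ 0 ρ| ≤ ρ * mom (fun s => |γ s|) 0 ρ := by
    rw [abs_mul, abs_of_nonneg hρ]
    gcongr
    simpa using abs_mom_le hγ 0 hρ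
  have h1 : |2 * mom γ 1 ρ| ≤ 2 * (ρ * mom (fun s => |γ s|) 0 ρ) := by
    rw [abs_mul, abs_two]
    gcongr
    simpa using abs_mom_le hγ 1 hρ
  have h2 : |mom γ 2 ρ / ρ| ≤ ρ * mom (fun s => |γ s|) 0 ρ := by
    rcases hρ.eq_or_lt with rfl | h
    · simp
    rw [abs_div, abs_of_pos h, div_le_iff₀ h]
    refine (abs_mom_le hγ 2 hρ).trans (le_of_eq ?_)
    ring
  rw [kThree]
  refine (abs_add_le _ _).trans ?_
  rw [abs_div, abs_two]
  have h3 := abs_add_le (ρ * mom γ 0 ρ - 2 * mom γ 1 ρ) (mom γ 2 ρ / ρ)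
  have h4 := abs_sub (ρ * mom γ 0 ρ) (2 * mom γ 1 ρ)
  linarith

theorem abs_pThree_le (hγ : Continuous γ) (hρ : 0 ≤ ρ) : |pThree γ ρ| ≤ avg γ ρ := by
  rcases hρ.eq_or_lt with rfl | h
  · simp [avg, pThree]
  have h1 := abs_mom_div_le hγ 0 h
  have h2 := abs_mom_div_le hγ 2 h
  rw [pThree, abs_div, abs_two]
  have h3 := abs_sub (mom γ 0 ρ / ρ) (mom γ 2 ρ / ρ ^ 3)
  rw [abs_div, abs_div, abs_of_pos h, abs_of_pos (pow_pos h 3)] at h3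
  simp only [zero_add, pow_one] at h1
  linarith

theorem abs_rThree_le (hγ : Continuous γ) (hρ : 0 ≤ ρ) :
    |rThree γ ρ| * ρ ^ 2 ≤ 2 * avg γ ρ := by
  rcases hρ.eq_or_lt with rfl | h
  · simp [avg]
  have h1 := abs_mom_div_le hγ 0 h
  have h2 := abs_mom_div_le hγ 2 h
  have e : |rThree γ ρ| * ρ ^ 2 = |3 * (mom γ 2 ρ / ρ ^ 3) - mom γ 0 ρ / ρ| / 2 := by
    have : 3 * (mom γ 2 ρ / ρ ^ 3) - mom γ 0 ρ / ρ = 2 * (rThree γ ρ * ρ ^ 2) := by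
      rw [rThree]; field_simp
    rw [this, abs_mul, abs_mul, abs_of_pos (pow_pos h 2), abs_two]
    ring
  rw [e]
  have h3 := abs_sub (3 * (mom γ 2 ρ / ρ ^ 3)) (mom γ 0 ρ / ρ)
  rw [abs_mul, abs_div, abs_div, abs_of_pos h, abs_of_pos (pow_pos h 3),
    abs_of_pos (by norm_num : (0 : ℝ) < 3)] at h3
  simp only [zero_add, pow_one] at h1
  linarith

theorem abs_tThree_le (hγ : Continuous γ) (hρ : 0 ≤ ρ) :
    |tThree γ ρ| * ρ ^ 4 ≤ |γ ρ| + 9 * avg γ ρ := by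
  rcases hρ.eq_or_lt with rfl | h
  · simp [avg]
  have h1 := abs_mom_div_le hγ 0 h
  have h2 := abs_mom_div_le hγ 2 h
  have e : |tThree γ ρ| * ρ ^ 4 =
      |2 * γ ρ + 3 * (mom γ 0 ρ / ρ) - 15 * (mom γ 2 ρ / ρ ^ 3)| / 2 := by
    have : 2 * γ ρ + 3 * (mom γ 0 ρ / ρ) - 15 * (mom γ 2 ρ / ρ ^ 3) = 2 * (tThree γ ρ * ρ ^ 4) := by
      rw [tThree]; field_simp
    rw [this, abs_mul, abs_mul, abs_of_pos (pow_pos h 4), abs_two]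
    ring
  rw [e]
  have h3 := abs_sub (2 * γ ρ + 3 * (mom γ 0 ρ / ρ)) (15 * (mom γ 2 ρ / ρ ^ 3))
  have h4 := abs_add_le (2 * γ ρ) (3 * (mom γ 0 ρ / ρ))
  rw [abs_mul 15, abs_div, abs_of_pos (pow_pos h 3), abs_of_pos (by norm_num : (0 : ℝ) < 15)] at h3
  rw [abs_mul, abs_two, abs_mul, abs_div, abs_of_pos h, abs_of_pos (by norm_num : (0 : ℝ) < 3)] at h4
  simp only [zero_add, pow_one] at h1
  linarith

end profiles

/-! ### Sobolev estimates for the composition -/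

section sobolev

variable {γ : ℝ → ℝ} {δ a b c R D S S' : ℝ} {v v₁ v₂ v₃ : ℝ → ℂ}

theorem integral_norm_le_l2 (hab : a < b) (hu : MemLp v 2 (vol a b)) :
    ∫ x in a..b, ‖v x‖ ≤ √(b - a) * l2 a b v := by
  have h0 : 0 < b - a := sub_pos.2 hab
  refine abs_le_of_sq_le_sq' ?_ (mul_nonneg (Real.sqrt_nonneg _) (l2_nonneg _ _ _)) |>.2
  rw [mul_pow, Real.sq_sqrt h0.le, l2_sq hab.le hu]
  exact sq_integral_norm_le hab (hu.intervalIntegrable_of_vol hab.le one_le_two)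
    (integrable_norm_sq hab.le hu)

theorem integral_pow_energy_le (hab : a < b) (hγ : Continuous γ) (hδ : 0 < δ)
    (hz : ∀ s ≤ δ, γ s = 0) (hv : ∀ x, HasDerivAt v (v₁ x) x) (hv₁ : ∀ x, HasDerivAt v₁ (v₂ x) x)
    (hv₂ : Continuous v₂) (hper : v a = v b) (hper₁ : v₁ a = v₁ b)
    (hR : ∀ x ∈ Icc a b, ‖v x‖ ≤ R) (hD : ∀ x ∈ Icc a b, ‖v₁ x‖ ≤ D) (hS : l2 a b v₂ ≤ S) (j : ℕ) :
    ∫ x in a..b, (‖v₁ x‖ ^ 2) ^ j * energy (fun s => γ s ^ 2) (v x) (v₁ x) ≤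
      3 * mom (fun s => γ s ^ 2) 0 R * (2 * j + 1) * ((D ^ 2) ^ j * (√(b - a) * S)) := by
  have cv₁ : Continuous v₁ := continuous_iff_continuousAt.2 fun x => (hv₁ x).continuousAt
  have hR0 : 0 ≤ R := (norm_nonneg _).trans (hR a (left_mem_Icc.2 hab.le))
  have hD0 : 0 ≤ D := (norm_nonneg _).trans (hD a (left_mem_Icc.2 hab.le))
  refine (integral_energy_le (φ := fun s => γ s ^ 2) (hγ.pow 2) (fun s => sq_nonneg _) hδ
    (fun s hs => by rw [hz s hs, zero_pow two_ne_zero]) hab.le hv hv₁ hv₂ hper hper₁ hR j).trans ?_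
  have hm := mom_nonneg (γ := fun s => γ s ^ 2) (fun s => sq_nonneg (γ s)) hR0
  refine mul_le_mul_of_nonneg_left ?_ (by positivity)
  calc ∫ x in a..b, (‖v₁ x‖ ^ 2) ^ j * ‖v₂ x‖ ≤ ∫ x in a..b, (D ^ 2) ^ j * ‖v₂ x‖ := by
        refine intervalIntegral.integral_mono_on hab.le
          (Continuous.intervalIntegrable (((cv₁.norm.pow 2).pow j).mul hv₂.norm) _ _)
          ((continuous_const.mul hv₂.norm).intervalIntegrable _ _) fun x hx => ?_
        gcongr
        exact hD x hx
    _ = (D ^ 2) ^ j * ∫ x in a..b, ‖v₂ x‖ := intervalIntegral.integral_const_mul _ _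
    _ ≤ _ := by
        gcongr
        exact (integral_norm_le_l2 hab (memLp_of_continuousOn hv₂.continuousOn 2)).trans (by gcongr)

/-- The second derivative is dominated pointwise by |γ|(|v|')² + 6A|v'|² plus a multiple of |v''|.
After squaring, one factor |v'|² becomes the weight j = 1 and the rest is the energy of γ². The
bound sees γ only through its L¹ and L² norms on [0, R]. -/
theorem exists_hPer_kTwo (hab : a < b) (hγ : Continuous γ) (hδ : 0 < δ) (hz : ∀ s ≤ δ, γ s = 0)
    (c : ℝ) (hv : ∀ x, HasDerivAt v (v₁ x) x) (hv₁ : ∀ x, HasDerivAt v₁ (v₂ x) x)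
    (hv₂ : Continuous v₂) (hper : v a = v b) (hper₁ : v₁ a = v₁ b)
    (hR : ∀ x ∈ Icc a b, ‖v x‖ ≤ R) (hD : ∀ x ∈ Icc a b, ‖v₁ x‖ ≤ D) (hS : l2 a b v₂ ≤ S) :
    ∃ w, HPer a b 2 w ∧ (w 0 = fun x => (kTwo c γ ‖v x‖ : ℂ) * v x) ∧
      l2 a b (w 2) ^ 2 ≤ 1944 * mom (fun s => γ s ^ 2) 0 R * D ^ 2 * √(b - a) * S +
        3 * (|c| + 3 * mom (fun s => |γ s|) 0 R) ^ 2 * S ^ 2 := by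
  have cv : Continuous v := continuous_iff_continuousAt.2 fun x => (hv x).continuousAt
  have cv₁ : Continuous v₁ := continuous_iff_continuousAt.2 fun x => (hv₁ x).continuousAt
  have hR0 : 0 ≤ R := (norm_nonneg _).trans (hR a (left_mem_Icc.2 hab.le))
  have zk : ∀ s < δ, kTwo c γ s = c := fun s hs => by simp [kTwo, mom_eq_zero hδ hz _ hs]
  have zp : ∀ s < δ, pTwo γ s = 0 := fun s hs => by simp [pTwo, mom_eq_zero hδ hz _ hs]
  have zr : ∀ s < δ, rTwo γ s = 0 := fun s hs => by
    simp [rTwo, mom_eq_zero hδ hz _ hs, hz s hs.le]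
  have cr : ∀ s > 0, ContinuousAt (rTwo γ) s := fun s hs =>
    (hγ.continuousAt.div (continuousAt_id.pow 3) (pow_pos hs 3).ne').sub
      (((hasDerivAt_mom hγ 1 s).continuousAt.const_mul 3).div (continuousAt_id.pow 5)
        (pow_pos hs 5).ne')
  have d0 : ∀ x, HasDerivAt (fun x => (kTwo c γ ‖v x‖ : ℂ) * v x)
      (comp₁ (kTwo c γ) (pTwo γ) v v₁ x) x := fun x =>
    hasDerivAt_comp₀ hδ zk zp (fun s hs => hasDerivAt_kTwo hγ c hs) (hv x)
  have d1 : ∀ x, HasDerivAt (comp₁ (kTwo c γ) (pTwo γ) v v₁)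
      (comp₂ (kTwo c γ) (pTwo γ) (rTwo γ) v v₁ v₂ x) x := fun x =>
    hasDerivAt_comp₁ hδ zk zp zr (fun s hs => hasDerivAt_kTwo hγ c hs)
      (fun s hs => hasDerivAt_pTwo hγ hs) (hv x) (hv₁ x)
  have c2 : Continuous (comp₂ (kTwo c γ) (pTwo γ) (rTwo γ) v v₁ v₂) :=
    continuous_comp₂ hδ zk zp zr (fun s hs => (hasDerivAt_kTwo hγ c hs).continuousAt)
      (fun s hs => (hasDerivAt_pTwo hγ hs).continuousAt) cr cv cv₁ hv₂
  have c1 : Continuous (comp₁ (kTwo c γ) (pTwo γ) v v₁) :=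
    continuous_iff_continuousAt.2 fun x => (d1 x).continuousAt
  have c0 : Continuous (fun x => (kTwo c γ ‖v x‖ : ℂ) * v x) :=
    continuous_iff_continuousAt.2 fun x => (d0 x).continuousAt
  refine ⟨fun k => if k = 0 then fun x => (kTwo c γ ‖v x‖ : ℂ) * v x else
    if k = 1 then comp₁ (kTwo c γ) (pTwo γ) v v₁ else
      comp₂ (kTwo c γ) (pTwo γ) (rTwo γ) v v₁ v₂, ⟨?_, ?_, ?_⟩, rfl, ?_⟩
  · intro k hk
    interval_cases k
    · exact IsPrim.of_hasDerivAt d0 c1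
    · exact IsPrim.of_hasDerivAt d1 c2
  · intro k hk
    interval_cases k
    · simp [hper]
    · simp [comp₁, hper, hper₁]
  · intro k hk
    interval_cases k
    · exact memLp_of_continuousOn c0.continuousOn 2
    · exact memLp_of_continuousOn c1.continuousOn 2
    · exact memLp_of_continuousOn c2.continuousOn 2
  · simp only [OfNat.ofNat_ne_zero, if_false, OfNat.ofNat_ne_one]
    rw [l2_sq hab.le (memLp_of_continuousOn c2.continuousOn 2)]
    set Γ := mom (fun s => |γ s|) 0 R
    have hΓ0 : 0 ≤ Γ := mom_nonneg (fun s => abs_nonneg _) hR0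
    have ce : Continuous fun x => (‖v₁ x‖ ^ 2) ^ 1 * energy (fun s => γ s ^ 2) (v x) (v₁ x) :=
      ((cv₁.norm.pow 2).pow 1).mul (continuous_energy (φ := fun s => γ s ^ 2) (hγ.pow 2) hδ
        (fun s hs => by rw [hz s hs, zero_pow two_ne_zero]) cv cv₁)
    -- The constant is 216 = 3 · 6² · 2: three summands, the coefficient 6, and the factor 2 of
    -- `avg_sq_le`. The energy bound with j = 1 contributes 3 · 3, which gives 1944.
    have hpt : ∀ x ∈ Icc a b, ‖comp₂ (kTwo c γ) (pTwo γ) (rTwo γ) v v₁ v₂ x‖ ^ 2 ≤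
        216 * ((‖v₁ x‖ ^ 2) ^ 1 * energy (fun s => γ s ^ 2) (v x) (v₁ x)) +
          3 * (|c| + 3 * Γ) ^ 2 * ‖v₂ x‖ ^ 2 := by
      intro x hx
      have hn := norm_nonneg (v x)
      have h1 := norm_comp₂_le (z := v x) (z₁ := v₁ x) (z₂ := v₂ x) (avg_nonneg γ hn)
        (mul_avg_le hγ hn (hR x hx)) (abs_kTwo_le hγ c hn (hR x hx)) (abs_pTwo_le hγ hn)
        (abs_rTwo_le hγ hn)
      have h2 := avg_sq_le hγ hn
      have h3 := abs_inner_div_le (v x) (v₁ x)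
      rw [energy]
      refine (pow_le_pow_left₀ (norm_nonneg _) h1 2).trans ?_
      generalize inner ℝ (v x) (v₁ x) / ‖v x‖ = u at *
      generalize halfMom (fun s => γ s ^ 2) ‖v x‖ / (‖v x‖ * √‖v x‖) = n at *
      have h4 : u ^ 2 ≤ ‖v₁ x‖ ^ 2 := by
        rw [← sq_abs]; exact pow_le_pow_left₀ (abs_nonneg _) h3 2
      have h5 : ∀ p q r : ℝ, (p + q + r) ^ 2 ≤ 3 * (p ^ 2 + q ^ 2 + r ^ 2) := fun p q r => by
        nlinarith [sq_nonneg (p - q), sq_nonneg (q - r), sq_nonneg (p - r)]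
      refine (h5 _ _ _).trans ?_
      have h6 : (|γ ‖v x‖| * u ^ 2) ^ 2 ≤ γ ‖v x‖ ^ 2 * u ^ 2 * ‖v₁ x‖ ^ 2 := by
        calc (|γ ‖v x‖| * u ^ 2) ^ 2 = γ ‖v x‖ ^ 2 * u ^ 2 * u ^ 2 := by
              rw [mul_pow, sq_abs]; ring
          _ ≤ _ := by gcongr
      have h7 : (6 * avg γ ‖v x‖ * ‖v₁ x‖ ^ 2) ^ 2 ≤ 36 * (2 * n) * (‖v₁ x‖ ^ 2) ^ 2 := by
        rw [mul_pow, mul_pow]; norm_num; gcongr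
      have h8 : 0 ≤ γ ‖v x‖ ^ 2 * u ^ 2 * ‖v₁ x‖ ^ 2 := by positivity
      have e : |c| + 2 * Γ + Γ = |c| + 3 * Γ := by ring
      rw [e]
      rw [pow_one]
      nlinarith
    have i2 : IntervalIntegrable (fun x => 3 * (|c| + 3 * Γ) ^ 2 * ‖v₂ x‖ ^ 2) volume a b :=
      (continuous_const.mul (hv₂.norm.pow 2)).intervalIntegrable _ _
    have h1 := intervalIntegral.integral_mono_on hab.le
      (Continuous.intervalIntegrable (c2.norm.pow 2) (μ := volume) a b)
      (((ce.intervalIntegrable (μ := volume) a b).const_mul 216).add i2) hpt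
    rw [intervalIntegral.integral_add ((ce.intervalIntegrable _ _).const_mul _) i2,
      intervalIntegral.integral_const_mul, intervalIntegral.integral_const_mul,
      ← l2_sq hab.le (memLp_of_continuousOn hv₂.continuousOn 2)] at h1
    have h2 := integral_pow_energy_le hab hγ hδ hz hv hv₁ hv₂ hper hper₁ hR hD hS 1
    have h3 : l2 a b v₂ ^ 2 ≤ S ^ 2 := pow_le_pow_left₀ (l2_nonneg _ _ _) hS 2
    have h4 : 3 * (|c| + 3 * Γ) ^ 2 * l2 a b v₂ ^ 2 ≤ 3 * (|c| + 3 * Γ) ^ 2 * S ^ 2 := by gcongr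
    refine h1.trans ?_
    norm_num at h2 h1 ⊢
    linarith

theorem exists_hPer_kThree (hab : a < b) (hγ : Continuous γ) (hδ : 0 < δ) (hz : ∀ s ≤ δ, γ s = 0)
    (c : ℝ) (hv : ∀ x, HasDerivAt v (v₁ x) x) (hv₁ : ∀ x, HasDerivAt v₁ (v₂ x) x)
    (hv₂ : ∀ x, HasDerivAt v₂ (v₃ x) x) (hv₃ : Continuous v₃) (hper : v a = v b)
    (hper₁ : v₁ a = v₁ b) (hper₂ : v₂ a = v₂ b) (hR : ∀ x ∈ Icc a b, ‖v x‖ ≤ R)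
    (hD : ∀ x ∈ Icc a b, ‖v₁ x‖ ≤ D) (hS : l2 a b v₂ ≤ S) (hS' : l2 a b v₃ ≤ S') :
    ∃ w, HPer a b 3 w ∧ (w 0 = fun x => (kThree c γ ‖v x‖ : ℂ) * v x) ∧
      l2 a b (w 3) ^ 2 ≤ 69120 * mom (fun s => γ s ^ 2) 0 R * D ^ 4 * √(b - a) * S +
        900 * mom (fun s => |γ s|) 0 R ^ 2 * D ^ 2 * S ^ 2 +
        4 * (|c| + 3 * (R * mom (fun s => |γ s|) 0 R)) ^ 2 * S' ^ 2 := by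
  have cv : Continuous v := continuous_iff_continuousAt.2 fun x => (hv x).continuousAt
  have cv₁ : Continuous v₁ := continuous_iff_continuousAt.2 fun x => (hv₁ x).continuousAt
  have cv₂ : Continuous v₂ := continuous_iff_continuousAt.2 fun x => (hv₂ x).continuousAt
  have hR0 : 0 ≤ R := (norm_nonneg _).trans (hR a (left_mem_Icc.2 hab.le))
  have zk : ∀ s < δ, kThree c γ s = c := fun s hs => by simp [kThree, mom_eq_zero hδ hz _ hs]
  have zp : ∀ s < δ, pThree γ s = 0 := fun s hs => by simp [pThree, mom_eq_zero hδ hz _ hs]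
  have zr : ∀ s < δ, rThree γ s = 0 := fun s hs => by simp [rThree, mom_eq_zero hδ hz _ hs]
  have zt : ∀ s < δ, tThree γ s = 0 := fun s hs => by
    simp [tThree, mom_eq_zero hδ hz _ hs, hz s hs.le]
  have ct : ∀ s > 0, ContinuousAt (tThree γ) s := fun s hs =>
    ((((hγ.continuousAt.const_mul 2).div (continuousAt_id.pow 4) (pow_pos hs 4).ne').add
      (((hasDerivAt_mom hγ 0 s).continuousAt.const_mul 3).div (continuousAt_id.pow 5)
        (pow_pos hs 5).ne')).sub
      (((hasDerivAt_mom hγ 2 s).continuousAt.const_mul 15).div (continuousAt_id.pow 7)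
        (pow_pos hs 7).ne')).div_const 2
  have d0 : ∀ x, HasDerivAt (fun x => (kThree c γ ‖v x‖ : ℂ) * v x)
      (comp₁ (kThree c γ) (pThree γ) v v₁ x) x := fun x =>
    hasDerivAt_comp₀ hδ zk zp (fun s hs => hasDerivAt_kThree hγ c hs) (hv x)
  have d1 : ∀ x, HasDerivAt (comp₁ (kThree c γ) (pThree γ) v v₁)
      (comp₂ (kThree c γ) (pThree γ) (rThree γ) v v₁ v₂ x) x := fun x =>
    hasDerivAt_comp₁ hδ zk zp zr (fun s hs => hasDerivAt_kThree hγ c hs)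
      (fun s hs => hasDerivAt_pThree hγ hs) (hv x) (hv₁ x)
  have d2 : ∀ x, HasDerivAt (comp₂ (kThree c γ) (pThree γ) (rThree γ) v v₁ v₂)
      (comp₃ (kThree c γ) (pThree γ) (rThree γ) (tThree γ) v v₁ v₂ v₃ x) x := fun x =>
    hasDerivAt_comp₂ hδ zk zp zr zt (fun s hs => hasDerivAt_kThree hγ c hs)
      (fun s hs => hasDerivAt_pThree hγ hs) (fun s hs => hasDerivAt_rThree hγ hs)
      (hv x) (hv₁ x) (hv₂ x)
  have c3 : Continuous (comp₃ (kThree c γ) (pThree γ) (rThree γ) (tThree γ) v v₁ v₂ v₃) :=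
    continuous_comp₃ hδ zk zp zr zt (fun s hs => (hasDerivAt_kThree hγ c hs).continuousAt)
      (fun s hs => (hasDerivAt_pThree hγ hs).continuousAt)
      (fun s hs => (hasDerivAt_rThree hγ hs).continuousAt) ct cv cv₁ cv₂ hv₃
  have c2 : Continuous (comp₂ (kThree c γ) (pThree γ) (rThree γ) v v₁ v₂) :=
    continuous_iff_continuousAt.2 fun x => (d2 x).continuousAt
  have c1 : Continuous (comp₁ (kThree c γ) (pThree γ) v v₁) :=
    continuous_iff_continuousAt.2 fun x => (d1 x).continuousAt
  have c0 : Continuous (fun x => (kThree c γ ‖v x‖ : ℂ) * v x) :=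
    continuous_iff_continuousAt.2 fun x => (d0 x).continuousAt
  refine ⟨fun k => if k = 0 then fun x => (kThree c γ ‖v x‖ : ℂ) * v x else
    if k = 1 then comp₁ (kThree c γ) (pThree γ) v v₁ else
      if k = 2 then comp₂ (kThree c γ) (pThree γ) (rThree γ) v v₁ v₂ else
        comp₃ (kThree c γ) (pThree γ) (rThree γ) (tThree γ) v v₁ v₂ v₃, ⟨?_, ?_, ?_⟩, rfl, ?_⟩
  · intro k hk
    interval_cases k
    · exact IsPrim.of_hasDerivAt d0 c1
    · exact IsPrim.of_hasDerivAt d1 c2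
    · exact IsPrim.of_hasDerivAt d2 c3
  · intro k hk
    interval_cases k
    · simp [hper]
    · simp [comp₁, hper, hper₁]
    · simp [comp₂, hper, hper₁, hper₂]
  · intro k hk
    interval_cases k
    · exact memLp_of_continuousOn c0.continuousOn 2
    · exact memLp_of_continuousOn c1.continuousOn 2
    · exact memLp_of_continuousOn c2.continuousOn 2
    · exact memLp_of_continuousOn c3.continuousOn 2
  · simp only [OfNat.ofNat_ne_zero, if_false, OfNat.ofNat_ne_one, Nat.reduceEqDiff]
    rw [l2_sq hab.le (memLp_of_continuousOn c3.continuousOn 2)]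
    set Γ := mom (fun s => |γ s|) 0 R
    have hΓ0 : 0 ≤ Γ := mom_nonneg (fun s => abs_nonneg _) hR0
    have ce : Continuous fun x => (‖v₁ x‖ ^ 2) ^ 2 * energy (fun s => γ s ^ 2) (v x) (v₁ x) :=
      ((cv₁.norm.pow 2).pow 2).mul (continuous_energy (φ := fun s => γ s ^ 2) (hγ.pow 2) hδ
        (fun s hs => by rw [hz s hs, zero_pow two_ne_zero]) cv cv₁)
    -- Now 4608 = 4 · 24² · 2 and 900 = 4 · 15². Two factors |v'|² are left over as weight, and the
    -- energy bound with j = 2 contributes 3 · 5, which gives 69120.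
    have hpt : ∀ x ∈ Icc a b, ‖comp₃ (kThree c γ) (pThree γ) (rThree γ) (tThree γ) v v₁ v₂ v₃ x‖ ^ 2 ≤
        4608 * ((‖v₁ x‖ ^ 2) ^ 2 * energy (fun s => γ s ^ 2) (v x) (v₁ x)) +
          (900 * Γ ^ 2 * D ^ 2 * ‖v₂ x‖ ^ 2 + 4 * (|c| + 3 * (R * Γ)) ^ 2 * ‖v₃ x‖ ^ 2) := by
      intro x hx
      have hn := norm_nonneg (v x)
      have h1 := norm_comp₃_le (z := v x) (z₁ := v₁ x) (z₂ := v₂ x) (z₃ := v₃ x) (avg_nonneg γ hn)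
        (mul_avg_le hγ hn (hR x hx)) (hR x hx) (abs_kThree_le hγ c hn (hR x hx))
        (abs_pThree_le hγ hn) (abs_rThree_le hγ hn) (abs_tThree_le hγ hn)
      have h2 := avg_sq_le hγ hn
      have h3 := abs_inner_div_le (v x) (v₁ x)
      have hDx := hD x hx
      rw [energy]
      refine (pow_le_pow_left₀ (norm_nonneg _) h1 2).trans ?_
      generalize inner ℝ (v x) (v₁ x) / ‖v x‖ = u at *
      generalize halfMom (fun s => γ s ^ 2) ‖v x‖ / (‖v x‖ * √‖v x‖) = n at *
      have h5 : ∀ p q r s : ℝ, (p + q + r + s) ^ 2 ≤ 4 * (p ^ 2 + q ^ 2 + r ^ 2 + s ^ 2) :=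
        fun p q r s => by
          nlinarith [sq_nonneg (p - q), sq_nonneg (q - r), sq_nonneg (p - r), sq_nonneg (p - s),
            sq_nonneg (q - s), sq_nonneg (r - s)]
      refine (h5 _ _ _ _).trans ?_
      have h6 : (|γ ‖v x‖| * |u| ^ 3) ^ 2 ≤ (‖v₁ x‖ ^ 2) ^ 2 * (γ ‖v x‖ ^ 2 * u ^ 2) := by
        calc (|γ ‖v x‖| * |u| ^ 3) ^ 2 = (|u| ^ 2) ^ 2 * (γ ‖v x‖ ^ 2 * u ^ 2) := by
              rw [mul_pow, sq_abs, sq_abs, ← pow_mul, mul_comm 3 2, pow_mul, sq_abs]; ring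
          _ ≤ _ := by gcongr
      have h7 : (24 * avg γ ‖v x‖ * ‖v₁ x‖ ^ 3) ^ 2 ≤ 576 * ((‖v₁ x‖ ^ 2) ^ 2 * ((2 * n) * ‖v₁ x‖ ^ 2)) := by
        calc _ = 576 * ((‖v₁ x‖ ^ 2) ^ 2 * (avg γ ‖v x‖ ^ 2 * ‖v₁ x‖ ^ 2)) := by ring
          _ ≤ _ := by gcongr
      have h8 : (15 * Γ * (‖v₁ x‖ * ‖v₂ x‖)) ^ 2 ≤ 225 * Γ ^ 2 * D ^ 2 * ‖v₂ x‖ ^ 2 := by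
        calc _ = 225 * Γ ^ 2 * ‖v₁ x‖ ^ 2 * ‖v₂ x‖ ^ 2 := by ring
          _ ≤ _ := by gcongr
      have h9 : 0 ≤ (‖v₁ x‖ ^ 2) ^ 2 * (γ ‖v x‖ ^ 2 * u ^ 2) := by positivity
      have e : |c| + 2 * (R * Γ) + R * Γ = |c| + 3 * (R * Γ) := by ring
      rw [e, mul_pow (|c| + 3 * (R * Γ))]
      linarith
    have i2 : IntervalIntegrable (fun x => 900 * Γ ^ 2 * D ^ 2 * ‖v₂ x‖ ^ 2) volume a b :=
      (continuous_const.mul (cv₂.norm.pow 2)).intervalIntegrable _ _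
    have i3 : IntervalIntegrable (fun x => 4 * (|c| + 3 * (R * Γ)) ^ 2 * ‖v₃ x‖ ^ 2) volume a b :=
      (continuous_const.mul (hv₃.norm.pow 2)).intervalIntegrable _ _
    have h1 := intervalIntegral.integral_mono_on hab.le
      (Continuous.intervalIntegrable (c3.norm.pow 2) (μ := volume) a b)
      (((ce.intervalIntegrable (μ := volume) a b).const_mul 4608).add (i2.add i3)) hpt
    rw [intervalIntegral.integral_add ((ce.intervalIntegrable _ _).const_mul _) (i2.add i3),
      intervalIntegral.integral_add i2 i3, intervalIntegral.integral_const_mul,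
      intervalIntegral.integral_const_mul, intervalIntegral.integral_const_mul,
      ← l2_sq hab.le (memLp_of_continuousOn cv₂.continuousOn 2),
      ← l2_sq hab.le (memLp_of_continuousOn hv₃.continuousOn 2)] at h1
    have h2 := integral_pow_energy_le hab hγ hδ hz hv hv₁ cv₂ hper hper₁ hR hD hS 2
    have h3 : l2 a b v₂ ^ 2 ≤ S ^ 2 := pow_le_pow_left₀ (l2_nonneg _ _ _) hS 2
    have h3' : l2 a b v₃ ^ 2 ≤ S' ^ 2 := pow_le_pow_left₀ (l2_nonneg _ _ _) hS' 2
    have h4 : 900 * Γ ^ 2 * D ^ 2 * l2 a b v₂ ^ 2 ≤ 900 * Γ ^ 2 * D ^ 2 * S ^ 2 := by gcongr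
    have h5 : 4 * (|c| + 3 * (R * Γ)) ^ 2 * l2 a b v₃ ^ 2 ≤
        4 * (|c| + 3 * (R * Γ)) ^ 2 * S' ^ 2 := by gcongr
    refine h1.trans ?_
    norm_num at h2 h1 ⊢
    linarith

end sobolev

/-! ### The nonlinearity -/

section nonlin

variable {a b : ℝ} {f : ℝ → ℝ}

theorem G_zero (f : ℝ → ℝ) : G f 0 = 0 := by simp [G]

theorem AssumptionA.exists_lip (hA : AssumptionA f) (R : ℝ) : ∃ K, 0 ≤ K ∧ ∀ z₁ z₂ : ℂ,
    ‖z₁‖ ≤ R → ‖z₂‖ ≤ R → ‖G f z₁ - G f z₂‖ ≤ K * ‖z₁ - z₂‖ := by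
  obtain ⟨C, hC⟩ := hA
  refine ⟨max (C (max R 1)) 0, le_max_right _ _, fun z₁ z₂ h₁ h₂ => ?_⟩
  refine (hC (max R 1) (lt_max_of_lt_right one_pos) z₁ z₂ (h₁.trans (le_max_left _ _))
    (h₂.trans (le_max_left _ _))).trans ?_
  exact mul_le_mul_of_nonneg_right (le_max_left _ _) (norm_nonneg _)

theorem AssumptionA.continuous (hA : AssumptionA f) : Continuous (G f) := by
  refine continuous_iff_continuousAt.2 fun z => ?_
  obtain ⟨K, hK, hL⟩ := hA.exists_lip (‖z‖ + 1)
  refine (LipschitzOnWith.continuousOn (K := K.toNNReal) (s := Metric.ball 0 (‖z‖ + 1)) ?_).continuousAt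
    (Metric.isOpen_ball.mem_nhds (by simp))
  refine LipschitzOnWith.of_dist_le_mul fun x hx y hy => ?_
  rw [dist_eq_norm, dist_eq_norm, Real.coe_toNNReal _ hK]
  exact hL x y (by simpa using (Metric.mem_ball.1 hx).le) (by simpa using (Metric.mem_ball.1 hy).le)

theorem IsPrim.hasDerivAt {u g : ℝ → ℂ} (h : IsPrim a b u g) (hg : ContinuousOn g (Icc a b))
    {x : ℝ} (hx : x ∈ Ioo a b) : HasDerivAt u (g x) x := by
  have hab : a ≤ b := (hx.1.trans hx.2).le
  have hn : Icc a b ∈ 𝓝 x := Icc_mem_nhds hx.1 hx.2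
  have h1 : HasDerivAt (fun y => ∫ t in a..y, g t) (g x) x :=
    intervalIntegral.integral_hasDerivAt_right (h.intble_mono le_rfl hx.1.le hx.2.le)
      ((hg.mono Ioo_subset_Icc_self).stronglyMeasurableAtFilter isOpen_Ioo x hx)
      (hg.continuousAt hn)
  exact (h1.const_add (u a)).congr_of_eventuallyEq (eventually_of_mem hn h.eq)

theorem IsPrim.comp_affine {u g : ℝ → ℂ} {c d x₀ m : ℝ} (hm : 0 < m)
    (h : IsPrim a b u g) (hac : a ≤ x₀ + c / m) (hcd : c ≤ d) (hdb : x₀ + d / m ≤ b) :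
    IsPrim c d (fun r => u (x₀ + r / m)) (fun r => (m : ℂ)⁻¹ * g (x₀ + r / m)) := by
  have hle : ∀ {p q : ℝ}, p ≤ q → x₀ + p / m ≤ x₀ + q / m := fun hpq => by gcongr
  have hi := h.intble_mono hac (hle hcd) hdb
  have e : ∀ r, x₀ + r / m = x₀ + m⁻¹ * r := fun r => by rw [div_eq_inv_mul]
  have hi' : IntervalIntegrable (fun r => g (x₀ + r / m)) volume c d := by
    have := (hi.comp_add_left x₀).comp_mul_left (c := m⁻¹) 
    simp only [add_sub_cancel_left, div_inv_eq_mul] at this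
    rw [div_mul_cancel₀ _ hm.ne', div_mul_cancel₀ _ hm.ne'] at this
    simpa only [e] using this
  refine ⟨hi'.const_mul _, fun r hr => ?_⟩
  rw [intervalIntegral.integral_const_mul]
  have h1 := intervalIntegral.integral_comp_add_mul (a := c) (b := r) g (inv_ne_zero hm.ne') x₀
  simp only [← e] at h1
  rw [h1, inv_inv, Complex.real_smul, ← mul_assoc, inv_mul_cancel₀ (by exact_mod_cast hm.ne'), one_mul]
  exact h.sub_eq hac (hle hr.1) ((hle hr.2).trans hdb)

theorem hPer_of_contDiff {u : ℝ → ℝ} (hu : ContDiff ℝ ∞ u)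
    (hs : tsupport u ⊆ Ioo a b) (m : ℕ) : HPer a b m fun k x => ((iteratedDeriv k u x : ℝ) : ℂ) := by
  have hc : ∀ k, Continuous (iteratedDeriv k u) := fun k =>
    hu.continuous_iteratedDeriv k (by exact_mod_cast le_top)
  have hts : ∀ k, tsupport (iteratedDeriv k u) ⊆ tsupport u := by
    intro k
    induction k with
    | zero => simp
    | succ k ih => rw [iteratedDeriv_succ]; exact tsupport_deriv_subset.trans ih
  have h0 : ∀ k x, x ∉ Ioo a b → iteratedDeriv k u x = 0 := fun k x hx =>
    image_eq_zero_of_notMem_tsupport fun h => hx (hs (hts k h))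
  refine ⟨fun k _ => IsPrim.of_hasDerivAt (fun x => ?_)
    (Complex.continuous_ofReal.comp (hc (k + 1))), fun k _ => ?_, fun k _ =>
    memLp_of_continuousOn (Complex.continuous_ofReal.comp (hc k)).continuousOn 2⟩
  · rw [iteratedDeriv_succ]
    refine HasDerivAt.ofReal_comp (DifferentiableAt.hasDerivAt ?_)
    exact (hu.differentiable_iteratedDeriv k (by exact_mod_cast WithTop.coe_lt_top _)) x
  · rw [h0 k a (by simp), h0 k b (by simp)]

/-- The chain of derivatives of `g(r) = f(r²) r` provided by the acting condition. -/
theorem AssumptionC.exists_chain (hab : a < b) (hA : AssumptionA f) {α : ℕ} (hα : 0 < α)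
    (hC : AssumptionC a b α f) {R : ℝ} (hR : 0 < R) : ∃ W : ℕ → ℝ → ℂ,
      (∀ k < α, IsPrim (-R) R (W k) (W (k + 1))) ∧
      (∀ r ∈ Icc (-R) R, W 0 r = ((f (r ^ 2) * r : ℝ) : ℂ)) ∧ MemLp (W α) 2 (vol (-R) R) := by
  -- This slope maps the middle half of (a, b), where the cutoff equals 1, onto [-R, R]. There the
  -- test function is a linear coordinate, and (C) speaks directly about r ↦ f(r²)r.
  set m := 4 * R / (b - a) with hm
  have h0 : 0 < b - a := sub_pos.2 hab
  have hm0 : 0 < m := by positivity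
  obtain ⟨B, hBi, hBo⟩ : ∃ B : ContDiffBump ((a + b) / 2), B.rIn = (b - a) / 4 ∧
      B.rOut = (b - a) * (3 / 8) := ⟨⟨(b - a) / 4, (b - a) * (3 / 8), by linarith, by linarith⟩, rfl, rfl⟩
  set u : ℝ → ℝ := fun x => B x * (m * (x - (a + b) / 2)) with hu
  have hud : ContDiff ℝ ∞ u := B.contDiff.mul (contDiff_const.mul (contDiff_id.sub contDiff_const))
  have hus : tsupport u ⊆ Ioo a b := by
    refine tsupport_mul_subset_left.trans ?_
    rw [B.tsupport_eq, hBo]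
    intro x hx
    rw [Metric.mem_closedBall, Real.dist_eq, abs_le] at hx
    constructor <;> linarith [hx.1, hx.2]
  have hP := hPer_of_contDiff hud hus α
  have hmem := hC _ (hP.memHper hab.le)
  have hcont : Continuous fun x => G f ((iteratedDeriv 0 u x : ℝ) : ℂ) := by
    simp only [iteratedDeriv_zero]
    exact hA.continuous.comp (Complex.continuous_ofReal.comp hud.continuous)
  obtain ⟨w, hw, hw0⟩ := hmem.exists_hPer_eq hab hα hcont.continuousOn
  have hl : a ≤ (a + b) / 2 + -R / m := by
    rw [hm]; field_simp; linarith
  have hr : (a + b) / 2 + R / m ≤ b := by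
    rw [hm]; field_simp; linarith
  have hPr : ∀ k < α, IsPrim (-R) R (fun r => ((m : ℂ)⁻¹) ^ k * w k ((a + b) / 2 + r / m))
      (fun r => ((m : ℂ)⁻¹) ^ (k + 1) * w (k + 1) ((a + b) / 2 + r / m)) := by
    intro k hk
    have := ((hw.prim k hk).comp_affine hm0 hl (by linarith : -R ≤ R) hr).const_mul (((m : ℂ)⁻¹) ^ k)
    refine ⟨?_, fun r hr => ?_⟩
    · simpa only [pow_succ, mul_assoc] using this.intble
    · simpa only [pow_succ, mul_assoc] using this.eq r hr
  refine ⟨fun k r => ((m : ℂ)⁻¹) ^ k * w k ((a + b) / 2 + r / m), hPr, fun r hr' => ?_, ?_⟩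
  · have hx : B ((a + b) / 2 + r / m) = 1 := by
      refine B.one_of_mem_closedBall ?_
      rw [Metric.mem_closedBall, Real.dist_eq, hBi, add_sub_cancel_left, abs_div, abs_of_pos hm0,
        div_le_iff₀ hm0, hm]
      have : |r| ≤ R := abs_le.2 hr'
      field_simp
      linarith
    have hur : u ((a + b) / 2 + r / m) = r := by
      simp only [hu, hx]
      field_simp
      ring
    simp only [pow_zero, one_mul, hw0, iteratedDeriv_zero, hur, G, Complex.norm_real]
    simp
  · have hm' : AEStronglyMeasurable (fun r => ((m : ℂ)⁻¹) ^ α * w α ((a + b) / 2 + r / m))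
        (vol (-R) R) := by
      obtain ⟨k, rfl⟩ := Nat.exists_eq_succ_of_ne_zero hα.ne'
      exact ((integrableOn_vol_iff (by linarith)).2 (hPr k (Nat.lt_succ_self k)).intble).aestronglyMeasurable
    rw [memLp_two_iff_integrable_sq_norm hm']
    have h1 : IntervalIntegrable (fun x => ‖w α x‖ ^ 2) volume a b :=
      integrable_norm_sq hab.le (hw.memLp α le_rfl)
    have h2 := h1.mono_set (c := (a + b) / 2 + -R / m) (d := (a + b) / 2 + R / m) (by
      rw [uIcc_of_le hab.le, uIcc_of_le (by gcongr; linarith)]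
      exact Icc_subset_Icc hl hr)
    have h3 := (h2.comp_add_left ((a + b) / 2)).comp_mul_left (c := m⁻¹)
    simp only [add_sub_cancel_left, div_inv_eq_mul] at h3
    rw [div_mul_cancel₀ _ hm0.ne', div_mul_cancel₀ _ hm0.ne'] at h3
    refine (intervalIntegrable_iff_integrableOn_Ioo_of_le (by linarith)).1
      ((h3.const_mul (‖((m : ℂ)⁻¹) ^ α‖ ^ 2)).congr ?_)
    intro r _
    simp only [norm_mul, mul_pow, div_eq_inv_mul]

end nonlin

/-! ### Radial profiles of the nonlinearity -/

section radial

variable {a b : ℝ} {f : ℝ → ℝ} {γ γ' : ℝ → ℝ} {R : ℝ}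

theorem memLp_ofReal_sub (hγ : MemLp (fun s => (γ s : ℂ)) 2 (vol a b))
    (hγ' : MemLp (fun s => (γ' s : ℂ)) 2 (vol a b)) :
    MemLp (fun s => ((γ s - γ' s : ℝ) : ℂ)) 2 (vol a b) := by
  simp only [Complex.ofReal_sub]
  exact hγ.sub hγ'

/-- Continuous functions are dense in L², and switching one off near 0 costs little since it is
bounded. Vanishing near 0 makes the associated radial maps linear there, hence differentiable along
any curve. -/
theorem exists_continuous_approx (hR : 0 < R) (hγ : MemLp (fun s => (γ s : ℂ)) 2 (vol 0 R))
    {ε : ℝ} (hε : 0 < ε) : ∃ γ' : ℝ → ℝ, Continuous γ' ∧ (∃ δ > 0, ∀ s ≤ δ, γ' s = 0) ∧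
      l2 0 R (fun s => ((γ s - γ' s : ℝ) : ℂ)) ≤ ε := by
  have hγr : MemLp γ 2 (vol 0 R) := hγ.re
  have hreg : (vol 0 R).Regular := by unfold vol; infer_instance
  obtain ⟨g, -, hg, hgc, -⟩ := hγr.exists_hasCompactSupport_eLpNorm_sub_le ENNReal.ofNat_ne_top
    (ε := ENNReal.ofReal (ε / 2)) (by simpa using hε)
  obtain ⟨B, hB⟩ := (isCompact_Icc (a := (0 : ℝ)) (b := R)).exists_bound_of_continuousOn
    hgc.continuousOn
  have hB0 : 0 ≤ B := (norm_nonneg _).trans (hB 0 (left_mem_Icc.2 hR.le))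
  -- The cutoff rises linearly on [δ, 2δ]; what it removes lives on [0, 2δ], is at most B there, and
  -- so has squared norm at most 2δB².
  obtain ⟨δ, hδ0, hδR, hδB⟩ : ∃ δ > 0, 2 * δ ≤ R ∧ 2 * δ * B ^ 2 ≤ (ε / 2) ^ 2 := by
    refine ⟨min (R / 2) ((ε / 2) ^ 2 / (2 * (B ^ 2 + 1))), by positivity, ?_, ?_⟩
    · linarith [min_le_left (R / 2) ((ε / 2) ^ 2 / (2 * (B ^ 2 + 1)))]
    · have h := min_le_right (R / 2) ((ε / 2) ^ 2 / (2 * (B ^ 2 + 1)))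
      rw [le_div_iff₀ (by positivity)] at h
      have : 0 < min (R / 2) ((ε / 2) ^ 2 / (2 * (B ^ 2 + 1))) := by positivity
      nlinarith
  set χ : ℝ → ℝ := fun s => min 1 (max 0 ((s - δ) / δ)) with hχ
  have hχ0 : ∀ s, 0 ≤ χ s := fun s => le_min zero_le_one (le_max_left _ _)
  have hχ1 : ∀ s, χ s ≤ 1 := fun s => min_le_left _ _
  refine ⟨fun s => g s * χ s, by fun_prop, ⟨δ, hδ0, fun s hs => ?_⟩, ?_⟩
  · have : (s - δ) / δ ≤ 0 := div_nonpos_of_nonpos_of_nonneg (by linarith) hδ0.le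
    simp [hχ, max_eq_left this]
  have hgm : MemLp (fun s => (g s : ℂ)) 2 (vol 0 R) :=
    memLp_of_continuousOn (Complex.continuous_ofReal.comp hgc).continuousOn 2
  have hdm : MemLp (fun s => ((g s - g s * χ s : ℝ) : ℂ)) 2 (vol 0 R) :=
    memLp_of_continuousOn (Complex.continuous_ofReal.comp (by fun_prop)).continuousOn 2
  have h1 : l2 0 R (fun s => ((γ s - g s : ℝ) : ℂ)) ≤ ε / 2 := by
    refine l2_le_of_eLpNorm_le (by positivity) (le_trans (le_of_eq ?_) hg)
    exact eLpNorm_congr_norm_ae (Eventually.of_forall fun s => by simp only [Complex.norm_real, Pi.sub_apply])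
  have h2 : l2 0 R (fun s => ((g s - g s * χ s : ℝ) : ℂ)) ≤ ε / 2 := by
    refine abs_le_of_sq_le_sq' ?_ (by positivity) |>.2
    rw [l2_sq hR.le hdm]
    have hi : ∀ p q : ℝ, IntervalIntegrable (fun s => ‖((g s - g s * χ s : ℝ) : ℂ)‖ ^ 2) volume p q :=
      fun p q => Continuous.intervalIntegrable (by fun_prop) _ _
    rw [← intervalIntegral.integral_add_adjacent_intervals (hi 0 (2 * δ)) (hi (2 * δ) R)]
    have e1 : ∫ s in (2 * δ)..R, ‖((g s - g s * χ s : ℝ) : ℂ)‖ ^ 2 = 0 := by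
      refine intervalIntegral.integral_zero_ae (Eventually.of_forall fun s hs => ?_)
      rw [uIoc_of_le hδR] at hs
      have : χ s = 1 := min_eq_left (le_max_of_le_right ((one_le_div hδ0).2 (by linarith [hs.1])))
      simp [this]
    have e2 : ∫ s in (0 : ℝ)..(2 * δ), ‖((g s - g s * χ s : ℝ) : ℂ)‖ ^ 2 ≤
        ∫ s in (0 : ℝ)..(2 * δ), B ^ 2 := by
      refine intervalIntegral.integral_mono_on (by positivity) (hi _ _) (by simp) fun s hs => ?_
      rw [Complex.norm_real, ← mul_one_sub, norm_mul]
      have hχs : ‖1 - χ s‖ ≤ 1 := by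
        rw [Real.norm_eq_abs, abs_le]; constructor <;> linarith [hχ0 s, hχ1 s]
      have := hB s ⟨hs.1, hs.2.trans hδR⟩
      exact pow_le_pow_left₀ (by positivity)
        ((mul_le_of_le_one_right (norm_nonneg _) hχs).trans this) 2
    rw [e1, add_zero]
    refine e2.trans ?_
    simpa using hδB
  calc l2 0 R (fun s => ((γ s - g s * χ s : ℝ) : ℂ))
      = l2 0 R (fun s => ((γ s - g s : ℝ) : ℂ) + ((g s - g s * χ s : ℝ) : ℂ)) := by
        congr 1; ext s; push_cast; ring
    _ ≤ _ := l2_add_le (memLp_ofReal_sub hγ hgm) hdm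
    _ ≤ ε := by linarith

theorem abs_mom_sub_le (hR : 0 < R) (hγ : MemLp (fun s => (γ s : ℂ)) 2 (vol 0 R))
    (hγ' : MemLp (fun s => (γ' s : ℂ)) 2 (vol 0 R)) (i : ℕ) {ρ : ℝ} (hρ : ρ ∈ Icc 0 R) :
    |mom γ i ρ - mom γ' i ρ| ≤ R ^ i * (√R * l2 0 R (fun s => ((γ s - γ' s : ℝ) : ℂ))) := by
  have hm : MemLp (fun s => ((γ s - γ' s : ℝ) : ℂ)) 2 (vol 0 R) :=
    memLp_ofReal_sub hγ hγ'
  have hre : ∀ {γ : ℝ → ℝ}, MemLp (fun s => (γ s : ℂ)) 2 (vol 0 R) →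
      IntervalIntegrable γ volume 0 R := fun h => by
    refine (intervalIntegrable_iff_integrableOn_Ioo_of_le hR.le).2 ?_
    exact (h.integrable one_le_two).re
  have hsub : uIcc 0 ρ ⊆ uIcc 0 R := by
    rw [uIcc_of_le hρ.1, uIcc_of_le hR.le]; exact Icc_subset_Icc le_rfl hρ.2
  have hci : ∀ {γ : ℝ → ℝ}, IntervalIntegrable γ volume 0 R →
      IntervalIntegrable (fun s => s ^ i * γ s) volume 0 ρ := fun h =>
    (h.mono_set hsub).continuousOn_mul (by fun_prop)
  have hd : IntervalIntegrable (fun s => γ s - γ' s) volume 0 R := (hre hγ).sub (hre hγ')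
  rw [mom, mom, ← intervalIntegral.integral_sub (hci (hre hγ)) (hci (hre hγ')), ← Real.norm_eq_abs]
  calc ‖∫ s in (0 : ℝ)..ρ, s ^ i * γ s - s ^ i * γ' s‖
      ≤ ∫ s in (0 : ℝ)..ρ, R ^ i * ‖γ s - γ' s‖ := by
        refine intervalIntegral.norm_integral_le_of_norm_le hρ.1 (Eventually.of_forall fun s hs => ?_)
          ((hd.mono_set hsub).norm.const_mul _)
        rw [← mul_sub, norm_mul, norm_pow, Real.norm_of_nonneg hs.1.le]
        have := hs.1
        have := hs.2.trans hρ.2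
        gcongr
    _ ≤ ∫ s in (0 : ℝ)..R, R ^ i * ‖γ s - γ' s‖ :=
        intervalIntegral.integral_mono_interval le_rfl hρ.1 hρ.2
          (Eventually.of_forall fun s => by positivity) (hd.norm.const_mul _)
    _ ≤ _ := by
        rw [intervalIntegral.integral_const_mul]
        gcongr
        have := integral_norm_le_l2 hR hm
        simpa only [Complex.norm_real, sub_zero] using this

/-- One step of Taylor's formula with integral remainder, by exchanging the order of integration.
Iterating it expresses f(r²)r through moments of its last derivative. -/
theorem IsPrim.integral_sub_pow_mul {u g : ℝ → ℂ} (h : IsPrim 0 R u g) {r : ℝ} (hr : r ∈ Icc 0 R)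
    (k : ℕ) : ∫ s in (0 : ℝ)..r, ((r - s : ℝ) : ℂ) ^ k * u s =
      (r : ℂ) ^ (k + 1) / (k + 1) * u 0 +
        (∫ s in (0 : ℝ)..r, ((r - s : ℝ) : ℂ) ^ (k + 1) * g s) / (k + 1) := by
  have hk : ((k : ℂ) + 1) ≠ 0 := by exact_mod_cast Nat.succ_ne_zero k
  have hi := h.intble_mono le_rfl hr.1 hr.2
  have hp : ∀ s, ∫ x in s..r, ((r - x : ℝ) : ℂ) ^ k = ((r - s : ℝ) : ℂ) ^ (k + 1) / (k + 1) := by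
    intro s
    have := intervalIntegral.integral_comp_sub_left (a := s) (b := r) (fun x : ℝ => x ^ k) r
    simp only [← Complex.ofReal_pow]
    rw [intervalIntegral.integral_ofReal, this, integral_pow]
    simp
  have hpc : Continuous fun x : ℝ => ((r - x : ℝ) : ℂ) ^ k := by fun_prop
  have hcg : ContinuousOn (fun s => ∫ x in (0 : ℝ)..s, g x) (uIcc 0 r) := by
    have := intervalIntegral.continuousOn_primitive_interval' hi left_mem_uIcc
    simpa using this
  calc ∫ s in (0 : ℝ)..r, ((r - s : ℝ) : ℂ) ^ k * u s
      = ∫ s in (0 : ℝ)..r, (((r - s : ℝ) : ℂ) ^ k * u 0 +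
          ((r - s : ℝ) : ℂ) ^ k * ∫ x in (0 : ℝ)..s, g x) := by
        refine intervalIntegral.integral_congr fun s hs => ?_
        rw [uIcc_of_le hr.1] at hs
        rw [h.eq s ⟨hs.1, hs.2.trans hr.2⟩, mul_add]
    _ = _ := by
        have hi2 : IntervalIntegrable (fun s => ((r - s : ℝ) : ℂ) ^ k * ∫ x in (0 : ℝ)..s, g x)
            volume 0 r := (hpc.continuousOn.mul hcg).intervalIntegrable
        rw [intervalIntegral.integral_add ((hpc.intervalIntegrable _ _).mul_const _)
          hi2, intervalIntegral.integral_mul_const, hp,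
          intervalIntegral_swap hr.1 (hpc.intervalIntegrable _ _) hi]
        simp only [hp]
        rw [← intervalIntegral.integral_div]
        simp only [sub_zero, div_mul_eq_mul_div]

theorem mom_re_eq {g : ℝ → ℂ} {r : ℝ} (hg : IntervalIntegrable g volume 0 r) (i : ℕ) :
    ((∫ s in (0 : ℝ)..r, (s : ℂ) ^ i * g s).re) = mom (fun s => (g s).re) i r := by
  have hk : IntervalIntegrable (fun s : ℝ => (s : ℂ) ^ i * g s) volume 0 r :=
    hg.continuousOn_mul (by fun_prop)
  have := Complex.reCLM.intervalIntegral_comp_comm hk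
  simp only [Complex.reCLM_apply] at this
  rw [← this, mom]
  simp only [← Complex.ofReal_pow, Complex.re_ofReal_mul]

/-- `f(r²) r` through its second derivative. -/
theorem exists_profile_two (hab : a < b) (hA : AssumptionA f) (hC : AssumptionC a b 2 f)
    (hR : 0 < R) : ∃ (c : ℝ) (γ : ℝ → ℝ), MemLp (fun s => (γ s : ℂ)) 2 (vol 0 R) ∧
      ∀ r ∈ Ioc 0 R, f (r ^ 2) = kTwo c γ r := by
  obtain ⟨W, hP, hW, hm⟩ := hC.exists_chain hab hA two_pos hR
  have hm0 : MemLp (W 2) 2 (vol 0 R) :=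
    hm.mono_measure (Measure.restrict_mono (Ioo_subset_Ioo (by linarith) le_rfl) le_rfl)
  have h0 := (hP 0 two_pos).mono (by linarith : -R ≤ 0) hR.le le_rfl
  have h1 := (hP 1 one_lt_two).mono (by linarith : -R ≤ 0) hR.le le_rfl
  refine ⟨(W 1 0).re, fun s => (W 2 s).re, hm0.re.ofReal, fun r hr => ?_⟩
  have hr' := Ioc_subset_Icc_self hr
  have hi := h1.intble_mono le_rfl hr.1.le hr.2
  have e0 := h0.eq r hr'
  have e1 := h1.integral_sub_pow_mul hr' 0
  rw [hW 0 (by constructor <;> linarith), hW r ⟨by linarith [hr.1], hr.2⟩] at e0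
  simp only [pow_zero, one_mul, zero_add, pow_one, Nat.cast_zero, div_one] at e1
  have e2 : ∫ s in (0 : ℝ)..r, ((r - s : ℝ) : ℂ) * W 2 s =
      (r : ℂ) * (∫ s in (0 : ℝ)..r, (s : ℂ) ^ 0 * W 2 s) -
        ∫ s in (0 : ℝ)..r, (s : ℂ) ^ 1 * W 2 s := by
    rw [← intervalIntegral.integral_const_mul, ← intervalIntegral.integral_sub]
    · refine intervalIntegral.integral_congr fun s _ => ?_
      simp; ring
    · exact (hi.continuousOn_mul (by fun_prop)).const_mul _
    · exact hi.continuousOn_mul (by fun_prop)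
  rw [e1, e2] at e0
  have e3 := congrArg Complex.re e0
  simp only [Complex.add_re, Complex.sub_re, Complex.re_ofReal_mul, mom_re_eq hi,
    Complex.ofReal_re] at e3
  have hr0 := hr.1.ne'
  rw [kTwo]
  field_simp
  linarith

/-- `f(r²) r` through its third derivative. -/
theorem exists_profile_three (hab : a < b) (hA : AssumptionA f) (hC : AssumptionC a b 3 f)
    (hR : 0 < R) : ∃ (c : ℝ) (γ : ℝ → ℝ), MemLp (fun s => (γ s : ℂ)) 2 (vol 0 R) ∧
      ∀ r ∈ Ioc 0 R, f (r ^ 2) = kThree c γ r := by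
  obtain ⟨W, hP, hW, hm⟩ := hC.exists_chain hab hA three_pos hR
  have hm0 : MemLp (W 3) 2 (vol 0 R) :=
    hm.mono_measure (Measure.restrict_mono (Ioo_subset_Ioo (by linarith) le_rfl) le_rfl)
  have hRR : -R ≤ R := by linarith
  have hz : (0 : ℝ) ∈ Ioo (-R) R := ⟨by linarith, hR⟩
  have c1 := (hP 1 (by norm_num)).continuousOn hRR
  have c2 := (hP 2 (by norm_num)).continuousOn hRR
  -- Since r ↦ f(r²)r is odd, its derivative is even and its second derivative vanishes at 0.
  -- Without this a term quadratic in r would remain, which `kThree` does not contain.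
  have hev : ∀ x ∈ Ioo (-R) R, W 1 (-x) = W 1 x := by
    intro x hx
    have hx' : -x ∈ Ioo (-R) R := ⟨by linarith [hx.2], by linarith [hx.1]⟩
    have d1 := (hP 0 (by norm_num)).hasDerivAt c1 hx
    have d2 := (((hP 0 (by norm_num)).hasDerivAt c1 hx').scomp x (hasDerivAt_neg x)).neg
    refine (d1.unique (d2.congr_of_eventuallyEq ?_) |>.trans (by simp)).symm
    filter_upwards [isOpen_Ioo.mem_nhds hx] with y hy
    have hy' : -y ∈ Ioo (-R) R := ⟨by linarith [hy.2], by linarith [hy.1]⟩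
    simp [hW y (Ioo_subset_Icc_self hy), hW (-y) (Ioo_subset_Icc_self hy')]
  have h20 : W 2 0 = 0 := by
    have d1 := (hP 1 (by norm_num)).hasDerivAt c2 hz
    have d2 := HasDerivAt.scomp (0 : ℝ) (by rw [neg_zero]; exact d1) (hasDerivAt_neg (0 : ℝ))
    have d3 := d1.unique (d2.congr_of_eventuallyEq ?_)
    · rw [neg_one_smul] at d3; exact self_eq_neg.1 d3
    · filter_upwards [isOpen_Ioo.mem_nhds hz] with y hy
      exact (hev y hy).symm
  have h0 := (hP 0 three_pos).mono (by linarith : -R ≤ 0) hR.le le_rfl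
  have h1 := (hP 1 (by norm_num)).mono (by linarith : -R ≤ 0) hR.le le_rfl
  have h2 := (hP 2 (by norm_num)).mono (by linarith : -R ≤ 0) hR.le le_rfl
  refine ⟨(W 1 0).re, fun s => (W 3 s).re, hm0.re.ofReal, fun r hr => ?_⟩
  have hr' := Ioc_subset_Icc_self hr
  have hi := h2.intble_mono le_rfl hr.1.le hr.2
  have e0 := h0.eq r hr'
  have e1 := h1.integral_sub_pow_mul hr' 0
  have e1' := h2.integral_sub_pow_mul hr' 1
  rw [hW 0 (by constructor <;> linarith), hW r ⟨by linarith [hr.1], hr.2⟩] at e0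
  simp only [pow_zero, one_mul, zero_add, pow_one, Nat.cast_zero, div_one] at e1
  have e2 : ∫ s in (0 : ℝ)..r, ((r - s : ℝ) : ℂ) ^ 2 * W 3 s =
      ((r ^ 2 : ℝ) : ℂ) * (∫ s in (0 : ℝ)..r, (s : ℂ) ^ 0 * W 3 s) -
        ((2 * r : ℝ) : ℂ) * (∫ s in (0 : ℝ)..r, (s : ℂ) ^ 1 * W 3 s) +
        ∫ s in (0 : ℝ)..r, (s : ℂ) ^ 2 * W 3 s := by
    have k : ∀ i : ℕ, IntervalIntegrable (fun s : ℝ => (s : ℂ) ^ i * W 3 s) volume 0 r := fun i =>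
      hi.continuousOn_mul (by fun_prop)
    rw [← intervalIntegral.integral_const_mul, ← intervalIntegral.integral_const_mul,
      ← intervalIntegral.integral_sub ((k 0).const_mul _) ((k 1).const_mul _),
      ← intervalIntegral.integral_add (((k 0).const_mul _).sub ((k 1).const_mul _)) (k 2)]
    refine intervalIntegral.integral_congr fun s _ => ?_
    simp; ring
  norm_num [h20] at e1'
  simp only [Complex.ofReal_sub] at e1 e2
  rw [e1, e1', e2] at e0
  have e3 := congrArg Complex.re e0
  have h22 : ∀ z : ℂ, (z / 2).re = z.re / 2 := fun z => by
    rw [show (2 : ℂ) = ((2 : ℝ) : ℂ) by norm_num, Complex.div_ofReal_re]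
  simp only [Complex.add_re, Complex.sub_re, Complex.re_ofReal_mul, mom_re_eq hi, h22,
    Complex.ofReal_re] at e3
  have hr0 := hr.1.ne'
  rw [kThree]
  field_simp
  linarith

end radial

/-! ### Quantitative form of the acting condition -/

section acting

variable {a b : ℝ} {f : ℝ → ℝ} {γ γ' : ℝ → ℝ} {R : ℝ}

theorem memLp_ofReal (hγ : Continuous γ) : MemLp (fun s => (γ s : ℂ)) 2 (vol a b) :=
  memLp_of_continuousOn (Complex.continuous_ofReal.comp hγ).continuousOn 2

theorem mom_sq_eq (hR : 0 < R) (hγ' : Continuous γ') :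
    mom (fun s => γ' s ^ 2) 0 R = l2 0 R (fun s => (γ' s : ℂ)) ^ 2 := by
  rw [l2_sq hR.le (memLp_ofReal hγ'), mom]
  simp [Complex.norm_real]

theorem mom_abs_le (hR : 0 < R) (hγ' : Continuous γ') :
    mom (fun s => |γ' s|) 0 R ≤ √R * l2 0 R (fun s => (γ' s : ℂ)) := by
  have := integral_norm_le_l2 hR (memLp_ofReal (a := 0) (b := R) hγ')
  simpa [mom, Complex.norm_real] using this

/-- A continuous profile close to `γ` in `L²`, with its moments. -/
theorem exists_moment_approx (hR : 0 < R) (hγ : MemLp (fun s => (γ s : ℂ)) 2 (vol 0 R)) :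
    ∃ Γ : ℝ, 0 ≤ Γ ∧ ∀ ε > 0, ∃ γ' : ℝ → ℝ, Continuous γ' ∧ (∃ δ > 0, ∀ s ≤ δ, γ' s = 0) ∧
      mom (fun s => γ' s ^ 2) 0 R ≤ Γ ∧ mom (fun s => |γ' s|) 0 R ≤ Γ ∧
      ∀ i ≤ 2, ∀ ρ ∈ Icc 0 R, |mom γ i ρ - mom γ' i ρ| ≤ R ^ i * ε := by
  set Λ := l2 0 R (fun s => (γ s : ℂ)) + 1 with hΛ
  have hΛ0 : 0 ≤ Λ := add_nonneg (l2_nonneg _ _ _) zero_le_one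
  have hs : 0 < √R := Real.sqrt_pos.2 hR
  refine ⟨Λ ^ 2 + √R * Λ, by positivity, fun ε hε => ?_⟩
  -- The 1 keeps the L² norm of the approximation below Λ for every ε; the other bound makes the
  -- moments close.
  obtain ⟨γ', hc, hδ, hl⟩ := exists_continuous_approx hR hγ (ε := min 1 (ε / √R)) (by positivity)
  have hm' : MemLp (fun s => (γ' s : ℂ)) 2 (vol 0 R) := memLp_ofReal hc
  have hle : l2 0 R (fun s => (γ' s : ℂ)) ≤ Λ := by
    have := l2_sub_le hγ (memLp_ofReal_sub hγ hm')
    simp only [Complex.ofReal_sub, sub_sub_cancel] at this hl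
    linarith [hl.trans (min_le_left _ _)]
  have h0 := l2_nonneg 0 R fun s => (γ' s : ℂ)
  refine ⟨γ', hc, hδ, ?_, ?_, fun i _ ρ hρ => ?_⟩
  · rw [mom_sq_eq hR hc]
    have : l2 0 R (fun s => (γ' s : ℂ)) ^ 2 ≤ Λ ^ 2 := by gcongr
    linarith [mul_nonneg hs.le hΛ0]
  · refine (mom_abs_le hR hc).trans ?_
    have : √R * l2 0 R (fun s => (γ' s : ℂ)) ≤ √R * Λ := by gcongr
    linarith [sq_nonneg Λ]
  · refine (abs_mom_sub_le hR hγ hm' i hρ).trans ?_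
    gcongr
    have := hl.trans (min_le_right _ _)
    rwa [le_div_iff₀' hs] at this

theorem norm_G_sub_le {k k' : ℝ → ℝ} {ε : ℝ} (hε : 0 ≤ ε) (hk : ∀ r ∈ Ioc 0 R, f (r ^ 2) = k r)
    (h : ∀ r ∈ Ioc 0 R, |k r - k' r| * r ≤ ε) {z : ℂ} (hz : ‖z‖ ≤ R) :
    ‖G f z - (k' ‖z‖ : ℂ) * z‖ ≤ ε := by
  rcases eq_or_ne z 0 with rfl | hz0
  · simpa [G] using hε
  have hm : ‖z‖ ∈ Ioc 0 R := ⟨norm_pos_iff.2 hz0, hz⟩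
  rw [G, hk _ hm, ← sub_mul, norm_mul, ← Complex.ofReal_sub, Complex.norm_real, Real.norm_eq_abs]
  exact h _ hm

/-- Smooth approximations of the nonlinearity that act on `H^α_per` with uniform bounds. -/
def SmoothApprox (a b : ℝ) (α : ℕ) (f : ℝ → ℝ) : Prop :=
  ∀ R S : ℝ, 0 < R → 0 ≤ S → ∃ K : ℝ, 0 ≤ K ∧ ∀ ε > 0, ∃ k : ℝ → ℝ,
    (∀ z : ℂ, ‖z‖ ≤ R → ‖G f z - (k ‖z‖ : ℂ) * z‖ ≤ ε) ∧
    ∀ (F : Finset ℤ) (c : ℤ → ℂ), (∀ x ∈ Icc a b, ‖tpd a b F c 0 x‖ ≤ R) →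
      (∀ x ∈ Icc a b, ‖tpd a b F c 1 x‖ ≤ R) → (∀ j ≤ α, l2 a b (tpd a b F c j) ≤ S) →
      ∃ w, HPer a b α w ∧ (w 0 = fun x => (k ‖tpd a b F c 0 x‖ : ℂ) * tpd a b F c 0 x) ∧
        l2 a b (w α) ≤ K

/-- The bound involves the approximating profile only through two moments that stay below Γ, so it
does not depend on ε although the approximation does. -/
theorem smoothApprox_two (hab : a < b) (hA : AssumptionA f) (hC : AssumptionC a b 2 f) :
    SmoothApprox a b 2 f := by
  intro R S hR hS
  obtain ⟨c, γ, hγ, hf⟩ := exists_profile_two hab hA hC hR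
  obtain ⟨Γ, hΓ, h⟩ := exists_moment_approx hR hγ
  refine ⟨√(1944 * Γ * R ^ 2 * √(b - a) * S + 3 * (|c| + 3 * Γ) ^ 2 * S ^ 2), Real.sqrt_nonneg _,
    fun ε hε => ?_⟩
  -- Multiplied by r ≤ R, the error in the profile is two moment errors with weight R each.
  obtain ⟨γ', hc, ⟨δ, hδ, hz⟩, h1, h2, hm⟩ := h (ε / (2 * R)) (by positivity)
  refine ⟨kTwo c γ', fun z hzR => norm_G_sub_le hε.le hf (fun r hr => ?_) hzR,
    fun F d hv hv1 hl => ?_⟩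
  · have hr' := Ioc_subset_Icc_self hr
    have m0 := hm 0 (by norm_num) r hr'
    have m1 := hm 1 (by norm_num) r hr'
    have hr0 := hr.1
    have e : (kTwo c γ r - kTwo c γ' r) * r =
        r * (mom γ 0 r - mom γ' 0 r) - (mom γ 1 r - mom γ' 1 r) := by
      simp only [kTwo]; field_simp; ring
    rw [← abs_of_pos hr0, ← abs_mul, abs_of_pos hr0, e]
    calc _ ≤ |r * (mom γ 0 r - mom γ' 0 r)| + |mom γ 1 r - mom γ' 1 r| := abs_sub _ _
      _ ≤ R * (R ^ 0 * (ε / (2 * R))) + R ^ 1 * (ε / (2 * R)) := by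
        rw [abs_mul, abs_of_pos hr0]; gcongr; exact hr.2
      _ = ε := by field_simp; norm_num
  · obtain ⟨w, hw, hw0, hw2⟩ := exists_hPer_kTwo hab hc hδ hz c (hasDerivAt_tpd a b F d 0)
      (hasDerivAt_tpd a b F d 1) (continuous_tpd a b F d 2) (tp_periodic hab F _)
      (tp_periodic hab F _) hv hv1 (hl 2 le_rfl)
    refine ⟨w, hw, hw0, Real.le_sqrt_of_sq_le (hw2.trans ?_)⟩
    have : 0 ≤ mom (fun s => |γ' s|) 0 R := mom_nonneg (fun _ => abs_nonneg _) hR.le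
    gcongr

theorem smoothApprox_three (hab : a < b) (hA : AssumptionA f) (hC : AssumptionC a b 3 f) :
    SmoothApprox a b 3 f := by
  intro R S hR hS
  obtain ⟨c, γ, hγ, hf⟩ := exists_profile_three hab hA hC hR
  obtain ⟨Γ, hΓ, h⟩ := exists_moment_approx hR hγ
  refine ⟨√(69120 * Γ * R ^ 4 * √(b - a) * S + 900 * Γ ^ 2 * R ^ 2 * S ^ 2 +
    4 * (|c| + 3 * (R * Γ)) ^ 2 * S ^ 2), Real.sqrt_nonneg _, fun ε hε => ?_⟩
  -- The three moment errors enter with total weight R²/2 + R² + R²/2 = 2R².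
  obtain ⟨γ', hc, ⟨δ, hδ, hz⟩, h1, h2, hm⟩ := h (ε / (2 * R ^ 2)) (by positivity)
  refine ⟨kThree c γ', fun z hzR => norm_G_sub_le hε.le hf (fun r hr => ?_) hzR,
    fun F d hv hv1 hl => ?_⟩
  · have hr' := Ioc_subset_Icc_self hr
    have m0 := hm 0 (by norm_num) r hr'
    have m1 := hm 1 (by norm_num) r hr'
    have m2 := hm 2 (by norm_num) r hr'
    have hr0 := hr.1
    have e : (kThree c γ r - kThree c γ' r) * r =
        r ^ 2 / 2 * (mom γ 0 r - mom γ' 0 r) - r * (mom γ 1 r - mom γ' 1 r) +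
          (mom γ 2 r - mom γ' 2 r) / 2 := by
      simp only [kThree]; field_simp; ring
    rw [← abs_of_pos hr0, ← abs_mul, abs_of_pos hr0, e]
    calc _ ≤ |r ^ 2 / 2 * (mom γ 0 r - mom γ' 0 r) - r * (mom γ 1 r - mom γ' 1 r)| +
          |(mom γ 2 r - mom γ' 2 r) / 2| := abs_add_le _ _
      _ ≤ |r ^ 2 / 2 * (mom γ 0 r - mom γ' 0 r)| + |r * (mom γ 1 r - mom γ' 1 r)| +
          |(mom γ 2 r - mom γ' 2 r) / 2| := by gcongr; exact abs_sub _ _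
      _ ≤ R ^ 2 / 2 * (R ^ 0 * (ε / (2 * R ^ 2))) + R * (R ^ 1 * (ε / (2 * R ^ 2))) +
          R ^ 2 * (ε / (2 * R ^ 2)) / 2 := by
        rw [abs_mul, abs_mul, abs_of_pos hr0, abs_of_nonneg (by positivity : 0 ≤ r ^ 2 / 2), abs_div,
          abs_two]
        have := hr.2
        gcongr
      _ = ε := by field_simp; norm_num
  · obtain ⟨w, hw, hw0, hw2⟩ := exists_hPer_kThree hab hc hδ hz c (hasDerivAt_tpd a b F d 0)
      (hasDerivAt_tpd a b F d 1) (hasDerivAt_tpd a b F d 2) (continuous_tpd a b F d 3)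
      (tp_periodic hab F _) (tp_periodic hab F _) (tp_periodic hab F _) hv hv1
      (hl 2 (by norm_num)) (hl 3 le_rfl)
    refine ⟨w, hw, hw0, Real.le_sqrt_of_sq_le (hw2.trans ?_)⟩
    have : 0 ≤ mom (fun s => |γ' s|) 0 R := mom_nonneg (fun _ => abs_nonneg _) hR.le
    gcongr

/-- On a finite set of frequencies the weights |μ|^α are bounded, so L² convergence carries the
bound on the α-th derivative over to the limit, with no loss in the constant. -/
theorem nrm_le_of_approx (hab : a < b) {u : ℝ → ℂ} (hu : MemLp u 2 (vol a b)) {α : ℕ} {K : ℝ}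
    (h : ∀ η > 0, ∃ w, HPer a b α w ∧ l2 a b (fun x => u x - w 0 x) ≤ η ∧ l2 a b (w α) ≤ K)
    (F : Finset ℤ) :
    nrm F (fun l => (freq a b l : ℂ) ^ α * fourierCoef a b u l) ≤ K / √(b - a) := by
  have hs : 0 < √(b - a) := Real.sqrt_pos.2 (sub_pos.2 hab)
  set Λ := ∑ l ∈ F, |freq a b l| ^ α with hΛ
  have hΛ0 : 0 ≤ Λ := Finset.sum_nonneg fun _ _ => by positivity
  refine le_of_forall_pos_le_add fun η hη => ?_
  obtain ⟨w, hw, hd, hK⟩ := h (η * √(b - a) / (Λ + 1)) (by positivity)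
  have hw0 := hw.memLp 0 (Nat.zero_le _)
  refine (nrm_le_sub_add F _ fun l => (freq a b l : ℂ) ^ α * fourierCoef a b (w 0) l).trans ?_
  rw [add_comm]
  refine add_le_add ((hw.nrm_le hab le_rfl F).trans (by gcongr)) ?_
  calc nrm F (fun l => (freq a b l : ℂ) ^ α * fourierCoef a b u l -
        (freq a b l : ℂ) ^ α * fourierCoef a b (w 0) l)
      ≤ Λ * nrm F (fourierCoef a b fun x => u x - w 0 x) := by
        refine nrm_le_nrm_mul hΛ0 fun l hl => ?_
        rw [← mul_sub, ← fourierCoef_sub hab.le hu hw0, norm_mul, norm_pow, Complex.norm_real,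
          Real.norm_eq_abs]
        gcongr
        exact Finset.single_le_sum (f := fun l => |freq a b l| ^ α) (fun _ _ => by positivity) hl
    _ ≤ Λ * (η * √(b - a) / (Λ + 1) / √(b - a)) := by
        gcongr
        exact (nrm_fourierCoef_le hab (hu.sub hw0) F).trans
          (div_le_div_of_nonneg_right hd hs.le)
    _ ≤ η := by
        field_simp
        linarith

/-- A map that acts on `H^α_per` and is approximated by smooth maps is bounded on bounded sets. -/
theorem SmoothApprox.exists_bound (hab : a < b) (hA : AssumptionA f) {α : ℕ} (hα : 2 ≤ α)
    (h : SmoothApprox a b α f) (S : ℝ) (hS : 0 ≤ S) : ∃ K : ℝ, 0 ≤ K ∧ ∀ w, HPer a b α w →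
      (∀ k ≤ α, l2 a b (w k) ≤ S) → ∀ F, nrm F (fun l => (freq a b l : ℂ) ^ α *
        fourierCoef a b (fun x => G f (w 0 x)) l) ≤ K := by
  have h0 : 0 < b - a := sub_pos.2 hab
  have hs : 0 < √(b - a) := Real.sqrt_pos.2 h0
  set R := √(2 / (b - a) * S ^ 2 + 2 * (b - a) * S ^ 2) + 1 with hR
  have hR0 : 0 < R := by positivity
  obtain ⟨K, hK0, hK⟩ := h R S hR0 hS
  obtain ⟨L, hL0, hL⟩ := hA.exists_lip R
  refine ⟨K / √(b - a), by positivity, fun w hw hwS F => ?_⟩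
  have hwc : ContinuousOn (w 0) (Icc a b) := hw.continuousOn hab.le (by omega)
  have hGc : ContinuousOn (fun x => G f (w 0 x)) (Icc a b) := hA.continuous.comp_continuousOn hwc
  have hsup : ∀ {u : ℕ → ℝ → ℂ}, HPer a b α u → (∀ k ≤ α, l2 a b (u k) ≤ S) → ∀ k < 2,
      ∀ x ∈ Icc a b, ‖u k x‖ ≤ R := by
    intro u hu hul k hk x hx
    have h1 := (hu.prim k (by omega)).norm_sq_le hab (hu.memLp (k + 1) (by omega)) hx
    have h2 := hul k (by omega)
    have h3 := hul (k + 1) (by omega)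
    have : ‖u k x‖ ≤ √(2 / (b - a) * S ^ 2 + 2 * (b - a) * S ^ 2) := by
      refine Real.le_sqrt_of_sq_le (h1.trans ?_)
      have := l2_nonneg a b (u k)
      have := l2_nonneg a b (u (k + 1))
      gcongr
    linarith
  refine nrm_le_of_approx hab (memLp_of_continuousOn hGc 2) (fun η hη => ?_) F
  set B := l2 a b (w α) / √(b - a) with hB
  have hB0 : 0 ≤ B := div_nonneg (l2_nonneg _ _ _) hs.le
  have hBF := fun F => hw.nrm_le hab le_rfl F
  -- The argument is approximated first: the projection onto X_N is a trigonometric polynomial whose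
  -- Sobolev norms do not exceed those of w, and the Lipschitz constant L transfers its L² error to
  -- G.
  obtain ⟨N, hN, hev, hNs⟩ : ∃ N : ℕ, 0 < N ∧ Even N ∧
      L * (√(b - a) * ((mesh a b N / Real.pi) ^ α * B)) ≤ η / 2 := by
    have ht : Tendsto (fun n : ℕ => L * (√(b - a) * ((mesh a b (2 * (n + 1)) / Real.pi) ^ α * B)))
        atTop (𝓝 (L * (√(b - a) * ((0 / Real.pi) ^ α * B)))) := by
      have hm : Tendsto (fun n : ℕ => mesh a b (2 * (n + 1))) atTop (𝓝 0) := by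
        have : Tendsto (fun n : ℕ => 2 * (n + 1)) atTop atTop :=
          tendsto_atTop_mono (fun n => by simp only [id]; omega) tendsto_id
        exact (tendsto_const_div_atTop_nhds_zero_nat (b - a)).comp this
      exact ((((hm.div_const _).pow _).mul_const _).const_mul _).const_mul _
    rw [zero_div, zero_pow (by omega), zero_mul, mul_zero, mul_zero] at ht
    obtain ⟨n, hn⟩ := (ht.eventually (gt_mem_nhds (half_pos hη))).exists
    exact ⟨2 * (n + 1), by omega, even_two_mul _, hn.le⟩
  -- The nonlinearity is approximated second, in sup norm; the factor √(b - a) converts to L². Each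
  -- of the two steps may cost η/2.
  obtain ⟨k, hk1, hk2⟩ := hK (η / (2 * √(b - a))) (by positivity)
  set v := tpd a b (idx N) (fourierCoef a b (w 0)) with hv
  have hvP : HPer a b α v := hPer_tpd hab _ _ α
  have hvl : ∀ j ≤ α, l2 a b (v j) ≤ S := by
    intro j hj
    rw [hv, l2_tpd hab]
    have := hw.nrm_le hab hj (idx N)
    rw [le_div_iff₀' hs] at this
    exact this.trans (hwS j hj)
  obtain ⟨u, hu, hu0, huK⟩ := hk2 (idx N) _ (hsup hvP hvl 0 two_pos) (hsup hvP hvl 1 one_lt_two) hvl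
  refine ⟨u, hu, ?_, huK⟩
  have hvc : ContinuousOn (v 0) (Icc a b) := hvP.continuousOn hab.le (by omega)
  have hwv : MemLp (fun x => w 0 x - v 0 x) 2 (vol a b) := memLp_of_continuousOn (hwc.sub hvc) 2
  have hone : MemLp (fun _ : ℝ => (1 : ℂ)) 2 (vol a b) := memLp_of_continuousOn continuousOn_const 2
  have h1 : l2 a b (fun x => G f (w 0 x) - G f (v 0 x)) ≤ η / 2 := by
    refine (l2_le_mul hL0 hwv (ae_vol_of_forall_Icc fun x hx =>
      hL _ _ (hsup hw hwS 0 two_pos x hx) (hsup hvP hvl 0 two_pos x hx))).trans (le_trans ?_ hNs)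
    exact mul_le_mul_of_nonneg_left (l2_sub_tpd_le hab hN hev hw hBF (Nat.zero_le _)) hL0
  have hl1 : l2 a b (fun _ => (1 : ℂ)) = √(b - a) := by
    have := l2_sq hab.le hone
    rw [← Real.sqrt_sq (l2_nonneg a b _), this]
    simp
  have h2 : l2 a b (fun x => G f (v 0 x) - u 0 x) ≤ η / 2 := by
    refine (l2_le_mul (K := η / (2 * √(b - a))) (by positivity) hone (ae_vol_of_forall_Icc
      fun x hx => ?_)).trans (le_of_eq ?_)
    · rw [norm_one, mul_one, hu0]
      exact hk1 _ (hsup hvP hvl 0 two_pos x hx)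
    · rw [hl1]; field_simp
  have hGv : ContinuousOn (fun x => G f (v 0 x)) (Icc a b) := hA.continuous.comp_continuousOn hvc
  have := l2_add_le (u := fun x => G f (w 0 x) - G f (v 0 x)) (v := fun x => G f (v 0 x) - u 0 x)
    (memLp_of_continuousOn (hGc.sub hGv) 2)
    (memLp_of_continuousOn (hGv.sub (hu.continuousOn hab.le (k := 0) (by omega))) 2)
  simp only [sub_add_sub_cancel] at this
  linarith

end acting

/-! ### The scheme in Fourier variables -/

section scheme

variable {a b : ℝ} {V f : ℝ → ℝ} {N : ℕ} {M K R : ℝ}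

theorem norm_phi1_le (θ : ℝ) : ‖phi1 (-Complex.I * (θ : ℝ))‖ ≤ 1 := by
  rw [phi1]
  split_ifs with h
  · simp
  · have h0 : θ ≠ 0 := fun h0 => h (by simp [h0])
    have := Real.norm_exp_I_mul_ofReal_sub_one_le (x := -θ)
    have e : -Complex.I * (θ : ℂ) = Complex.I * ((-θ : ℝ) : ℂ) := by push_cast; ring
    rw [e, norm_div, norm_mul, Complex.norm_I, one_mul, Complex.norm_real]
    exact div_le_one_of_le₀ this (norm_nonneg _)

theorem mul_phi1 (z : ℂ) : z * phi1 z = Complex.exp z - 1 := by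
  rw [phi1]
  split_ifs with h
  · simp [h]
  · rw [mul_div_cancel₀ _ h]

theorem norm_exp_neg_I_mul (θ : ℝ) : ‖Complex.exp (-Complex.I * (θ : ℝ))‖ = 1 := by
  have e : -Complex.I * (θ : ℂ) = ((-θ : ℝ) : ℂ) * Complex.I := by push_cast; ring
  rw [e, Complex.norm_exp_ofReal_mul_I]

/-- Fourier coefficients of the discretized potential and nonlinear terms. -/
def discForce (a b : ℝ) (V f : ℝ → ℝ) (N : ℕ) (x : ℤ → ℂ) (l : ℤ) : ℂ :=
  fourierCoef a b (fun y => (V y : ℂ) * tp a b (idx N) x y) l +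
    discreteCoef a b N (gridValues a b N fun y => G f (tp a b (idx N) x y)) l

theorem discreteCoef_congr {v w : Fin (N + 1) → ℂ} (h : ∀ j : Fin N, v j.castSucc = w j.castSucc)
    (l : ℤ) : discreteCoef a b N v l = discreteCoef a b N w l := by
  simp only [discreteCoef, h]

/-- The new grid values are those of an element of X_N, whose discrete coefficients are its own
coefficients. The nonlinear term may be evaluated through the interpolant because the interpolant
returns the grid values. -/
theorem discreteCoef_efp_succ (hab : a < b) (hN : 0 < N) (hev : Even N) (V f : ℝ → ℝ)
    (ψ₀ : ℝ → ℂ) (τ : ℝ) (n : ℕ) {l : ℤ} (hl : l ∈ idx N) :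
    discreteCoef a b N (efp a b V f ψ₀ τ N (n + 1)) l =
      Complex.exp (-Complex.I * (τ * freq a b l ^ 2 : ℝ)) *
          discreteCoef a b N (efp a b V f ψ₀ τ N n) l -
        Complex.I * τ * (phi1 (-Complex.I * (τ * freq a b l ^ 2 : ℝ)) *
          discForce a b V f N (discreteCoef a b N (efp a b V f ψ₀ τ N n)) l) := by
  refine discreteCoef_eq_of_eq_tp hab hN (c := fun l =>
    Complex.exp (-Complex.I * (τ * freq a b l ^ 2 : ℝ)) *
          discreteCoef a b N (efp a b V f ψ₀ τ N n) l -
        Complex.I * τ * (phi1 (-Complex.I * (τ * freq a b l ^ 2 : ℝ)) *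
          discForce a b V f N (discreteCoef a b N (efp a b V f ψ₀ τ N n)) l)) (fun j => ?_) hl
  have hG : ∀ l, discreteCoef a b N (fun k => G f (efp a b V f ψ₀ τ N n k)) l =
      discreteCoef a b N (gridValues a b N fun y =>
        G f (tp a b (idx N) (discreteCoef a b N (efp a b V f ψ₀ τ N n)) y)) l := by
    refine discreteCoef_congr fun j => ?_
    have := interp_node hab hN hev (efp a b V f ψ₀ τ N n) j
    rw [interp_eq_tp] at this
    simp [gridValues, this]
  simp only [efp, efpStep, tp, sub_mul, Finset.sum_sub_distrib, Finset.mul_sum, Fin.val_castSucc]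
  congr 1
  refine Finset.sum_congr rfl fun k _ => ?_
  simp only [hG, discForce, interp_eq_tp, tp]
  ring

theorem norm_le_ae_of_eLpNorm_top (hM : 0 ≤ M) (hV : eLpNorm V ∞ (vol a b) ≤ ENNReal.ofReal M) :
    ∀ᵐ x ∂vol a b, ‖(V x : ℂ)‖ ≤ M := by
  filter_upwards [ae_le_eLpNormEssSup (f := V) (μ := vol a b)] with x hx
  rw [eLpNorm_exponent_top] at hV
  have := hx.trans hV
  rw [← ofReal_norm, ENNReal.ofReal_le_ofReal_iff hM] at this
  rwa [Complex.norm_real]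

theorem memLp_potential_mul (hV : MemLp V ∞ (vol a b)) {u : ℝ → ℂ} (hu : MemLp u 2 (vol a b)) :
    MemLp (fun x => (V x : ℂ) * u x) 2 (vol a b) :=
  hu.mul' (hV.ofReal (K := ℂ))

theorem l2_potential_mul_le (hM : 0 ≤ M) (hVM : ∀ᵐ x ∂vol a b, ‖(V x : ℂ)‖ ≤ M)
    {u : ℝ → ℂ} (hu : MemLp u 2 (vol a b)) :
    l2 a b (fun x => (V x : ℂ) * u x) ≤ M * l2 a b u := by
  refine l2_le_mul hM hu ?_
  filter_upwards [hVM] with x hx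
  rw [norm_mul]
  gcongr

theorem nrm_potential_le (hab : a < b) (hM : 0 ≤ M) (hV : MemLp V ∞ (vol a b))
    (hVM : ∀ᵐ x ∂vol a b, ‖(V x : ℂ)‖ ≤ M) {u v : ℝ → ℂ} (hu : MemLp u 2 (vol a b))
    (hv : MemLp v 2 (vol a b)) (F : Finset ℤ) :
    nrm F (fun l => fourierCoef a b (fun x => (V x : ℂ) * u x) l -
      fourierCoef a b (fun x => (V x : ℂ) * v x) l) ≤
        M * (l2 a b (fun x => u x - v x) / √(b - a)) := by
  have huv : MemLp (fun x => u x - v x) 2 (vol a b) := hu.sub hv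
  have e : (fun l => fourierCoef a b (fun x => (V x : ℂ) * u x) l -
      fourierCoef a b (fun x => (V x : ℂ) * v x) l) =
      fourierCoef a b (fun x => (V x : ℂ) * (u x - v x)) := by
    ext l
    rw [← fourierCoef_sub hab.le (memLp_potential_mul hV hu) (memLp_potential_mul hV hv)]
    simp only [mul_sub]
  rw [e, ← mul_div_assoc]
  refine (nrm_fourierCoef_le hab (memLp_potential_mul hV huv) F).trans ?_
  gcongr
  exact l2_potential_mul_le hM hVM huv

/-- Grid values of the nonlinearity depend on the discrete coefficients in a Lipschitz way. -/
theorem nrm_discreteCoef_G_sub_le (hab : a < b) (hN : 0 < N) (hev : Even N) (hK : 0 ≤ K)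
    (hL : ∀ z₁ z₂ : ℂ, ‖z₁‖ ≤ R → ‖z₂‖ ≤ R → ‖G f z₁ - G f z₂‖ ≤ K * ‖z₁ - z₂‖) {u v : ℝ → ℂ}
    (hu : ∀ y ∈ Icc a b, ‖u y‖ ≤ R) (hv : ∀ y ∈ Icc a b, ‖v y‖ ≤ R) :
    nrm (idx N) (fun l => discreteCoef a b N (gridValues a b N fun y => G f (u y)) l -
      discreteCoef a b N (gridValues a b N fun y => G f (v y)) l) ≤
    K * nrm (idx N) (fun l => discreteCoef a b N (gridValues a b N u) l -
      discreteCoef a b N (gridValues a b N v) l) := by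
  simp only [← discreteCoef_sub]
  refine nrm_discreteCoef_le_mul hab hN hev hK fun j => ?_
  have hj := node_mem_Icc hab hN (j := j) j.2.le
  exact hL _ _ (hu _ hj) (hv _ hj)

theorem discreteCoef_gridValues_tp (hab : a < b) (hN : 0 < N) (x : ℤ → ℂ) {l : ℤ} (hl : l ∈ idx N) :
    discreteCoef a b N (gridValues a b N (tp a b (idx N) x)) l = x l :=
  discreteCoef_eq_of_eq_tp hab hN (fun _ => rfl) hl

theorem nrm_discForce_sub_le (hab : a < b) (hN : 0 < N) (hev : Even N) (hM : 0 ≤ M)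
    (hV : MemLp V ∞ (vol a b)) (hVM : ∀ᵐ x ∂vol a b, ‖(V x : ℂ)‖ ≤ M) (hK : 0 ≤ K)
    (hL : ∀ z₁ z₂ : ℂ, ‖z₁‖ ≤ R → ‖z₂‖ ≤ R → ‖G f z₁ - G f z₂‖ ≤ K * ‖z₁ - z₂‖) {x y : ℤ → ℂ}
    (hx : ∀ t ∈ Icc a b, ‖tp a b (idx N) x t‖ ≤ R) (hy : ∀ t ∈ Icc a b, ‖tp a b (idx N) y t‖ ≤ R) :
    nrm (idx N) (fun l => discForce a b V f N x l - discForce a b V f N y l) ≤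
      (M + K) * nrm (idx N) (fun l => x l - y l) := by
  have hs : 0 < √(b - a) := Real.sqrt_pos.2 (sub_pos.2 hab)
  have h1 := nrm_potential_le hab hM hV hVM (memLp_tp a b (idx N) x) (memLp_tp a b (idx N) y) (idx N)
  have h2 := nrm_discreteCoef_G_sub_le hab hN hev hK hL hx hy
  have e1 : l2 a b (fun t => tp a b (idx N) x t - tp a b (idx N) y t) =
      √(b - a) * nrm (idx N) (fun l => x l - y l) := by
    rw [← l2_tp hab]
    congr 1
    ext t
    simp [tp, sub_mul]
  have e2 : nrm (idx N) (fun l => discreteCoef a b N (gridValues a b N (tp a b (idx N) x)) l -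
      discreteCoef a b N (gridValues a b N (tp a b (idx N) y)) l) =
      nrm (idx N) (fun l => x l - y l) := nrm_congr fun l hl => by
    rw [discreteCoef_gridValues_tp hab hN x hl, discreteCoef_gridValues_tp hab hN y hl]
  rw [e1, mul_div_cancel_left₀ _ hs.ne'] at h1
  rw [e2] at h2
  refine le_trans (le_of_eq ?_) ((nrm_add_le _ _ _).trans ((add_le_add h1 h2).trans (by rw [add_mul])))
  exact nrm_congr fun l _ => by rw [discForce, discForce, add_sub_add_comm]

theorem discForce_zero (a b : ℝ) (V f : ℝ → ℝ) (N : ℕ) : discForce a b V f N 0 = 0 := by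
  ext l
  have : tp a b (idx N) 0 = 0 := by ext; simp [tp]
  simp [discForce, this, fourierCoef, discreteCoef, gridValues, G_zero]

theorem nrm_discForce_le (hab : a < b) (hN : 0 < N) (hev : Even N) (hM : 0 ≤ M)
    (hV : MemLp V ∞ (vol a b)) (hVM : ∀ᵐ x ∂vol a b, ‖(V x : ℂ)‖ ≤ M) (hK : 0 ≤ K)
    (hL : ∀ z₁ z₂ : ℂ, ‖z₁‖ ≤ R → ‖z₂‖ ≤ R → ‖G f z₁ - G f z₂‖ ≤ K * ‖z₁ - z₂‖) {x : ℤ → ℂ}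
    (hx : ∀ t ∈ Icc a b, ‖tp a b (idx N) x t‖ ≤ R) :
    nrm (idx N) (discForce a b V f N x) ≤ (M + K) * nrm (idx N) x := by
  have hR : 0 ≤ R := (norm_nonneg _).trans (hx a (left_mem_Icc.2 hab.le))
  have := nrm_discForce_sub_le hab hN hev hM hV hVM hK hL hx (y := 0)
    (fun t _ => by simpa [tp] using hR)
  simpa [discForce_zero] using this

/-- Consistency of the discretized force, on a function with its smoothness constants. -/
theorem nrm_force_sub_discForce_le (hab : a < b) (hN : 0 < N) (hev : Even N) (hM : 0 ≤ M)
    (hV : MemLp V ∞ (vol a b)) (hVM : ∀ᵐ x ∂vol a b, ‖(V x : ℂ)‖ ≤ M) (hK : 0 ≤ K)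
    (hL : ∀ z₁ z₂ : ℂ, ‖z₁‖ ≤ R → ‖z₂‖ ≤ R → ‖G f z₁ - G f z₂‖ ≤ K * ‖z₁ - z₂‖) {m : ℕ}
    (hm : 1 ≤ m) {w W : ℕ → ℝ → ℂ} (hw : HPer a b m w) (hW : HPer a b m W)
    (hWw : W 0 = fun y => G f (w 0 y)) {B : ℝ}
    (hB : ∀ F, nrm F (fun l => (freq a b l : ℂ) ^ m * fourierCoef a b (w 0) l) ≤ B)
    (hB' : ∀ F, nrm F (fun l => (freq a b l : ℂ) ^ m * fourierCoef a b (W 0) l) ≤ B)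
    (hwR : ∀ y ∈ Icc a b, ‖w 0 y‖ ≤ R) {x : ℤ → ℂ}
    (hx : ∀ t ∈ Icc a b, ‖tp a b (idx N) x t‖ ≤ R) :
    nrm (idx N) (fun l => fourierCoef a b (fun y => (V y : ℂ) * w 0 y + G f (w 0 y)) l -
      discForce a b V f N x l) ≤
        (M + K) * nrm (idx N) (fun l => fourierCoef a b (w 0) l - x l) +
          (M + 2 * K + 2) * B * mesh a b N ^ m := by
  have hs : 0 < √(b - a) := Real.sqrt_pos.2 (sub_pos.2 hab)
  have hm0 := mesh_pos hab hN
  have hB0 : 0 ≤ B := (nrm_nonneg _ _).trans (hB ∅)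
  have hw0 := hw.memLp 0 (Nat.zero_le _)
  have hW0 : MemLp (fun y => G f (w 0 y)) 2 (vol a b) := hWw ▸ hW.memLp 0 (Nat.zero_le _)
  set δ := nrm (idx N) (fun l => fourierCoef a b (w 0) l - x l) with hδ
  have htp := memLp_tp a b (idx N) (fourierCoef a b (w 0))
  have h1 := nrm_potential_le hab hM hV hVM hw0 (memLp_tp a b (idx N) x) (idx N)
  have e1 : l2 a b (fun t => w 0 t - tp a b (idx N) x t) ≤ √(b - a) * (mesh a b N ^ m * B + δ) := by
    have t1 := l2_add_le (u := fun t => w 0 t - tp a b (idx N) (fourierCoef a b (w 0)) t)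
      (v := tp a b (idx N) fun l => fourierCoef a b (w 0) l - x l) (hw0.sub htp) (memLp_tp _ _ _ _)
    have t2 := l2_sub_tpd_le hab hN hev hw hB (Nat.zero_le _)
    rw [tpd_zero, Nat.sub_zero] at t2
    have t3 : (mesh a b N / Real.pi) ^ m ≤ mesh a b N ^ m := by
      gcongr
      exact div_le_self hm0.le (by linarith [Real.pi_gt_three])
    rw [l2_tp hab] at t1
    have t4 : (fun t => w 0 t - tp a b (idx N) (fourierCoef a b (w 0)) t +
        tp a b (idx N) (fun l => fourierCoef a b (w 0) l - x l) t) =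
        fun t => w 0 t - tp a b (idx N) x t := by
      ext t; simp [tp, sub_mul]
    rw [t4] at t1
    refine t1.trans ?_
    rw [mul_add]
    refine add_le_add (t2.trans ?_) le_rfl
    gcongr
  have e2 : M * (l2 a b (fun t => w 0 t - tp a b (idx N) x t) / √(b - a)) ≤
      M * (mesh a b N ^ m * B + δ) := by
    gcongr
    rwa [div_le_iff₀' hs]
  have h2 := nrm_discreteCoef_G_sub_le hab hN hev hK hL hwR hx
  have h3 := nrm_discreteCoef_sub_fourierCoef_le hab hN hev hm hw hB
  have h4 := nrm_discreteCoef_sub_fourierCoef_le hab hN hev hm hW hB'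
  have e3 : nrm (idx N) (fun l => discreteCoef a b N (gridValues a b N (w 0)) l -
      discreteCoef a b N (gridValues a b N (tp a b (idx N) x)) l) ≤ 2 * mesh a b N ^ m * B + δ := by
    refine le_trans (le_of_eq ?_) ((nrm_add_le (idx N) _ _).trans (add_le_add h3 le_rfl))
    refine nrm_congr fun l hl => ?_
    rw [discreteCoef_gridValues_tp hab hN x hl]
    simp
  have e4 := h2.trans (mul_le_mul_of_nonneg_left e3 hK)
  rw [hWw] at h4
  have key : nrm (idx N) (fun l => fourierCoef a b (fun y => (V y : ℂ) * w 0 y + G f (w 0 y)) l -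
      discForce a b V f N x l) ≤ M * (mesh a b N ^ m * B + δ) +
        (K * (2 * mesh a b N ^ m * B + δ) + 2 * mesh a b N ^ m * B) := by
    refine le_trans (le_of_eq ?_) ((nrm_add_le (idx N) _ _).trans
      (add_le_add (h1.trans e2) ((nrm_sub_le (idx N) _ _).trans (add_le_add e4 h4))))
    refine nrm_congr fun l _ => ?_
    rw [fourierCoef_add hab.le (memLp_potential_mul hV hw0) hW0, discForce]
    congr 1
    ring
  refine key.trans (le_of_eq ?_)
  ring

end scheme

/-! ### Evolution of the Fourier coefficients -/

section evolution

variable {a b T : ℝ} {F : Finset ℤ}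

/-- The mean value inequality in the Euclidean space on `F`. Treating the coefficients as one vector
avoids any factor depending on the size of `F`. -/
theorem nrm_image_sub_le {p p' : ℝ → ℤ → ℂ} {s : Set ℝ} {D : ℝ} (hs : Convex ℝ s)
    (h : ∀ t ∈ s, ∀ l ∈ F, HasDerivWithinAt (fun t => p t l) (p' t l) s t)
    (hb : ∀ t ∈ s, nrm F (p' t) ≤ D) {t r : ℝ} (ht : t ∈ s) (hr : r ∈ s) :
    nrm F (fun l => p r l - p t l) ≤ D * |r - t| := by
  have key := hs.norm_image_sub_le_of_norm_hasDerivWithin_le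
    (f := fun t => (WithLp.toLp 2 fun l : F => p t l : EuclideanSpace ℂ F))
    (f' := fun t => WithLp.toLp 2 fun l : F => p' t l) (C := D) (fun t ht => ?_)
    (fun t ht => by rw [← nrm_eq_norm]; exact hb t ht) ht hr
  · rw [Real.norm_eq_abs] at key
    rw [nrm_eq_norm]
    exact key
  · rw [hasDerivWithinAt_iff_hasFDerivWithinAt, hasFDerivWithinAt_piLp]
    intro l
    have := (h t ht l l.2).hasFDerivWithinAt
    refine this.congr_fderiv ?_
    ext
    simp

/-- Duhamel's integral for a constant force: this is where φ₁ comes from. -/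
theorem exp_neg_mul_integral (θ τ : ℝ) :
    Complex.exp (-Complex.I * (τ * θ : ℝ)) * ∫ r in (0 : ℝ)..τ, Complex.exp (Complex.I * (r * θ : ℝ)) =
      τ * phi1 (-Complex.I * (τ * θ : ℝ)) := by
  rcases eq_or_ne θ 0 with rfl | hθ
  · simp [phi1]
  rcases eq_or_ne τ 0 with rfl | hτ
  · simp
  have h0 : (Complex.I * (θ : ℂ)) ≠ 0 := mul_ne_zero Complex.I_ne_zero (by exact_mod_cast hθ)
  have e : ∀ r : ℝ, Complex.exp (Complex.I * (r * θ : ℝ)) = Complex.exp (Complex.I * θ * r) :=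
    fun r => by push_cast; congr 1; ring
  have hz : -Complex.I * (τ * θ : ℝ) ≠ 0 :=
    mul_ne_zero (neg_ne_zero.2 Complex.I_ne_zero) (by exact_mod_cast mul_ne_zero hτ hθ)
  simp only [e]
  rw [integral_exp_mul_complex h0, phi1, if_neg hz]
  have hτ' : (τ : ℂ) ≠ 0 := by exact_mod_cast hτ
  have hθ' : (θ : ℂ) ≠ 0 := by exact_mod_cast hθ
  have e2 : Complex.exp (-Complex.I * (τ * θ : ℝ)) * Complex.exp (Complex.I * θ * τ) = 1 := by
    rw [← Complex.exp_add, ← Complex.exp_zero]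
    congr 1
    push_cast; ring
  have e3 : Complex.exp (Complex.I * θ * (0 : ℝ)) = 1 := by simp
  rw [e3, mul_div_assoc', mul_sub, e2]
  have hI := Complex.I_ne_zero
  push_cast
  field_simp
  ring

/-- `c` solves `i c' = μ² c + g` on `[0, T]`, with derivative `d`. -/
structure CoefEvol (a b T : ℝ) (c d g : ℝ → ℤ → ℂ) : Prop where
  deriv : ∀ t ∈ Icc 0 T, ∀ l, HasDerivWithinAt (fun s => c s l) (d t l) (Icc 0 T) t
  eq : ∀ t ∈ Icc 0 T, ∀ l, Complex.I * d t l = (freq a b l : ℂ) ^ 2 * c t l + g t l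

/-- The exponential integrator step with exact data. -/
def ewiStep (a b τ : ℝ) (c g : ℤ → ℂ) (l : ℤ) : ℂ :=
  Complex.exp (-Complex.I * (τ * freq a b l ^ 2 : ℝ)) * c l -
    Complex.I * τ * (phi1 (-Complex.I * (τ * freq a b l ^ 2 : ℝ)) * g l)

variable {c d g : ℝ → ℤ → ℂ}

/-- Let e(r) = e^{irμ²}. The function e(s-t)c(s) + i(∫₀^{s-t} e)g(t) has derivative -i e(s-t)(g(s) -
g(t)), because the stiff term μ²c cancels. The mean value inequality then needs only that g varies
little over the step. The weight κ is 1 for L² and μ for H¹. -/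
theorem CoefEvol.local_error (h : CoefEvol a b T c d g) (κ : ℤ → ℂ) {t τ D : ℝ} (ht : 0 ≤ t)
    (hτ : 0 ≤ τ) (htT : t + τ ≤ T)
    (hD : ∀ s ∈ Icc t (t + τ), nrm F (fun l => κ l * (g s l - g t l)) ≤ D) :
    nrm F (fun l => κ l * (c (t + τ) l - ewiStep a b τ (c t) (g t) l)) ≤ D * τ := by
  have hsub : Icc t (t + τ) ⊆ Icc 0 T := Icc_subset_Icc ht htT
  set e : ℤ → ℝ → ℂ := fun l r => Complex.exp (Complex.I * (r * freq a b l ^ 2 : ℝ)) with he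
  have hec : ∀ l, Continuous (e l) := fun l => by fun_prop
  have hed : ∀ l s, HasDerivAt (fun s => e l (s - t))
      (e l (s - t) * (Complex.I * (freq a b l : ℂ) ^ 2)) s := by
    intro l s
    have h1 : HasDerivAt (fun s : ℝ => Complex.I * (((s - t) * freq a b l ^ 2 : ℝ) : ℂ))
        (Complex.I * (freq a b l : ℂ) ^ 2) s := by
      have := ((((hasDerivAt_id s).sub_const t).mul_const (freq a b l ^ 2)).ofReal_comp).const_mul
        Complex.I
      simpa using this
    exact h1.cexp
  have hen : ∀ l r, ‖e l r‖ = 1 := fun l r => Complex.norm_exp_I_mul_ofReal _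
  have hint : ∀ l s, HasDerivAt (fun s => ∫ r in (0 : ℝ)..(s - t), e l r) (e l (s - t)) s := by
    intro l s
    have h1 := ((hec l).integral_hasStrictDerivAt 0 (s - t)).hasDerivAt
    simpa [Function.comp_def] using h1.scomp s ((hasDerivAt_id s).sub_const t)
  have key := nrm_image_sub_le (F := F) (D := D) (convex_Icc t (t + τ))
    (p := fun s l => κ l * (e l (s - t) * c s l + Complex.I * (∫ r in (0 : ℝ)..(s - t), e l r) * g t l))
    (p' := fun s l => κ l * (e l (s - t) * (Complex.I * (freq a b l : ℂ) ^ 2) * c s l +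
      e l (s - t) * d s l + Complex.I * e l (s - t) * g t l)) (fun s hs l _ => ?_) (fun s hs => ?_)
    (left_mem_Icc.2 (by linarith)) (right_mem_Icc.2 (by linarith))
  · rw [add_sub_cancel_left, abs_of_nonneg hτ] at key
    refine le_trans (le_of_eq (nrm_congr fun l _ => ?_)) key
    have e1 := exp_neg_mul_integral (freq a b l ^ 2) τ
    have e2 : e l τ * Complex.exp (-Complex.I * (τ * freq a b l ^ 2 : ℝ)) = 1 := by
      rw [he, ← Complex.exp_add, ← Complex.exp_zero]
      congr 1
      ring
    have e3 : e l 0 = 1 := by simp [he]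
    rw [sub_self, intervalIntegral.integral_same, e3, ← mul_sub, norm_mul,
      norm_mul]
    congr 1
    rw [← one_mul ‖c (t + τ) l - _‖, ← hen l τ, ← norm_mul, ewiStep]
    congr 1
    have e4 : ∫ r in (0 : ℝ)..τ, e l r =
        e l τ * (τ * phi1 (-Complex.I * (τ * freq a b l ^ 2 : ℝ))) := by
      rw [← e1, ← mul_assoc, e2, one_mul]
    rw [e4]
    linear_combination (-c t l) * e2
  · have := (((hed l s).hasDerivWithinAt.mul ((h.deriv s (hsub hs) l).mono hsub)).add
      (((hint l s).hasDerivWithinAt.const_mul Complex.I).mul_const (g t l))).const_mul (κ l)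
    exact this
  · refine le_trans (le_of_eq (nrm_congr fun l _ => ?_)) (hD s hs)
    have e1 : κ l * (e l (s - t) * (Complex.I * (freq a b l : ℂ) ^ 2) * c s l +
      e l (s - t) * d s l + Complex.I * e l (s - t) * g t l) =
        e l (s - t) * -Complex.I * (κ l * (g s l - g t l)) := by
      have := h.eq s (hsub hs) l
      linear_combination (-Complex.I * e l (s - t) * κ l) * this +
        (e l (s - t) * κ l * d s l) * Complex.I_sq
    rw [e1, norm_mul, norm_mul, hen, norm_neg, Complex.norm_I, one_mul, one_mul]

end evolution

/-! ### Convergence in `L²` and stability in `H²` -/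

section convergence

variable {a b T : ℝ} {V f : ℝ → ℝ} {N m : ℕ} {M R K B Λ τ : ℝ} {ψ : ℝ → ℝ → ℂ}
  {d : ℝ → ℤ → ℂ} {F : Finset ℤ}

/-- Fourier coefficients of `V u + G(u)`. -/
def force (a b : ℝ) (V f : ℝ → ℝ) (u : ℝ → ℂ) : ℤ → ℂ :=
  fourierCoef a b fun y => (V y : ℂ) * u y + G f (u y)

/-- A solution in Fourier variables, with the constants that enter the error estimates. -/
structure SolData (a b T : ℝ) (V f : ℝ → ℝ) (m : ℕ) (M R K B Λ : ℝ) (ψ : ℝ → ℝ → ℂ)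
    (d : ℝ → ℤ → ℂ) : Prop where
  M_nonneg : 0 ≤ M
  K_nonneg : 0 ≤ K
  Λ_nonneg : 0 ≤ Λ
  memLp_potential : MemLp V ∞ (vol a b)
  potential_le : ∀ᵐ x ∂vol a b, ‖(V x : ℂ)‖ ≤ M
  lip : ∀ z₁ z₂ : ℂ, ‖z₁‖ ≤ R → ‖z₂‖ ≤ R → ‖G f z₁ - G f z₂‖ ≤ K * ‖z₁ - z₂‖
  evol : CoefEvol a b T (fun t => fourierCoef a b (ψ t)) d fun t => force a b V f (ψ t)
  smooth : ∀ t ∈ Icc 0 T, ∃ w W, HPer a b m w ∧ HPer a b m W ∧ w 0 = ψ t ∧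
    (W 0 = fun y => G f (ψ t y)) ∧
    (∀ F, nrm F (fun l => (freq a b l : ℂ) ^ m * fourierCoef a b (w 0) l) ≤ B) ∧
    ∀ F, nrm F (fun l => (freq a b l : ℂ) ^ m * fourierCoef a b (W 0) l) ≤ B
  sup_le : ∀ t ∈ Icc 0 T, ∀ y ∈ Icc a b, ‖ψ t y‖ ≤ R
  force_lip : ∀ F, ∀ s ∈ Icc 0 T, ∀ t ∈ Icc 0 T,
    nrm F (fun l => force a b V f (ψ s) l - force a b V f (ψ t) l) ≤ Λ * |s - t|

theorem nrm_ewiStep_sub_le (hτ : 0 ≤ τ) (F : Finset ℤ) (κ c g x y : ℤ → ℂ) :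
    nrm F (fun l => κ l * (ewiStep a b τ c g l - ewiStep a b τ x y l)) ≤
      nrm F (fun l => κ l * (c l - x l)) + τ * nrm F (fun l => κ l * (g l - y l)) := by
  have e : (fun l => κ l * (ewiStep a b τ c g l - ewiStep a b τ x y l)) = fun l =>
      Complex.exp (-Complex.I * (τ * freq a b l ^ 2 : ℝ)) * (κ l * (c l - x l)) -
        Complex.I * τ * phi1 (-Complex.I * (τ * freq a b l ^ 2 : ℝ)) * (κ l * (g l - y l)) := by
    ext l; simp only [ewiStep]; ring
  rw [e]
  refine (nrm_sub_le F _ _).trans (add_le_add (le_of_eq (nrm_congr fun l _ => ?_))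
    (nrm_le_nrm_mul hτ fun l _ => ?_))
  · rw [norm_mul, norm_exp_neg_I_mul, one_mul]
  · rw [norm_mul]
    refine mul_le_mul_of_nonneg_right ?_ (norm_nonneg _)
    rw [norm_mul, norm_mul, Complex.norm_I, one_mul, Complex.norm_real, Real.norm_of_nonneg hτ]
    exact mul_le_of_le_one_right hτ (norm_phi1_le _)

/-- The error after one step, in the norm weighted by `κ`. -/
theorem CoefEvol.nrm_step_le {c d g : ℝ → ℤ → ℂ} (h : CoefEvol a b T c d g) (κ : ℤ → ℂ) {t Λ : ℝ}
    (ht : 0 ≤ t) (hτ : 0 ≤ τ) (htT : t + τ ≤ T) (hΛ : 0 ≤ Λ)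
    (hg : ∀ s ∈ Icc 0 T, nrm F (fun l => κ l * (g s l - g t l)) ≤ Λ * |s - t|) (x y : ℤ → ℂ) :
    nrm F (fun l => κ l * (c (t + τ) l - ewiStep a b τ x y l)) ≤
      nrm F (fun l => κ l * (c t l - x l)) + τ * (nrm F (fun l => κ l * (g t l - y l)) + Λ * τ) := by
  have h1 := h.local_error (F := F) κ ht hτ htT (D := Λ * τ) fun s hs => by
    refine (hg s ⟨ht.trans hs.1, hs.2.trans htT⟩).trans ?_
    rw [abs_of_nonneg (by linarith [hs.1])]
    gcongr
    linarith [hs.2]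
  have h2 := nrm_ewiStep_sub_le (a := a) (b := b) hτ F κ (c t) (g t) x y
  have h3 := nrm_add_le F (fun l => κ l * (c (t + τ) l - ewiStep a b τ (c t) (g t) l))
    (fun l => κ l * (ewiStep a b τ (c t) (g t) l - ewiStep a b τ x y l))
  simp only [← mul_add, sub_add_sub_cancel] at h3
  linarith

theorem discrete_gronwall {E : ℕ → ℝ} {α β : ℝ} (hα : 0 ≤ α) (hβ : 0 ≤ β) (hτ : 0 ≤ τ) (h0 : 0 ≤ E 0)
    {n : ℕ} (h : ∀ k < n, E (k + 1) ≤ E k + τ * (α * E k + β)) :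
    E n ≤ Real.exp (α * (n * τ)) * (E 0 + n * τ * β) := by
  induction n with
  | zero => simp
  | succ n ih =>
    have h1 := ih fun k hk => h k (hk.trans (Nat.lt_succ_self n))
    have h2 := h n (Nat.lt_succ_self n)
    have h3 : 1 + τ * α ≤ Real.exp (α * τ) := by
      have := Real.add_one_le_exp (α * τ); linarith
    have h4 : Real.exp (α * ((n + 1 : ℕ) * τ)) = Real.exp (α * τ) * Real.exp (α * (n * τ)) := by
      rw [← Real.exp_add]; congr 1; push_cast; ring
    have h5 : (1 : ℝ) ≤ Real.exp (α * ((n + 1 : ℕ) * τ)) := Real.one_le_exp (by positivity)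
    have h6 : 0 ≤ Real.exp (α * (n * τ)) * (E 0 + n * τ * β) := by positivity
    calc E (n + 1) ≤ (1 + τ * α) * E n + τ * β := by linarith
      _ ≤ (1 + τ * α) * (Real.exp (α * (n * τ)) * (E 0 + n * τ * β)) + τ * β := by gcongr
      _ ≤ Real.exp (α * τ) * (Real.exp (α * (n * τ)) * (E 0 + n * τ * β)) +
          Real.exp (α * ((n + 1 : ℕ) * τ)) * (τ * β) := by
        have : 0 ≤ τ * β := by positivity
        exact add_le_add (mul_le_mul_of_nonneg_right h3 h6) (le_mul_of_one_le_left this h5)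
      _ = _ := by rw [h4]; push_cast; ring

/-- The scheme in Fourier variables. -/
structure IsDiscSol (a b : ℝ) (V f : ℝ → ℝ) (N : ℕ) (τ : ℝ) (x : ℕ → ℤ → ℂ) : Prop where
  step : ∀ n, ∀ l ∈ idx N, x (n + 1) l = ewiStep a b τ (x n) (discForce a b V f N (x n)) l

variable {x : ℕ → ℤ → ℂ}

theorem SolData.nrm_error_le (h : SolData a b T V f m M R K B Λ ψ d) (hab : a < b) (hN : 0 < N)
    (hev : Even N) (hm : 1 ≤ m) (hτ : 0 < τ) (hx : IsDiscSol a b V f N τ x) {n : ℕ}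
    (hn : n * τ ≤ T) (hsup : ∀ k < n, ∀ y ∈ Icc a b, ‖tp a b (idx N) (x k) y‖ ≤ R) {k : ℕ}
    (hk : k < n) :
    nrm (idx N) (fun l => fourierCoef a b (ψ ((k + 1 : ℕ) * τ)) l - x (k + 1) l) ≤
      nrm (idx N) (fun l => fourierCoef a b (ψ (k * τ)) l - x k l) +
        τ * ((M + K) * nrm (idx N) (fun l => fourierCoef a b (ψ (k * τ)) l - x k l) +
          ((M + 2 * K + 2) * B * mesh a b N ^ m + Λ * τ)) := by
  have hkn : ((k : ℝ) + 1) ≤ n := by exact_mod_cast hk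
  have ht0 : 0 ≤ (k : ℝ) * τ := by positivity
  have htT : (k : ℝ) * τ + τ ≤ T := by nlinarith
  have ht : (k : ℝ) * τ ∈ Icc 0 T := ⟨ht0, by linarith⟩
  obtain ⟨w, W, hw, hW, hw0, hW0, hB, hB'⟩ := h.smooth _ ht
  have h1 := nrm_force_sub_discForce_le hab hN hev h.M_nonneg h.memLp_potential h.potential_le
    h.K_nonneg h.lip hm hw hW (by rw [hW0, hw0]) hB hB' (by rw [hw0]; exact h.sup_le _ ht)
    (hsup k hk)
  rw [hw0] at h1
  have h2 := h.evol.nrm_step_le (F := idx N) (fun _ => 1) ht0 hτ.le htT h.Λ_nonneg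
    (fun s hs => by simpa using h.force_lip (idx N) s hs _ ht) (x k) (discForce a b V f N (x k))
  simp only [one_mul] at h2
  have e : nrm (idx N) (fun l => fourierCoef a b (ψ ((k + 1 : ℕ) * τ)) l - x (k + 1) l) =
      nrm (idx N) (fun l => fourierCoef a b (ψ (k * τ + τ)) l -
        ewiStep a b τ (x k) (discForce a b V f N (x k)) l) := by
    refine nrm_congr fun l hl => ?_
    rw [hx.step k l hl]
    congr 4
    push_cast; ring
  rw [e]
  refine h2.trans ?_
  rw [← add_assoc]
  gcongr
  exact h1

/-- Sup bounds are required only strictly before step n, so the estimate at step n is available for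
proving the bound at step n. -/
theorem SolData.nrm_error_le_of_sup_le (h : SolData a b T V f m M R K B Λ ψ d) (hab : a < b)
    (hN : 0 < N) (hev : Even N) (hm : 1 ≤ m) (hτ : 0 < τ) (hx : IsDiscSol a b V f N τ x)
    (hx0 : nrm (idx N) (fun l => fourierCoef a b (ψ 0) l - x 0 l) ≤ 2 * mesh a b N ^ m * B)
    (hB : 0 ≤ B) {n : ℕ} (hn : n * τ ≤ T)
    (hsup : ∀ k < n, ∀ y ∈ Icc a b, ‖tp a b (idx N) (x k) y‖ ≤ R) :
    nrm (idx N) (fun l => fourierCoef a b (ψ (n * τ)) l - x n l) ≤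
      Real.exp ((M + K) * T) * (2 * B + T * ((M + 2 * K + 2) * B + Λ)) * (τ + mesh a b N ^ m) := by
  have hm0 := mesh_pos hab hN
  have hM := h.M_nonneg
  have hK := h.K_nonneg
  have hΛ := h.Λ_nonneg
  have hnτ : 0 ≤ (n : ℝ) * τ := by positivity
  have hT : 0 ≤ T := hnτ.trans hn
  have key := discrete_gronwall (E := fun n => nrm (idx N) fun l =>
    fourierCoef a b (ψ (n * τ)) l - x n l) (α := M + K)
    (β := (M + 2 * K + 2) * B * mesh a b N ^ m + Λ * τ) (by positivity) (by positivity) hτ.le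
    (nrm_nonneg _ _) (n := n) fun k hk => h.nrm_error_le hab hN hev hm hτ hx hn hsup hk
  refine key.trans ?_
  simp only [Nat.cast_zero, zero_mul]
  rw [mul_assoc (Real.exp ((M + K) * T))]
  have e1 : Real.exp ((M + K) * (n * τ)) ≤ Real.exp ((M + K) * T) := by gcongr
  have e2 : nrm (idx N) (fun l => fourierCoef a b (ψ 0) l - x 0 l) +
      n * τ * ((M + 2 * K + 2) * B * mesh a b N ^ m + Λ * τ) ≤
      2 * mesh a b N ^ m * B + T * ((M + 2 * K + 2) * B * mesh a b N ^ m + Λ * τ) := by gcongr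
  have e0 : 0 ≤ nrm (idx N) (fun l => fourierCoef a b (ψ 0) l - x 0 l) := nrm_nonneg _ _
  refine mul_le_mul e1 (e2.trans ?_) (by positivity) (by positivity)
  have p1 : 0 ≤ 2 * B * τ := by positivity
  have p2 : 0 ≤ T * ((M + 2 * K + 2) * B) * τ := by positivity
  have p3 : 0 ≤ T * Λ * mesh a b N ^ m := by positivity
  linarith

/-- The residual `μ² x + F(x)` of the discrete stationary equation grows slowly. -/
theorem IsDiscSol.nrm_residual_le (hx : IsDiscSol a b V f N τ x) (hab : a < b) (hN : 0 < N)
    (hev : Even N) (hM : 0 ≤ M) (hV : MemLp V ∞ (vol a b)) (hVM : ∀ᵐ x ∂vol a b, ‖(V x : ℂ)‖ ≤ M)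
    (hK : 0 ≤ K) (hτ : 0 ≤ τ)
    (hL : ∀ z₁ z₂ : ℂ, ‖z₁‖ ≤ R → ‖z₂‖ ≤ R → ‖G f z₁ - G f z₂‖ ≤ K * ‖z₁ - z₂‖) (n : ℕ) :
    nrm (idx N) (fun l => (freq a b l : ℂ) ^ 2 * x (n + 1) l) ≤
      nrm (idx N) (fun l => (freq a b l : ℂ) ^ 2 * x n l + discForce a b V f N (x n) l) +
        nrm (idx N) (discForce a b V f N (x n)) ∧
    ((∀ y ∈ Icc a b, ‖tp a b (idx N) (x n) y‖ ≤ R) →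
      (∀ y ∈ Icc a b, ‖tp a b (idx N) (x (n + 1)) y‖ ≤ R) →
      nrm (idx N) (fun l => (freq a b l : ℂ) ^ 2 * x (n + 1) l + discForce a b V f N (x (n + 1)) l) ≤
        (1 + (M + K) * τ) *
          nrm (idx N) (fun l => (freq a b l : ℂ) ^ 2 * x n l + discForce a b V f N (x n) l)) := by
  set Y : ℤ → ℂ := fun l => (freq a b l : ℂ) ^ 2 * x n l + discForce a b V f N (x n) l with hY
  have hz : ∀ l, -Complex.I * (τ * freq a b l ^ 2 : ℝ) * phi1 (-Complex.I * (τ * freq a b l ^ 2 : ℝ)) =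
      Complex.exp (-Complex.I * (τ * freq a b l ^ 2 : ℝ)) - 1 := fun l => mul_phi1 _
  -- Multiplying the step by μ² turns τμ²φ₁ into an exponential minus 1, so two derivatives of the
  -- new iterate cost no negative power of τ or h.
  have e1 : ∀ l ∈ idx N, (freq a b l : ℂ) ^ 2 * x (n + 1) l =
      Complex.exp (-Complex.I * (τ * freq a b l ^ 2 : ℝ)) * Y l - discForce a b V f N (x n) l := by
    intro l hl
    have := hz l
    push_cast at this
    rw [hx.step n l hl, ewiStep, hY]
    push_cast
    linear_combination discForce a b V f N (x n) l * this
  -- The increment is τ times a bounded multiple of the residual. Hence the force changes by O(τ)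
  -- relative to the residual, and the residual satisfies a Gronwall recursion.
  have e2 : ∀ l ∈ idx N, x (n + 1) l - x n l =
      -Complex.I * τ * phi1 (-Complex.I * (τ * freq a b l ^ 2 : ℝ)) * Y l := by
    intro l hl
    have := hz l
    push_cast at this
    rw [hx.step n l hl, ewiStep, hY]
    push_cast
    linear_combination (-x n l) * this
  have nE : nrm (idx N) (fun l => Complex.exp (-Complex.I * (τ * freq a b l ^ 2 : ℝ)) * Y l) =
      nrm (idx N) Y := nrm_congr fun l _ => by rw [norm_mul, norm_exp_neg_I_mul, one_mul]
  constructor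
  · rw [← nE]
    refine le_trans (le_of_eq (nrm_congr fun l hl => by rw [e1 l hl])) (nrm_sub_le _ _ _)
  · intro h1 h2
    have d1 := nrm_discForce_sub_le hab hN hev hM hV hVM hK hL h2 h1
    have d2 : nrm (idx N) (fun l => x (n + 1) l - x n l) ≤ τ * nrm (idx N) Y := by
      refine nrm_le_nrm_mul hτ fun l hl => ?_
      rw [e2 l hl, norm_mul]
      refine mul_le_mul_of_nonneg_right ?_ (norm_nonneg _)
      rw [norm_mul, norm_mul, norm_neg, Complex.norm_I, one_mul, Complex.norm_real,
        Real.norm_of_nonneg hτ]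
      exact mul_le_of_le_one_right hτ (norm_phi1_le _)
    have d3 : nrm (idx N) (fun l => (freq a b l : ℂ) ^ 2 * x (n + 1) l +
        discForce a b V f N (x (n + 1)) l) ≤ nrm (idx N) Y +
          nrm (idx N) (fun l => discForce a b V f N (x (n + 1)) l - discForce a b V f N (x n) l) := by
      rw [← nE]
      refine le_trans (le_of_eq (nrm_congr fun l hl => ?_)) (nrm_add_le _ _ _)
      rw [e1 l hl]
      congr 1
      ring
    have d4 : (M + K) * nrm (idx N) (fun l => x (n + 1) l - x n l) ≤ (M + K) * (τ * nrm (idx N) Y) := by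
      gcongr
    linarith

end convergence

/-! ### Uniform `H²` bounds for the scheme -/

section stability

variable {a b T : ℝ} {V f : ℝ → ℝ} {N m : ℕ} {M R K B Λ τ B₀ C₀ C₂ : ℝ} {ψ : ℝ → ℝ → ℂ}
  {d : ℝ → ℤ → ℂ} {x : ℕ → ℤ → ℂ}

/-- The deviation is at most 1 in sup norm, by interpolating its small L² norm with a merely bounded
H² norm; this is the margin 1 in the choice of R. -/
theorem norm_tp_le_of_close (hab : a < b) {F : Finset ℤ} {c y : ℤ → ℂ} {ε D : ℝ}
    (hc : nrm F c ≤ B₀) (hc' : nrm F (fun l => freq a b l * c l) ≤ B₀)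
    (hR : √(2 * B₀ ^ 2 + 2 * (b - a) ^ 2 * B₀ ^ 2) + 1 ≤ R) (hε : nrm F (fun l => c l - y l) ≤ ε)
    (hD : nrm F (fun l => (freq a b l : ℂ) ^ 2 * (c l - y l)) ≤ D)
    (hs : ε * (2 + 2 * (b - a) ^ 2 * D) ≤ 1) {t : ℝ} (ht : t ∈ Icc a b) :
    ‖tp a b F y t‖ ≤ R := by
  have hε0 : 0 ≤ ε := (nrm_nonneg _ _).trans hε
  have hD0 : 0 ≤ D := (nrm_nonneg _ _).trans hD
  have h1 : ‖tp a b F c t‖ ≤ √(2 * B₀ ^ 2 + 2 * (b - a) ^ 2 * B₀ ^ 2) := by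
    refine Real.le_sqrt_of_sq_le ((norm_tp_sq_le hab F c ht).trans ?_)
    have := nrm_nonneg F c
    have := nrm_nonneg F (fun l => freq a b l * c l)
    gcongr
  have h2 : ‖tp a b F (fun l => c l - y l) t‖ ≤ 1 := by
    refine abs_le_of_sq_le_sq' ?_ zero_le_one |>.2
    have h3 := nrm_sq_le_mul (F := F) (c := fun l => c l - y l) (freq a b)
    have h3' : nrm F (fun l => (freq a b l : ℂ) * (c l - y l)) ^ 2 ≤ ε * D := by
      refine h3.trans (mul_le_mul hε ?_ (nrm_nonneg _ _) hε0)
      simpa using hD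
    have h4 : nrm F (fun l => c l - y l) ^ 2 ≤ ε := by
      have : ε ≤ 1 := by
        have : 0 ≤ ε * (2 * (b - a) ^ 2 * D) := by positivity
        linarith
      calc _ ≤ ε ^ 2 := by have := nrm_nonneg F (fun l => c l - y l); gcongr
        _ ≤ ε := by nlinarith
    refine (norm_tp_sq_le hab F _ ht).trans ?_
    calc _ ≤ 2 * ε + 2 * (b - a) ^ 2 * (ε * D) := by gcongr
      _ ≤ 1 ^ 2 := by linarith
  have h5 : tp a b F y t = tp a b F c t - tp a b F (fun l => c l - y l) t := by
    simp [tp, sub_mul]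
  rw [h5]
  linarith [norm_sub_le (tp a b F c t) (tp a b F (fun l => c l - y l) t)]

theorem SolData.nrm_freq_sq_le (h : SolData a b T V f m M R K B Λ ψ d) {t : ℝ}
    (ht : t ∈ Icc 0 T) (F : Finset ℤ) :
    nrm F (fun l => (freq a b l : ℂ) ^ m * fourierCoef a b (ψ t) l) ≤ B := by
  obtain ⟨w, W, -, -, hw0, -, hB, -⟩ := h.smooth t ht
  rw [← hw0]
  exact hB F

/-- The order of the bootstrap matters. The L² error at n + 1 uses sup bounds up to n; the H² bound
at n + 1 uses the residual at n and needs no sup bound at n + 1. Interpolating the two gives the sup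
bound at n + 1, and only then is the residual at n + 1 estimated. -/
theorem SolData.stability (h : SolData a b T V f 2 M R K B Λ ψ d) (hab : a < b) (hN : 0 < N)
    (hev : Even N) (hτ : 0 < τ) (hT : 0 ≤ T) (hx : IsDiscSol a b V f N τ x)
    (hx0 : nrm (idx N) (fun l => fourierCoef a b (ψ 0) l - x 0 l) ≤ 2 * mesh a b N ^ 2 * B)
    (hB₀ : ∀ t ∈ Icc 0 T, nrm (idx N) (fourierCoef a b (ψ t)) ≤ B₀ ∧
      nrm (idx N) (fun l => freq a b l * fourierCoef a b (ψ t) l) ≤ B₀)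
    (hR : √(2 * B₀ ^ 2 + 2 * (b - a) ^ 2 * B₀ ^ 2) + 1 ≤ R)
    (hC₀ : C₀ = Real.exp ((M + K) * T) * (2 * B + T * ((M + 2 * K + 2) * B + Λ)))
    (hC₂ : C₂ = Real.exp ((M + K) * T) * (B + 2 * Real.pi ^ 2 * B + (M + K) * (B₀ + 1)) +
      (M + K) * (B₀ + 1))
    (hsmall : C₀ * (τ + mesh a b N ^ 2) * (2 + 2 * (b - a) ^ 2 * (C₂ + B)) ≤ 1)
    {n : ℕ} (hn : n * τ ≤ T) :
    (∀ y ∈ Icc a b, ‖tp a b (idx N) (x n) y‖ ≤ R) ∧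
      nrm (idx N) (fun l => (freq a b l : ℂ) ^ 2 * x n l) ≤ C₂ ∧ nrm (idx N) (x n) ≤ B₀ + 1 ∧
      nrm (idx N) (fun l => fourierCoef a b (ψ (n * τ)) l - x n l) ≤ C₀ * (τ + mesh a b N ^ 2) := by
  have hm0 := mesh_pos hab hN
  have hM := h.M_nonneg
  have hK := h.K_nonneg
  have hΛ := h.Λ_nonneg
  have hB : 0 ≤ B := (nrm_nonneg _ _).trans (h.nrm_freq_sq_le (left_mem_Icc.2 hT) (idx N))
  have hB₀' : 0 ≤ B₀ := (nrm_nonneg _ _).trans (hB₀ 0 (left_mem_Icc.2 hT)).1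
  have hC₂0 : 0 ≤ C₂ := by rw [hC₂]; positivity
  have hC₀0 : 0 ≤ C₀ := by rw [hC₀]; positivity
  set ε := C₀ * (τ + mesh a b N ^ 2) with hε
  have hε0 : 0 ≤ ε := by positivity
  have hε1 : ε ≤ 1 := by
    have : 0 ≤ ε * (2 * (b - a) ^ 2 * (C₂ + B)) := by positivity
    linarith
  have hmem : ∀ {n : ℕ}, n * τ ≤ T → (n : ℝ) * τ ∈ Icc 0 T := fun hn => ⟨by positivity, hn⟩
  have herr : ∀ {n : ℕ}, n * τ ≤ T → (∀ k < n, ∀ y ∈ Icc a b, ‖tp a b (idx N) (x k) y‖ ≤ R) →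
      nrm (idx N) (fun l => fourierCoef a b (ψ (n * τ)) l - x n l) ≤ ε := fun hn hs => by
    rw [hε, hC₀]
    exact h.nrm_error_le_of_sup_le hab hN hev one_le_two hτ hx hx0 hB hn hs
  have hxn : ∀ {n : ℕ}, n * τ ≤ T → nrm (idx N) (fun l => fourierCoef a b (ψ (n * τ)) l - x n l) ≤ ε →
      nrm (idx N) (x n) ≤ B₀ + 1 := fun {n} hn he => by
    have h1 := nrm_sub_le (idx N) (fourierCoef a b (ψ (n * τ)))
      (fun l => fourierCoef a b (ψ (n * τ)) l - x n l)
    simp only [sub_sub_cancel] at h1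
    have := (hB₀ _ (hmem hn)).1
    exact h1.trans (by linarith)
  have hsup : ∀ {n : ℕ}, n * τ ≤ T →
      nrm (idx N) (fun l => fourierCoef a b (ψ (n * τ)) l - x n l) ≤ ε →
      nrm (idx N) (fun l => (freq a b l : ℂ) ^ 2 * x n l) ≤ C₂ →
      ∀ y ∈ Icc a b, ‖tp a b (idx N) (x n) y‖ ≤ R := fun {n} hn he h2 y hy => by
    refine norm_tp_le_of_close hab (hB₀ _ (hmem hn)).1 (hB₀ _ (hmem hn)).2 hR he (D := C₂ + B) ?_
      hsmall hy
    simp only [mul_sub]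
    refine (nrm_sub_le _ _ _).trans ?_
    linarith [h.nrm_freq_sq_le (hmem hn) (idx N)]
  have hforce : ∀ {n : ℕ}, n * τ ≤ T →
      nrm (idx N) (fun l => fourierCoef a b (ψ (n * τ)) l - x n l) ≤ ε →
      (∀ y ∈ Icc a b, ‖tp a b (idx N) (x n) y‖ ≤ R) →
      nrm (idx N) (discForce a b V f N (x n)) ≤ (M + K) * (B₀ + 1) := fun {n} hn he hs => by
    refine (nrm_discForce_le hab hN hev hM h.memLp_potential h.potential_le hK h.lip hs).trans ?_
    have := hxn hn he
    gcongr
  set Y₀ := B + 2 * Real.pi ^ 2 * B + (M + K) * (B₀ + 1) with hY₀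
  have hY₀0 : 0 ≤ Y₀ := by positivity
  have hexp : ∀ {n : ℕ}, n * τ ≤ T → Real.exp ((M + K) * (n * τ)) * Y₀ + (M + K) * (B₀ + 1) ≤ C₂ :=
    fun {n} hn => by
      rw [hC₂]
      gcongr
  have main : ∀ n : ℕ, n * τ ≤ T → (∀ k ≤ n, ∀ y ∈ Icc a b, ‖tp a b (idx N) (x k) y‖ ≤ R) ∧
      nrm (idx N) (fun l => (freq a b l : ℂ) ^ 2 * x n l) ≤ C₂ ∧
      nrm (idx N) (fun l => (freq a b l : ℂ) ^ 2 * x n l + discForce a b V f N (x n) l) ≤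
        Real.exp ((M + K) * (n * τ)) * Y₀ := by
    intro n
    induction n with
    | zero =>
      intro hn
      have he := herr hn (by simp)
      -- The initial H² bound comes from the inverse inequality: the interpolation error O(h²) is
      -- multiplied by (π/h)², and the powers of h cancel.
      have h2 : nrm (idx N) (fun l => (freq a b l : ℂ) ^ 2 * x 0 l) ≤ B + 2 * Real.pi ^ 2 * B := by
        have h3 := nrm_sub_le (idx N) (fun l => (freq a b l : ℂ) ^ 2 * fourierCoef a b (ψ 0) l)
          (fun l => (freq a b l : ℂ) ^ 2 * (fourierCoef a b (ψ 0) l - x 0 l))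
        simp only [← mul_sub, sub_sub_cancel] at h3
        have h4 := nrm_freq_pow_mul_le hab hN 2 (fun l => fourierCoef a b (ψ 0) l - x 0 l)
        have h5 : (Real.pi / mesh a b N) ^ 2 *
            nrm (idx N) (fun l => fourierCoef a b (ψ 0) l - x 0 l) ≤
            (Real.pi / mesh a b N) ^ 2 * (2 * mesh a b N ^ 2 * B) := by gcongr
        have h6 : (Real.pi / mesh a b N) ^ 2 * (2 * mesh a b N ^ 2 * B) = 2 * Real.pi ^ 2 * B := by
          field_simp
        linarith [h.nrm_freq_sq_le (left_mem_Icc.2 hT) (idx N)]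
      have h2' : nrm (idx N) (fun l => (freq a b l : ℂ) ^ 2 * x 0 l) ≤ C₂ := by
        have := hexp hn
        simp only [Nat.cast_zero, zero_mul, mul_zero, Real.exp_zero, one_mul] at this
        have : 0 ≤ (M + K) * (B₀ + 1) := by positivity
        linarith
      have hs := hsup hn he h2'
      refine ⟨fun k hk => ?_, h2', ?_⟩
      · rw [Nat.le_zero.1 hk]; exact hs
      · simp only [Nat.cast_zero, zero_mul, mul_zero, Real.exp_zero, one_mul]
        exact (nrm_add_le _ _ _).trans (add_le_add h2 (hforce hn he hs))
    | succ n ih =>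
      intro hn
      have hn' : (n : ℝ) * τ ≤ T := by push_cast at hn; linarith
      obtain ⟨hs, h2, hy⟩ := ih hn'
      have he' := herr hn' fun k hk => hs k hk.le
      have he := herr hn fun k hk => hs k (Nat.lt_succ_iff.1 hk)
      obtain ⟨r1, r2⟩ := hx.nrm_residual_le hab hN hev hM h.memLp_potential h.potential_le hK hτ.le
        h.lip n
      have h2' : nrm (idx N) (fun l => (freq a b l : ℂ) ^ 2 * x (n + 1) l) ≤ C₂ :=
        (r1.trans (add_le_add hy (hforce hn' he' (hs n le_rfl)))).trans (hexp hn')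
      have hs' := hsup hn he h2'
      refine ⟨fun k hk => ?_, h2', ?_⟩
      · rcases Nat.le_succ_iff.1 hk with hk | rfl
        · exact hs k hk
        · exact hs'
      · have h3 : 1 + (M + K) * τ ≤ Real.exp ((M + K) * τ) := by
          have := Real.add_one_le_exp ((M + K) * τ); linarith
        refine (r2 (hs n le_rfl) hs').trans ?_
        calc (1 + (M + K) * τ) * _ ≤ Real.exp ((M + K) * τ) * (Real.exp ((M + K) * (n * τ)) * Y₀) :=
            mul_le_mul h3 hy (nrm_nonneg _ _) (Real.exp_nonneg _)
          _ = _ := by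
            rw [← mul_assoc, ← Real.exp_add]
            congr 2
            push_cast; ring
  obtain ⟨hs, h2, -⟩ := main n hn
  have he := herr hn fun k hk => hs k hk.le
  exact ⟨hs n le_rfl, h2, hxn hn he, he⟩

end stability

/-! ### From the solution to its Fourier coefficients -/

section extraction

variable {a b T : ℝ} {V f : ℝ → ℝ} {N m : ℕ} {M R K B Λ S : ℝ} {ψ₀ : ℝ → ℂ} {ψ ψt : ℝ → ℝ → ℂ}

theorem hNorm_le_of_sizeM (h : sizeM a b T V ψ ψt ≤ ENNReal.ofReal M) {t : ℝ} (ht : t ∈ Icc 0 T) :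
    hNorm a b 2 (ψ t) ≤ ENNReal.ofReal M :=
  (le_iSup₂ (f := fun t (_ : t ∈ Icc 0 T) => hNorm a b 2 (ψ t)) t ht).trans
    ((le_max_left _ _).trans ((le_max_left _ _).trans h))

theorem eLpNorm_deriv_le_of_sizeM (h : sizeM a b T V ψ ψt ≤ ENNReal.ofReal M) {t : ℝ}
    (ht : t ∈ Icc 0 T) : eLpNorm (ψt t) 2 (vol a b) ≤ ENNReal.ofReal M :=
  (le_iSup₂ (f := fun t (_ : t ∈ Icc 0 T) => eLpNorm (ψt t) 2 (vol a b)) t ht).trans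
    ((le_max_left _ _).trans ((le_max_right _ _).trans h))

theorem eLpNorm_potential_le_of_sizeM (h : sizeM a b T V ψ ψt ≤ ENNReal.ofReal M) :
    eLpNorm V ∞ (vol a b) ≤ ENNReal.ofReal M :=
  (le_max_right _ _).trans ((le_max_right _ _).trans h)

/-- Successive derivatives of a continuous curve in `H^m_per`. -/
theorem ContHper.exists_family (hab : a < b) (hm : 0 < m) (h : ContHper a b T m ψ)
    (hc : ∀ t ∈ Icc 0 T, ContinuousOn (ψ t) (Icc a b)) :
    ∃ w : ℝ → ℕ → ℝ → ℂ, ∀ t ∈ Icc 0 T, HPer a b m (w t) ∧ w t 0 = ψ t := by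
  have : ∀ t, ∃ w : ℕ → ℝ → ℂ, t ∈ Icc 0 T → HPer a b m w ∧ w 0 = ψ t := fun t => by
    by_cases ht : t ∈ Icc 0 T
    · obtain ⟨w, hw, hw0⟩ := (h t ht).1.exists_hPer_eq hab hm (hc t ht)
      exact ⟨w, fun _ => ⟨hw, hw0⟩⟩
    · exact ⟨fun _ => 0, fun h => absurd h ht⟩
  choose w hw using this
  exact ⟨w, hw⟩

theorem HPer.l2_le (hab : a ≤ b) {w : ℕ → ℝ → ℂ} (h : HPer a b m w) (hS : 0 ≤ S)
    (hw : hNorm a b m (w 0) ≤ ENNReal.ofReal S) {k : ℕ} (hk : k ≤ m) : l2 a b (w k) ≤ S :=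
  l2_le_of_eLpNorm_le hS (((h.isWeakDerivs hab).eLpNorm_le_hNorm hk).trans hw)

theorem HPer.norm_le (hab : a < b) {w : ℕ → ℝ → ℂ} (h : HPer a b m w) {k : ℕ} (hk : k < m)
    (h0 : l2 a b (w k) ≤ S) (h1 : l2 a b (w (k + 1)) ≤ S) {y : ℝ} (hy : y ∈ Icc a b) :
    ‖w k y‖ ≤ √(2 / (b - a) * S ^ 2 + 2 * (b - a) * S ^ 2) := by
  have hb : 0 < b - a := sub_pos.2 hab
  refine Real.le_sqrt_of_sq_le (((h.prim k hk).norm_sq_le hab (h.memLp (k + 1) hk) hy).trans ?_)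
  have := l2_nonneg a b (w k)
  have := l2_nonneg a b (w (k + 1))
  gcongr

theorem tendsto_fourierCoef_zero (hab : a < b) {ι : Type*} {𝓕 : Filter ι} {u : ι → ℝ → ℂ}
    (hu : ∀ᶠ i in 𝓕, MemLp (u i) 2 (vol a b))
    (h : Tendsto (fun i => eLpNorm (u i) 2 (vol a b)) 𝓕 (𝓝 0)) (l : ℤ) :
    Tendsto (fun i => fourierCoef a b (u i) l) 𝓕 (𝓝 0) := by
  have h1 : Tendsto (fun i => l2 a b (u i) / √(b - a)) 𝓕 (𝓝 0) := by
    have := (ENNReal.tendsto_toReal ENNReal.zero_ne_top).comp h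
    simpa [l2, Function.comp_def] using this.div_const (√(b - a))
  exact squeeze_zero_norm' (hu.mono fun i hi => norm_fourierCoef_le hab hi l) h1

/-- Fourier coefficients of spatial derivatives are differentiable in time. -/
theorem ContDiffH.hasDerivWithinAt (hab : a < b) (hd : ContDiffH a b T m ψ ψt)
    {w v : ℝ → ℕ → ℝ → ℂ} (hw : ∀ t ∈ Icc 0 T, HPer a b m (w t) ∧ w t 0 = ψ t)
    (hv : ∀ t ∈ Icc 0 T, IsWeakDerivs a b m (ψt t) (v t) ∧ ∀ k ≤ m, MemLp (v t k) 2 (vol a b))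
    {k : ℕ} (hk : k ≤ m) {t : ℝ} (ht : t ∈ Icc 0 T) (l : ℤ) :
    HasDerivWithinAt (fun s => fourierCoef a b (w s k) l) (fourierCoef a b (v t k) l) (Icc 0 T) t := by
  rw [hasDerivWithinAt_iff_tendsto_slope]
  have hev : ∀ᶠ s in 𝓝[Icc 0 T \ {t}] t, s ∈ Icc 0 T :=
    eventually_of_mem self_mem_nhdsWithin fun s hs => hs.1
  have hL : ∀ s ∈ Icc 0 T, MemLp (w s k) 2 (vol a b) := fun s hs => (hw s hs).1.memLp k hk
  have hv' := (hv t ht).2 k hk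
  have hq : ∀ s ∈ Icc 0 T,
      MemLp (fun x => ((s - t : ℝ) : ℂ)⁻¹ * (w s k x - w t k x)) 2 (vol a b) := fun s hs =>
    ((hL s hs).sub (hL t ht)).const_mul _
  have hD : ∀ s ∈ Icc 0 T, IsWeakDerivs a b m ((s - t)⁻¹ • (ψ s - ψ t) - ψt t)
      (fun j => (fun x => ((s - t : ℝ) : ℂ)⁻¹ * (w s j x - w t j x)) - v t j) := by
    intro s hs
    have h1 := (((hw s hs).1.sub (hw t ht).1).const_mul (((s - t : ℝ) : ℂ)⁻¹)).isWeakDerivs hab.le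
    refine (h1.congr_ae (Eventually.of_forall fun x => ?_)).sub (hv t ht).1
    simp [(hw s hs).2, (hw t ht).2]
  have h0 : Tendsto (fun s => fourierCoef a b
      (fun x => ((s - t : ℝ) : ℂ)⁻¹ * (w s k x - w t k x) - v t k x) l)
      (𝓝[Icc 0 T \ {t}] t) (𝓝 0) := by
    refine tendsto_fourierCoef_zero hab (hev.mono fun s hs => (hq s hs).sub hv') ?_ l
    refine tendsto_of_tendsto_of_tendsto_of_le_of_le' tendsto_const_nhds (hd t ht).2.2.2
      (Eventually.of_forall fun s => zero_le) (hev.mono fun s hs => ?_)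
    exact (hD s hs).eLpNorm_le_hNorm hk
  have h1 := h0.add_const (fourierCoef a b (v t k) l)
  rw [zero_add] at h1
  refine h1.congr' (hev.mono fun s hs => ?_)
  rw [fourierCoef_sub hab.le (hq s hs) hv', fourierCoef_const_mul,
    fourierCoef_sub hab.le (hL s hs) (hL t ht), sub_add_cancel, slope_def_module,
    Complex.real_smul, Complex.ofReal_inv]

theorem ContDiffH.memLp (hd : ContDiffH a b T m ψ ψt) {t : ℝ} (ht : t ∈ Icc 0 T) :
    MemLp (ψt t) 2 (vol a b) := by
  obtain ⟨-, ⟨v, hv, hvL⟩, -, -⟩ := hd t ht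
  exact (memLp_congr_ae hv.1).1 (hvL 0 (Nat.zero_le _))

/-- Needed to extend the equation to t = 0, where it is not assumed. -/
theorem ContDiffH.continuousOn_fourierCoef (hab : a < b) (hd : ContDiffH a b T m ψ ψt) (l : ℤ) :
    ContinuousOn (fun t => fourierCoef a b (ψt t) l) (Icc 0 T) := by
  intro t ht
  obtain ⟨-, ⟨v, hv, hvL⟩, hc, -⟩ := hd t ht
  have hL : ∀ s ∈ Icc 0 T, MemLp (ψt s) 2 (vol a b) := fun s hs => hd.memLp hs
  have hev : ∀ᶠ s in 𝓝[Icc 0 T] t, s ∈ Icc 0 T := self_mem_nhdsWithin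
  have h0 : Tendsto (fun s => fourierCoef a b (fun x => ψt s x - ψt t x) l) (𝓝[Icc 0 T] t) (𝓝 0) := by
    refine tendsto_fourierCoef_zero hab (hev.mono fun s hs => (hL s hs).sub (hL t ht)) ?_ l
    refine tendsto_of_tendsto_of_tendsto_of_le_of_le' tendsto_const_nhds hc
      (Eventually.of_forall fun s => zero_le) (hev.mono fun s hs => ?_)
    obtain ⟨-, ⟨v', hv', -⟩, -, -⟩ := hd s hs
    rw [← eLpNorm_congr_ae (hv'.sub hv).1]
    exact (hv'.sub hv).eLpNorm_le_hNorm (Nat.zero_le _)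
  have h1 := h0.add_const (fourierCoef a b (ψt t) l)
  rw [zero_add] at h1
  refine h1.congr' (hev.mono fun s hs => ?_)
  rw [fourierCoef_sub hab.le (hL s hs) (hL t ht), sub_add_cancel]

/-- The mean value inequality on each finite set of coefficients, then Parseval. It makes ψ
Lipschitz in time in L² with a constant controlled by the time derivative. -/
theorem l2_time_sub_le (hab : a < b) {d : ℝ → ℤ → ℂ} (hL : ∀ t ∈ Icc 0 T, MemLp (ψ t) 2 (vol a b))
    (hder : ∀ t ∈ Icc 0 T, ∀ l, HasDerivWithinAt (fun s => fourierCoef a b (ψ s) l) (d t l)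
      (Icc 0 T) t) {D : ℝ} (hD : ∀ F, ∀ t ∈ Icc 0 T, nrm F (d t) ≤ D) {s t : ℝ} (hs : s ∈ Icc 0 T)
    (ht : t ∈ Icc 0 T) : l2 a b (fun x => ψ s x - ψ t x) ≤ √(b - a) * (D * |s - t|) := by
  refine l2_le_of_nrm_le hab ((hL s hs).sub (hL t ht)) fun F => ?_
  refine le_trans (le_of_eq (nrm_congr fun l _ => ?_)) (nrm_image_sub_le (F := F) (convex_Icc 0 T)
    (fun t ht l _ => hder t ht l) (hD F) ht hs)
  rw [← fourierCoef_sub hab.le (hL s hs) (hL t ht)]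
  rfl

theorem nrm_force_sub_le (hab : a < b) (hM : 0 ≤ M) (hV : MemLp V ∞ (vol a b))
    (hVM : ∀ᵐ x ∂vol a b, ‖(V x : ℂ)‖ ≤ M) (hK : 0 ≤ K)
    (hL : ∀ z₁ z₂ : ℂ, ‖z₁‖ ≤ R → ‖z₂‖ ≤ R → ‖G f z₁ - G f z₂‖ ≤ K * ‖z₁ - z₂‖) {u v : ℝ → ℂ}
    (hu : MemLp u 2 (vol a b)) (hv : MemLp v 2 (vol a b))
    (hGu : MemLp (fun x => G f (u x)) 2 (vol a b)) (hGv : MemLp (fun x => G f (v x)) 2 (vol a b))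
    (huR : ∀ y ∈ Icc a b, ‖u y‖ ≤ R) (hvR : ∀ y ∈ Icc a b, ‖v y‖ ≤ R) (F : Finset ℤ) :
    nrm F (fun l => force a b V f u l - force a b V f v l) ≤
      (M + K) * (l2 a b (fun x => u x - v x) / √(b - a)) := by
  have h1 := nrm_potential_le hab hM hV hVM hu hv F
  have h2 : nrm F (fun l => fourierCoef a b (fun x => G f (u x)) l -
      fourierCoef a b (fun x => G f (v x)) l) ≤ K * (l2 a b (fun x => u x - v x) / √(b - a)) := by
    simp only [← fourierCoef_sub hab.le hGu hGv]
    refine (nrm_fourierCoef_le hab (hGu.sub hGv) F).trans ?_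
    rw [← mul_div_assoc]
    gcongr
    exact l2_le_mul hK (hu.sub hv) (ae_vol_of_forall_Icc fun y hy => hL _ _ (huR y hy) (hvR y hy))
  rw [add_mul]
  refine le_trans (le_of_eq (nrm_congr fun l _ => ?_)) ((nrm_add_le F _ _).trans (add_le_add h1 h2))
  rw [force, force, fourierCoef_add hab.le (memLp_potential_mul hV hu) hGu,
    fourierCoef_add hab.le (memLp_potential_mul hV hv) hGv, add_sub_add_comm]

/-- The equation in Fourier variables, for positive times. -/
theorem IsNLSESolution.coef_eq (hab : a < b) (h : IsNLSESolution a b T V f ψ₀ ψ ψt)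
    (hV : MemLp V ∞ (vol a b)) {t : ℝ} (ht : t ∈ Ioc 0 T) {w : ℕ → ℝ → ℂ} (hw : HPer a b 2 w)
    (hw0 : w 0 = ψ t) (hG : MemLp (fun x => G f (ψ t x)) 2 (vol a b)) (l : ℤ) :
    Complex.I * fourierCoef a b (ψt t) l =
      (freq a b l : ℂ) ^ 2 * fourierCoef a b (ψ t) l + force a b V f (ψ t) l := by
  obtain ⟨w', hw', heq⟩ := h.equation t ht
  have hψ : MemLp (ψ t) 2 (vol a b) := hw0 ▸ hw.memLp 0 (Nat.zero_le _)
  have h1 := (hw.isWeakDerivs hab.le).ae_unique (by rwa [hw0]) 2 le_rfl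
  have hVG : MemLp (fun x => (V x : ℂ) * ψ t x + G f (ψ t x)) 2 (vol a b) :=
    (memLp_potential_mul hV hψ).add hG
  rw [← fourierCoef_const_mul, fourierCoef_congr_ae hab.le (v := fun x =>
    ((V x : ℂ) * ψ t x + G f (ψ t x)) - w 2 x) (by
      filter_upwards [heq, h1] with x hx h1x
      rw [hx, h1x]; ring), fourierCoef_sub hab.le hVG (hw.memLp 2 le_rfl),
    hw.fourierCoef_eq hab le_rfl, hw0, mul_pow, Complex.I_sq, force]
  ring

end extraction

/-! ### Constants uniform over the solutions of size M, and passage from coefficients to Sobolev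
norms -/

section estimates

variable {a b T : ℝ} {V f : ℝ → ℝ} {N m : ℕ} {M R K B Λ S : ℝ} {ψ₀ : ℝ → ℂ} {ψ ψt : ℝ → ℝ → ℂ}

/-- Uniform smoothness of a function in `H^m_per` and of its image under the nonlinearity. -/
theorem SmoothApprox.exists_smooth (hab : a < b) (hA : AssumptionA f) (hm : 2 ≤ m)
    (h : SmoothApprox a b m f) (hC : AssumptionC a b m f) (hS : 0 ≤ S) :
    ∃ B : ℝ, 0 ≤ B ∧ ∀ w, HPer a b m w → (∀ k ≤ m, l2 a b (w k) ≤ S) → ∃ W, HPer a b m W ∧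
      (W 0 = fun y => G f (w 0 y)) ∧
      (∀ F, nrm F (fun l => (freq a b l : ℂ) ^ m * fourierCoef a b (w 0) l) ≤ B) ∧
      ∀ F, nrm F (fun l => (freq a b l : ℂ) ^ m * fourierCoef a b (W 0) l) ≤ B := by
  obtain ⟨K, hK0, hK⟩ := h.exists_bound hab hA hm S hS
  have hs : 0 < √(b - a) := Real.sqrt_pos.2 (sub_pos.2 hab)
  have hS' : 0 ≤ S / √(b - a) := by positivity
  refine ⟨S / √(b - a) + K, by positivity, fun w hw hwS => ?_⟩
  have hc : ContinuousOn (fun y => G f (w 0 y)) (Icc a b) :=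
    hA.continuous.comp_continuousOn (hw.continuousOn hab.le (by omega))
  obtain ⟨W, hW, hW0⟩ := (hC _ (hw.memHper hab.le)).exists_hPer_eq hab (by omega) hc
  refine ⟨W, hW, hW0, fun F => (hw.nrm_le hab le_rfl F).trans ?_, fun F => ?_⟩
  · have : l2 a b (w m) / √(b - a) ≤ S / √(b - a) := by
      have := hwS m le_rfl
      gcongr
    linarith
  · rw [hW0]
    linarith [hK w hw hwS F]

/-- All constants are fixed before V and ψ. This is the point where (C) is used in its quantitative
form: the bound B on second derivatives of G(ψ) depends on ψ only through M. -/
theorem exists_solData (hab : a < b) (hA : AssumptionA f) (hC : AssumptionC a b 2 f) (hT : 0 < T)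
    (hM : 0 ≤ M) : ∃ B₀ R K B Λ : ℝ, 0 ≤ B₀ ∧ 0 ≤ K ∧ 0 ≤ B ∧ 0 ≤ Λ ∧
      √(2 * B₀ ^ 2 + 2 * (b - a) ^ 2 * B₀ ^ 2) + 1 ≤ R ∧
      ∀ (V : ℝ → ℝ) (ψ₀ : ℝ → ℂ) (ψ ψt : ℝ → ℝ → ℂ), MemLp V ∞ (vol a b) →
        IsNLSESolution a b T V f ψ₀ ψ ψt → ContHper a b T 2 ψ → ContDiffH a b T 0 ψ ψt →
        sizeM a b T V ψ ψt ≤ ENNReal.ofReal M →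
        SolData a b T V f 2 M R K B Λ ψ (fun t => fourierCoef a b (ψt t)) ∧
        ∀ t ∈ Icc 0 T, ∀ F, nrm F (fourierCoef a b (ψ t)) ≤ B₀ ∧
          nrm F (fun l => freq a b l * fourierCoef a b (ψ t) l) ≤ B₀ := by
  have hb : 0 < b - a := sub_pos.2 hab
  have hs : 0 < √(b - a) := Real.sqrt_pos.2 hb
  set B₀ := M / √(b - a) with hB₀
  set R := √(2 / (b - a) * M ^ 2 + 2 * (b - a) * M ^ 2) + 1 with hR
  obtain ⟨K, hK0, hK⟩ := hA.exists_lip R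
  obtain ⟨B, hB0, hB⟩ := (smoothApprox_two hab hA hC).exists_smooth hab hA le_rfl hC hM
  refine ⟨B₀, R, K, B, (M + K) * B₀, by positivity, hK0, hB0, by positivity, ?_,
    fun V ψ₀ ψ ψt hV hsol hH hd hsize => ?_⟩
  -- Equality holds: R was defined as the embedding bound in terms of M, plus the margin 1, and B₀
  -- is M divided by √(b - a).
  · rw [hR, hB₀]
    refine le_of_eq ?_
    congr 2
    rw [div_pow, Real.sq_sqrt hb.le]
    field_simp
  obtain ⟨w, hw⟩ := hH.exists_family hab two_pos hsol.continuousOn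
  have hwl : ∀ t ∈ Icc 0 T, ∀ k ≤ 2, l2 a b (w t k) ≤ M := fun t ht k hk =>
    (hw t ht).1.l2_le hab.le hM (by rw [(hw t ht).2]; exact hNorm_le_of_sizeM hsize ht) hk
  have hψL : ∀ t ∈ Icc 0 T, MemLp (ψ t) 2 (vol a b) := fun t ht =>
    memLp_of_continuousOn (hsol.continuousOn t ht) 2
  have hGL : ∀ t ∈ Icc 0 T, MemLp (fun x => G f (ψ t x)) 2 (vol a b) := fun t ht =>
    memLp_of_continuousOn (hA.continuous.comp_continuousOn (hsol.continuousOn t ht)) 2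
  have hsup : ∀ t ∈ Icc 0 T, ∀ y ∈ Icc a b, ‖ψ t y‖ ≤ R := fun t ht y hy => by
    have := (hw t ht).1.norm_le hab two_pos (hwl t ht 0 (by norm_num)) (hwl t ht 1 (by norm_num)) hy
    rw [(hw t ht).2] at this
    linarith
  have hVM := norm_le_ae_of_eLpNorm_top hM (eLpNorm_potential_le_of_sizeM hsize)
  have hdn : ∀ F, ∀ t ∈ Icc 0 T, nrm F (fourierCoef a b (ψt t)) ≤ B₀ := fun F t ht => by
    refine (nrm_fourierCoef_le hab (hd.memLp ht) F).trans ?_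
    have := l2_le_of_eLpNorm_le hM (eLpNorm_deriv_le_of_sizeM hsize ht)
    rw [hB₀]
    gcongr
  have hder : ∀ t ∈ Icc 0 T, ∀ l, HasDerivWithinAt (fun s => fourierCoef a b (ψ s) l)
      (fourierCoef a b (ψt t) l) (Icc 0 T) t := fun t ht l =>
    hd.hasDerivWithinAt hab (w := fun t _ => ψ t) (v := fun t _ => ψt t)
      (fun t ht => ⟨⟨by simp, by simp, fun _ _ => hψL t ht⟩, rfl⟩)
      (fun t ht => ⟨⟨ae_eq_refl _, by simp⟩, fun _ _ => hd.memLp ht⟩) le_rfl ht l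
  have hlip : ∀ F, ∀ s ∈ Icc 0 T, ∀ t ∈ Icc 0 T,
      nrm F (fun l => force a b V f (ψ s) l - force a b V f (ψ t) l) ≤ (M + K) * B₀ * |s - t| := by
    intro F s hs' t ht
    refine (nrm_force_sub_le hab hM hV hVM hK0 hK (hψL s hs') (hψL t ht) (hGL s hs') (hGL t ht)
      (hsup s hs') (hsup t ht) F).trans ?_
    rw [mul_assoc]
    have h1 := l2_time_sub_le hab hψL hder hdn hs' ht
    gcongr
    rwa [div_le_iff₀' hs]
  have heq : ∀ t ∈ Icc 0 T, ∀ l, Complex.I * fourierCoef a b (ψt t) l =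
      (freq a b l : ℂ) ^ 2 * fourierCoef a b (ψ t) l + force a b V f (ψ t) l := by
    intro t ht l
    have hc : ContinuousOn (fun t => fourierCoef a b (ψ t) l) (Icc 0 T) := fun t ht =>
      (hder t ht l).continuousWithinAt
    have hf : ContinuousOn (fun t => force a b V f (ψ t) l) (Icc 0 T) := by
      refine (LipschitzOnWith.of_dist_le_mul (K := ((M + K) * B₀).toNNReal) fun s hs' t ht => ?_).continuousOn
      rw [Real.coe_toNNReal _ (by positivity), dist_eq_norm, Real.dist_eq]
      exact (norm_le_nrm (c := fun l => force a b V f (ψ s) l - force a b V f (ψ t) l)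
        (Finset.mem_singleton_self l)).trans (hlip {l} s hs' t ht)
    have hE : EqOn (fun t => Complex.I * fourierCoef a b (ψt t) l)
        (fun t => (freq a b l : ℂ) ^ 2 * fourierCoef a b (ψ t) l + force a b V f (ψ t) l)
        (Ioc 0 T) := fun t ht =>
      hsol.coef_eq hab hV ht (hw t (Ioc_subset_Icc_self ht)).1 (hw t (Ioc_subset_Icc_self ht)).2
        (hGL t (Ioc_subset_Icc_self ht)) l
    -- Both sides are continuous on [0, T] and agree on (0, T], so the equation extends to t = 0,
    -- where the first step starts.
    exact hE.of_subset_closure ((hd.continuousOn_fourierCoef hab l).const_smul Complex.I)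
      ((hc.const_smul ((freq a b l : ℂ) ^ 2)).add hf) Ioc_subset_Icc_self
      (by rw [closure_Ioc hT.ne]) ht
  refine ⟨⟨hM, hK0, by positivity, hV, hVM, hK, ⟨hder, heq⟩, fun t ht => ?_, hsup, hlip⟩,
    fun t ht F => ?_⟩
  · obtain ⟨W, hW, hW0, h1, h2⟩ := hB (w t) (hw t ht).1 (hwl t ht)
    rw [(hw t ht).2] at hW0
    exact ⟨w t, W, (hw t ht).1, hW, (hw t ht).2, hW0, h1, h2⟩
  · have h0 := (hw t ht).1.nrm_le hab (Nat.zero_le _) F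
    have h1 := (hw t ht).1.nrm_le hab one_le_two F
    simp only [pow_zero, one_mul, pow_one, (hw t ht).2] at h0 h1
    have k0 := hwl t ht 0 (by norm_num)
    have k1 := hwl t ht 1 (by norm_num)
    rw [(hw t ht).2] at k0
    exact ⟨h0.trans (by rw [hB₀]; gcongr), h1.trans (by rw [hB₀]; gcongr)⟩

/-- Distance from a function in `H^m_per` to a trigonometric polynomial. -/
theorem HPer.l2_sub_tpd_le_add (hab : a < b) (hN : 0 < N) (hev : Even N) {w : ℕ → ℝ → ℂ}
    (h : HPer a b m w)
    (hB : ∀ F, nrm F (fun l => (freq a b l : ℂ) ^ m * fourierCoef a b (w 0) l) ≤ B) {k : ℕ}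
    (hk : k ≤ m) (x : ℤ → ℂ) : l2 a b (w k - tpd a b (idx N) x k) ≤ √(b - a) *
      (mesh a b N ^ (m - k) * B +
        nrm (idx N) fun l => (freq a b l : ℂ) ^ k * (fourierCoef a b (w 0) l - x l)) := by
  have hm0 := mesh_pos hab hN
  have hB0 : 0 ≤ B := (nrm_nonneg _ _).trans (hB ∅)
  have h1 := l2_sub_tpd_le hab hN hev h hB hk
  have h2 : (mesh a b N / Real.pi) ^ (m - k) ≤ mesh a b N ^ (m - k) := by
    gcongr
    exact div_le_self hm0.le (by linarith [Real.pi_gt_three])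
  have h3 := l2_add_le (u := w k - tpd a b (idx N) (fourierCoef a b (w 0)) k)
    (v := tpd a b (idx N) (fun l => fourierCoef a b (w 0) l - x l) k)
    ((h.memLp k hk).sub (memLp_tp _ _ _ _)) (memLp_tp _ _ _ _)
  rw [l2_tpd hab] at h3
  have e : (fun y => (w k - tpd a b (idx N) (fourierCoef a b (w 0)) k) y +
      tpd a b (idx N) (fun l => fourierCoef a b (w 0) l - x l) k y) = w k - tpd a b (idx N) x k := by
    ext y
    simp [tpd, tp, mul_sub, sub_mul]
  rw [e] at h3
  refine h3.trans ?_
  rw [mul_add]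
  refine add_le_add (h1.trans ?_) le_rfl
  gcongr

theorem HPer.eLpNorm_sub_tp_le (hab : a < b) (hN : 0 < N) (hev : Even N) {w : ℕ → ℝ → ℂ}
    (h : HPer a b m w)
    (hB : ∀ F, nrm F (fun l => (freq a b l : ℂ) ^ m * fourierCoef a b (w 0) l) ≤ B) (x : ℤ → ℂ)
    {E : ℝ} (hE : nrm (idx N) (fun l => fourierCoef a b (w 0) l - x l) ≤ E) :
    eLpNorm (w 0 - tp a b (idx N) x) 2 (vol a b) ≤
      ENNReal.ofReal (√(b - a) * (mesh a b N ^ m * B + E)) := by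
  have h1 := h.l2_sub_tpd_le_add hab hN hev hB (Nat.zero_le _) x
  simp only [tpd_zero, Nat.sub_zero, pow_zero, one_mul] at h1
  rw [← ofReal_l2 ((h.memLp 0 (Nat.zero_le _)).sub (memLp_tp _ _ _ _))]
  exact ENNReal.ofReal_le_ofReal (h1.trans (by gcongr))

theorem HPer.hNorm_one_sub_tp_le (hab : a < b) (hN : 0 < N) (hev : Even N) (hm : 1 ≤ m)
    {w : ℕ → ℝ → ℂ} (h : HPer a b m w)
    (hB : ∀ F, nrm F (fun l => (freq a b l : ℂ) ^ m * fourierCoef a b (w 0) l) ≤ B) (x : ℤ → ℂ)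
    {E E' : ℝ} (hE : nrm (idx N) (fun l => fourierCoef a b (w 0) l - x l) ≤ E)
    (hE' : nrm (idx N) (fun l => freq a b l * (fourierCoef a b (w 0) l - x l)) ≤ E') :
    hNorm a b 1 (w 0 - tp a b (idx N) x) ≤ ENNReal.ofReal (√(b - a) * (mesh a b N ^ m * B + E) +
      √(b - a) * (mesh a b N ^ (m - 1) * B + E')) := by
  have hB0 : 0 ≤ B := (nrm_nonneg _ _).trans (hB ∅)
  have hE0 := (nrm_nonneg _ _).trans hE
  have hE0' := (nrm_nonneg _ _).trans hE'
  have hm0 := mesh_pos hab hN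
  have hd := (h.mono hm).sub (hPer_tpd hab (idx N) x 1)
  have h1 := (hd.isWeakDerivs hab.le).hNorm_le
  have h2 := h.l2_sub_tpd_le_add hab hN hev hB hm x
  simp only [pow_one] at h2
  simp only [Pi.sub_apply, tpd_zero] at h1
  refine h1.trans ?_
  rw [Finset.sum_range_succ, Finset.sum_range_one, ENNReal.ofReal_add (by positivity) (by positivity)]
  refine add_le_add ?_ ?_
  · simp only [tpd_zero]
    exact h.eLpNorm_sub_tp_le hab hN hev hB x hE
  · have hmm : MemLp (w 1 - tpd a b (idx N) x 1) 2 (vol a b) := hd.memLp 1 le_rfl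
    rw [← ofReal_l2 hmm]
    exact ENNReal.ofReal_le_ofReal (h2.trans (by gcongr))

theorem hNorm_tp_le (hab : a < b) (F : Finset ℤ) (x : ℤ → ℂ) (m : ℕ) :
    hNorm a b m (tp a b F x) ≤ ENNReal.ofReal
      (∑ k ∈ Finset.range (m + 1), √(b - a) * nrm F fun l => (freq a b l : ℂ) ^ k * x l) := by
  have hd := hPer_tpd hab F x m
  have h1 := (hd.isWeakDerivs hab.le).hNorm_le
  rw [tpd_zero] at h1
  rw [ENNReal.ofReal_sum_of_nonneg fun k _ => mul_nonneg (Real.sqrt_nonneg _) (nrm_nonneg _ _)]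
  refine h1.trans (Finset.sum_le_sum fun k hk => ?_)
  rw [← l2_tpd hab]
  exact (ofReal_l2 (hd.memLp k (Nat.lt_succ_iff.1 (Finset.mem_range.1 hk)))).ge

theorem isDiscSol_efp (hab : a < b) (hN : 0 < N) (hev : Even N) (V f : ℝ → ℝ) (ψ₀ : ℝ → ℂ) (τ : ℝ) :
    IsDiscSol a b V f N τ fun n => discreteCoef a b N (efp a b V f ψ₀ τ N n) :=
  ⟨fun n _ hl => discreteCoef_efp_succ hab hN hev V f ψ₀ τ n hl⟩

theorem SolData.nrm_initial_le {d : ℝ → ℤ → ℂ} (h : SolData a b T V f m M R K B Λ ψ d) (hab : a < b)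
    (hN : 0 < N) (hev : Even N) (hm : 1 ≤ m) (hT : 0 ≤ T) (h0 : ∀ x ∈ Icc a b, ψ 0 x = ψ₀ x)
    (τ : ℝ) : nrm (idx N) (fun l => fourierCoef a b (ψ 0) l -
      discreteCoef a b N (efp a b V f ψ₀ τ N 0) l) ≤ 2 * mesh a b N ^ m * B := by
  obtain ⟨w, W, hw, -, hw0, -, hB, -⟩ := h.smooth 0 (left_mem_Icc.2 hT)
  refine le_trans (le_of_eq (nrm_congr fun l _ => ?_))
    (nrm_discreteCoef_sub_fourierCoef_le hab hN hev hm hw hB)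
  rw [norm_sub_rev, hw0]
  congr 2
  refine discreteCoef_congr (fun j => ?_) l
  simp only [efp, gridValues]
  exact (h0 _ (node_mem_Icc hab hN j.2.le)).symm

end estimates

/-! ### First order convergence for `H²` solutions -/

section firstOrder

variable {a b T : ℝ} {V f : ℝ → ℝ} {N m : ℕ} {M R K B Λ τ B₀ C₀ C₂ : ℝ} {ψ₀ : ℝ → ℂ}
  {ψ ψt : ℝ → ℝ → ℂ} {d : ℝ → ℤ → ℂ}

/-- What the stability analysis provides about the Fourier coefficients `x` of the numerical
solution and `c` of the exact solution. -/
structure StableAt (a b R B₀ C₀ C₂ τ : ℝ) (N : ℕ) (c x : ℤ → ℂ) : Prop where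
  sup_le : ∀ y ∈ Icc a b, ‖tp a b (idx N) x y‖ ≤ R
  nrm_sq_freq_le : nrm (idx N) (fun l => (freq a b l : ℂ) ^ 2 * x l) ≤ C₂
  nrm_le : nrm (idx N) x ≤ B₀ + 1
  error_le : nrm (idx N) (fun l => c l - x l) ≤ C₀ * (τ + mesh a b N ^ 2)

/-- C₀ and C₂ are known in advance from M, K, B, Λ, B₀ and T. The smallness condition of the
bootstrap thus becomes a pair of separate thresholds on τ and h. -/
theorem SolData.exists_stable (hab : a < b) (hT : 0 < T) (hM : 0 ≤ M) (hK : 0 ≤ K) (hΛ : 0 ≤ Λ)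
    (hB : 0 ≤ B) (hB₀ : 0 ≤ B₀) (hR : √(2 * B₀ ^ 2 + 2 * (b - a) ^ 2 * B₀ ^ 2) + 1 ≤ R) :
    ∃ τ₀ > (0 : ℝ), ∃ h₀ > (0 : ℝ), τ₀ ≤ 1 ∧ h₀ ≤ 1 ∧ ∃ C₀ C₂ : ℝ, 0 ≤ C₀ ∧ 0 ≤ C₂ ∧
      ∀ (V : ℝ → ℝ) (ψ₀ : ℝ → ℂ) (ψ : ℝ → ℝ → ℂ) (d : ℝ → ℤ → ℂ),
        SolData a b T V f 2 M R K B Λ ψ d → (∀ x ∈ Icc a b, ψ 0 x = ψ₀ x) →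
        (∀ t ∈ Icc 0 T, ∀ F, nrm F (fourierCoef a b (ψ t)) ≤ B₀ ∧
          nrm F (fun l => freq a b l * fourierCoef a b (ψ t) l) ≤ B₀) →
        ∀ τ : ℝ, 0 < τ → τ < τ₀ → ∀ N : ℕ, 0 < N → Even N → mesh a b N < h₀ → ∀ n : ℕ, n * τ ≤ T →
          StableAt a b R B₀ C₀ C₂ τ N (fourierCoef a b (ψ (n * τ)))
            (discreteCoef a b N (efp a b V f ψ₀ τ N n)) := by
  obtain ⟨C₀, hC₀⟩ : ∃ C₀, C₀ = Real.exp ((M + K) * T) * (2 * B + T * ((M + 2 * K + 2) * B + Λ)) :=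
    ⟨_, rfl⟩
  obtain ⟨C₂, hC₂⟩ : ∃ C₂, C₂ = Real.exp ((M + K) * T) * (B + 2 * Real.pi ^ 2 * B + (M + K) * (B₀ + 1)) +
      (M + K) * (B₀ + 1) := ⟨_, rfl⟩
  have hC₀0 : 0 ≤ C₀ := by rw [hC₀]; positivity
  have hC₂0 : 0 ≤ C₂ := by rw [hC₂]; positivity
  -- With τ₀ = h₀² = 1/(2(Q + 1)), both τ and h² contribute at most 1/2 to the smallness condition
  -- Q(τ + h²) ≤ 1.
  obtain ⟨Q, hQ⟩ : ∃ Q, Q = C₀ * (2 + 2 * (b - a) ^ 2 * (C₂ + B)) := ⟨_, rfl⟩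
  have hQ0 : 0 ≤ Q := by rw [hQ]; positivity
  have hτ₀ : 0 < 1 / (2 * (Q + 1)) := by positivity
  have hτ₁ : 1 / (2 * (Q + 1)) ≤ 1 := by
    rw [div_le_one (by positivity)]; linarith
  refine ⟨1 / (2 * (Q + 1)), hτ₀, √(1 / (2 * (Q + 1))), Real.sqrt_pos.2 hτ₀, hτ₁,
    Real.sqrt_le_one.2 hτ₁, C₀, C₂, hC₀0, hC₂0, fun V ψ₀ ψ d h h0 hB₀' τ hτ hτlt N hN hev hh n hn => ?_⟩
  have hm0 := mesh_pos hab hN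
  have hh2 : mesh a b N ^ 2 ≤ 1 / (2 * (Q + 1)) := by
    rw [← Real.sq_sqrt hτ₀.le]
    gcongr
  have hsmall : C₀ * (τ + mesh a b N ^ 2) * (2 + 2 * (b - a) ^ 2 * (C₂ + B)) ≤ 1 := by
    calc _ = Q * (τ + mesh a b N ^ 2) := by rw [hQ]; ring
      _ ≤ Q * (1 / (2 * (Q + 1)) + 1 / (2 * (Q + 1))) := by gcongr
      _ ≤ 1 := by field_simp; linarith
  obtain ⟨h1, h2, h3, h4⟩ := h.stability hab hN hev hτ hT.le (isDiscSol_efp hab hN hev V f ψ₀ τ)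
    (h.nrm_initial_le hab hN hev one_le_two hT.le h0 τ) (fun t ht => hB₀' t ht (idx N)) hR hC₀ hC₂
    hsmall hn
  exact ⟨h1, h2, h3, h4⟩

/-- Interpolation between the L² error C₀(τ + h²) and the bounded H² error C₂ + B; the square root
gives √τ + h. -/
theorem StableAt.nrm_freq_sub_le {c x : ℤ → ℂ} (h : StableAt a b R B₀ C₀ C₂ τ N c x) (hab : a < b)
    (hN : 0 < N) (hτ : 0 ≤ τ) (hC₀ : 0 ≤ C₀)
    (hB : nrm (idx N) (fun l => (freq a b l : ℂ) ^ 2 * c l) ≤ B) :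
    nrm (idx N) (fun l => freq a b l * (c l - x l)) ≤ √(C₀ * (C₂ + B)) * (√τ + mesh a b N) := by
  have hm0 := mesh_pos hab hN
  have hB0 := (nrm_nonneg _ _).trans hB
  have hC₂ := (nrm_nonneg _ _).trans h.nrm_sq_freq_le
  have h1 := nrm_sq_le_mul (F := idx N) (c := fun l => c l - x l) (freq a b)
  have h2 : nrm (idx N) (fun l => ((freq a b l ^ 2 : ℝ) : ℂ) * (c l - x l)) ≤ C₂ + B := by
    simp only [Complex.ofReal_pow, mul_sub]
    refine (nrm_sub_le _ _ _).trans ?_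
    linarith [h.nrm_sq_freq_le]
  have h3 : nrm (idx N) (fun l => freq a b l * (c l - x l)) ^ 2 ≤
      C₀ * (τ + mesh a b N ^ 2) * (C₂ + B) :=
    h1.trans (mul_le_mul h.error_le h2 (nrm_nonneg _ _) (by positivity))
  refine abs_le_of_sq_le_sq' (h3.trans ?_) (by positivity) |>.2
  rw [mul_pow, Real.sq_sqrt (by positivity)]
  have h4 : τ + mesh a b N ^ 2 ≤ (√τ + mesh a b N) ^ 2 := by
    have : 0 ≤ √τ * mesh a b N := by positivity
    nlinarith [Real.sq_sqrt hτ]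
  calc C₀ * (τ + mesh a b N ^ 2) * (C₂ + B) = C₀ * (C₂ + B) * (τ + mesh a b N ^ 2) := by ring
    _ ≤ _ := by gcongr

theorem StableAt.hNorm_two_le {c x : ℤ → ℂ} (h : StableAt a b R B₀ C₀ C₂ τ N c x) (hab : a < b) :
    hNorm a b 2 (tp a b (idx N) x) ≤
      ENNReal.ofReal (√(b - a) * ((B₀ + 1) + √((B₀ + 1) * C₂) + C₂)) := by
  refine (hNorm_tp_le hab (idx N) x 2).trans (ENNReal.ofReal_le_ofReal ?_)
  rw [Finset.sum_range_succ, Finset.sum_range_succ, Finset.sum_range_one, ← mul_add, ← mul_add]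
  have h1 := nrm_sq_le_mul (F := idx N) (c := x) (freq a b)
  simp only [Complex.ofReal_pow] at h1
  have h0 := (nrm_nonneg _ _).trans h.nrm_le
  have h2 : nrm (idx N) (fun l => freq a b l * x l) ≤ √((B₀ + 1) * C₂) :=
    Real.le_sqrt_of_sq_le (h1.trans (mul_le_mul h.nrm_le h.nrm_sq_freq_le (nrm_nonneg _ _) h0))
  simp only [pow_zero, one_mul, pow_one]
  gcongr
  · exact h.nrm_le
  · exact h.nrm_sq_freq_le

/-- The estimates for a solution in `H²_per` that follow from stability. -/
theorem SolData.estimates (h : SolData a b T V f 2 M R K B Λ ψ d) (hab : a < b) (hN : 0 < N)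
    (hev : Even N) (hτ : 0 < τ) (hτ1 : τ ≤ 1) (hh1 : mesh a b N ≤ 1) (hC₀ : 0 ≤ C₀) (hC₂ : 0 ≤ C₂)
    {t : ℝ} (ht : t ∈ Icc 0 T) {x : ℤ → ℂ} (hB₀ : 0 ≤ B₀) (hB : 0 ≤ B)
    (hs : StableAt a b R B₀ C₀ C₂ τ N (fourierCoef a b (ψ t)) x) {C : ℝ}
    (hC : C = √(b - a) * (B + C₀) + √(b - a) * ((B₀ + 1) + √((B₀ + 1) * C₂) + C₂) +
      √(b - a) * (B + √(C₀ * (C₂ + B)))) :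
    eLpNorm (ψ t - tp a b (idx N) x) 2 (vol a b) ≤ ENNReal.ofReal (C * (τ + mesh a b N ^ 2)) ∧
      hNorm a b 2 (tp a b (idx N) x) ≤ ENNReal.ofReal C ∧
      hNorm a b 1 (ψ t - tp a b (idx N) x) ≤ ENNReal.ofReal (C * (√τ + mesh a b N)) := by
  have hm0 := mesh_pos hab hN
  obtain ⟨w, W, hw, -, hw0, -, hB', -⟩ := h.smooth t ht
  have hE := hs.error_le
  have hE' := hs.nrm_freq_sub_le hab hN hτ.le hC₀ (h.nrm_freq_sq_le ht (idx N))
  rw [← hw0] at hE hE' ⊢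
  have p1 : 0 ≤ √(b - a) * (B + C₀) := by positivity
  have p2 : 0 ≤ √(b - a) * ((B₀ + 1) + √((B₀ + 1) * C₂) + C₂) := by positivity
  have p3 : 0 ≤ √(b - a) * (B + √(C₀ * (C₂ + B))) := by positivity
  have q1 : √(b - a) * (mesh a b N ^ 2 * B + C₀ * (τ + mesh a b N ^ 2)) ≤
      √(b - a) * (B + C₀) * (τ + mesh a b N ^ 2) := by
    have : 0 ≤ √(b - a) * (B * τ) := by positivity
    linarith
  refine ⟨(hw.eLpNorm_sub_tp_le hab hN hev hB' x hE).trans (ENNReal.ofReal_le_ofReal ?_),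
    (hs.hNorm_two_le hab).trans (ENNReal.ofReal_le_ofReal (by linarith)),
    (hw.hNorm_one_sub_tp_le hab hN hev one_le_two hB' x hE hE').trans (ENNReal.ofReal_le_ofReal ?_)⟩
  · refine q1.trans ?_
    gcongr
    linarith
  -- Here τ ≤ 1 and h ≤ 1 are used, so that the L² part of the H¹ norm is absorbed by the seminorm
  -- rate.
  · have r1 : τ + mesh a b N ^ 2 ≤ √τ + mesh a b N := by
      have h1 : τ ≤ √τ := Real.le_sqrt_of_sq_le (by nlinarith)
      have h2 : mesh a b N ^ 2 ≤ mesh a b N := by nlinarith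
      linarith
    have r2 : √(b - a) * (B + C₀) * (τ + mesh a b N ^ 2) ≤
      √(b - a) * (B + C₀) * (√τ + mesh a b N) := by gcongr
    have r3 : √(b - a) * (mesh a b N ^ (2 - 1) * B + √(C₀ * (C₂ + B)) * (√τ + mesh a b N)) ≤
        √(b - a) * (B + √(C₀ * (C₂ + B))) * (√τ + mesh a b N) := by
      have : 0 ≤ √(b - a) * (B * √τ) := by positivity
      simp only [Nat.add_one_sub_one, pow_one]
      linarith
    have r4 : 0 ≤ √(b - a) * ((B₀ + 1) + √((B₀ + 1) * C₂) + C₂) * (√τ + mesh a b N) := by positivity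
    rw [hC]
    linarith

end firstOrder

/-! ### Estimates in `H¹` -/

section weighted

variable {a b T : ℝ} {V f : ℝ → ℝ} {N m : ℕ} {M R K B Λ S : ℝ} {ψ ψt φ : ℝ → ℝ → ℂ}

/-- Near each time the norm is controlled by continuity, and finitely many neighbourhoods cover [0,
T]. The resulting bound depends on the solution, which is allowed for the constant of part (ii). -/
theorem exists_hNorm_bound (h : ∀ t ∈ Icc 0 T, MemW a b m 2 (φ t) ∧
    Tendsto (fun s => hNorm a b m (φ s - φ t)) (𝓝[Icc 0 T] t) (𝓝 0)) :
    ∃ S : ℝ, 0 ≤ S ∧ ∀ t ∈ Icc 0 T, hNorm a b m (φ t) ≤ ENNReal.ofReal S := by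
  refine isCompact_Icc.induction_on (p := fun U => ∃ S : ℝ, 0 ≤ S ∧
    ∀ t ∈ U, hNorm a b m (φ t) ≤ ENNReal.ofReal S) ⟨0, le_rfl, by simp⟩
    (fun U U' hU ⟨S, hS, h⟩ => ⟨S, hS, fun t ht => h t (hU ht)⟩)
    (fun U U' ⟨S, hS, h⟩ ⟨S', hS', h'⟩ => ⟨S + S', by positivity, fun t ht => ?_⟩) fun t ht => ?_
  · rcases ht with ht | ht
    · exact (h t ht).trans (ENNReal.ofReal_le_ofReal (by linarith))
    · exact (h' t ht).trans (ENNReal.ofReal_le_ofReal (by linarith))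
  obtain ⟨⟨w, hw, hwL⟩, hc⟩ := h t ht
  refine ⟨_, inter_mem self_mem_nhdsWithin (hc.eventually_le_const zero_lt_one),
    (∑ k ∈ Finset.range (m + 1), (1 + eLpNorm (w k) 2 (vol a b))).toReal, ENNReal.toReal_nonneg,
    fun s hs => ?_⟩
  obtain ⟨w', hw', hwL'⟩ := (h s hs.1).1
  have hfin : ∑ k ∈ Finset.range (m + 1), (1 + eLpNorm (w k) 2 (vol a b)) ≠ ⊤ := by
    refine ENNReal.sum_ne_top.2 fun k hk => ENNReal.add_ne_top.2 ⟨ENNReal.one_ne_top, ?_⟩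
    exact (hwL k (Nat.lt_succ_iff.1 (Finset.mem_range.1 hk))).eLpNorm_ne_top
  rw [ENNReal.ofReal_toReal hfin]
  refine hw'.hNorm_le.trans (Finset.sum_le_sum fun k hk => ?_)
  have hk' : k ≤ m := Nat.lt_succ_iff.1 (Finset.mem_range.1 hk)
  have h1 := ((hw'.sub hw).eLpNorm_le_hNorm hk').trans hs.2
  have h2 := eLpNorm_add_le ((hwL' k hk').sub (hwL k hk')).1 (hwL k hk').1 one_le_two
  rw [sub_add_cancel] at h2
  exact h2.trans (add_le_add h1 le_rfl)

theorem ContHper.exists_bound (h : ContHper a b T m ψ) :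
    ∃ S : ℝ, 0 ≤ S ∧ ∀ t ∈ Icc 0 T, hNorm a b m (ψ t) ≤ ENNReal.ofReal S :=
  exists_hNorm_bound fun t ht => ⟨by
    obtain ⟨w, hw, hwL, -⟩ := (h t ht).1
    exact ⟨w, hw, hwL⟩, (h t ht).2⟩

theorem ContDiffH.exists_bound (h : ContDiffH a b T m ψ ψt) :
    ∃ S : ℝ, 0 ≤ S ∧ ∀ t ∈ Icc 0 T, hNorm a b m (ψt t) ≤ ENNReal.ofReal S :=
  exists_hNorm_bound fun t ht => ⟨(h t ht).2.1, (h t ht).2.2.1⟩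

/-- Multiplication by a potential in `H¹_per` is bounded on `H¹_per`. -/
theorem exists_potential_bound (hab : a < b) (hV : MemHper a b 1 fun x => (V x : ℂ)) :
    ∃ C : ℝ, 0 ≤ C ∧ ∀ w, HPer a b 1 w → ∀ F,
      nrm F (fun l => freq a b l * fourierCoef a b (fun x => (V x : ℂ) * w 0 x) l) ≤
        C * (l2 a b (w 0) + l2 a b (w 1)) := by
  have hb : 0 < b - a := sub_pos.2 hab
  have hs : 0 < √(b - a) := Real.sqrt_pos.2 hb
  obtain ⟨v, hv, hv0⟩ := hV.exists_hPer hab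
  have hvc := hv.continuousOn hab.le one_pos
  obtain ⟨A, hA⟩ := isCompact_Icc.exists_bound_of_continuousOn hvc
  have hA0 : 0 ≤ A := (norm_nonneg _).trans (hA a (left_mem_Icc.2 hab.le))
  obtain ⟨Q, hQ⟩ : ∃ Q, Q = √(2 / (b - a)) + √(2 * (b - a)) := ⟨_, rfl⟩
  have hQ0 : 0 ≤ Q := by rw [hQ]; positivity
  have hv1 := l2_nonneg a b (v 1)
  refine ⟨(A + Q * l2 a b (v 1)) / √(b - a), by positivity, fun w hw F => ?_⟩
  have hwc := hw.continuousOn hab.le one_pos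
  have h0 := l2_nonneg a b (w 0)
  have h1 := l2_nonneg a b (w 1)
  have hsup : ∀ y ∈ Icc a b, ‖w 0 y‖ ≤ Q * (l2 a b (w 0) + l2 a b (w 1)) := fun y hy => by
    refine abs_le_of_sq_le_sq' (((hw.prim 0 one_pos).norm_sq_le hab (hw.memLp 1 le_rfl) hy).trans ?_)
      (by positivity) |>.2
    have e1 := Real.sq_sqrt (by positivity : 0 ≤ 2 / (b - a))
    have e2 := Real.sq_sqrt (by positivity : 0 ≤ 2 * (b - a))
    calc _ = (√(2 / (b - a)) * l2 a b (w 0)) ^ 2 + (√(2 * (b - a)) * l2 a b (w 1)) ^ 2 := by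
          rw [mul_pow, mul_pow, e1, e2]
      _ ≤ (√(2 / (b - a)) * l2 a b (w 0) + √(2 * (b - a)) * l2 a b (w 1)) ^ 2 := by
          have : 0 ≤ √(2 / (b - a)) * l2 a b (w 0) * (√(2 * (b - a)) * l2 a b (w 1)) := by positivity
          nlinarith
      _ ≤ (Q * (l2 a b (w 0) + l2 a b (w 1))) ^ 2 := by
          have p1 : 0 ≤ √(2 / (b - a)) * l2 a b (w 1) := by positivity
          have p2 : 0 ≤ √(2 * (b - a)) * l2 a b (w 0) := by positivity
          gcongr
          rw [hQ]
          linarith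
  have hP := (hv.prim 0 one_pos).mul hab.le (hw.prim 0 one_pos)
  have m1 : MemLp (fun x => v 1 x * w 0 x) 2 (vol a b) :=
    (memLp_of_continuousOn hwc ⊤).mul' (hv.memLp 1 le_rfl)
  have m2 : MemLp (fun x => v 0 x * w 1 x) 2 (vol a b) :=
    (hw.memLp 1 le_rfl).mul' (memLp_of_continuousOn hvc ⊤)
  have hper : v 0 a * w 0 a = v 0 b * w 0 b := by rw [hv.per 0 one_pos, hw.per 0 one_pos]
  have e1 : l2 a b (fun x => v 1 x * w 0 x) ≤ Q * (l2 a b (w 0) + l2 a b (w 1)) * l2 a b (v 1) := by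
    refine l2_le_mul (by positivity) (hv.memLp 1 le_rfl) (ae_vol_of_forall_Icc fun y hy => ?_)
    rw [norm_mul, mul_comm]
    exact mul_le_mul_of_nonneg_right (hsup y hy) (norm_nonneg _)
  have e2 : l2 a b (fun x => v 0 x * w 1 x) ≤ A * l2 a b (w 1) := by
    refine l2_le_mul hA0 (hw.memLp 1 le_rfl) (ae_vol_of_forall_Icc fun y hy => ?_)
    rw [norm_mul]
    exact mul_le_mul_of_nonneg_right (hA y hy) (norm_nonneg _)
  have e3 : nrm F (fun l => freq a b l * fourierCoef a b (fun x => (V x : ℂ) * w 0 x) l) =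
      nrm F (fourierCoef a b fun x => v 1 x * w 0 x + v 0 x * w 1 x) := by
    refine nrm_congr fun l _ => ?_
    rw [hP.fourierCoef_eq hab hper, norm_mul, norm_mul, norm_mul, Complex.norm_I, one_mul]
    congr 2
    exact fourierCoef_congr_ae hab.le (hv0.mono fun x hx => by simp only [hx]) l
  rw [e3, div_mul_eq_mul_div]
  refine (nrm_fourierCoef_le hab (m1.add m2) F).trans ?_
  gcongr
  refine (l2_add_le m1 m2).trans ((add_le_add e1 e2).trans ?_)
  have : 0 ≤ A * l2 a b (w 0) := by positivity
  linarith

theorem MemW.of_hPer (hab : a ≤ b) {w : ℕ → ℝ → ℂ} (hw : HPer a b m w) : MemW a b m 2 (w 0) :=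
  ⟨w, hw.isWeakDerivs hab, hw.memLp⟩

theorem HPer.hNorm_le (hab : a ≤ b) {w : ℕ → ℝ → ℂ} (hw : HPer a b m w)
    (hS : ∀ k ≤ m, l2 a b (w k) ≤ S) : hNorm a b m (w 0) ≤ ENNReal.ofReal ((m + 1) * S) := by
  refine (hw.isWeakDerivs hab).hNorm_le.trans ((Finset.sum_le_sum (g := fun _ => ENNReal.ofReal S)
    fun k hk => ?_).trans (le_of_eq ?_))
  · have hk' : k ≤ m := Nat.lt_succ_iff.1 (Finset.mem_range.1 hk)
    rw [← ofReal_l2 (hw.memLp k hk')]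
    exact ENNReal.ofReal_le_ofReal (hS k hk')
  · rw [Finset.sum_const, Finset.card_range, nsmul_eq_mul, ENNReal.ofReal_mul (by positivity)]
    congr 1
    rw [← Nat.cast_succ, ENNReal.ofReal_natCast]

theorem HPer.hNorm_one_le (hab : a ≤ b) {w : ℕ → ℝ → ℂ} (hw : HPer a b 1 w) :
    hNorm a b 1 (w 0) ≤ ENNReal.ofReal (l2 a b (w 0) + l2 a b (w 1)) := by
  refine (hw.isWeakDerivs hab).hNorm_le.trans (le_of_eq ?_)
  rw [Finset.sum_range_succ, Finset.sum_range_one, ENNReal.ofReal_add (l2_nonneg _ _ _)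
    (l2_nonneg _ _ _), ofReal_l2 (hw.memLp 0 zero_le_one), ofReal_l2 (hw.memLp 1 le_rfl)]

/-- Assumption (B) in Fourier variables, on periodic functions. -/
theorem AssumptionB.exists_bound (hab : a < b) (hB : AssumptionB a b f) (hC : AssumptionC a b 2 f)
    (hA : AssumptionA f) (hS : 0 ≤ S) : ∃ C : ℝ, 0 ≤ C ∧ ∀ w w', HPer a b 3 w → HPer a b 3 w' →
      (∀ k ≤ 3, l2 a b (w k) ≤ S) → (∀ k ≤ 3, l2 a b (w' k) ≤ S) → ∀ F,
      nrm F (fun l => freq a b l * (fourierCoef a b (fun x => G f (w 0 x)) l -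
        fourierCoef a b (fun x => G f (w' 0 x)) l)) ≤
          C * (l2 a b (w 0 - w' 0) + l2 a b (w 1 - w' 1)) := by
  have hb : 0 < b - a := sub_pos.2 hab
  have hs : 0 < √(b - a) := Real.sqrt_pos.2 hb
  -- An H³ norm is at most the sum of four L² norms, each at most S.
  obtain ⟨C, hC'⟩ := hB ((3 + 1) * S).toNNReal
  refine ⟨C / √(b - a), by positivity, fun w w' hw hw' hwS hwS' F => ?_⟩
  have hG : ∀ {w : ℕ → ℝ → ℂ}, HPer a b 3 w → ∃ W, HPer a b 2 W ∧ W 0 = fun x => G f (w 0 x) :=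
    fun {w} hw => (hC _ ((hw.mono (by norm_num)).memHper hab.le)).exists_hPer_eq hab two_pos
      (hA.continuous.comp_continuousOn (hw.continuousOn hab.le three_pos))
  obtain ⟨W, hW, hW0⟩ := hG hw
  obtain ⟨W', hW', hW0'⟩ := hG hw'
  have h3 := hw.hNorm_le hab.le hwS
  have h2 := (hw'.mono (by norm_num : 2 ≤ 3)).hNorm_le hab.le fun k hk => hwS' k (by omega)
  have h2' : hNorm a b 2 (w' 0) ≤ ENNReal.ofReal ((3 + 1) * S) :=
    h2.trans (ENNReal.ofReal_le_ofReal (by push_cast; linarith))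
  have key := hC' (w 0) (w' 0) (MemW.of_hPer hab.le hw) (MemW.of_hPer hab.le (hw'.mono (by norm_num)))
    (by exact_mod_cast h3) h2'
  have hd := (hw.sub hw').mono (by norm_num : 1 ≤ 3)
  have hdW := (hW.sub hW').mono one_le_two
  have h1 := key.trans (mul_le_mul_right (hd.hNorm_one_le hab.le) (C : ℝ≥0∞))
  have h0 : l2 a b (W 1 - W' 1) ≤ C * (l2 a b (w 0 - w' 0) + l2 a b (w 1 - w' 1)) := by
    refine l2_le_of_eLpNorm_le (mul_nonneg C.coe_nonneg (add_nonneg (l2_nonneg _ _ _) (l2_nonneg _ _ _))) ?_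
    rw [ENNReal.ofReal_mul C.coe_nonneg, ENNReal.ofReal_coe_nnreal]
    have e : (fun x => G f (w 0 x) - G f (w' 0 x)) = (W - W') 0 := by
      ext x; simp [hW0, hW0']
    rw [e] at h1
    exact ((hdW.isWeakDerivs hab.le).eLpNorm_le_hNorm le_rfl).trans h1
  have h4 := hdW.nrm_le hab le_rfl F
  rw [div_mul_eq_mul_div]
  refine le_trans (le_of_eq (nrm_congr fun l _ => ?_)) (h4.trans (div_le_div_of_nonneg_right h0 hs.le))
  rw [pow_one, ← hW0, ← hW0', ← fourierCoef_sub hab.le (hW.memLp 0 zero_le_two)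
    (hW'.memLp 0 zero_le_two)]
  rfl

/-- Assumption (B') in Fourier variables. -/
theorem AssumptionB'.exists_bound (hab : a < b) (hB : AssumptionB' a b f) (S : ℝ) :
    ∃ C : ℝ, 0 ≤ C ∧ ∀ N : ℕ, 0 < N → Even N → ∀ x y : ℤ → ℂ,
      hNorm a b 3 (tp a b (idx N) x) ≤ ENNReal.ofReal S →
      hNorm a b 2 (tp a b (idx N) y) ≤ ENNReal.ofReal S →
      nrm (idx N) (fun l => freq a b l * (
        discreteCoef a b N (gridValues a b N fun t => G f (tp a b (idx N) x t)) l -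
        discreteCoef a b N (gridValues a b N fun t => G f (tp a b (idx N) y t)) l)) ≤
      C * (nrm (idx N) (fun l => x l - y l) + nrm (idx N) fun l => freq a b l * (x l - y l)) := by
  have hb : 0 < b - a := sub_pos.2 hab
  have hs : 0 < √(b - a) := Real.sqrt_pos.2 hb
  obtain ⟨C, hC⟩ := hB S.toNNReal
  refine ⟨C, C.coe_nonneg, fun N hN hev x y hx hy => ?_⟩
  have hmem : ∀ x : ℤ → ℂ, tp a b (idx N) x ∈ XN a b N := fun x => by
    have : tp a b (idx N) x = ∑ l ∈ idx N, x l • mode a b l := by ext; simp [tp]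
    rw [this]
    exact Submodule.sum_mem _ fun l hl => Submodule.smul_mem _ _
      (Submodule.subset_span ⟨l, hl, rfl⟩)
  have key := hC N hN hev _ (hmem x) _ (hmem y) hx hy
  have e1 : tp a b (idx N) x - tp a b (idx N) y = tpd a b (idx N) (fun l => x l - y l) 0 := by
    ext t; simp [tpd, tp, sub_mul]
  have h1 := (hPer_tpd hab (idx N) (fun l => x l - y l) 1).hNorm_one_le hab.le
  rw [e1] at key
  have h2 := key.trans (mul_le_mul_right h1 (C : ℝ≥0∞))
  rw [interp_eq_tp, ← tpd_zero] at h2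
  have h3 := ((hPer_tpd hab (idx N) (discreteCoef a b N (gridValues a b N fun t =>
    G f (tp a b (idx N) x t) - G f (tp a b (idx N) y t))) 1).isWeakDerivs hab.le).eLpNorm_le_hNorm
      le_rfl |>.trans h2
  rw [← ENNReal.ofReal_coe_nnreal, ← ENNReal.ofReal_mul C.coe_nonneg] at h3
  have h4 := l2_le_of_eLpNorm_le (mul_nonneg C.coe_nonneg (add_nonneg (l2_nonneg _ _ _) (l2_nonneg _ _ _))) h3
  simp only [l2_tpd hab, pow_zero, one_mul, pow_one] at h4
  rw [← mul_add, mul_left_comm] at h4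
  refine le_trans (le_of_eq (nrm_congr fun l _ => ?_)) (le_of_mul_le_mul_left h4 hs)
  rw [← discreteCoef_sub]
  rfl

end weighted

/-! ### Optimal `H¹` convergence for `H³` solutions -/

section secondOrder

variable {a b T : ℝ} {V f : ℝ → ℝ} {N m : ℕ} {M R K B Λ S τ B₀ C₀ C₂ CV CB CI D : ℝ} {ψ₀ : ℝ → ℂ}
  {ψ ψt : ℝ → ℝ → ℂ} {d : ℝ → ℤ → ℂ} {x : ℤ → ℂ}

/-- Truncating the Fourier series increases no L² norm of a derivative, so the projection inherits
the H^m bound needed to apply (B'). -/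
theorem HPer.hNorm_tp_le (hab : a < b) {w : ℕ → ℝ → ℂ} (hw : HPer a b m w)
    (hS : ∀ k ≤ m, l2 a b (w k) ≤ S) (F : Finset ℤ) :
    hNorm a b m (tp a b F (fourierCoef a b (w 0))) ≤ ENNReal.ofReal ((m + 1) * S) := by
  have hs : 0 < √(b - a) := Real.sqrt_pos.2 (sub_pos.2 hab)
  rw [← tpd_zero]
  refine (hPer_tpd hab F _ m).hNorm_le hab.le fun k hk => ?_
  rw [l2_tpd hab]
  have := hw.nrm_le hab hk F
  rw [le_div_iff₀' hs] at this
  exact this.trans (hS k hk)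

/-- Consistency of the discretized force in the `H¹` seminorm. -/
theorem nrm_freq_force_sub_discForce_le (hab : a < b) (hN : 0 < N) (hev : Even N)
    (hV : MemLp V ∞ (vol a b)) (hK : 0 ≤ K) (hh : mesh a b N ≤ 1)
    (hL : ∀ z₁ z₂ : ℂ, ‖z₁‖ ≤ R → ‖z₂‖ ≤ R → ‖G f z₁ - G f z₂‖ ≤ K * ‖z₁ - z₂‖) (hCV : 0 ≤ CV)
    (hpot : ∀ w, HPer a b 1 w → ∀ F, nrm F (fun l => freq a b l *
      fourierCoef a b (fun x => (V x : ℂ) * w 0 x) l) ≤ CV * (l2 a b (w 0) + l2 a b (w 1)))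
    {w W : ℕ → ℝ → ℂ} (hw : HPer a b 3 w) (hW : HPer a b 3 W) (hWw : W 0 = fun y => G f (w 0 y))
    (hB : ∀ F, nrm F (fun l => (freq a b l : ℂ) ^ 3 * fourierCoef a b (w 0) l) ≤ B)
    (hB' : ∀ F, nrm F (fun l => (freq a b l : ℂ) ^ 3 * fourierCoef a b (W 0) l) ≤ B)
    (hwR : ∀ y ∈ Icc a b, ‖w 0 y‖ ≤ R)
    (hcR : ∀ t ∈ Icc a b, ‖tp a b (idx N) (fourierCoef a b (w 0)) t‖ ≤ R)
    (hint : nrm (idx N) (fun l => freq a b l * (discreteCoef a b N (gridValues a b N fun t =>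
        G f (tp a b (idx N) (fourierCoef a b (w 0)) t)) l -
        discreteCoef a b N (gridValues a b N fun t => G f (tp a b (idx N) x t)) l)) ≤
      CI * (nrm (idx N) (fun l => fourierCoef a b (w 0) l - x l) +
        nrm (idx N) fun l => freq a b l * (fourierCoef a b (w 0) l - x l))) :
    nrm (idx N) (fun l => freq a b l * (force a b V f (w 0) l - discForce a b V f N x l)) ≤
      (CV * √(b - a) + CI) * (nrm (idx N) (fun l => fourierCoef a b (w 0) l - x l) +
        nrm (idx N) fun l => freq a b l * (fourierCoef a b (w 0) l - x l)) +
      (2 * (CV * √(b - a)) + 2 * Real.pi * (1 + K)) * B * mesh a b N ^ 2 := by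
  have hm0 := mesh_pos hab hN
  have hB0 : 0 ≤ B := (nrm_nonneg _ _).trans (hB ∅)
  have hw0 := hw.memLp 0 (by norm_num)
  have hW0 : MemLp (fun y => G f (w 0 y)) 2 (vol a b) := hWw ▸ hW.memLp 0 (by norm_num)
  obtain ⟨E, hE⟩ : ∃ E, E = nrm (idx N) (fun l => fourierCoef a b (w 0) l - x l) := ⟨_, rfl⟩
  obtain ⟨E', hE'⟩ : ∃ E', E' = nrm (idx N) fun l => freq a b l * (fourierCoef a b (w 0) l - x l) :=
    ⟨_, rfl⟩
  rw [← hE, ← hE'] at hint ⊢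
  have hd := (hw.mono (by norm_num : 1 ≤ 3)).sub (hPer_tpd hab (idx N) x 1)
  have p1 : nrm (idx N) (fun l => freq a b l * (fourierCoef a b (fun y => (V y : ℂ) * w 0 y) l -
      fourierCoef a b (fun y => (V y : ℂ) * tp a b (idx N) x y) l)) ≤
      CV * (√(b - a) * (mesh a b N ^ 2 * B + E) + √(b - a) * (mesh a b N ^ 2 * B + E')) := by
    have h0 := hw.l2_sub_tpd_le_add hab hN hev hB (by norm_num : 0 ≤ 3) x
    have h1 := hw.l2_sub_tpd_le_add hab hN hev hB (by norm_num : 1 ≤ 3) x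
    simp only [pow_zero, one_mul, pow_one, ← hE, ← hE', Nat.sub_zero, Nat.reduceSub] at h0 h1
    have h0' : l2 a b (w 0 - tpd a b (idx N) x 0) ≤ √(b - a) * (mesh a b N ^ 2 * B + E) := by
      refine h0.trans ?_
      have : mesh a b N ^ 3 ≤ mesh a b N ^ 2 := pow_le_pow_of_le_one hm0.le hh (by norm_num)
      gcongr
    refine le_trans (le_of_eq (nrm_congr fun l _ => ?_)) ((hpot _ hd (idx N)).trans
      (mul_le_mul_of_nonneg_left (add_le_add h0' h1) hCV))
    rw [← fourierCoef_sub hab.le (memLp_potential_mul hV hw0)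
      (memLp_potential_mul hV (memLp_tp a b (idx N) x))]
    simp only [Pi.sub_apply, tpd_zero, mul_sub]
  -- For aliasing errors one derivative costs π/h by the inverse inequality, turning h³ into h².
  have i1 : ∀ y : ℤ → ℂ, nrm (idx N) y ≤ 2 * mesh a b N ^ 3 * B →
      nrm (idx N) (fun l => freq a b l * y l) ≤ 2 * Real.pi * B * mesh a b N ^ 2 := fun y hy => by
    have := nrm_freq_pow_mul_le hab hN 1 y
    simp only [pow_one] at this
    refine this.trans ?_
    calc Real.pi / mesh a b N * nrm (idx N) y
        ≤ Real.pi / mesh a b N * (2 * mesh a b N ^ 3 * B) := by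
          have := Real.pi_pos
          gcongr
      _ = _ := by field_simp
  have p2 := i1 _ (nrm_discreteCoef_sub_fourierCoef_le hab hN hev (by norm_num) hW hB')
  have e3 : nrm (idx N) (fun l => discreteCoef a b N (gridValues a b N fun y => G f (w 0 y)) l -
      discreteCoef a b N (gridValues a b N fun y =>
        G f (tp a b (idx N) (fourierCoef a b (w 0)) y)) l) ≤ K * (2 * mesh a b N ^ 3 * B) := by
    refine (nrm_discreteCoef_G_sub_le hab hN hev hK hL hwR hcR).trans ?_
    gcongr
    refine le_trans (le_of_eq (nrm_congr fun l hl => ?_))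
      (nrm_discreteCoef_sub_fourierCoef_le hab hN hev (by norm_num) hw hB)
    rw [discreteCoef_gridValues_tp hab hN _ hl]
  have p3 : nrm (idx N) (fun l => freq a b l * (
      discreteCoef a b N (gridValues a b N fun y => G f (w 0 y)) l -
      discreteCoef a b N (gridValues a b N fun y =>
        G f (tp a b (idx N) (fourierCoef a b (w 0)) y)) l)) ≤
      2 * Real.pi * K * B * mesh a b N ^ 2 := by
    have := nrm_freq_pow_mul_le hab hN 1 fun l =>
      discreteCoef a b N (gridValues a b N fun y => G f (w 0 y)) l -
        discreteCoef a b N (gridValues a b N fun y =>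
          G f (tp a b (idx N) (fourierCoef a b (w 0)) y)) l
    simp only [pow_one] at this
    refine this.trans ?_
    calc _ ≤ Real.pi / mesh a b N * (K * (2 * mesh a b N ^ 3 * B)) := by
          have := Real.pi_pos
          gcongr
      _ = _ := by field_simp
  rw [hWw] at p2
  have key := (nrm_add_le (idx N) _ _).trans (add_le_add p1 ((nrm_sub_le (idx N) _ _).trans
    (add_le_add ((nrm_add_le (idx N) _ _).trans (add_le_add p3 hint)) p2)))
  refine le_trans (le_of_eq (nrm_congr fun l _ => ?_)) (key.trans (le_of_eq ?_))
  · rw [force, fourierCoef_add hab.le (memLp_potential_mul hV hw0) hW0, discForce]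
    congr 1
    ring
  · ring

/-- Time regularity of the force in the `H¹` seminorm. -/
theorem nrm_freq_force_sub_le (hab : a < b) (hV : MemLp V ∞ (vol a b))
    (hpot : ∀ w, HPer a b 1 w → ∀ F, nrm F (fun l => freq a b l *
      fourierCoef a b (fun x => (V x : ℂ) * w 0 x) l) ≤ CV * (l2 a b (w 0) + l2 a b (w 1)))
    {w w' : ℕ → ℝ → ℂ} (hw : HPer a b 1 w) (hw' : HPer a b 1 w')
    (hG : MemLp (fun x => G f (w 0 x)) 2 (vol a b)) (hG' : MemLp (fun x => G f (w' 0 x)) 2 (vol a b))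
    {F : Finset ℤ}
    (hnl : nrm F (fun l => freq a b l * (fourierCoef a b (fun x => G f (w 0 x)) l -
        fourierCoef a b (fun x => G f (w' 0 x)) l)) ≤
          CB * (l2 a b (w 0 - w' 0) + l2 a b (w 1 - w' 1))) :
    nrm F (fun l => freq a b l * (force a b V f (w 0) l - force a b V f (w' 0) l)) ≤
      (CV + CB) * (l2 a b (w 0 - w' 0) + l2 a b (w 1 - w' 1)) := by
  have hw0 := hw.memLp 0 zero_le_one
  have hw0' := hw'.memLp 0 zero_le_one
  rw [add_mul]
  refine le_trans (le_of_eq (nrm_congr fun l _ => ?_)) ((nrm_add_le F _ _).trans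
    (add_le_add (hpot _ (hw.sub hw') F) hnl))
  rw [force, force, fourierCoef_add hab.le (memLp_potential_mul hV hw0) hG,
    fourierCoef_add hab.le (memLp_potential_mul hV hw0') hG', ← mul_add]
  simp only [Pi.sub_apply, mul_sub]
  rw [fourierCoef_sub hab.le (memLp_potential_mul hV hw0) (memLp_potential_mul hV hw0')]
  congr 1
  ring

/-- Only the smoothness clause changes with m, so the L² error analysis can be repeated with three
derivatives. -/
theorem SolData.upgrade (h : SolData a b T V f m M R K B Λ ψ d) {m' : ℕ} {B' : ℝ}
    (hs : ∀ t ∈ Icc 0 T, ∃ w W, HPer a b m' w ∧ HPer a b m' W ∧ w 0 = ψ t ∧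
      (W 0 = fun y => G f (ψ t y)) ∧
      (∀ F, nrm F (fun l => (freq a b l : ℂ) ^ m' * fourierCoef a b (w 0) l) ≤ B') ∧
      ∀ F, nrm F (fun l => (freq a b l : ℂ) ^ m' * fourierCoef a b (W 0) l) ≤ B') :
    SolData a b T V f m' M R K B' Λ ψ d :=
  ⟨h.M_nonneg, h.K_nonneg, h.Λ_nonneg, h.memLp_potential, h.potential_le, h.lip, h.evol, hs,
    h.sup_le, h.force_lip⟩

/-- Lipschitz continuity in time of the solution in `H¹`. -/
theorem exists_time_lipschitz (hab : a < b) (hd : ContDiffH a b T 1 ψ ψt) {w : ℝ → ℕ → ℝ → ℂ}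
    (hw : ∀ t ∈ Icc 0 T, HPer a b 1 (w t) ∧ w t 0 = ψ t) :
    ∃ D : ℝ, 0 ≤ D ∧ ∀ s ∈ Icc 0 T, ∀ t ∈ Icc 0 T,
      l2 a b (w s 0 - w t 0) + l2 a b (w s 1 - w t 1) ≤ D * |s - t| := by
  have hs0 : 0 < √(b - a) := Real.sqrt_pos.2 (sub_pos.2 hab)
  obtain ⟨S, hS, hSt⟩ := hd.exists_bound
  have : ∀ t, ∃ v : ℕ → ℝ → ℂ, t ∈ Icc 0 T → IsWeakDerivs a b 1 (ψt t) v ∧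
      ∀ k ≤ 1, MemLp (v k) 2 (vol a b) := fun t => by
    by_cases ht : t ∈ Icc 0 T
    · obtain ⟨v, hv⟩ := (hd t ht).2.1
      exact ⟨v, fun _ => hv⟩
    · exact ⟨fun _ => 0, fun h => absurd h ht⟩
  choose v hv using this
  have key : ∀ k ≤ 1, ∀ s ∈ Icc 0 T, ∀ t ∈ Icc 0 T,
      l2 a b (w s k - w t k) ≤ √(b - a) * (S / √(b - a) * |s - t|) := fun k hk s hs t ht => by
    refine l2_time_sub_le (ψ := fun t => w t k) (d := fun t => fourierCoef a b (v t k)) hab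
      (fun t ht => (hw t ht).1.memLp k hk) (fun t ht l => hd.hasDerivWithinAt hab hw hv hk ht l)
      (fun F t ht => ?_) hs ht
    refine (nrm_fourierCoef_le hab ((hv t ht).2 k hk) F).trans ?_
    have := l2_le_of_eLpNorm_le hS (((hv t ht).1.eLpNorm_le_hNorm hk).trans (hSt t ht))
    gcongr
  refine ⟨2 * S, by positivity, fun s hs t ht => ?_⟩
  have e : √(b - a) * (S / √(b - a) * |s - t|) = S * |s - t| := by field_simp
  have h0 := key 0 zero_le_one s hs t ht
  have h1 := key 1 le_rfl s hs t ht
  rw [e] at h0 h1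
  linarith

end secondOrder

/-! ### Gronwall in the H¹ seminorm and the estimates for H³ solutions -/

section secondOrderEstimate

variable {a b T : ℝ} {V f : ℝ → ℝ} {N m : ℕ} {M R K B Λ S τ B₀ C₀ C₂ α β Λ' : ℝ} {ψ₀ : ℝ → ℂ}
  {ψ ψt : ℝ → ℝ → ℂ} {d : ℝ → ℤ → ℂ}

/-- Gronwall's inequality for the `H¹` seminorm of the error. -/
theorem SolData.nrm_freq_error_le (h : SolData a b T V f m M R K B Λ ψ d) {x : ℕ → ℤ → ℂ}
    (hx : IsDiscSol a b V f N τ x) (hτ : 0 < τ) (hα : 0 ≤ α) (hβ : 0 ≤ β) (hΛ' : 0 ≤ Λ')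
    (hlip : ∀ s ∈ Icc 0 T, ∀ t ∈ Icc 0 T, nrm (idx N) (fun l => freq a b l *
      (force a b V f (ψ s) l - force a b V f (ψ t) l)) ≤ Λ' * |s - t|) {n : ℕ} (hn : n * τ ≤ T)
    (hcons : ∀ k < n, nrm (idx N) (fun l => freq a b l *
      (force a b V f (ψ (k * τ)) l - discForce a b V f N (x k) l)) ≤
        α * nrm (idx N) (fun l => freq a b l * (fourierCoef a b (ψ (k * τ)) l - x k l)) + β) :
    nrm (idx N) (fun l => freq a b l * (fourierCoef a b (ψ (n * τ)) l - x n l)) ≤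
      Real.exp (α * T) * (nrm (idx N) (fun l => freq a b l * (fourierCoef a b (ψ 0) l - x 0 l)) +
        T * (β + Λ' * τ)) := by
  have hT : 0 ≤ T := le_trans (by positivity) hn
  have key := discrete_gronwall (E := fun n => nrm (idx N) fun l => freq a b l *
    (fourierCoef a b (ψ (n * τ)) l - x n l)) (α := α) (β := β + Λ' * τ) hα (by positivity) hτ.le
    (nrm_nonneg _ _) (n := n) fun k hk => by
      have hkn : ((k : ℝ) + 1) ≤ n := by exact_mod_cast hk
      have ht0 : 0 ≤ (k : ℝ) * τ := by positivity
      have htT : (k : ℝ) * τ + τ ≤ T := by nlinarith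
      have ht : (k : ℝ) * τ ∈ Icc 0 T := ⟨ht0, by linarith⟩
      have h2 := h.evol.nrm_step_le (F := idx N) (fun l => (freq a b l : ℂ)) ht0 hτ.le htT hΛ'
        (fun s hs => hlip s hs _ ht) (x k) (discForce a b V f N (x k))
      have e : nrm (idx N) (fun l => freq a b l *
          (fourierCoef a b (ψ ((k + 1 : ℕ) * τ)) l - x (k + 1) l)) =
          nrm (idx N) (fun l => freq a b l * (fourierCoef a b (ψ (k * τ + τ)) l -
            ewiStep a b τ (x k) (discForce a b V f N (x k)) l)) := by
        refine nrm_congr fun l hl => ?_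
        rw [hx.step k l hl]
        congr 5
        push_cast; ring
      rw [e]
      refine h2.trans ?_
      rw [← add_assoc]
      gcongr
      exact hcons k hk
  refine key.trans ?_
  simp only [Nat.cast_zero, zero_mul]
  have := nrm_nonneg (idx N) fun l => freq a b l * (fourierCoef a b (ψ 0) l - x 0 l)
  gcongr

/-- The estimates for a solution in `H³_per`. -/
theorem exists_secondOrder (hab : a < b) (hT : 0 < T) (hA : AssumptionA f)
    (hC : AssumptionC a b 2 f) (hd : SolData a b T V f 2 M R K B Λ ψ d)
    (hc : ∀ t ∈ Icc 0 T, ContinuousOn (ψ t) (Icc a b)) (h0 : ∀ x ∈ Icc a b, ψ 0 x = ψ₀ x)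
    (hB₀ : 0 ≤ B₀) (hR : √(2 * B₀ ^ 2 + 2 * (b - a) ^ 2 * B₀ ^ 2) + 1 ≤ R) (hC₂ : 0 ≤ C₂)
    (hcB₀ : ∀ t ∈ Icc 0 T, ∀ F, nrm F (fourierCoef a b (ψ t)) ≤ B₀ ∧
      nrm F (fun l => freq a b l * fourierCoef a b (ψ t) l) ≤ B₀)
    (hV : MemHper a b 1 fun x => (V x : ℂ)) (hfB : AssumptionB a b f) (hfB' : AssumptionB' a b f)
    (hfC : AssumptionC a b 3 f) (hψ : ContHper a b T 3 ψ) (hψt : ContDiffH a b T 1 ψ ψt) :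
    ∃ C' : ℝ, ∀ τ : ℝ, 0 < τ → ∀ N : ℕ, 0 < N → Even N → mesh a b N ≤ 1 →
      (∀ n : ℕ, n * τ ≤ T → StableAt a b R B₀ C₀ C₂ τ N (fourierCoef a b (ψ (n * τ)))
        (discreteCoef a b N (efp a b V f ψ₀ τ N n))) → ∀ n : ℕ, n * τ ≤ T →
      eLpNorm (ψ (n * τ) - interp a b N (efp a b V f ψ₀ τ N n)) 2 (vol a b) ≤
          ENNReal.ofReal (C' * (τ + mesh a b N ^ 3)) ∧
        hNorm a b 1 (ψ (n * τ) - interp a b N (efp a b V f ψ₀ τ N n)) ≤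
          ENNReal.ofReal (C' * (τ + mesh a b N ^ 2)) := by
  have hM := hd.M_nonneg
  have hK := hd.K_nonneg
  have hΛ := hd.Λ_nonneg
  have hVm := hd.memLp_potential
  obtain ⟨S, hS, hSt⟩ := hψ.exists_bound
  obtain ⟨w, hw⟩ := hψ.exists_family hab three_pos hc
  have hwl : ∀ t ∈ Icc 0 T, ∀ k ≤ 3, l2 a b (w t k) ≤ S := fun t ht k hk =>
    (hw t ht).1.l2_le hab.le hS (by rw [(hw t ht).2]; exact hSt t ht) hk
  have hw1 : ∀ t ∈ Icc 0 T, HPer a b 1 (w t) ∧ w t 0 = ψ t := fun t ht =>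
    ⟨(hw t ht).1.mono (by norm_num), (hw t ht).2⟩
  obtain ⟨B₃, hB₃, hsm⟩ := (smoothApprox_three hab hA hfC).exists_smooth hab hA (by norm_num) hfC hS
  have hd3 : SolData a b T V f 3 M R K B₃ Λ ψ d := hd.upgrade fun t ht => by
    obtain ⟨W, hW, hW0, k1, k2⟩ := hsm (w t) (hw t ht).1 (hwl t ht)
    rw [(hw t ht).2] at hW0
    exact ⟨w t, W, (hw t ht).1, hW, (hw t ht).2, hW0, k1, k2⟩
  obtain ⟨D, hD, hDl⟩ := exists_time_lipschitz hab hψt hw1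
  obtain ⟨CV, hCV, hpot⟩ := exists_potential_bound hab hV
  obtain ⟨CB, hCB, hnl⟩ := hfB.exists_bound hab hC hA hS
  obtain ⟨S₂, hS₂⟩ : ∃ S₂, S₂ = √(b - a) * ((B₀ + 1) + √((B₀ + 1) * C₂) + C₂) := ⟨_, rfl⟩
  have hS₂0 : 0 ≤ S₂ := by rw [hS₂]; positivity
  -- The radius covers both arguments of (B'): 4S bounds the projected solution in H³ and S₂ bounds
  -- the numerical solution in H².
  obtain ⟨CI, hCI, hint⟩ := hfB'.exists_bound hab (4 * S + S₂)
  obtain ⟨CE, hCE⟩ : ∃ CE, CE = Real.exp ((M + K) * T) *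
    (2 * B₃ + T * ((M + 2 * K + 2) * B₃ + Λ)) := ⟨_, rfl⟩
  have hCE0 : 0 ≤ CE := by rw [hCE]; positivity
  obtain ⟨α, hα⟩ : ∃ α, α = CV * √(b - a) + CI := ⟨_, rfl⟩
  have hα0 : 0 ≤ α := by rw [hα]; positivity
  obtain ⟨q, hq⟩ : ∃ q, q = (2 * (CV * √(b - a)) + 2 * Real.pi * (1 + K)) * B₃ := ⟨_, rfl⟩
  have hpi := Real.pi_pos
  have hq0 : 0 ≤ q := by rw [hq]; positivity
  obtain ⟨Λ', hΛ'⟩ : ∃ Λ', Λ' = (CV + CB) * D := ⟨_, rfl⟩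
  have hΛ'0 : 0 ≤ Λ' := by rw [hΛ']; positivity
  obtain ⟨CE', hCE'⟩ : ∃ CE', CE' = Real.exp (α * T) *
    (2 * Real.pi * B₃ + T * (α * CE + q + Λ')) := ⟨_, rfl⟩
  have hCE'0 : 0 ≤ CE' := by rw [hCE']; positivity
  refine ⟨√(b - a) * (B₃ + CE) + √(b - a) * (B₃ + CE'), fun τ hτ N hN hev hh hst n hn => ?_⟩
  have hm0 := mesh_pos hab hN
  have hh32 : mesh a b N ^ 3 ≤ mesh a b N ^ 2 := pow_le_pow_of_le_one hm0.le hh (by norm_num)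
  have hx := isDiscSol_efp hab hN hev V f ψ₀ τ
  have hx0 := hd3.nrm_initial_le hab hN hev (by norm_num) hT.le h0 τ
  have hE : ∀ n : ℕ, n * τ ≤ T → nrm (idx N) (fun l => fourierCoef a b (ψ (n * τ)) l -
      discreteCoef a b N (efp a b V f ψ₀ τ N n) l) ≤ CE * (τ + mesh a b N ^ 3) := fun n hn => by
    rw [hCE]
    -- The sup bounds were already obtained at the H² level, so no new induction is needed for the
    -- rate h³.
    exact hd3.nrm_error_le_of_sup_le hab hN hev (by norm_num) hτ hx hx0 hB₃ hn fun k hk =>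
      (hst k (le_trans (by gcongr) hn)).sup_le
  have hlip : ∀ s ∈ Icc 0 T, ∀ t ∈ Icc 0 T, nrm (idx N) (fun l => freq a b l *
      (force a b V f (ψ s) l - force a b V f (ψ t) l)) ≤ Λ' * |s - t| := fun s hs t ht => by
    have hG : ∀ t ∈ Icc 0 T, MemLp (fun x => G f (w t 0 x)) 2 (vol a b) := fun t ht => by
      rw [(hw t ht).2]
      exact memLp_of_continuousOn (hA.continuous.comp_continuousOn (hc t ht)) 2
    have := nrm_freq_force_sub_le hab hVm hpot (hw1 s hs).1 (hw1 t ht).1 (hG s hs) (hG t ht)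
      (hnl _ _ (hw s hs).1 (hw t ht).1 (hwl s hs) (hwl t ht) (idx N))
    rw [← (hw s hs).2, ← (hw t ht).2]
    refine this.trans ?_
    rw [hΛ', mul_assoc]
    exact mul_le_mul_of_nonneg_left (hDl s hs t ht) (by positivity)
  have hcons : ∀ k < n, nrm (idx N) (fun l => freq a b l * (force a b V f (ψ (k * τ)) l -
      discForce a b V f N (discreteCoef a b N (efp a b V f ψ₀ τ N k)) l)) ≤
      α * nrm (idx N) (fun l => freq a b l * (fourierCoef a b (ψ (k * τ)) l -
        discreteCoef a b N (efp a b V f ψ₀ τ N k) l)) +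
        (α * CE + q) * (τ + mesh a b N ^ 2) := fun k hk => by
    have hkT : (k : ℝ) * τ ≤ T := le_trans (by gcongr) hn
    have ht : (k : ℝ) * τ ∈ Icc 0 T := ⟨by positivity, hkT⟩
    obtain ⟨W, hW, hW0, k1, k2⟩ := hsm (w (k * τ)) (hw _ ht).1 (hwl _ ht)
    have hstk := hst k hkT
    have h1 := (hw _ ht).1.hNorm_tp_le hab (hwl _ ht) (idx N)
    have h2 := hstk.hNorm_two_le hab
    rw [← hS₂] at h2
    have hint' := hint N hN hev _ _
      (h1.trans (ENNReal.ofReal_le_ofReal (by push_cast; linarith)))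
      (h2.trans (ENNReal.ofReal_le_ofReal (by linarith)))
    have hcR : ∀ t ∈ Icc a b, ‖tp a b (idx N) (fourierCoef a b (w (k * τ) 0)) t‖ ≤ R := fun t ht' => by
      rw [(hw _ ht).2]
      have hb := hcB₀ _ ht (idx N)
      -- Applied with the polynomial compared to itself, so with zero deviation: this gives the sup
      -- bound for the projection of ψ.
      exact norm_tp_le_of_close hab (ε := 0) (D := 0) hb.1 hb.2 hR (by simp [nrm]) (by simp [nrm])
        (by simp) ht'
    have := nrm_freq_force_sub_discForce_le hab hN hev hVm hK hh hd.lip hCV hpot (hw _ ht).1 hW hW0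
      k1 k2 (by rw [(hw _ ht).2]; exact hd.sup_le _ ht) hcR hint'
    rw [(hw _ ht).2, ← hα, ← hq] at this
    refine this.trans ?_
    have hEk := mul_le_mul_of_nonneg_left (hE k hkT) hα0
    have e1 : α * (CE * (τ + mesh a b N ^ 3)) ≤ α * (CE * (τ + mesh a b N ^ 2)) := by gcongr
    have e2 : 0 ≤ q * τ := by positivity
    linarith
  have hE' : nrm (idx N) (fun l => freq a b l * (fourierCoef a b (ψ (n * τ)) l -
      discreteCoef a b N (efp a b V f ψ₀ τ N n) l)) ≤ CE' * (τ + mesh a b N ^ 2) := by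
    have hβ0 : 0 ≤ (α * CE + q) * (τ + mesh a b N ^ 2) := by positivity
    have g := hd3.nrm_freq_error_le hx hτ hα0 hβ0 hΛ'0 hlip hn hcons
    have g0 : nrm (idx N) (fun l => freq a b l * (fourierCoef a b (ψ 0) l -
        discreteCoef a b N (efp a b V f ψ₀ τ N 0) l)) ≤ 2 * Real.pi * B₃ * mesh a b N ^ 2 := by
      have := nrm_freq_pow_mul_le hab hN 1 fun l => fourierCoef a b (ψ 0) l -
        discreteCoef a b N (efp a b V f ψ₀ τ N 0) l
      simp only [pow_one] at this
      refine this.trans ?_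
      calc _ ≤ Real.pi / mesh a b N * (2 * mesh a b N ^ 3 * B₃) := by gcongr
        _ = _ := by field_simp
    refine g.trans ?_
    rw [hCE', mul_assoc]
    refine mul_le_mul_of_nonneg_left ?_ (Real.exp_nonneg _)
    have e1 : 0 ≤ 2 * Real.pi * B₃ * τ := by positivity
    have e2 : 0 ≤ T * (Λ' * mesh a b N ^ 2) := by positivity
    linarith
  obtain ⟨W, hW, hW0, k1, k2⟩ := hsm (w (n * τ)) (hw _ ⟨by positivity, hn⟩).1
    (hwl _ ⟨by positivity, hn⟩)
  have hwn := hw (n * τ) ⟨by positivity, hn⟩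
  have hEn := hE n hn
  rw [interp_eq_tp]
  rw [← hwn.2] at hEn hE' ⊢
  have r0 : 0 ≤ √(b - a) * (B₃ + CE') := by positivity
  have r1 : √(b - a) * (mesh a b N ^ 3 * B₃ + CE * (τ + mesh a b N ^ 3)) ≤
      √(b - a) * (B₃ + CE) * (τ + mesh a b N ^ 3) := by
    have : 0 ≤ √(b - a) * (B₃ * τ) := by positivity
    linarith
  refine ⟨(hwn.1.eLpNorm_sub_tp_le hab hN hev k1 _ hEn).trans (ENNReal.ofReal_le_ofReal ?_),
    (hwn.1.hNorm_one_sub_tp_le hab hN hev (by norm_num) k1 _ hEn hE').trans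
      (ENNReal.ofReal_le_ofReal ?_)⟩
  · refine r1.trans ?_
    gcongr
    linarith
  · have r2 : √(b - a) * (B₃ + CE) * (τ + mesh a b N ^ 3) ≤
        √(b - a) * (B₃ + CE) * (τ + mesh a b N ^ 2) := by gcongr
    have r3 : √(b - a) * (mesh a b N ^ (3 - 1) * B₃ + CE' * (τ + mesh a b N ^ 2)) ≤
        √(b - a) * (B₃ + CE') * (τ + mesh a b N ^ 2) := by
      have : 0 ≤ √(b - a) * (B₃ * τ) := by positivity
      simp only [Nat.reduceSub]
      linarith
    rw [add_mul]
    linarith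

end secondOrderEstimate

end EWI

end

theorem mainTheorem3 (a b : ℝ) (hab : a < b) (f : ℝ → ℝ)
    (hA : EWI.AssumptionA f) (hC : EWI.AssumptionC a b 2 f) (T : ℝ) (hT : 0 < T) (M : ℝ) :
    ∃ τ₀ > (0 : ℝ), ∃ h₀ > (0 : ℝ), ∃ C : ℝ,
      ∀ (V : ℝ → ℝ) (ψ₀ : ℝ → ℂ) (ψ ψt : ℝ → ℝ → ℂ),
        MemLp V ∞ (EWI.vol a b) →
        EWI.IsNLSESolution a b T V f ψ₀ ψ ψt →
        EWI.ContHper a b T 2 ψ → EWI.ContDiffH a b T 0 ψ ψt →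
        EWI.sizeM a b T V ψ ψt ≤ ENNReal.ofReal M →
        (∀ τ : ℝ, 0 < τ → τ < τ₀ → ∀ N : ℕ, 0 < N → Even N → EWI.mesh a b N < h₀ →
          ∀ n : ℕ, n * τ ≤ T →
            eLpNorm (ψ (n * τ) - EWI.interp a b N (EWI.efp a b V f ψ₀ τ N n)) 2 (EWI.vol a b) ≤
                ENNReal.ofReal (C * (τ + EWI.mesh a b N ^ 2)) ∧
              EWI.hNorm a b 2 (EWI.interp a b N (EWI.efp a b V f ψ₀ τ N n)) ≤
                ENNReal.ofReal C ∧
              EWI.hNorm a b 1 (ψ (n * τ) - EWI.interp a b N (EWI.efp a b V f ψ₀ τ N n)) ≤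
                ENNReal.ofReal (C * (√τ + EWI.mesh a b N))) ∧
        (EWI.MemW a b 1 4 (fun x => (V x : ℂ)) → EWI.MemHper a b 1 (fun x => (V x : ℂ)) →
          EWI.AssumptionB a b f → EWI.AssumptionB' a b f → EWI.AssumptionC a b 3 f →
          EWI.ContHper a b T 3 ψ → EWI.ContDiffH a b T 1 ψ ψt →
          ∃ C' : ℝ, ∀ τ : ℝ, 0 < τ → τ < τ₀ → ∀ N : ℕ, 0 < N → Even N → EWI.mesh a b N < h₀ →
            ∀ n : ℕ, n * τ ≤ T →
              eLpNorm (ψ (n * τ) - EWI.interp a b N (EWI.efp a b V f ψ₀ τ N n)) 2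
                  (EWI.vol a b) ≤
                  ENNReal.ofReal (C' * (τ + EWI.mesh a b N ^ 3)) ∧
                EWI.hNorm a b 1 (ψ (n * τ) - EWI.interp a b N (EWI.efp a b V f ψ₀ τ N n)) ≤
                  ENNReal.ofReal (C' * (τ + EWI.mesh a b N ^ 2))) := by
  -- M is an arbitrary real; `ENNReal.ofReal` truncates negative values to 0, so M may be replaced
  -- by max M 0.
  have hM : ENNReal.ofReal M = ENNReal.ofReal (max M 0) := by
    rcases le_total M 0 with h | h
    · rw [max_eq_right h, ENNReal.ofReal_of_nonpos h, ENNReal.ofReal_zero]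
    · rw [max_eq_left h]
  obtain ⟨B₀, R, K, B, Λ, hB₀, hK, hB, hΛ, hR, hsd⟩ :=
    EWI.exists_solData hab hA hC hT (le_max_right M 0)
  obtain ⟨τ₀, hτ₀, h₀, hh₀, hτ₁, hh₁, C₀, C₂, hC₀, hC₂, hst⟩ :=
    EWI.SolData.exists_stable (f := f) hab hT (le_max_right M 0) hK hΛ hB hB₀ hR
  refine ⟨τ₀, hτ₀, h₀, hh₀,
    √(b - a) * (B + C₀) + √(b - a) * ((B₀ + 1) + √((B₀ + 1) * C₂) + C₂) +
      √(b - a) * (B + √(C₀ * (C₂ + B))), fun V ψ₀ ψ ψt hV hsol hψ hψt hsize => ?_⟩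
  rw [hM] at hsize
  obtain ⟨hd, hcB⟩ := hsd V ψ₀ ψ ψt hV hsol hψ hψt hsize
  have hst' := hst V ψ₀ ψ _ hd hsol.initial hcB
  refine ⟨fun τ hτ hτ' N hN hev hh n hn => ?_, fun _ hV1 hfB hfB' hfC hψ3 hψt1 => ?_⟩
  · rw [EWI.interp_eq_tp]
    exact hd.estimates hab hN hev hτ (hτ'.le.trans hτ₁) (hh.le.trans hh₁) hC₀ hC₂
      ⟨by positivity, hn⟩ hB₀ hB (hst' τ hτ hτ' N hN hev hh n hn) rfl
  · obtain ⟨C', hC'⟩ := EWI.exists_secondOrder (C₀ := C₀) hab hT hA hC hd hsol.continuousOn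
      hsol.initial hB₀ hR hC₂ hcB hV1 hfB hfB' hfC hψ3 hψt1
    exact ⟨C', fun τ hτ hτ' N hN hev hh n hn => hC' τ hτ N hN hev (hh.le.trans hh₁)
      (fun k hk => hst' τ hτ hτ' N hN hev hh k hk) n hn⟩
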